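/- **Setting.** An instance of strip packing consists of a strip of integer width $W\ge 1$ and finitely many axis-parallel rectangular items; item $i$ has positive integer width $w_i$ and height $h_i$ (no rotations). A packing of height $H$ places all items at integer coordinates, pairwise interior-disjoint, in $[0,W]\times[0,H]$. For a positive integer $\mathrm{OPT}$ and reals $0<\mu<\delta\le 1$ the items are classified as follows: - $L$ (large): $w_i\ge\delta W$ and $h_i\ge\delta\,\mathrm{OPT}$; - $T$ (tall): $w_i<\delta W$ and $h_i>\mathrm{OPT}/3$; - $V$ (vertical): $w_i<\mu W$ and $\delta\,\mathrm{OPT}\le h_i\le \mathrm{OPT}/3$; - $H$ (horizontal): $w_i\ge\delta W$ and $h_i<\mu\,\mathrm{OPT}$; - $S$ (small): $w_i<\mu W$ and $h_i<\mu\,\mathrm{OPT}$; - $M$ (medium): all other items. For $0<\varepsilon<1$ and an exponent $k$, call $(\delta,\mu)$ *admissible* if $0<\mu<\delta\le1$, $\mu\le(\varepsilon\delta)^k$, and the items of $M$ can be packed into two boxes of sizes $W\times\varepsilon\,\mathrm{OPT}$ and $\frac{\varepsilon W}{3}\times\frac{\mathrm{OPT}}3$ (sizes rounded down to integers). **Theorem.**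 There is an absolute constant $C>0$ such that for every $0<\varepsilon<1$ there is an exponent $k=k(\varepsilon)$ with the following two properties. 1. There is $c=c(\varepsilon)>0$ such that for every instance and every integer $\mathrm{OPT}\ge1$ for which a packing of height $\mathrm{OPT}$ exists, there are admissible $\delta,\mu$ with $\mu\ge c$. 2. Consider any instance that has a packing of height $\mathrm{OPT}$, and any admissible $\delta,\mu$ such that $\varepsilon\delta\,\mathrm{OPT}$ is a positive integer and the height of every item in $L\cup T\cup V$ is a multiple of it. Then for some integer $H'\le(\frac43+C\varepsilon)\mathrm{OPT}$ there are a partition of the area $W\times H'$ into at most $C/(\varepsilon^6\delta^7)$ rectangular boxes with integer coordinates and a packing of all the items into this area such that every item is contained in one of the boxes and - each item of $L$ is the only item in its box; - there are two distinct boxes, of sizes $W\times\varepsilon\,\mathrm{OPT}$ and $\frac{\varepsilon W}{3}\times\frac{\mathrm{OPT}}3$ (rounded down to integers), that contain all the items of $M$ and no other items; - each item $i\in T\cup V$ is contained in a vertical box of height exactly $h_i$, where a box is *vertical* if its width is at most $\varepsilon\delta W$ or if it is exactly the rectangle occupied by a single tall item; - each item of $H$ is contained in a horizontal box, that is, a box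 of height exactly $\varepsilon\delta\,\mathrm{OPT}$. -/

import Mathlib

/-- An axis-parallel rectangle with integer coordinates: `(x, y)` is its lower left corner,
`w` its width and `h` its height. -/
@[ext]
structure Rect where
  x : ℕ
  y : ℕ
  w : ℕ
  h : ℕ

namespace Rect

/-- The unit cells `[a, a+1] × [b, b+1]` of a rectangle, each given by its corner `(a, b)`.
Two rectangles with integer coordinates have disjoint interiors iff they share no unit cell. -/
def cells (r : Rect) : Finset (ℕ × ℕ) :=
  Finset.Ico r.x (r.x + r.w) ×ˢ Finset.Ico r.y (r.y + r.h)

/-- `r.Inside s`: the rectangle `r` is contained in the rectangle `s`. -/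
def Inside (r s : Rect) : Prop :=
  s.x ≤ r.x ∧ r.x + r.w ≤ s.x + s.w ∧ s.y ≤ r.y ∧ r.y + r.h ≤ s.y + s.h

/-- The family `box` is a partition of the rectangle `A` into rectangles. -/
def IsPartition {N : ℕ} (A : Rect) (box : Fin N → Rect) : Prop :=
  (∀ b, (box b).Inside A) ∧
  (∀ b b', b ≠ b' → Disjoint (box b).cells (box b').cells) ∧
  (∀ q ∈ A.cells, ∃ b, q ∈ (box b).cells)

end Rect

/-- An instance of strip packing: a strip of width `W` and `n` rectangular items with positive
integer widths and heights. -/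
structure StripInstance (n : ℕ) where
  W : ℕ
  w : Fin n → ℕ
  h : Fin n → ℕ
  W_pos : 0 < W
  w_pos : ∀ i, 0 < w i
  h_pos : ∀ i, 0 < h i

namespace StripInstance

variable {n : ℕ} (I : StripInstance n)

/-- The rectangle occupied by item `i` when its lower left corner is at `p i` (no rotations). -/
def itemRect (p : Fin n → ℕ × ℕ) (i : Fin n) : Rect :=
  ⟨(p i).1, (p i).2, I.w i, I.h i⟩

/-- `p` packs the items of `s` into a rectangle of width `a` and height `b`. -/
def IsPacking (s : Set (Fin n)) (a b : ℕ) (p : Fin n → ℕ × ℕ) : Prop :=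
  (∀ i ∈ s, (I.itemRect p i).Inside ⟨0, 0, a, b⟩) ∧
  (∀ i ∈ s, ∀ j ∈ s, i ≠ j → Disjoint (I.itemRect p i).cells (I.itemRect p j).cells)

/-- `p` is a solution of height at most `b`: it packs all the items into the strip. -/
def IsSolution (b : ℕ) (p : Fin n → ℕ × ℕ) : Prop :=
  I.IsPacking Set.univ I.W b p

/-- Large items `L`. -/
def large (δ : ℝ) (OPT : ℕ) : Set (Fin n) :=
  {i | δ * I.W ≤ I.w i ∧ δ * OPT ≤ I.h i}

/-- Tall items `T`. -/
def tall (δ : ℝ) (OPT : ℕ) : Set (Fin n) :=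
  {i | (I.w i : ℝ) < δ * I.W ∧ (OPT : ℝ) / 3 < I.h i}

/-- Vertical items `V`. -/
def vertical (δ μ : ℝ) (OPT : ℕ) : Set (Fin n) :=
  {i | (I.w i : ℝ) < μ * I.W ∧ δ * OPT ≤ I.h i ∧ (I.h i : ℝ) ≤ (OPT : ℝ) / 3}

/-- Horizontal items `H`. -/
def horizontal (δ μ : ℝ) (OPT : ℕ) : Set (Fin n) :=
  {i | δ * I.W ≤ I.w i ∧ (I.h i : ℝ) < μ * OPT}

/-- Small items `S`. -/
def small (μ : ℝ) (OPT : ℕ) : Set (Fin n) :=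
  {i | (I.w i : ℝ) < μ * I.W ∧ (I.h i : ℝ) < μ * OPT}

/-- Medium items `M`: all the other items. -/
def medium (δ μ : ℝ) (OPT : ℕ) : Set (Fin n) :=
  (I.large δ OPT ∪ I.tall δ OPT ∪ I.vertical δ μ OPT ∪ I.horizontal δ μ OPT ∪ I.small μ OPT)ᶜ

/-- The medium items can be packed into one box of size `W × ε OPT` and one box of size
`(ε W / 3) × (OPT / 3)`, where sizes are rounded down to integers. -/
def MediumPackable (ε δ μ : ℝ) (OPT : ℕ) : Prop :=
  ∃ s t : Set (Fin n), I.medium δ μ OPT = s ∪ t ∧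
    (∃ p, I.IsPacking s I.W ⌊ε * OPT⌋₊ p) ∧
    (∃ p, I.IsPacking t ⌊ε * I.W / 3⌋₊ (OPT / 3) p)

/-- The parameters `δ` and `μ` are admissible for the instance, `ε`, `OPT` and the exponent `k`. -/
def Admissible (ε : ℝ) (k : ℕ) (δ μ : ℝ) (OPT : ℕ) : Prop :=
  0 < μ ∧ μ < δ ∧ δ ≤ 1 ∧ μ ≤ (ε * δ) ^ k ∧ I.MediumPackable ε δ μ OPT

/-- A horizontal box has height `ε δ OPT`. -/
def IsHorizontalBox (ε δ : ℝ) (OPT : ℕ) (b : Rect) : Prop :=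
  (b.h : ℝ) = ε * δ * OPT

/-- A vertical box has width at most `ε δ W`, or it is exactly the area of one tall item
(some tall items are wider than `ε δ W`; each such item needs a box of its own). -/
def IsVerticalBox (ε δ : ℝ) (OPT : ℕ) (p : Fin n → ℕ × ℕ) (b : Rect) : Prop :=
  (b.w : ℝ) ≤ ε * δ * I.W ∨ ∃ i ∈ I.tall δ OPT, b = I.itemRect p i

end StripInstance

/-! Existence of admissible parameters is a pigeonhole argument. Along a rapidly decreasing sequence
of thresholds, taken in consecutive pairs as δ and μ, a medium item has its width or its height in
the gap between the two. The gaps of different pairs are disjoint, so an item is medium for at most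
two pairs, and among about 200/ε pairs one has medium items of total area at most (ε/100)·W·OPT.
Shelf packing puts these into the two boxes (`StripInstance.exists_admissible`).

For the structure theorem let g = εδ·OPT. The given packing is stretched vertically by the factor 1
+ 12ε. Item heights do not change, so all large, tall and vertical items can be moved to multiples
of g (`exists_stretch`), and above every tall item about 4ε·OPT of height becomes free. Horizontal
items inside a row of height g lie in maximal free strips of that row; the few that cross a row line
fit together into one extra row of height g. Large items and strips now stay fixed as obstacles.

Vertical lines through the ends of the obstacles and through multiples of about εδW cut the strip
into slabs. Inside a slab the obstacles span the full width, so the free area consists of boxes.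
Tall items starting below OPT/3 all cover the level OPT/3, and the others all cover the level
2·OPT/3. So two tall items of the same kind never lie above each other, and a column meets at most
one of each kind. Tall items go to the floor or the ceiling of their box. Vertical items are cut
into columns of width one: the contents of a column that meets at most one tall item are pushed to
the opposite side of the box, while the contents between two tall items are taken out. A sorting
argument (`exists_runs`) rearranges everything on the two sides into O(R²) runs of equal pieces,
where R = O(1/(εδ)) is the number of rows.

The contents taken out of one column have height at most OPT/3, since two tall items use more than
2·OPT/3. They could form one layer of height OPT/3 above everything, which is where 4/3 comes from,
but this layer must also hold the second medium box. Here the free space above the tall items helps: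
every column with two tall items had unused height σ, so after sorting the box has enough room to
take a fraction φ = ε/2 of the contents back (`exists_returned`). Thus at most (1 - φ)W columns
remain outside, and the medium box fits beside them. For ε > 1/16 a second layer of height OPT/3
costs only O(ε)·OPT, and nothing has to return.

A run of columns has many different contents. By a Carathéodory argument
(`exists_sparse_combination`) a few contents suffice, with real widths; rounding the widths down
gives boxes of exact heights. Whole items are then filled in greedily, and what does not fit has
total width far below εδW, because vertical items are very narrow (`exists_vertical_packing`). It
goes next to the medium box.

The area around the reserved boxes is cut into at most three times as many rectangles plus one
(`exists_free_rects`). Small items fill these by shelves with little waste, and an additional empty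
shelf of height ε·OPT makes up for the waste (`exists_completed_partition`, `Setup.waste_lt`). -/

section StructuredPacking

open Finset

/-! ### Rectangles, cells and separating lines. -/

namespace Rect

/-- Two rectangles are separated by a horizontal or a vertical line. -/
def Sep (r s : Rect) : Prop :=
  r.x + r.w ≤ s.x ∨ s.x + s.w ≤ r.x ∨ r.y + r.h ≤ s.y ∨ s.y + s.h ≤ r.y

lemma mem_cells {r : Rect} {q : ℕ × ℕ} :
    q ∈ r.cells ↔ (r.x ≤ q.1 ∧ q.1 < r.x + r.w) ∧ r.y ≤ q.2 ∧ q.2 < r.y + r.h := by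
  simp [cells]

lemma card_cells (r : Rect) : r.cells.card = r.w * r.h := by
  simp [cells]

lemma Sep.symm {r s : Rect} (h : r.Sep s) : s.Sep r := by
  unfold Sep at *; omega

lemma Sep.disjoint {r s : Rect} (h : r.Sep s) : Disjoint r.cells s.cells := by
  rw [Finset.disjoint_left]
  intro q hq hq'
  rw [mem_cells] at hq hq'
  unfold Sep at h
  omega

lemma sep_of_disjoint {r s : Rect} (h : Disjoint r.cells s.cells) (hr : 0 < r.w) (hr' : 0 < r.h)
    (hs : 0 < s.w) (hs' : 0 < s.h) : r.Sep s := by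
  by_contra hc
  unfold Sep at hc
  push Not at hc
  rw [Finset.disjoint_left] at h
  refine h (a := (max r.x s.x, max r.y s.y)) ?_ ?_ <;> rw [mem_cells] <;> simp only <;> omega

lemma Inside.trans {r s t : Rect} (h : r.Inside s) (h' : s.Inside t) : r.Inside t := by
  unfold Inside at *; omega

lemma Sep.mono {r s r' s' : Rect} (h : r.Sep s) (hr : r'.Inside r) (hs : s'.Inside s) :
    r'.Sep s' := by
  unfold Sep Inside at *; omega

lemma Inside.cells_subset {r s : Rect} (h : r.Inside s) : r.cells ⊆ s.cells := by
  intro q hq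
  rw [mem_cells] at *
  unfold Inside at h; omega

end Rect

/-! ### Shelf packing, greedy filling and sparse combinations. -/

section Packing

variable {ι : Type*}

/-- `p` packs the rectangles of sizes `w i × h i`, `i ∈ s`, into an `a × b` rectangle. -/
def PackIn (w h : ι → ℕ) (s : Finset ι) (a b : ℕ) (p : ι → ℕ × ℕ) : Prop :=
  (∀ i ∈ s, (p i).1 + w i ≤ a ∧ (p i).2 + h i ≤ b) ∧
  ∀ i ∈ s, ∀ j ∈ s, i ≠ j →
    Rect.Sep ⟨(p i).1, (p i).2, w i, h i⟩ ⟨(p j).1, (p j).2, w j, h j⟩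

lemma exists_line_positions (w : ι → ℕ) (s : Finset ι) :
    ∃ pos : ι → ℕ, (∀ i ∈ s, pos i + w i ≤ ∑ j ∈ s, w j) ∧
      ∀ i ∈ s, ∀ j ∈ s, i ≠ j → pos i + w i ≤ pos j ∨ pos j + w j ≤ pos i := by
  classical
  induction s using Finset.induction_on with
  | empty => exact ⟨fun _ => 0, by simp, by simp⟩
  | insert a s ha ih =>
    obtain ⟨pos, h1, h2⟩ := ih
    refine ⟨fun i => if i = a then ∑ j ∈ s, w j else pos i, ?_, ?_⟩
    · intro i hi
      rw [sum_insert ha]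
      rcases mem_insert.1 hi with rfl | hi
      · simp; omega
      · have : i ≠ a := fun h => ha (h ▸ hi)
        have := h1 i hi
        simp [*]; omega
    · intro i hi j hj hij
      rcases mem_insert.1 hi with rfl | hi' <;> rcases mem_insert.1 hj with rfl | hj'
      · exact absurd rfl hij
      · have := h1 j hj'
        simp [hij.symm]; omega
      · have := h1 i hi'
        simp [hij]; omega
      · have e1 : i ≠ a := fun h => ha (h ▸ hi')
        have e2 : j ≠ a := fun h => ha (h ▸ hj')
        simpa [e1, e2] using h2 i hi' j hj' hij

/-- Greedy choice of a shelf: the tallest items, as many as fit in width `a`. -/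
lemma exists_greedy_shelf (w h : ι → ℕ) (s : Finset ι) (a m : ℕ) (hw : ∀ i ∈ s, w i ≤ m) :
    ∃ F ⊆ s, ∑ i ∈ F, w i ≤ a ∧ (F = s ∨ a ≤ ∑ i ∈ F, w i + m) ∧
      ∀ i ∈ F, ∀ j ∈ s, j ∉ F → h j ≤ h i := by
  classical
  -- Sets closed upwards in height that fit into the width; take one of maximal cardinality. If
  -- items remain, adding the tallest of them keeps the set closed upwards, so by maximality it no
  -- longer fits.
  let C := s.powerset.filter fun F => ∑ i ∈ F, w i ≤ a ∧ ∀ i ∈ F, ∀ j ∈ s, j ∉ F → h j ≤ h i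
  have hC : C.Nonempty := ⟨∅, by simp [C]⟩
  obtain ⟨F, hF, hmax⟩ := C.exists_max_image card hC
  simp only [C, mem_filter, mem_powerset] at hF hmax
  obtain ⟨hFs, hFa, hFu⟩ := hF
  refine ⟨F, hFs, hFa, ?_, hFu⟩
  by_cases hne : F = s
  · exact Or.inl hne
  right
  have hns : (s \ F).Nonempty := by
    rw [sdiff_nonempty]
    exact fun h => hne (hFs.antisymm h)
  obtain ⟨j, hj, hjm⟩ := (s \ F).exists_max_image h hns
  rw [mem_sdiff] at hj
  by_contra hlt
  push Not at hlt
  have hwj := hw j hj.1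
  have := hmax (insert j F) ⟨insert_subset hj.1 hFs, by rw [sum_insert hj.2]; omega, ?_⟩
  · rw [card_insert_of_notMem hj.2] at this; omega
  · intro i hi l hl hlF
    rw [mem_insert, not_or] at hlF
    have hl' : h l ≤ h j := hjm l (mem_sdiff.2 ⟨hl, hlF.2⟩)
    rcases mem_insert.1 hi with rfl | hi
    · exact hl'
    · exact hl'.trans (hFu i hi j hj.1 hj.2)

/-- Next fit decreasing height: either everything fits or little area is wasted. -/
lemma exists_shelf_packing (w h : ι → ℕ) (a m : ℕ) : ∀ (N : ℕ) (s : Finset ι) (b hm : ℕ),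
    s.card ≤ N → (∀ i ∈ s, w i ≤ m) → (∀ i ∈ s, w i ≤ a) → (∀ i ∈ s, 0 < w i) →
    (∀ i ∈ s, h i ≤ hm) →
    ∃ t ⊆ s, ∃ p, PackIn w h t a b p ∧
      (t = s ∨ (a - m) * (b - hm) ≤ ∑ i ∈ t, w i * h i) := by
  classical
  intro N
  induction N with
  | zero =>
    intro s b hm hs _ _ _ _
    have : s = ∅ := by simpa using hs
    subst this
    exact ⟨∅, by simp, fun _ => 0, ⟨by simp, by simp⟩, Or.inl rfl⟩
  | succ N ih =>
    intro s b hm hs hwm hwa hw0 hh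
    rcases s.eq_empty_or_nonempty with rfl | hne
    · exact ⟨∅, by simp, fun _ => 0, ⟨by simp, by simp⟩, Or.inl rfl⟩
    obtain ⟨k, hk, hkmax⟩ := s.exists_max_image h hne
    by_cases hb : b < h k
    · refine ⟨∅, by simp, fun _ => 0, ⟨by simp, by simp⟩, Or.inr ?_⟩
      have := hh k hk
      have : b - hm = 0 := by omega
      simp [this]
    push Not at hb
    obtain ⟨F, hFs, hFa, hFfull, hFu⟩ := exists_greedy_shelf w h s a m hwm
    obtain ⟨pos, hp1, hp2⟩ := exists_line_positions w F
    rcases hFfull with rfl | hfull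
    · refine ⟨F, subset_rfl, fun i => (pos i, 0), ⟨?_, ?_⟩, Or.inl rfl⟩
      · intro i hi
        have := hp1 i hi; have := hkmax i hi
        simp only; omega
      · intro i hi j hj hij
        have := hp2 i hi j hj hij
        unfold Rect.Sep; simp only; omega
    rcases F.eq_empty_or_nonempty with rfl | hFne
    · refine ⟨∅, by simp, fun _ => 0, ⟨by simp, by simp⟩, Or.inr ?_⟩
      have : a - m = 0 := by simp at hfull; omega
      simp [this]
    have hcard : (s \ F).card ≤ N := by
      rw [card_sdiff_of_subset hFs]
      have := hFne.card_pos
      omega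
    -- height of the tallest remaining item
    obtain ⟨H2, hH2, hH2F⟩ : ∃ H2, (∀ j ∈ s \ F, h j ≤ H2) ∧ ∀ i ∈ F, H2 ≤ h i := by
      refine ⟨(s \ F).sup h, fun j hj => le_sup hj, fun i hi => Finset.sup_le fun j hj => ?_⟩
      rw [mem_sdiff] at hj
      exact hFu i hi j hj.1 hj.2
    obtain ⟨t, hts, p, hp, hfin⟩ := ih (s \ F) (b - h k) H2 hcard
      (fun i hi => hwm i (mem_sdiff.1 hi).1) (fun i hi => hwa i (mem_sdiff.1 hi).1)
      (fun i hi => hw0 i (mem_sdiff.1 hi).1) hH2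
    have hdis : Disjoint F t := by
      rw [Finset.disjoint_left]
      intro i hi hit
      exact (mem_sdiff.1 (hts hit)).2 hi
    refine ⟨F ∪ t, union_subset hFs (hts.trans sdiff_subset),
      fun i => if i ∈ F then (pos i, 0) else ((p i).1, (p i).2 + h k), ⟨?_, ?_⟩, ?_⟩
    · intro i hi
      by_cases hiF : i ∈ F
      · have := hp1 i hiF; have := hkmax i (hFs hiF)
        simp only [hiF, if_true]; omega
      · have hit : i ∈ t := by
          rcases mem_union.1 hi with h | h
          · exact absurd h hiF
          · exact h
        have := hp.1 i hit
        simp only [hiF, if_false]; omega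
    · intro i hi j hj hij
      have key : ∀ i, i ∈ F ∪ t → i ∉ F → i ∈ t := fun i hi hiF =>
        (mem_union.1 hi).resolve_left hiF
      by_cases hiF : i ∈ F <;> by_cases hjF : j ∈ F <;> simp only [hiF, hjF, if_true, if_false]
      · have := hp2 i hiF j hjF hij
        unfold Rect.Sep; simp only; omega
      · have := hkmax i (hFs hiF)
        unfold Rect.Sep; simp only; omega
      · have := hkmax j (hFs hjF)
        unfold Rect.Sep; simp only; omega
      · have := hp.2 i (key i hi hiF) j (key j hj hjF) hij
        unfold Rect.Sep at *; simp only at *; omega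
    · rcases hfin with rfl | hfin
      · left; exact union_sdiff_of_subset hFs
      · right
        rw [sum_union hdis]
        -- A shelf is charged with the height of the next one: its items fill width at least `a - m`
        -- and all have height at least `H2`. These bounds telescope, and only the height of the
        -- first shelf is lost.
        have h1 : (a - m) * H2 ≤ ∑ i ∈ F, w i * h i := by
          calc (a - m) * H2 ≤ (∑ i ∈ F, w i) * H2 := Nat.mul_le_mul_right _ (by omega)
            _ = ∑ i ∈ F, w i * H2 := by rw [sum_mul]
            _ ≤ _ := sum_le_sum fun i hi => Nat.mul_le_mul_left _ (hH2F i hi)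
        have h2 : b - hm ≤ H2 + (b - h k - H2) := by
          have := hh k hk; omega
        calc (a - m) * (b - hm) ≤ (a - m) * (H2 + (b - h k - H2)) := Nat.mul_le_mul_left _ h2
          _ = (a - m) * H2 + (a - m) * (b - h k - H2) := by ring
          _ ≤ _ := Nat.add_le_add h1 hfin

/-- Items of total area less than half of the rectangle can be packed, up to one item height. -/
lemma exists_half_packing (w h : ι → ℕ) (s : Finset ι) (a b hm : ℕ)
    (hwa : ∀ i ∈ s, w i ≤ a) (hw0 : ∀ i ∈ s, 0 < w i) (hh : ∀ i ∈ s, h i ≤ hm)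
    (harea : 2 * ∑ i ∈ s, w i * h i + 2 * a * hm < a * b) :
    ∃ p, PackIn w h s a b p := by
  classical
  -- Items wider than half are stacked on each other; the stack fills more than half of its area.
  -- Above it the others are packed in shelves with `m = a / 2`, which also wastes at most half of
  -- each shelf.
  set s1 := s.filter fun i => a < 2 * w i with hs1
  set s2 := s.filter fun i => ¬ a < 2 * w i with hs2
  have hsum : ∑ i ∈ s1, w i * h i + ∑ i ∈ s2, w i * h i = ∑ i ∈ s, w i * h i :=
    sum_filter_add_sum_filter_not s _ _
  have ha : 0 < a := by
    rcases Nat.eq_zero_or_pos a with rfl | h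
    · simp at harea
    · exact h
  set B := ∑ i ∈ s1, h i with hB
  have hB1 : a * B ≤ 2 * ∑ i ∈ s1, w i * h i := by
    rw [hB, mul_sum, mul_sum]
    refine sum_le_sum fun i hi => ?_
    have := (mem_filter.1 hi).2
    nlinarith
  have hBb : B ≤ b := by
    by_contra hc
    push Not at hc
    have : a * b ≤ a * B := Nat.mul_le_mul_left _ hc.le
    omega
  obtain ⟨t, hts, p, hp, hfin⟩ := exists_shelf_packing w h a (a / 2) s2.card s2 (b - B) hm le_rfl
    (fun i hi => by have := (mem_filter.1 hi).2; omega) (fun i hi => hwa i (mem_filter.1 hi).1)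
    (fun i hi => hw0 i (mem_filter.1 hi).1) (fun i hi => hh i (mem_filter.1 hi).1)
  obtain ⟨pos, hp1, hp2⟩ := exists_line_positions h s1
  have ht : t = s2 := by
    rcases hfin with h | hfin
    · exact h
    exfalso
    have h1 : ∑ i ∈ t, w i * h i ≤ ∑ i ∈ s2, w i * h i := sum_le_sum_of_subset hts
    have h2 : a * (b - B - hm) ≤ 2 * ((a - a / 2) * (b - B - hm)) := by
      rw [← mul_assoc]; exact Nat.mul_le_mul_right _ (by omega)
    have h3 : a * b ≤ a * (b - B - hm) + a * B + a * hm := by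
      rw [← mul_add, ← mul_add]; exact Nat.mul_le_mul_left _ (by omega)
    have h4 : a * hm * 2 = 2 * a * hm := by ring
    have h5 : 0 ≤ a * hm := Nat.zero_le _
    omega
  subst ht
  refine ⟨fun i => if i ∈ s1 then (0, pos i) else ((p i).1, (p i).2 + B), ?_, ?_⟩
  · intro i hi
    by_cases h1 : i ∈ s1
    · have := hp1 i h1; have := hwa i hi
      simp only [h1, if_true]; omega
    · have h2 : i ∈ s2 := by
        simp only [hs1, hs2, mem_filter, not_and] at h1 ⊢
        exact ⟨hi, h1 hi⟩
      have := hp.1 i h2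
      simp only [h1, if_false]; omega
  · intro i hi j hj hij
    have key : ∀ i ∈ s, i ∉ s1 → i ∈ s2 := fun i hi h1 => by
      simp only [hs1, hs2, mem_filter, not_and] at h1 ⊢
      exact ⟨hi, h1 hi⟩
    by_cases h1 : i ∈ s1 <;> by_cases h2 : j ∈ s1 <;> simp only [h1, h2, if_true, if_false]
    · have := hp2 i h1 j h2 hij
      unfold Rect.Sep; simp only; omega
    · have := hp1 i h1
      unfold Rect.Sep; simp only; omega
    · have := hp1 j h2
      unfold Rect.Sep; simp only; omega
    · have := hp.2 i (key i hi h1) j (key j hj h2) hij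
      unfold Rect.Sep at *; simp only at *; omega

/-- Greedy filling of intervals: what does not fit has filled every interval almost completely. -/
lemma exists_greedy_fill {κ : Type*} (w : ι → ℕ) (m : ℕ) (cap : κ → ℕ) (K : Finset κ) :
    ∀ s : Finset ι, (∀ i ∈ s, w i ≤ m) →
    ∃ (rest : Finset ι) (fill : κ → Finset ι), rest ⊆ s ∧ (∀ k ∈ K, fill k ⊆ s) ∧
      (∀ i ∈ s, i ∈ rest ∨ ∃ k ∈ K, i ∈ fill k) ∧
      (∀ k ∈ K, Disjoint rest (fill k)) ∧
      (∀ k ∈ K, ∀ l ∈ K, k ≠ l → Disjoint (fill k) (fill l)) ∧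
      (∀ k ∈ K, ∑ i ∈ fill k, w i ≤ cap k) ∧
      (∑ i ∈ rest, w i ≤ (∑ i ∈ s, w i + K.card * m) - ∑ k ∈ K, cap k) := by
  classical
  induction K using Finset.induction_on with
  | empty =>
    intro s _
    exact ⟨s, fun _ => ∅, subset_rfl, by simp, by simp, by simp, by simp, by simp, by simp⟩
  | insert a K ha ih =>
    intro s hs
    -- With all heights zero the order of the items plays no role, and only the filling property of
    -- the shelf remains.
    obtain ⟨F, hFs, hFa, hFfull, -⟩ := exists_greedy_shelf w (fun _ => 0) s (cap a) m hs
    obtain ⟨rest, fill, h1, h2, h3, h4, h5, h6, h7⟩ :=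
      ih (s \ F) fun i hi => hs i (mem_sdiff.1 hi).1
    have hne : ∀ k ∈ K, k ≠ a := fun k hk h => ha (h ▸ hk)
    have hsum : ∑ i ∈ s \ F, w i + ∑ i ∈ F, w i = ∑ i ∈ s, w i := sum_sdiff hFs
    refine ⟨rest, fun k => if k = a then F else fill k, h1.trans sdiff_subset, ?_, ?_, ?_, ?_, ?_, ?_⟩
    · intro k hk
      rcases mem_insert.1 hk with rfl | hk
      · simpa using hFs
      · simpa [hne k hk] using (h2 k hk).trans sdiff_subset
    · intro i hi
      by_cases hiF : i ∈ F
      · exact Or.inr ⟨a, mem_insert_self _ _, by simpa using hiF⟩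
      · rcases h3 i (mem_sdiff.2 ⟨hi, hiF⟩) with h | ⟨k, hk, hik⟩
        · exact Or.inl h
        · exact Or.inr ⟨k, mem_insert_of_mem hk, by simpa [hne k hk] using hik⟩
    · intro k hk
      rcases mem_insert.1 hk with rfl | hk
      · simp only [if_true]
        exact Finset.disjoint_of_subset_left h1 sdiff_disjoint
      · simpa [hne k hk] using h4 k hk
    · intro k hk l hl hkl
      rcases mem_insert.1 hk with rfl | hk' <;> rcases mem_insert.1 hl with rfl | hl'
      · exact absurd rfl hkl
      · simp only [if_true, hne l hl', if_false]
        exact (Finset.disjoint_of_subset_left (h2 l hl') sdiff_disjoint).symm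
      · simp only [if_true, hne k hk', if_false]
        exact Finset.disjoint_of_subset_left (h2 k hk') sdiff_disjoint
      · simpa [hne k hk', hne l hl'] using h5 k hk' l hl' hkl
    · intro k hk
      rcases mem_insert.1 hk with rfl | hk
      · simpa using hFa
      · simpa [hne k hk] using h6 k hk
    · rw [card_insert_of_notMem ha, sum_insert ha, add_mul]
      rcases hFfull with rfl | hfull
      · have : rest = ∅ := by simpa using h1
        simp [this]
      · omega

/-- A nonnegative combination can be rewritten with at most as many terms as there are
coordinates. -/
lemma exists_sparse_combination {α D : Type*} [Fintype D] (J : Finset α) (v : α → D → ℝ)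
    (x : α → ℝ) (hx : ∀ j ∈ J, 0 ≤ x j) :
    ∃ (S : Finset α) (y : α → ℝ), S ⊆ J ∧ S.card ≤ Fintype.card D ∧ (∀ j ∈ S, 0 ≤ y j) ∧
      ∀ d, ∑ j ∈ S, y j * v j d = ∑ j ∈ J, x j * v j d := by
  classical
  let good : Finset α → Prop := fun S => ∃ y : α → ℝ, (∀ j ∈ S, 0 ≤ y j) ∧
    ∀ d, ∑ j ∈ S, y j * v j d = ∑ j ∈ J, x j * v j d
  have hne : (J.powerset.filter good).Nonempty :=
    ⟨J, mem_filter.2 ⟨mem_powerset_self J, x, hx, fun _ => rfl⟩⟩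
  -- A representation of minimal support. If it had more vectors than coordinates, a linear
  -- dependence with some positive coefficient could be subtracted until one term vanishes.
  obtain ⟨S, hS, hmin⟩ := (J.powerset.filter good).exists_min_image card hne
  obtain ⟨hSJ, y, hy, hsum⟩ := mem_filter.1 hS
  rw [mem_powerset] at hSJ
  refine ⟨S, y, hSJ, ?_, hy, hsum⟩
  by_contra hc
  push Not at hc
  have hfr : Module.finrank ℝ (D → ℝ) < S.card := by simpa using hc
  have key : ∃ c : α → ℝ, (∀ d, ∑ j ∈ S, c j * v j d = 0) ∧ ∃ j ∈ S, 0 < c j := by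
    have hli : ¬ LinearIndependent ℝ (fun j : S => v j) := fun h => by
      have := h.fintype_card_le_finrank
      simp only [Fintype.card_coe] at this
      omega
    rw [Fintype.not_linearIndependent_iff] at hli
    obtain ⟨c, hc0, j0, hj0⟩ := hli
    have hc1 : ∀ d, ∑ j ∈ S, (fun a => if h : a ∈ S then c ⟨a, h⟩ else 0) j * v j d = 0 := by
      intro d
      rw [← Finset.sum_coe_sort]
      have := congrFun hc0 d
      simpa using this
    rcases lt_or_gt_of_ne hj0 with h | h
    · refine ⟨fun a => -(fun a => if h : a ∈ S then c ⟨a, h⟩ else 0) a, fun d => ?_, j0, j0.2, ?_⟩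
      · simp only [neg_mul, sum_neg_distrib, hc1 d, neg_zero]
      · simpa using h
    · exact ⟨_, hc1, j0, j0.2, by simpa using h⟩
  obtain ⟨c, hc0, hpos⟩ := key
  set P := S.filter fun j => 0 < c j with hP
  have hPne : P.Nonempty := by
    obtain ⟨j, hj, hj0⟩ := hpos
    exact ⟨j, mem_filter.2 ⟨hj, hj0⟩⟩
  -- Ratio test: the smallest `y j / c j` over positive `c j` is the largest multiple of `c` that
  -- can be subtracted without making a coefficient negative, and it removes the term `k`.
  obtain ⟨k, hk, hkmin⟩ := P.exists_min_image (fun j => y j / c j) hPne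
  have hkS := (mem_filter.1 hk).1
  have hck := (mem_filter.1 hk).2
  have hgood : good (S.erase k) := by
    refine ⟨fun j => y j - y k / c k * c j, ?_, ?_⟩
    · intro j hj
      have hjS := mem_of_mem_erase hj
      by_cases hcj : 0 < c j
      · have := hkmin j (mem_filter.2 ⟨hjS, hcj⟩)
        rw [le_div_iff₀ hcj] at this
        linarith
      · have h1 : 0 ≤ y k / c k := div_nonneg (hy k hkS) hck.le
        have := hy j hjS
        nlinarith
    · intro d
      have h0 : (y k - y k / c k * c k) * v k d = 0 := by
        rw [div_mul_cancel₀ _ hck.ne']; ring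
      have h1 := Finset.add_sum_erase S (fun j => (y j - y k / c k * c j) * v j d) hkS
      simp only [h0, zero_add] at h1
      rw [h1, ← hsum d]
      simp only [sub_mul, sum_sub_distrib, mul_assoc]
      rw [← mul_sum, hc0 d]; ring
  have := hmin (S.erase k) (mem_filter.2 ⟨mem_powerset.2 ((erase_subset _ _).trans hSJ), hgood⟩)
  rw [card_erase_of_mem hkS] at this
  have := card_pos.2 ⟨k, hkS⟩
  omega

end Packing

/-! ### Neighbours in a finite set of cut points. -/

section Grid

/-- The last point of `P` that is at most `x`. -/
def loPt (P : Finset ℕ) (x : ℕ) : ℕ := (P.filter (· ≤ x)).sup id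

/-- The first point of `P` after `x`. -/
noncomputable def hiPt (P : Finset ℕ) (x : ℕ) : ℕ := sInf {p | p ∈ P ∧ x < p}

variable {P : Finset ℕ} {x y a : ℕ}

lemma loPt_le : loPt P x ≤ x :=
  Finset.sup_le fun _ hp => (mem_filter.1 hp).2

lemma le_loPt (ha : a ∈ P) (hax : a ≤ x) : a ≤ loPt P x :=
  le_sup (f := id) (mem_filter.2 ⟨ha, hax⟩)

lemma loPt_mem (ha : a ∈ P) (hax : a ≤ x) : loPt P x ∈ P := by
  obtain ⟨b, hb, hbe⟩ := exists_mem_eq_sup (P.filter (· ≤ x)) ⟨a, mem_filter.2 ⟨ha, hax⟩⟩ id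
  have : loPt P x = b := hbe
  rw [this]
  exact (mem_filter.1 hb).1

lemma hiPt_le (ha : a ∈ P) (hax : x < a) : hiPt P x ≤ a := Nat.sInf_le ⟨ha, hax⟩

lemma hiPt_mem (ha : a ∈ P) (hax : x < a) : hiPt P x ∈ P :=
  (Nat.sInf_mem (s := {p | p ∈ P ∧ x < p}) ⟨a, ha, hax⟩).1

lemma lt_hiPt (ha : a ∈ P) (hax : x < a) : x < hiPt P x :=
  (Nat.sInf_mem (s := {p | p ∈ P ∧ x < p}) ⟨a, ha, hax⟩).2

lemma loPt_eq (ha : a ∈ P) (hax : a ≤ x) (h : ∀ p ∈ P, p ≤ x → p ≤ a) : loPt P x = a :=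
  le_antisymm (h _ (loPt_mem ha hax) loPt_le) (le_loPt ha hax)

lemma hiPt_eq (ha : a ∈ P) (hax : x < a) (h : ∀ p ∈ P, x < p → a ≤ p) : hiPt P x = a :=
  le_antisymm (hiPt_le ha hax) (h _ (hiPt_mem ha hax) (lt_hiPt ha hax))

lemma loPt_self (ha : a ∈ P) : loPt P a = a := loPt_eq ha le_rfl fun _ _ h => h

/-- No point of `P` lies strictly between the two neighbours of `x`, so every `y` in that cell has
the same neighbours. The points `a` and `b` guarantee that both neighbours exist and neither value
is a default. -/
lemma grid_congr (h1 : loPt P x ≤ y) (h2 : y < hiPt P x) (ha : a ∈ P) (hax : a ≤ x) {b : ℕ}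
    (hb : b ∈ P) (hxb : x < b) : loPt P y = loPt P x ∧ hiPt P y = hiPt P x := by
  constructor
  · refine loPt_eq (loPt_mem ha hax) h1 fun p hp hpy => ?_
    by_contra hc
    push Not at hc
    by_cases hpx : p ≤ x
    · exact absurd (le_loPt hp hpx) (by omega)
    · exact absurd (hiPt_le hp (not_le.1 hpx)) (by omega)
  · refine hiPt_eq (hiPt_mem hb hxb) h2 fun p hp hpy => ?_
    by_cases hpx : x < p
    · exact hiPt_le hp hpx
    · have := le_loPt hp (not_lt.1 hpx)
      omega

end Grid

/-! ### Sorting the floor and the ceiling of a box into few runs. -/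

section Machine

variable {ι : Type*}

/-- Counts the integer points of disjoint intervals. It is used along a row with widths and, with
`h` in the role of `w`, along a column. -/
lemma sum_width_le (Q : Finset ι) (s w : ι → ℕ) (a b : ℕ)
    (hin : ∀ i ∈ Q, a ≤ s i ∧ s i + w i ≤ b)
    (hdis : ∀ i ∈ Q, ∀ j ∈ Q, i ≠ j → s i + w i ≤ s j ∨ s j + w j ≤ s i) :
    ∑ i ∈ Q, w i ≤ b - a := by
  classical
  have h1 : (Q.biUnion fun i => Ico (s i) (s i + w i)).card = ∑ i ∈ Q, w i := by
    rw [card_biUnion]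
    · simp
    · intro i hi j hj hij
      rw [Function.onFun, Finset.disjoint_left]
      intro x hx hx'
      rw [mem_Ico] at hx hx'
      have := hdis i hi j hj hij
      omega
  rw [← h1, ← Nat.card_Ico]
  refine card_le_card fun x hx => ?_
  obtain ⟨i, hi, hx⟩ := mem_biUnion.1 hx
  have := hin i hi
  rw [mem_Ico] at *
  omega

/-- A maximal row of equal items at the floor or at the ceiling of a box. -/
structure Run where
  side : Bool
  p : ℕ
  q : ℕ
  key : ℕ

/-- Sorting inside the regions between consecutive cuts. The items that cross a cut stay; in a
region with left end `a` the items of side `σ a` are moved to the left end, by decreasing key, the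
others to the right end, by increasing key. -/
theorem exists_runs_of_regions (A : Finset ι) (side : ι → Bool) (s w key : ι → ℕ) (ht : ℕ → ℕ)
    (hmono : Monotone ht) (H ℓ r : ℕ) (hw : ∀ i ∈ A, 0 < w i)
    (same : ∀ i ∈ A, ∀ j ∈ A, i ≠ j → side i = side j → s i + w i ≤ s j ∨ s j + w j ≤ s i)
    (opp : ∀ i ∈ A, ∀ j ∈ A, side i ≠ side j →
      s i + w i ≤ s j ∨ s j + w j ≤ s i ∨ ht (key i) + ht (key j) ≤ H)
    (meets : ∀ i ∈ A, ℓ < s i + w i ∧ s i < r)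
    (D : Finset ℕ) (hℓD : ℓ ∈ D) (hrD : r ∈ D) (hD : ∀ d ∈ D, ℓ ≤ d ∧ d ≤ r) (σ : ℕ → Bool)
    (stay : ι → Prop) (hstay : ∀ i, stay i ↔ ∃ d ∈ D, s i < d ∧ d < s i + w i)
    (R2 : ∀ i ∈ A, ¬ stay i → side i = σ (loPt D (s i)) → ∀ j ∈ A, side j = side i →
      ¬ (s j < loPt D (s i) ∧ loPt D (s i) < s j + w j))
    (R3 : ∀ i ∈ A, ¬ stay i → side i ≠ σ (loPt D (s i)) → ∀ j ∈ A, side j = side i →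
      ¬ (s j < hiPt D (s i) ∧ hiPt D (s i) < s j + w j))
    (R4 : ∀ i ∈ A, ¬ stay i → ∀ j ∈ A, stay j → side j ≠ side i → s j < hiPt D (s i) →
      loPt D (s i) < s j + w j → ht (key i) + ht (key j) ≤ H) :
    ∃ ρ : ι → Run,
      (∀ i ∈ A, (ρ i).side = side i ∧ (ρ i).key = key i) ∧
      (∀ i ∈ A, stay i → (ρ i).p = s i ∧ (ρ i).q = s i + w i) ∧
      (∀ i ∈ A, ¬ stay i → ℓ ≤ (ρ i).p ∧ (ρ i).q ≤ r) ∧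
      (∀ i ∈ A, ∀ R, R = ρ i → ∀ Q : Finset ι, (∀ j, j ∈ Q ↔ j ∈ A ∧ ρ j = R) →
        R.p + ∑ j ∈ Q, w j = R.q) ∧
      (∀ i ∈ A, ∀ j ∈ A, ρ i ≠ ρ j → side i = side j →
        (ρ i).q ≤ (ρ j).p ∨ (ρ j).q ≤ (ρ i).p) ∧
      (∀ i ∈ A, ∀ j ∈ A, side i ≠ side j →
        (ρ i).q ≤ (ρ j).p ∨ (ρ j).q ≤ (ρ i).p ∨ ht (key i) + ht (key j) ≤ H) ∧
      ∃ 𝓡 : Finset Run, (∀ i ∈ A, ρ i ∈ 𝓡) ∧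
        ∀ K, (∃ S : Finset ℕ, S.card ≤ K ∧ ∀ i ∈ A, key i ∈ S) →
        𝓡.card ≤ 2 * D.card * K + 2 * D.card := by
  classical
  let M : ℕ → Bool → Finset ι := fun a τ =>
    A.filter fun j => ¬ stay j ∧ loPt D (s j) = a ∧ side j = τ
  -- `G` and `E` are the widths of the members with key above `k` and with key at least `k`. Sorted
  -- by key, the items of key `k` therefore occupy the distances from `G` to `E` from the end of the
  -- region to which their side is moved.
  let G : ℕ → Bool → ℕ → ℕ := fun a τ k => ∑ j ∈ (M a τ).filter (fun j => k < key j), w j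
  let E : ℕ → Bool → ℕ → ℕ := fun a τ k => ∑ j ∈ (M a τ).filter (fun j => k ≤ key j), w j
  let reg : ℕ → Bool → ℕ → Run := fun a τ k =>
    if τ = σ a then ⟨τ, a + G a τ k, a + E a τ k, k⟩
    else ⟨τ, hiPt D a - E a τ k, hiPt D a - G a τ k, k⟩
  let ρ : ι → Run := fun i =>
    if stay i then ⟨side i, s i, s i + w i, key i⟩ else reg (loPt D (s i)) (side i) (key i)
  have inr : ∀ i ∈ A, ¬ stay i → ℓ ≤ s i ∧ s i + w i ≤ r := by
    intro i hi hs
    rw [hstay] at hs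
    push Not at hs
    have h1 := hs ℓ hℓD; have h2 := hs r hrD; have h3 := meets i hi
    constructor
    · by_contra hc; have := h1 (by omega); omega
    · by_contra hc; have := h2 h3.2; omega
  have hlo : ∀ i ∈ A, ¬ stay i → loPt D (s i) ∈ D ∧ hiPt D (s i) ∈ D ∧ loPt D (s i) ≤ s i ∧
      s i < hiPt D (s i) ∧ s i + w i ≤ hiPt D (s i) ∧
      hiPt D (loPt D (s i)) = hiPt D (s i) := by
    intro i hi hs
    have h1 := inr i hi hs
    have h2 := meets i hi
    refine ⟨loPt_mem hℓD h1.1, hiPt_mem hrD h2.2, loPt_le, lt_hiPt hrD h2.2, ?_, ?_⟩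
    · by_contra hc
      exact hs ((hstay i).2 ⟨_, hiPt_mem hrD h2.2, lt_hiPt hrD h2.2, by omega⟩)
    · exact (grid_congr le_rfl (loPt_le.trans_lt (lt_hiPt hrD h2.2)) hℓD h1.1 hrD h2.2).2
  -- facts about members of a region
  have hM : ∀ a τ j, j ∈ M a τ ↔ j ∈ A ∧ ¬ stay j ∧ loPt D (s j) = a ∧ side j = τ := by
    intro a τ j; simp [M]
  have hMin : ∀ a τ, ∀ j ∈ M a τ, a ≤ s j ∧ s j + w j ≤ hiPt D a := by
    intro a τ j hj
    obtain ⟨h1, h2, rfl, -⟩ := (hM _ _ _).1 hj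
    have := hlo j h1 h2
    omega
  have hMdis : ∀ a τ, ∀ i ∈ M a τ, ∀ j ∈ M a τ, i ≠ j → s i + w i ≤ s j ∨ s j + w j ≤ s i := by
    intro a τ i hi j hj hij
    obtain ⟨h1, -, -, h4⟩ := (hM _ _ _).1 hi
    obtain ⟨h1', -, -, h4'⟩ := (hM _ _ _).1 hj
    exact same i h1 j h1' hij (h4.trans h4'.symm)
  have hGE : ∀ a τ k, E a τ k = G a τ k + ∑ j ∈ (M a τ).filter (fun j => key j = k), w j := by
    intro a τ k
    simp only [E, G]
    rw [← sum_union]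
    · congr 1
      ext j
      simp only [mem_union, mem_filter]
      constructor
      · rintro ⟨h1, h2⟩
        rcases h2.eq_or_lt with h | h
        · exact Or.inr ⟨h1, h.symm⟩
        · exact Or.inl ⟨h1, h⟩
      · rintro (⟨h1, h2⟩ | ⟨h1, h2⟩)
        · exact ⟨h1, h2.le⟩
        · exact ⟨h1, h2.symm.le⟩
    · rw [Finset.disjoint_left]
      intro j hj hj'
      have := (mem_filter.1 hj).2; have := (mem_filter.1 hj').2
      omega
  have hEG : ∀ a τ k k', k < k' → E a τ k' ≤ G a τ k := by
    intro a τ k k' hk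
    refine sum_le_sum_of_subset fun j hj => ?_
    rw [mem_filter] at *
    exact ⟨hj.1, by omega⟩
  have hEpos : ∀ i ∈ A, ¬ stay i → G (loPt D (s i)) (side i) (key i) <
      E (loPt D (s i)) (side i) (key i) := by
    intro i hi hs
    rw [hGE]
    have : w i ≤ ∑ j ∈ (M (loPt D (s i)) (side i)).filter (fun j => key j = key i), w j :=
      single_le_sum (f := w) (fun _ _ => Nat.zero_le _)
        (mem_filter.2 ⟨(hM _ _ _).2 ⟨hi, hs, rfl, rfl⟩, rfl⟩)
    have := hw i hi
    omega
  have hEtot : ∀ a τ k lo up, (∀ j ∈ M a τ, lo ≤ s j ∧ s j + w j ≤ up) → E a τ k ≤ up - lo := by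
    intro a τ k lo up h
    exact sum_width_le _ s w lo up (fun j hj => h j (mem_filter.1 hj).1)
      fun i hi j hj => hMdis a τ i (mem_filter.1 hi).1 j (mem_filter.1 hj).1
  -- the extent of the run of a region
  have hreg : ∀ i ∈ A, ¬ stay i → loPt D (s i) ≤ (ρ i).p ∧ (ρ i).p < (ρ i).q ∧
      (ρ i).q ≤ hiPt D (s i) := by
    intro i hi hs
    have h1 := hEpos i hi hs
    have h2 := hEtot (loPt D (s i)) (side i) (key i) _ _ (hMin _ _)
    have h3 := hlo i hi hs
    simp only [ρ, hs, if_false, reg]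
    split_ifs <;> simp only <;> omega
  -- A staying item contains a cut and a region has no cut in its interior, so a staying item that
  -- overlaps the region crosses one of its ends.
  have hcross : ∀ j ∈ A, stay j → ∀ i ∈ A, ¬ stay i → s j < hiPt D (s i) →
      loPt D (s i) < s j + w j → (s j < loPt D (s i) ∧ loPt D (s i) < s j + w j) ∨
      (s j < hiPt D (s i) ∧ hiPt D (s i) < s j + w j) := by
    intro j hj hsj i hi hsi h1 h2
    obtain ⟨d, hd, hd1, hd2⟩ := (hstay j).1 hsj
    by_contra hc
    have h3 : loPt D (s i) ≤ s j := by by_contra h; exact hc (Or.inl ⟨by omega, h2⟩)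
    have h4 : s j + w j ≤ hiPt D (s i) := by by_contra h; exact hc (Or.inr ⟨h1, by omega⟩)
    by_cases hdx : d ≤ s i
    · have := le_loPt hd hdx; omega
    · have := hiPt_le hd (not_le.1 hdx); omega
  refine ⟨ρ, ?_, ?_, ?_, ?_, ?_, ?_, ?_⟩
  · intro i _
    by_cases hs : stay i
    · simp [ρ, hs]
    · simp only [ρ, hs, if_false, reg]
      split_ifs <;> exact ⟨rfl, rfl⟩
  · intro i _ hs
    simp [ρ, hs]
  · intro i hi hs
    have h1 := hreg i hi hs
    have h2 := hlo i hi hs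
    have h3 := hD _ h2.1; have h4 := hD _ h2.2.1
    omega
  · -- widths add up
    have hne : ∀ i ∈ A, ∀ j ∈ A, stay i → ρ j = ρ i → j = i := by
      intro i hi j hj hs he
      by_contra hji
      have hside : side j = side i := by
        have h1 : (ρ j).side = side j := by
          by_cases hs : stay j
          · simp [ρ, hs]
          · simp only [ρ, hs, if_false, reg]; split_ifs <;> rfl
        have h2 : (ρ i).side = side i := by simp [ρ, hs]
        rw [← h1, he, h2]
      have hp : (ρ j).p = s i := by rw [he]; simp [ρ, hs]
      have hq : (ρ j).q = s i + w i := by rw [he]; simp [ρ, hs]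
      by_cases hsj : stay j
      · have h1 := same j hj i hi hji hside
        simp only [ρ, hsj, if_true] at hp hq
        have := hw i hi
        omega
      · have h1 := hreg j hj hsj
        rw [hp, hq] at h1
        obtain ⟨d, hd, hd1, hd2⟩ := (hstay i).1 hs
        by_cases hdx : d ≤ s j
        · have := le_loPt hd hdx; omega
        · have := hiPt_le hd (not_le.1 hdx); omega
    intro i hi R hR Q hQ
    by_cases hs : stay i
    · have : Q = {i} := by
        ext j
        rw [hQ, mem_singleton, hR]
        constructor
        · rintro ⟨h1, h2⟩; exact hne i hi j h1 hs h2
        · rintro rfl; exact ⟨hi, rfl⟩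
      rw [this, hR]
      simp [ρ, hs]
    · have hQe : Q = (M (loPt D (s i)) (side i)).filter (fun j => key j = key i) := by
        ext j
        rw [hQ, mem_filter, hM, hR]
        constructor
        · rintro ⟨h1, h2⟩
          have hsj : ¬ stay j := fun h => hs (by rw [hne j h1 i hi h h2.symm]; exact h)
          have e1 : (ρ j).side = side j ∧ (ρ j).key = key j := by
            simp only [ρ, hsj, if_false, reg]; split_ifs <;> exact ⟨rfl, rfl⟩
          have e2 : (ρ i).side = side i ∧ (ρ i).key = key i := by
            simp only [ρ, hs, if_false, reg]; split_ifs <;> exact ⟨rfl, rfl⟩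
          have r1 := hreg i hi hs
          have r2 := hreg j h1 hsj
          rw [h2] at r2
          have l1 := hlo i hi hs
          have l2 := hlo j h1 hsj
          refine ⟨⟨h1, hsj, ?_, ?_⟩, ?_⟩
          · -- same region
            have hx : loPt D (s i) ≤ (ρ i).p := r1.1
            have g1 := (grid_congr (P := D) (x := s i) (y := (ρ i).p) (by omega) (by omega)
              hℓD (inr i hi hs).1 hrD (meets i hi).2).1
            have g2 := (grid_congr (P := D) (x := s j) (y := (ρ i).p) (by omega) (by omega)
              hℓD (inr j h1 hsj).1 hrD (meets j h1).2).1
            rw [← g1, ← g2]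
          · rw [← e1.1, h2, e2.1]
          · rw [← e1.2, h2, e2.2]
        · rintro ⟨⟨h1, h2, h3, h4⟩, h5⟩
          refine ⟨h1, ?_⟩
          simp [ρ, h2, hs, h3, h4, h5]
      rw [hQe, hR]
      have h1 := hGE (loPt D (s i)) (side i) (key i)
      have h2 := hEtot (loPt D (s i)) (side i) (key i) _ _ (hMin _ _)
      have h3 := hlo i hi hs
      simp only [ρ, hs, if_false, reg]
      split_ifs <;> simp only <;> omega
  · -- runs of the same side
    -- `R2` and `R3` say that a staying item of the same side does not cross the end to which the
    -- side is moved. So it crosses the other end, all members of the region lie before it, and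
    -- their total width, hence the sorted pile, ends before it too.
    have hsr : ∀ i ∈ A, ∀ j ∈ A, ¬ stay i → stay j → side i = side j →
        (ρ i).q ≤ (ρ j).p ∨ (ρ j).q ≤ (ρ i).p := by
      intro i hi j hj hsi hsj hside
      have r1 := hreg i hi hsi
      have e1 : (ρ j).p = s j ∧ (ρ j).q = s j + w j := by simp [ρ, hsj]
      rw [e1.1, e1.2]
      by_cases c1 : s j < hiPt D (s i)
      swap
      · omega
      by_cases c2 : loPt D (s i) < s j + w j
      swap
      · omega
      have hmem : ∀ k ∈ M (loPt D (s i)) (side i), s k + w k ≤ s j ∨ s j + w j ≤ s k := by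
        intro k hk
        obtain ⟨k1, k2, k3, k4⟩ := (hM _ _ _).1 hk
        exact same k k1 j hj (fun h => k2 (h ▸ hsj)) (k4.trans hside)
      have l1 := hlo i hi hsi
      by_cases hσ : side i = σ (loPt D (s i))
      · have := R2 i hi hsi hσ j hj hside.symm
        have hc := (hcross j hj hsj i hi hsi c1 c2).resolve_left this
        have h2 := hEtot (loPt D (s i)) (side i) (key i) (loPt D (s i)) (s j) (by
          intro k hk
          have := hMin _ _ k hk
          have := hmem k hk
          have : 0 < w k := hw k ((hM _ _ _).1 hk).1
          omega)
        have hE := hEpos i hi hsi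
        left
        simp only [ρ, hsi, if_false, reg, hσ, if_true]
        rw [← hσ]
        omega
      · have := R3 i hi hsi hσ j hj hside.symm
        have hc := (hcross j hj hsj i hi hsi c1 c2).resolve_right this
        have h2 := hEtot (loPt D (s i)) (side i) (key i) (s j + w j) (hiPt D (s i)) (by
          intro k hk
          have := hMin _ _ k hk
          have := hmem k hk
          have : 0 < w k := hw k ((hM _ _ _).1 hk).1
          omega)
        have hE := hEpos i hi hsi
        right
        simp only [ρ, hsi, if_false, reg, hσ]
        omega
    intro i hi j hj hne hside
    by_cases hsi : stay i <;> by_cases hsj : stay j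
    · have e1 : (ρ i).p = s i ∧ (ρ i).q = s i + w i := by simp [ρ, hsi]
      have e2 : (ρ j).p = s j ∧ (ρ j).q = s j + w j := by simp [ρ, hsj]
      have := same i hi j hj (fun h => hne (h ▸ rfl)) hside
      omega
    · exact (hsr j hj i hi hsj hsi hside.symm).symm
    · exact hsr i hi j hj hsi hsj hside
    · have r1 := hreg i hi hsi
      have r2 := hreg j hj hsj
      by_cases hl : loPt D (s i) = loPt D (s j)
      · have l1 := hlo i hi hsi
        have hk : key i ≠ key j := by
          intro hk
          apply hne
          simp [ρ, hsi, hsj, hl, hside, hk]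
        have h2 := hEtot (loPt D (s i)) (side i) (key i) _ _ (hMin _ _)
        have h3 := hEtot (loPt D (s j)) (side j) (key j) _ _ (hMin _ _)
        simp only [ρ, hsi, hsj, if_false, reg, ← hl, ← hside] at *
        rcases lt_or_gt_of_ne hk with hk | hk
        · have := hEG (loPt D (s i)) (side i) _ _ hk
          split_ifs <;> simp only <;> omega
        · have := hEG (loPt D (s i)) (side i) _ _ hk
          split_ifs <;> simp only <;> omega
      · have l1 := hlo i hi hsi
        have l2 := hlo j hj hsj
        rcases lt_or_gt_of_ne hl with hl | hl
        · have : hiPt D (s i) ≤ loPt D (s j) := by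
            rw [← l1.2.2.2.2.2]; exact hiPt_le l2.1 hl
          omega
        · have : hiPt D (s j) ≤ loPt D (s i) := by
            rw [← l2.2.2.2.2.2]; exact hiPt_le l1.1 hl
          omega
  · -- runs of opposite sides
    have hsr : ∀ i ∈ A, ∀ j ∈ A, ¬ stay i → stay j → side i ≠ side j →
        (ρ i).q ≤ (ρ j).p ∨ (ρ j).q ≤ (ρ i).p ∨ ht (key i) + ht (key j) ≤ H := by
      intro i hi j hj hsi hsj hside
      have r1 := hreg i hi hsi
      have e1 : (ρ j).p = s j ∧ (ρ j).q = s j + w j := by simp [ρ, hsj]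
      rw [e1.1, e1.2]
      by_cases c1 : s j < hiPt D (s i)
      swap
      · omega
      by_cases c2 : loPt D (s i) < s j + w j
      swap
      · omega
      exact Or.inr (Or.inr (R4 i hi hsi j hj hsj (Ne.symm hside) c1 c2))
    -- If the two heights together exceed `H`, then the items of side `side i` with key at least
    -- `key i` and those of the other side with key at least `key j` were pairwise disjoint in the
    -- original position. So their total width is at most that of the region, and the parts of the
    -- two piles that contain the runs of `i` and `j`, sorted from opposite ends, do not meet.
    have hnn : ∀ i ∈ A, ∀ j ∈ A, ¬ stay i → ¬ stay j → side i ≠ side j →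
        side i = σ (loPt D (s i)) → loPt D (s i) = loPt D (s j) → H < ht (key i) + ht (key j) →
        (ρ i).q ≤ (ρ j).p := by
      intro i hi j hj hsi hsj hside hσ hl hH
      have l1 := hlo i hi hsi
      have hσ' : side j ≠ σ (loPt D (s j)) := by rw [← hl, ← hσ]; exact Ne.symm hside
      have hsum : E (loPt D (s i)) (side i) (key i) + E (loPt D (s i)) (side j) (key j) ≤
          hiPt D (s i) - loPt D (s i) := by
        simp only [E]
        rw [← sum_union]
        · refine sum_width_le _ s w _ _ ?_ ?_
          · intro k hk
            rw [← l1.2.2.2.2.2]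
            rcases mem_union.1 hk with hk | hk
            · exact hMin _ _ k (mem_filter.1 hk).1
            · exact hMin _ _ k (mem_filter.1 hk).1
          · have hX : ∀ k ∈ (M (loPt D (s i)) (side i)).filter (fun k => key i ≤ key k),
                ∀ k' ∈ (M (loPt D (s i)) (side j)).filter (fun k => key j ≤ key k),
                s k + w k ≤ s k' ∨ s k' + w k' ≤ s k := by
              intro k hk k' hk'
              obtain ⟨k1, k2⟩ := mem_filter.1 hk
              obtain ⟨k1', k2'⟩ := mem_filter.1 hk'
              obtain ⟨a1, -, -, a4⟩ := (hM _ _ _).1 k1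
              obtain ⟨b1, -, -, b4⟩ := (hM _ _ _).1 k1'
              have := opp k a1 k' b1 (by rw [a4, b4]; exact hside)
              have := hmono k2; have := hmono k2'
              omega
            intro k hk k' hk' hkk
            rcases mem_union.1 hk with hk | hk <;> rcases mem_union.1 hk' with hk' | hk'
            · exact hMdis _ _ k (mem_filter.1 hk).1 k' (mem_filter.1 hk').1 hkk
            · exact hX k hk k' hk'
            · exact (hX k' hk' k hk).symm
            · exact hMdis _ _ k (mem_filter.1 hk).1 k' (mem_filter.1 hk').1 hkk
        · rw [Finset.disjoint_left]
          intro k hk hk'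
          have h1 := ((hM _ _ _).1 (mem_filter.1 hk).1).2.2.2
          have h2 := ((hM _ _ _).1 (mem_filter.1 hk').1).2.2.2
          exact hside (h1.symm.trans h2)
      have hσ'' : ¬ side j = σ (loPt D (s i)) := by rw [hl]; exact hσ'
      simp only [ρ, hsi, hsj, if_false, reg, ← hl]
      rw [if_pos hσ, if_neg hσ'']
      simp only
      omega
    intro i hi j hj hside
    by_cases hsi : stay i <;> by_cases hsj : stay j
    · have e1 : (ρ i).p = s i ∧ (ρ i).q = s i + w i := by simp [ρ, hsi]
      have e2 : (ρ j).p = s j ∧ (ρ j).q = s j + w j := by simp [ρ, hsj]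
      have := opp i hi j hj hside
      omega
    · have := hsr j hj i hi hsj hsi (Ne.symm hside)
      omega
    · exact hsr i hi j hj hsi hsj hside
    · have r1 := hreg i hi hsi
      have r2 := hreg j hj hsj
      have l1 := hlo i hi hsi
      have l2 := hlo j hj hsj
      by_cases hl : loPt D (s i) = loPt D (s j)
      · by_cases hH : ht (key i) + ht (key j) ≤ H
        · exact Or.inr (Or.inr hH)
        push Not at hH
        by_cases hσ : side i = σ (loPt D (s i))
        · exact Or.inl (hnn i hi j hj hsi hsj hside hσ hl hH)
        · have hσ' : side j = σ (loPt D (s j)) := by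
            rw [← hl]
            revert hside hσ
            cases side i <;> cases side j <;> cases σ (loPt D (s i)) <;> simp
          exact Or.inr (Or.inl (hnn j hj i hi hsj hsi (Ne.symm hside) hσ' hl.symm (by omega)))
      · rcases lt_or_gt_of_ne hl with hl | hl
        · have : hiPt D (s i) ≤ loPt D (s j) := by
            rw [← l1.2.2.2.2.2]; exact hiPt_le l2.1 hl
          omega
        · have : hiPt D (s j) ≤ loPt D (s i) := by
            rw [← l2.2.2.2.2.2]; exact hiPt_le l1.1 hl
          omega
  -- A run in a region is determined by the left end of the region, the side and the key. A run of a
  -- staying item is charged to a cut that the item crosses; each cut is crossed by at most one item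
  -- of each side.
  · refine ⟨A.image ρ, fun i hi => mem_image_of_mem _ hi, fun K ⟨S, hSK, hS⟩ => ?_⟩
    have hsplit : A.image ρ ⊆
        ((D ×ˢ (univ : Finset Bool)) ×ˢ S).image (fun x => reg x.1.1 x.1.2 x.2) ∪
        (A.filter stay).image ρ := by
      intro R hR
      obtain ⟨i, hi, rfl⟩ := mem_image.1 hR
      by_cases hs : stay i
      · exact mem_union_right _ (mem_image_of_mem _ (mem_filter.2 ⟨hi, hs⟩))
      · refine mem_union_left _ (mem_image.2 ⟨((loPt D (s i), side i), key i), ?_, ?_⟩)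
        · simp [hS i hi, (hlo i hi hs).1]
        · simp [ρ, hs]
    have h1 : (((D ×ˢ (univ : Finset Bool)) ×ˢ S).image (fun x => reg x.1.1 x.1.2 x.2)).card ≤
        2 * D.card * K := by
      refine card_image_le.trans ?_
      rw [card_product, card_product, card_univ, Fintype.card_bool, mul_comm D.card 2]
      exact Nat.mul_le_mul_left _ hSK
    have h2 : ((A.filter stay).image ρ).card ≤ 2 * D.card := by
      refine card_image_le.trans ?_
      choose! f hf using fun i => (hstay i).1
      have : (A.filter stay).card ≤ (D ×ˢ (univ : Finset Bool)).card := by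
        refine card_le_card_of_injOn (fun i => (f i, side i)) ?_ ?_
        · intro i hi
          have := (mem_filter.1 (mem_coe.1 hi)).2
          simp [(hf i this).1]
        · intro i hi j hj hij
          obtain ⟨hi1, hi2⟩ := mem_filter.1 (mem_coe.1 hi)
          obtain ⟨hj1, hj2⟩ := mem_filter.1 (mem_coe.1 hj)
          simp only [Prod.mk.injEq] at hij
          by_contra hne
          have := same i hi1 j hj1 hne hij.2
          have h1 := hf i hi2; have h2 := hf j hj2
          rw [hij.1] at h1
          omega
      rw [card_product, card_univ, Fintype.card_bool] at this
      omega
    exact (card_le_card hsplit).trans ((card_union_le _ _).trans (by omega))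

/-- Items at the floor (`side = false`) and at the ceiling (`side = true`) of a box can be
rearranged into few runs of equal items, keeping the items that cross the sides of the box. -/
theorem exists_runs (A : Finset ι) (side : ι → Bool) (s w key : ι → ℕ) (ht : ℕ → ℕ)
    (hmono : Monotone ht) (H ℓ r : ℕ) (hℓr : ℓ < r) (hw : ∀ i ∈ A, 0 < w i)
    (same : ∀ i ∈ A, ∀ j ∈ A, i ≠ j → side i = side j → s i + w i ≤ s j ∨ s j + w j ≤ s i)
    (opp : ∀ i ∈ A, ∀ j ∈ A, side i ≠ side j →
      s i + w i ≤ s j ∨ s j + w j ≤ s i ∨ ht (key i) + ht (key j) ≤ H)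
    (meets : ∀ i ∈ A, ℓ < s i + w i ∧ s i < r)
    (K : ℕ) (S : Finset ℕ) (hSK : S.card ≤ K) (hS : ∀ i ∈ A, key i ∈ S) :
    ∃ ρ : ι → Run,
      (∀ i ∈ A, (ρ i).side = side i ∧ (ρ i).key = key i) ∧
      (∀ i ∈ A, s i < ℓ ∨ r < s i + w i → (ρ i).p = s i ∧ (ρ i).q = s i + w i) ∧
      (∀ i ∈ A, ℓ ≤ s i → s i + w i ≤ r → ℓ ≤ (ρ i).p ∧ (ρ i).q ≤ r) ∧
      (∀ i ∈ A, ∀ R, R = ρ i → ∀ Q : Finset ι, (∀ j, j ∈ Q ↔ j ∈ A ∧ ρ j = R) →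
        R.p + ∑ j ∈ Q, w j = R.q) ∧
      (∀ i ∈ A, ∀ j ∈ A, ρ i ≠ ρ j → side i = side j →
        (ρ i).q ≤ (ρ j).p ∨ (ρ j).q ≤ (ρ i).p) ∧
      (∀ i ∈ A, ∀ j ∈ A, side i ≠ side j →
        (ρ i).q ≤ (ρ j).p ∨ (ρ j).q ≤ (ρ i).p ∨ ht (key i) + ht (key j) ≤ H) ∧
      ∃ 𝓡 : Finset Run, (∀ i ∈ A, ρ i ∈ 𝓡) ∧ 𝓡.card ≤ 8 * (K + 2) * (K + 1) := by
  classical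
  -- The tops that lie inside the box. `first k` and `last k` are the extreme points reached by
  -- those of key at least `k`. Cutting there, for each of the at most `K` keys, makes every bottom
  -- that crosses a cut comparable with the tops of the adjacent regions.
  let Tm : Finset ι := A.filter fun i => side i = true ∧ ℓ ≤ s i ∧ s i + w i ≤ r
  let first : ℕ → ℕ := fun k => sInf {x | ∃ j ∈ Tm, k ≤ key j ∧ s j = x}
  let last : ℕ → ℕ := fun k => (Tm.filter fun j => k ≤ key j).sup fun j => s j + w j
  let X₁ : Finset ℕ := (A.filter fun i => side i = true ∧ s i < ℓ).image fun i => min (s i + w i) r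
  let X₂ : Finset ℕ :=
    (A.filter fun i => side i = true ∧ r < s i + w i).image fun i => max (s i) ℓ
  let C : Finset ℕ := {ℓ, r} ∪ X₁ ∪ X₂ ∪ Tm.image (fun i => first (key i)) ∪
    Tm.image (fun i => last (key i))
  have hTm : ∀ i, i ∈ Tm ↔ i ∈ A ∧ side i = true ∧ ℓ ≤ s i ∧ s i + w i ≤ r := by
    intro i; simp [Tm]
  have first_le : ∀ i ∈ Tm, ∀ k ≤ key i, first k ≤ s i := fun i hi k hk =>
    Nat.sInf_le ⟨i, hi, hk, rfl⟩
  have first_eq : ∀ i ∈ Tm, ∀ k ≤ key i, ∃ j ∈ Tm, k ≤ key j ∧ s j = first k := fun i hi k hk =>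
    Nat.sInf_mem (s := {x | ∃ j ∈ Tm, k ≤ key j ∧ s j = x}) ⟨_, i, hi, hk, rfl⟩
  have le_last : ∀ i ∈ Tm, ∀ k ≤ key i, s i + w i ≤ last k := fun i hi k hk =>
    le_sup (f := fun j => s j + w j) (mem_filter.2 ⟨hi, hk⟩)
  have last_eq : ∀ i ∈ Tm, ∀ k ≤ key i, ∃ j ∈ Tm, k ≤ key j ∧ s j + w j = last k := by
    intro i hi k hk
    obtain ⟨j, hj, e⟩ := exists_mem_eq_sup (Tm.filter fun j => k ≤ key j)
      ⟨i, mem_filter.2 ⟨hi, hk⟩⟩ fun j => s j + w j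
    exact ⟨j, (mem_filter.1 hj).1, (mem_filter.1 hj).2, e.symm⟩
  have hC : ∀ c, c ∈ C ↔ c = ℓ ∨ c = r ∨
      (∃ i ∈ A, side i = true ∧ s i < ℓ ∧ c = min (s i + w i) r) ∨
      (∃ i ∈ A, side i = true ∧ r < s i + w i ∧ c = max (s i) ℓ) ∨
      (∃ i ∈ Tm, c = first (key i)) ∨ (∃ i ∈ Tm, c = last (key i)) := by
    intro c
    simp only [C, X₁, X₂, mem_union, mem_insert, mem_singleton, mem_image, mem_filter]
    constructor
    · rintro (((((h | h) | ⟨i, h1, rfl⟩) | ⟨i, h1, rfl⟩) | ⟨i, h1, rfl⟩) | ⟨i, h1, rfl⟩)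
      · exact Or.inl h
      · exact Or.inr (Or.inl h)
      · exact Or.inr (Or.inr (Or.inl ⟨i, h1.1, h1.2.1, h1.2.2, rfl⟩))
      · exact Or.inr (Or.inr (Or.inr (Or.inl ⟨i, h1.1, h1.2.1, h1.2.2, rfl⟩)))
      · exact Or.inr (Or.inr (Or.inr (Or.inr (Or.inl ⟨i, h1, rfl⟩))))
      · exact Or.inr (Or.inr (Or.inr (Or.inr (Or.inr ⟨i, h1, rfl⟩))))
    · rintro (h | h | ⟨i, h1, h2, h3, rfl⟩ | ⟨i, h1, h2, h3, rfl⟩ | ⟨i, h1, rfl⟩ | ⟨i, h1, rfl⟩)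
      · exact Or.inl (Or.inl (Or.inl (Or.inl (Or.inl h))))
      · exact Or.inl (Or.inl (Or.inl (Or.inl (Or.inr h))))
      · exact Or.inl (Or.inl (Or.inl (Or.inr ⟨i, ⟨h1, h2, h3⟩, rfl⟩)))
      · exact Or.inl (Or.inl (Or.inr ⟨i, ⟨h1, h2, h3⟩, rfl⟩))
      · exact Or.inl (Or.inr ⟨i, h1, rfl⟩)
      · exact Or.inr ⟨i, h1, rfl⟩
  have hℓC : ℓ ∈ C := (hC ℓ).2 (Or.inl rfl)
  have hrC : r ∈ C := (hC r).2 (Or.inr (Or.inl rfl))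
  have hCb : ∀ c ∈ C, ℓ ≤ c ∧ c ≤ r := by
    intro c hc
    rcases (hC c).1 hc with h | h | ⟨i, h1, h2, h3, h⟩ | ⟨i, h1, h2, h3, h⟩ | ⟨i, h1, h⟩ |
      ⟨i, h1, h⟩
    · omega
    · omega
    · have := meets i h1; omega
    · have := meets i h1; omega
    · obtain ⟨j, hj, h2, h3⟩ := first_eq i h1 _ le_rfl
      have := (hTm j).1 hj
      have := hw j this.1
      omega
    · obtain ⟨j, hj, h2, h3⟩ := last_eq i h1 _ le_rfl
      have := (hTm j).1 hj
      have := hw j this.1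
      omega
  have hCcard : C.card ≤ 2 * K + 4 := by
    have h1 : X₁.card ≤ 1 := by
      refine card_image_le.trans (card_le_one.2 fun i hi j hj => ?_)
      obtain ⟨i1, i2, i3⟩ := mem_filter.1 hi
      obtain ⟨j1, j2, j3⟩ := mem_filter.1 hj
      by_contra hne
      have := same i i1 j j1 hne (i2.trans j2.symm)
      have := meets i i1; have := meets j j1
      omega
    have h2 : X₂.card ≤ 1 := by
      refine card_image_le.trans (card_le_one.2 fun i hi j hj => ?_)
      obtain ⟨i1, i2, i3⟩ := mem_filter.1 hi
      obtain ⟨j1, j2, j3⟩ := mem_filter.1 hj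
      by_contra hne
      have := same i i1 j j1 hne (i2.trans j2.symm)
      have := meets i i1; have := meets j j1
      omega
    have h3 : ∀ f : ℕ → ℕ, (Tm.image fun i => f (key i)).card ≤ K := by
      intro f
      refine le_trans (card_le_card ?_) ((card_image_le (s := S) (f := f)).trans hSK)
      intro x hx
      obtain ⟨i, hi, rfl⟩ := mem_image.1 hx
      exact mem_image_of_mem _ (hS i ((hTm i).1 hi).1)
    have h4 : ({ℓ, r} : Finset ℕ).card ≤ 2 := card_le_two
    have h5 := h3 first
    have h6 := h3 last
    have e1 := card_union_le ({ℓ, r} ∪ X₁ ∪ X₂ ∪ Tm.image (fun i => first (key i)))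
      (Tm.image (fun i => last (key i)))
    have e2 := card_union_le ({ℓ, r} ∪ X₁ ∪ X₂) (Tm.image (fun i => first (key i)))
    have e3 := card_union_le ({ℓ, r} ∪ X₁) X₂
    have e4 := card_union_le {ℓ, r} X₁
    change (({ℓ, r} ∪ X₁ ∪ X₂ ∪ Tm.image (fun i => first (key i)) ∪
      Tm.image (fun i => last (key i))) : Finset ℕ).card ≤ _
    omega
  -- tops cross a cut of the first kind only at the sides of the box
  have topcross : ∀ c ∈ C, ∀ j ∈ A, side j = true → s j < c → c < s j + w j → c = ℓ ∨ c = r := by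
    intro c hc j hj hjs hj1 hj2
    have key' : ∀ i ∈ A, side i = true → j ≠ i → s i + w i ≤ s j ∨ s j + w j ≤ s i :=
      fun i hi his hne => same i hi j hj (Ne.symm hne) (his.trans hjs.symm)
    rcases (hC c).1 hc with h | h | ⟨i, h1, h2, h3, h⟩ | ⟨i, h1, h2, h3, h⟩ | ⟨i, h1, h⟩ |
      ⟨i, h1, h⟩
    · exact Or.inl h
    · exact Or.inr h
    · by_cases hji : j = i
      · subst hji; omega
      · have := key' i h1 h2 hji
        have := meets i h1
        omega
    · by_cases hji : j = i
      · subst hji; omega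
      · have := key' i h1 h2 hji
        have := meets i h1
        omega
    · obtain ⟨i', h4, h5, h6⟩ := first_eq i h1 _ le_rfl
      have h7 := (hTm i').1 h4
      have := hw i' h7.1
      by_cases hji : j = i'
      · subst hji; omega
      · have := key' i' h7.1 h7.2.1 hji
        omega
    · obtain ⟨i', h4, h5, h6⟩ := last_eq i h1 _ le_rfl
      have h7 := (hTm i').1 h4
      have := hw i' h7.1
      by_cases hji : j = i'
      · subst hji; omega
      · have := key' i' h7.1 h7.2.1 hji
        omega
  -- The right end of a top that crosses `ℓ` is itself a cut, so this top covers the whole first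
  -- region. The same holds for `r` in `topr`.
  have topℓ : ∀ j ∈ A, side j = true → s j < ℓ → ∀ x, ℓ ≤ x → x < r → loPt C x = ℓ →
      hiPt C x ≤ s j + w j := by
    intro j hj hjs hj1 x hx hxr hlo
    have hm : min (s j + w j) r ∈ C := (hC _).2 (Or.inr (Or.inr (Or.inl ⟨j, hj, hjs, hj1, rfl⟩)))
    have := meets j hj
    have : x < min (s j + w j) r := by
      by_contra hc
      have := le_loPt hm (not_lt.1 hc)
      omega
    have := hiPt_le hm this
    omega
  have topr : ∀ j ∈ A, side j = true → r < s j + w j → ∀ x, ℓ ≤ x → x < r → hiPt C x = r →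
      s j ≤ loPt C x := by
    intro j hj hjs hj1 x hx hxr hhi
    have hm : max (s j) ℓ ∈ C :=
      (hC _).2 (Or.inr (Or.inr (Or.inr (Or.inl ⟨j, hj, hjs, hj1, rfl⟩))))
    have := meets j hj
    have : max (s j) ℓ ≤ x := by
      by_contra hc
      have := hiPt_le hm (not_le.1 hc)
      omega
    have := le_loPt hm this
    omega
  -- a bottom crossing an end of the region of a movable top is compatible with that top
  have record : ∀ i ∈ Tm, ∀ j ∈ A, side j = false →
      (s j < loPt C (s i) ∧ loPt C (s i) < s j + w j ∨
        s i + w i ≤ hiPt C (s i) ∧ s j < hiPt C (s i) ∧ hiPt C (s i) < s j + w j) →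
      ht (key i) + ht (key j) ≤ H := by
    intro i hi j hj hjs hcr
    have hi' := (hTm i).1 hi
    have hwi := hw i hi'.1
    -- It suffices that `j` overlaps, in the original position, some top of key at least `key i`,
    -- because heights are monotone in the key.
    have comp : ∀ i' ∈ Tm, key i ≤ key i' → s j < s i' + w i' → s i' < s j + w j →
        ht (key i) + ht (key j) ≤ H := by
      intro i' h1 h2 h3 h4
      have h5 := (hTm i').1 h1
      have := opp i' h5.1 j hj (by rw [h5.2.1, hjs]; simp)
      have := hmono h2
      omega
    obtain ⟨f, f1, f2, f3⟩ := first_eq i hi _ le_rfl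
    obtain ⟨l, l1, l2, l3⟩ := last_eq i hi _ le_rfl
    have f4 := first_le i hi _ le_rfl
    have l4 := le_last i hi _ le_rfl
    have f5 : first (key i) ∈ C :=
      (hC _).2 (Or.inr (Or.inr (Or.inr (Or.inr (Or.inl ⟨i, hi, rfl⟩)))))
    have l5 : last (key i) ∈ C :=
      (hC _).2 (Or.inr (Or.inr (Or.inr (Or.inr (Or.inr ⟨i, hi, rfl⟩)))))
    have hf' := (hTm f).1 f1
    have hl' := (hTm l).1 l1
    have hwf := hw f hf'.1
    have hwl := hw l hl'.1
    have c1 := loPt_mem hℓC hi'.2.2.1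
    have c2 := hiPt_mem hrC (show s i < r by omega)
    have c3 := loPt_le (P := C) (x := s i)
    have c4 := lt_hiPt hrC (show s i < r by omega)
    have fle := le_loPt f5 f4
    have lge := hiPt_le l5 (show s i < last (key i) by omega)
    have samei : ∀ t ∈ Tm, ∀ i' ∈ A, side i' = true → t ≠ i' →
        s i' + w i' ≤ s t ∨ s t + w t ≤ s i' :=
      fun t ht i' hi'A hs hne => same i' hi'A t ((hTm t).1 ht).1 (Ne.symm hne)
        (hs.trans ((hTm t).1 ht).2.1.symm)
    rcases hcr with ⟨hcr1, hcr2⟩ | ⟨hcr0, hcr1, hcr2⟩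
    -- The left end of the region lies between `first (key i)` and the top `i`. If it is the `first`
    -- or `last` point of another key, the top reaching it there either has key at least `key i`,
    -- and then `comp` applies, or it has a smaller key. In the second case `first` would have to
    -- lie further left, or `last` further right. The right end is symmetric.
    · by_cases hfc : first (key i) = loPt C (s i)
      · exact comp f f1 f2 (by omega) (by omega)
      rcases (hC _).1 c1 with h | h | ⟨t, h1, h2, h3, h⟩ | ⟨t, h1, h2, h3, h⟩ | ⟨t, h1, h⟩ |
        ⟨t, h1, h⟩
      · omega
      · omega
      · have := samei f f1 t h1 h2 (by rintro rfl; omega)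
        have := meets t h1
        omega
      · have := samei i hi t h1 h2 (by rintro rfl; omega)
        have := meets t h1
        omega
      · obtain ⟨i', h4, h5, h6⟩ := first_eq t h1 _ le_rfl
        have h7 := (hTm i').1 h4
        have := hw i' h7.1
        rcases le_total (key i) (key i') with hk | hk
        · exact comp i' h4 hk (by omega) (by omega)
        · have := first_le f f1 (key t) (by omega)
          omega
      · obtain ⟨i', h4, h5, h6⟩ := last_eq t h1 _ le_rfl
        have h7 := (hTm i').1 h4
        have := hw i' h7.1
        rcases le_total (key i) (key i') with hk | hk
        · exact comp i' h4 hk (by omega) (by omega)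
        · have := le_last i hi (key t) (by omega)
          omega
    · by_cases hlc : last (key i) = hiPt C (s i)
      · exact comp l l1 l2 (by omega) (by omega)
      rcases (hC _).1 c2 with h | h | ⟨t, h1, h2, h3, h⟩ | ⟨t, h1, h2, h3, h⟩ | ⟨t, h1, h⟩ |
        ⟨t, h1, h⟩
      · omega
      · omega
      · have := samei i hi t h1 h2 (by rintro rfl; omega)
        have := meets t h1
        omega
      · have := samei l l1 t h1 h2 (by rintro rfl; omega)
        have := meets t h1
        omega
      · obtain ⟨i', h4, h5, h6⟩ := first_eq t h1 _ le_rfl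
        have h7 := (hTm i').1 h4
        have := hw i' h7.1
        rcases le_total (key i) (key i') with hk | hk
        · exact comp i' h4 hk (by omega) (by omega)
        · have := first_le i hi (key t) (by omega)
          omega
      · obtain ⟨i', h4, h5, h6⟩ := last_eq t h1 _ le_rfl
        have h7 := (hTm i').1 h4
        have := hw i' h7.1
        rcases le_total (key i) (key i') with hk | hk
        · exact comp i' h4 hk (by omega) (by omega)
        · have := le_last l l1 (key t) (by omega)
          omega
  -- the cut of the second kind inside a region
  have hdcut : ∀ c, ∃ d, (d = hiPt C c ∧ ∀ j ∈ A, side j = false → c ≤ s j →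
        s j + w j ≤ hiPt C c → False) ∨
      ∃ j ∈ A, side j = false ∧ c ≤ s j ∧ s j + w j ≤ hiPt C c ∧ d = s j + w j ∧
        ∀ i ∈ A, side i = false → c ≤ s i → s i + w i ≤ hiPt C c → key i ≤ key j := by
    intro c
    by_cases hne : (A.filter fun j => side j = false ∧ c ≤ s j ∧ s j + w j ≤ hiPt C c).Nonempty
    · obtain ⟨j, hj, hm⟩ := exists_max_image _ key hne
      rw [mem_filter] at hj
      exact ⟨_, Or.inr ⟨j, hj.1, hj.2.1, hj.2.2.1, hj.2.2.2, rfl, fun i h1 h2 h3 h4 =>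
        hm i (mem_filter.2 ⟨h1, h2, h3, h4⟩)⟩⟩
    · refine ⟨_, Or.inl ⟨rfl, fun j h1 h2 h3 h4 => hne ⟨j, mem_filter.2 ⟨h1, h2, h3, h4⟩⟩⟩⟩
  choose dcut hdcut using hdcut
  have dcut_bd : ∀ c ∈ C, c < r → c < dcut c ∧ dcut c ≤ hiPt C c := by
    intro c hc hcr
    have := lt_hiPt hrC hcr
    rcases hdcut c with ⟨h, -⟩ | ⟨j, h1, h2, h3, h4, h5, -⟩
    · omega
    · have := hw j h1; omega
  let D : Finset ℕ := C ∪ (C.filter (· < r)).image dcut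
  have hD : ∀ d, d ∈ D ↔ d ∈ C ∨ ∃ c ∈ C, c < r ∧ dcut c = d := by
    intro d; simp [D, and_assoc]
  have hCD : ∀ c ∈ C, c ∈ D := fun c hc => (hD c).2 (Or.inl hc)
  have hDb : ∀ d ∈ D, ℓ ≤ d ∧ d ≤ r := by
    intro d hd
    rcases (hD d).1 hd with h | ⟨c, h1, h2, rfl⟩
    · exact hCb d h
    · have := dcut_bd c h1 h2
      have := hCb c h1
      have := hiPt_le hrC h2
      omega
  have botcross : ∀ c ∈ C, c < r → dcut c ∉ C → ∀ j ∈ A, side j = false →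
      ¬ (s j < dcut c ∧ dcut c < s j + w j) := by
    rintro c hc hcr hd j hj hjs ⟨hj1, hj2⟩
    rcases hdcut c with ⟨h, -⟩ | ⟨j', h1, h2, h3, h4, h5, -⟩
    · exact hd (h ▸ hiPt_mem hrC hcr)
    · have := hw j' h1
      by_cases hjj : j = j'
      · subst hjj; omega
      · have := same j hj j' h1 hjj (hjs.trans h2.symm)
        omega
  -- description of the regions
  have region : ∀ x, ℓ ≤ x → x < r → ∃ c ∈ C, ∃ c' ∈ C, c = loPt C x ∧ c' = hiPt C x ∧ c ≤ x ∧
      x < c' ∧ c < r ∧ hiPt C c = c' ∧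
      (x < dcut c ∧ loPt D x = c ∧ hiPt D x = dcut c ∨
        dcut c ≤ x ∧ loPt D x = dcut c ∧ hiPt D x = c' ∧ dcut c ∉ C) := by
    intro x hx hxr
    have c1 := loPt_mem hℓC hx
    have c2 := hiPt_mem hrC hxr
    have c3 := loPt_le (P := C) (x := x)
    have c4 := lt_hiPt hrC hxr
    have c5 : hiPt C (loPt C x) = hiPt C x :=
      (grid_congr le_rfl (by omega) hℓC hx hrC hxr).2
    have cr : loPt C x < r := by omega
    have bd := dcut_bd _ c1 cr
    have hdD : dcut (loPt C x) ∈ D := (hD _).2 (Or.inr ⟨_, c1, cr, rfl⟩)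
    have out : ∀ p ∈ D, p ≤ loPt C x ∨ p = dcut (loPt C x) ∨ hiPt C x ≤ p := by
      intro p hp
      rcases (hD p).1 hp with h | ⟨q, h1, h2, rfl⟩
      · by_cases hpx : p ≤ x
        · exact Or.inl (le_loPt h hpx)
        · exact Or.inr (Or.inr (hiPt_le h (not_le.1 hpx)))
      · have := dcut_bd q h1 h2
        by_cases hqx : q ≤ x
        · have h3 := le_loPt h1 hqx
          rcases h3.eq_or_lt with h4 | h4
          · exact Or.inr (Or.inl (by rw [h4]))
          · have := hiPt_le c1 h4
            omega
        · have := hiPt_le h1 (not_le.1 hqx)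
          omega
    refine ⟨_, c1, _, c2, rfl, rfl, c3, c4, cr, c5, ?_⟩
    by_cases hdx : x < dcut (loPt C x)
    · refine Or.inl ⟨hdx, loPt_eq (hCD _ c1) c3 fun p hp hpx => ?_,
        hiPt_eq hdD hdx fun p hp hpx => ?_⟩
      · have := out p hp; omega
      · have := out p hp; omega
    · push Not at hdx
      refine Or.inr ⟨hdx, loPt_eq hdD hdx fun p hp hpx => ?_,
        hiPt_eq (hCD _ c2) c4 fun p hp hpx => ?_, fun hd => ?_⟩
      · have := out p hp; omega
      · have := out p hp; omega
      · have := le_loPt hd hdx; omega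
  have instay : ∀ i ∈ A, ¬ (∃ d ∈ D, s i < d ∧ d < s i + w i) → ℓ ≤ s i ∧ s i + w i ≤ r ∧
      ∀ c ∈ C, ¬ (s i < c ∧ c < s i + w i) := by
    intro i hi hs
    have h3 := meets i hi
    refine ⟨?_, ?_, fun c hc h => hs ⟨c, hCD c hc, h⟩⟩
    · by_contra hc; exact hs ⟨ℓ, hCD _ hℓC, by omega, by omega⟩
    · by_contra hc; exact hs ⟨r, hCD _ hrC, by omega, by omega⟩
  -- Between consecutive cuts of `C` the tops move outwards to both ends, the highest at the ends,
  -- and the bottoms gather around `dcut`, the highest next to it. So tops are moved left exactly in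
  -- the regions that start at a point of `C`.
  obtain ⟨ρ, ρ1, ρ2, ρ3, ρ4, ρ5, ρ6, 𝓡, hρ𝓡, h𝓡⟩ := exists_runs_of_regions A side s w key ht hmono H
    ℓ r hw same opp meets D (hCD _ hℓC) (hCD _ hrC) hDb (fun a => decide (a ∈ C))
    (fun i => ∃ d ∈ D, s i < d ∧ d < s i + w i) (fun _ => Iff.rfl)
    (by
      intro i hi hs hσ j hj hji ⟨hj1, hj2⟩
      obtain ⟨i1, i2, i3⟩ := instay i hi hs
      have hm := meets i hi
      have hwi := hw i hi
      obtain ⟨c, hc, c', hc', e1, e2, g1, g2, g3, g4, ⟨g5, g6, g7⟩ | ⟨g5, g6, g7, g8⟩⟩ :=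
        region (s i) i1 hm.2
      · rw [g6] at hσ hj1 hj2
        rw [decide_eq_true hc] at hσ
        have hjs := hji.trans hσ
        rcases topcross c hc j hj hjs hj1 hj2 with h | h
        · have := topℓ j hj hjs (by omega) (s i) i1 hm.2 (by omega)
          have := same i hi j hj (by rintro rfl; omega) hji.symm
          omega
        · omega
      · rw [g6] at hσ hj1 hj2
        rw [decide_eq_false g8] at hσ
        exact botcross c hc g3 g8 j hj (hji.trans hσ) ⟨hj1, hj2⟩)
    (by
      intro i hi hs hσ j hj hji ⟨hj1, hj2⟩
      obtain ⟨i1, i2, i3⟩ := instay i hi hs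
      have hm := meets i hi
      have hwi := hw i hi
      obtain ⟨c, hc, c', hc', e1, e2, g1, g2, g3, g4, ⟨g5, g6, g7⟩ | ⟨g5, g6, g7, g8⟩⟩ :=
        region (s i) i1 hm.2
      · rw [g6, decide_eq_true hc] at hσ
        rw [g7] at hj1 hj2
        have his : side i = false := by simpa using hσ
        have hic : s i + w i ≤ c' := by
          by_contra h; exact i3 c' hc' ⟨g2, by omega⟩
        rcases hdcut c with ⟨h, h'⟩ | ⟨j', h1, h2, h3, h4, h5, -⟩
        · exact h' i hi his g1 (by omega)
        · have := hw j' h1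
          by_cases hjj : j = j'
          · subst hjj; omega
          · have := same j hj j' h1 hjj ((hji.trans his).trans h2.symm)
            omega
      · rw [g6, decide_eq_false g8] at hσ
        rw [g7] at hj1 hj2
        have his : side i = true := by simpa using hσ
        have hjs := hji.trans his
        rcases topcross c' hc' j hj hjs hj1 hj2 with h | h
        · omega
        · have := topr j hj hjs (by omega) (s i) i1 hm.2 (by omega)
          have := same i hi j hj (by rintro rfl; omega) hji.symm
          have := hw j hj
          omega)
    (by
      rintro i hi hs j hj ⟨d, hd, hd1, hd2⟩ hji hj1 hj2
      obtain ⟨i1, i2, i3⟩ := instay i hi hs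
      have hm := meets i hi
      have hmj := meets j hj
      have hwi := hw i hi
      obtain ⟨c, hc, c', hc', e1, e2, g1, g2, g3, g4, hreg⟩ := region (s i) i1 hm.2
      have hic : s i + w i ≤ c' := by
        by_contra h; exact i3 c' hc' ⟨g2, by omega⟩
      have bd := dcut_bd c hc g3
      have hjD : loPt D (s i) < s j + w j ∧ c < s j + w j ∧ s j < c' := by
        rcases hreg with ⟨g5, g6, g7⟩ | ⟨g5, g6, g7, g8⟩ <;> omega
      have hout : ∀ p ∈ D, p ≤ loPt D (s i) ∨ hiPt D (s i) ≤ p := by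
        intro p hp
        by_cases hpx : p ≤ s i
        · exact Or.inl (le_loPt hp hpx)
        · exact Or.inr (hiPt_le hp (not_le.1 hpx))
      have houtC : ∀ p ∈ C, p ≤ c ∨ c' ≤ p := by
        intro p hp
        by_cases hpx : p ≤ s i
        · exact Or.inl (e1 ▸ le_loPt hp hpx)
        · exact Or.inr (e2 ▸ hiPt_le hp (not_le.1 hpx))
      cases his : side i
      · -- a bottom in a region, a top staying
        have hjs : side j = true := by
          rw [his] at hji; simpa using hji
        rcases hdcut c with ⟨h, h'⟩ | ⟨j', h1, h2, h3, h4, h5, h6⟩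
        · exact (h' i hi his g1 (by omega)).elim
        · have hk := h6 i hi his g1 (by omega)
          have hwj' := hw j' h1
          -- `j'` is a bottom of largest key inside this part and it ends at `dcut c`. A top
          -- reaching that point as stated overlaps `j'`, so it is compatible with `j'` and with
          -- every lower bottom of the part.
          suffices hov : s j < dcut c ∧ dcut c ≤ s j + w j by
            have := opp j hj j' h1 (by rw [hjs, h2]; simp)
            have := hmono hk
            omega
          have hcc : s j < c → c' ≤ s j + w j := by
            intro h
            rcases topcross c hc j hj hjs h hjD.2.1 with h7 | h7
            · have := topℓ j hj hjs (by omega) (s i) i1 hm.2 (by omega)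
              omega
            · omega
          have hcc' : c' < s j + w j → s j ≤ c := by
            intro h
            rcases topcross c' hc' j hj hjs hjD.2.2 h with h7 | h7
            · omega
            · have := topr j hj hjs (by omega) (s i) i1 hm.2 (by omega)
              omega
          have := hout d hd
          rcases hreg with ⟨g5, g6, g7⟩ | ⟨g5, g6, g7, g8⟩
          · rw [g6, g7] at this
            omega
          · rw [g6, g7] at this
            omega
      · -- a top in a region, a bottom staying
        have hjs : side j = false := by
          rw [his] at hji; simpa using hji
        have hiT : i ∈ Tm := (hTm i).2 ⟨hi, his, i1, i2⟩
        -- No bottom crosses a `dcut` outside of `C`, so a staying bottom crosses a cut of `C`. If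
        -- it overlaps the region it then crosses an end of the surrounding interval of `C`, where
        -- `record` applies.
        obtain ⟨q, hq, hq1, hq2⟩ : ∃ q ∈ C, s j < q ∧ q < s j + w j := by
          by_cases hdC : d ∈ C
          · exact ⟨d, hdC, hd1, hd2⟩
          · rcases (hD d).1 hd with h | ⟨e, h1, h2, rfl⟩
            · exact absurd h hdC
            · exact absurd ⟨hd1, hd2⟩ (botcross e h1 h2 hdC j hj hjs)
        refine record i hiT j hj hjs ?_
        rw [← e1, ← e2]
        have := houtC q hq
        omega)
  refine ⟨ρ, ρ1, fun i hi hc => ρ2 i hi ?_, fun i hi h1 h2 => ?_, ρ4, ρ5, ρ6, 𝓡, hρ𝓡, ?_⟩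
  · by_contra hs
    have := instay i hi hs
    omega
  · by_cases hs : ∃ d ∈ D, s i < d ∧ d < s i + w i
    · have := ρ2 i hi hs
      omega
    · exact ρ3 i hi hs
  · have h1 := h𝓡 K ⟨S, hSK, hS⟩
    have h2 : D.card ≤ 2 * C.card := by
      refine (card_union_le _ _).trans ?_
      have := (card_image_le (s := C.filter (· < r)) (f := dcut)).trans (card_filter_le _ _)
      omega
    calc 𝓡.card ≤ 2 * D.card * (K + 1) := by linarith [h1]
      _ ≤ 2 * (2 * (2 * K + 4)) * (K + 1) := by gcongr; omega
      _ = 8 * (K + 2) * (K + 1) := by ring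

end Machine

/-! ### Maximal intervals and the decomposition of the free area. -/

/-- `[a, b)` is a maximal interval of points of `[0, N)` with the property `P`. -/
def IsMaxInt (P : ℕ → Prop) (N a b : ℕ) : Prop :=
  a < b ∧ b ≤ N ∧ (∀ z, a ≤ z → z < b → P z) ∧ (a = 0 ∨ ¬ P (a - 1)) ∧ (b = N ∨ ¬ P b)

lemma exists_isMaxInt (P : ℕ → Prop) {N x : ℕ} (hx : P x) (hxN : x < N) :
    ∃ a b, IsMaxInt P N a b ∧ a ≤ x ∧ x < b := by
  classical
  have hb : ∃ b, x < b ∧ (b = N ∨ ¬ P b) := ⟨N, hxN, Or.inl rfl⟩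
  have ha : ∃ a, a ≤ x ∧ ∀ z, a ≤ z → z ≤ x → P z := ⟨x, le_rfl, fun z h1 h2 => by
    rwa [le_antisymm h2 h1]⟩
  have b1 := Nat.find_spec hb
  have b2 := fun m => @Nat.find_min _ _ hb m
  have b3 : Nat.find hb ≤ N := Nat.find_min' hb ⟨hxN, Or.inl rfl⟩
  have a1 := Nat.find_spec ha
  have a2 := fun m => @Nat.find_min _ _ ha m
  refine ⟨Nat.find ha, Nat.find hb, ⟨by omega, b3, fun z h1 h2 => ?_, ?_, b1.2⟩, a1.1, b1.1⟩
  · by_cases hz : z ≤ x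
    · exact a1.2 z h1 hz
    · by_contra hc
      exact b2 z h2 ⟨by omega, Or.inr hc⟩
  · by_contra hc
    push Not at hc
    refine a2 (Nat.find ha - 1) (by omega) ⟨by omega, fun z h1 h2 => ?_⟩
    rcases h1.eq_or_lt with h | h
    · rw [← h]; exact hc.2
    · exact a1.2 z (by omega) h2

lemma IsMaxInt.unique {P : ℕ → Prop} {N a b a' b' x : ℕ} (h : IsMaxInt P N a b)
    (h' : IsMaxInt P N a' b') (hx : a ≤ x ∧ x < b) (hx' : a' ≤ x ∧ x < b') : a = a' ∧ b = b' := by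
  obtain ⟨h1, h2, h3, h4, h5⟩ := h
  obtain ⟨h1', h2', h3', h4', h5'⟩ := h'
  constructor
  · rcases lt_trichotomy a a' with h | h | h
    · rcases h4' with h6 | h6
      · omega
      · exact (h6 (h3 _ (by omega) (by omega))).elim
    · exact h
    · rcases h4 with h6 | h6
      · omega
      · exact (h6 (h3' _ (by omega) (by omega))).elim
  · rcases lt_trichotomy b b' with h | h | h
    · rcases h5 with h6 | h6
      · omega
      · exact (h6 (h3' _ (by omega) (by omega))).elim
    · exact h
    · rcases h5' with h6 | h6
      · omega
      · exact (h6 (h3 _ (by omega) (by omega))).elim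

/-- The free area around `m` disjoint rectangles can be cut into at most `3 m + 1` rectangles. -/
theorem exists_free_rects (𝓜 : Finset Rect) (W H : ℕ)
    (hdis : ∀ R ∈ 𝓜, ∀ R' ∈ 𝓜, R ≠ R' → Disjoint R.cells R'.cells) :
    ∃ 𝓕 : Finset Rect, 𝓕.card ≤ 3 * 𝓜.card + 1 ∧ (∀ T ∈ 𝓕, T.Inside ⟨0, 0, W, H⟩) ∧
      (∀ T ∈ 𝓕, ∀ T' ∈ 𝓕, T ≠ T' → Disjoint T.cells T'.cells) ∧
      (∀ T ∈ 𝓕, ∀ R ∈ 𝓜, Disjoint T.cells R.cells) ∧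
      ∀ q ∈ (⟨0, 0, W, H⟩ : Rect).cells, (∃ R ∈ 𝓜, q ∈ R.cells) ∨ ∃ T ∈ 𝓕, q ∈ T.cells := by
  classical
  let free : ℕ → ℕ → Prop := fun x y => ∀ R ∈ 𝓜, (x, y) ∉ R.cells
  let seg : ℕ → ℕ → ℕ → Prop := fun lo hi x => IsMaxInt (free x) H lo hi
  -- A maximal row of adjacent columns that share the same maximal free vertical segment. These
  -- rectangles partition the free area.
  let good : Rect → Prop := fun T => IsMaxInt (seg T.y (T.y + T.h)) W T.x (T.x + T.w)
  let big : Finset Rect := (((range (W + 1) ×ˢ range (H + 1)) ×ˢ (range (W + 1) ×ˢ range (H + 1))).image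
    fun t => ⟨t.1.1, t.1.2, t.2.1, t.2.2⟩)
  have hseg : ∀ T, good T → ∀ x, T.x ≤ x → x < T.x + T.w → seg T.y (T.y + T.h) x :=
    fun T hT => hT.2.2.1
  have hgpos : ∀ T, good T → 0 < T.w ∧ 0 < T.h ∧ T.x + T.w ≤ W ∧ T.y + T.h ≤ H := by
    intro T hT
    have h1 := hseg T hT T.x le_rfl hT.1
    have := hT.1; have := hT.2.1; have := h1.1; have := h1.2.1
    omega
  have hF : ∀ T, T ∈ big.filter good ↔ good T := by
    intro T
    rw [mem_filter, and_iff_right_iff_imp]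
    intro hT
    have := hgpos T hT
    refine mem_image.2 ⟨((T.x, T.y), (T.w, T.h)), ?_, rfl⟩
    simp only [mem_product, mem_range]
    omega
  have huniq : ∀ T T', good T → good T' → ∀ x y, (x, y) ∈ T.cells → (x, y) ∈ T'.cells → T = T' := by
    intro T T' hT hT' x y hq hq'
    rw [Rect.mem_cells] at hq hq'
    simp only at hq hq'
    have h1 := (hseg T hT x hq.1.1 hq.1.2).unique (hseg T' hT' x hq'.1.1 hq'.1.2) hq.2 hq'.2
    have hT2 : IsMaxInt (seg T.y (T.y + T.h)) W T'.x (T'.x + T'.w) := by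
      rw [h1.2, h1.1]; exact hT'
    have h2 := IsMaxInt.unique hT hT2 hq.1 hq'.1
    ext <;> omega
  refine ⟨big.filter good, ?_, fun T hT => ?_, fun T hT T' hT' hne => ?_, fun T hT R hR => ?_,
    fun q hq => ?_⟩
  · let tok : Finset ((Rect × Fin 3) ⊕ Unit) := (𝓜 ×ˢ univ).disjSum univ
    have htok : tok.card = 3 * 𝓜.card + 1 := by
      simp [tok, card_product, mul_comm]
    -- What ends `T` on its left: an obstacle directly above or below `T` that starts exactly at
    -- `T.x`, an obstacle whose right edge touches the left edge of `T`, or the corner of the strip.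
    -- Each obstacle has one token for each of the three roles.
    let owns : Rect → (Rect × Fin 3) ⊕ Unit → Prop := fun T t => match t with
      | Sum.inl (R, 0) => T.x = R.x ∧ T.y + T.h = R.y
      | Sum.inl (R, 1) => T.x = R.x ∧ T.y = R.y + R.h
      | Sum.inl (R, 2) => R.x + R.w = T.x ∧
          (∃ y, T.y ≤ y ∧ y < T.y + T.h ∧ (T.x - 1, y) ∈ R.cells) ∧
          ∀ R' ∈ 𝓜, (T.x, T.y + T.h) ∈ R'.cells → R'.x < T.x
      | Sum.inr _ => T.x = 0 ∧ T.y = 0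
    have hcell : ∀ T, good T → ∀ x y, T.x ≤ x → x < T.x + T.w → T.y ≤ y → y < T.y + T.h →
        (x, y) ∈ T.cells := fun T _ x y h1 h2 h3 h4 => Rect.mem_cells.2 ⟨⟨h1, h2⟩, h3, h4⟩
    have hfree : ∀ T, good T → ∀ x y, T.x ≤ x → x < T.x + T.w → T.y ≤ y → y < T.y + T.h →
        ∀ R ∈ 𝓜, (x, y) ∉ R.cells :=
      fun T hT x y h1 h2 h3 h4 => (hseg T hT x h1 h2).2.2.1 y h3 h4
    have hown : ∀ T, good T → ∃ t ∈ tok, owns T t := by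
      intro T hT
      have hp := hgpos T hT
      have hs := hseg T hT T.x le_rfl (by omega)
      have hf := hfree T hT T.x
      by_cases h0 : ∃ R ∈ 𝓜, (T.x, T.y + T.h) ∈ R.cells ∧ T.x ≤ R.x
      · obtain ⟨R, hR, h1, h2⟩ := h0
        refine ⟨Sum.inl (R, 0), by simp [tok, hR], ?_⟩
        have h3 := hf (T.y + T.h - 1) le_rfl (by omega) (by omega) (by omega) R hR
        rw [Rect.mem_cells] at h1 h3
        simp only at h1 h3
        change T.x = R.x ∧ T.y + T.h = R.y
        omega
      by_cases h0' : 0 < T.y ∧ ∃ R ∈ 𝓜, (T.x, T.y - 1) ∈ R.cells ∧ T.x ≤ R.x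
      · obtain ⟨hy, R, hR, h1, h2⟩ := h0'
        refine ⟨Sum.inl (R, 1), by simp [tok, hR], ?_⟩
        have h3 := hf T.y le_rfl (by omega) (by omega) (by omega) R hR
        rw [Rect.mem_cells] at h1 h3
        simp only at h1 h3
        change T.x = R.x ∧ T.y = R.y + R.h
        omega
      push Not at h0 h0'
      have hbot : T.y = 0 ∨ ∃ R ∈ 𝓜, (T.x, T.y - 1) ∈ R.cells ∧ R.x < T.x := by
        rcases hs.2.2.2.1 with h | h
        · exact Or.inl h
        · simp only [free] at h
          push Not at h
          obtain ⟨R, hR, h⟩ := h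
          by_cases hy : T.y = 0
          · exact Or.inl hy
          · exact Or.inr ⟨R, hR, h, h0' (by omega) R hR h⟩
      rcases hT.2.2.2.1 with hx | hx
      · refine ⟨Sum.inr (), by simp [tok], hx, ?_⟩
        rcases hbot with h | ⟨R, -, -, h⟩ <;> omega
      by_cases hx0 : T.x = 0
      · refine ⟨Sum.inr (), by simp [tok], hx0, ?_⟩
        rcases hbot with h | ⟨R, -, -, h⟩ <;> omega
      have hex : ∃ y, T.y ≤ y ∧ y < T.y + T.h ∧ ∃ R ∈ 𝓜, (T.x - 1, y) ∈ R.cells := by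
        by_contra hc
        push Not at hc
        refine hx ⟨by omega, by omega, fun y h1 h2 R hR => hc y h1 h2 R hR, ?_, ?_⟩
        · rcases hbot with h | ⟨R, hR, h1, h2⟩
          · exact Or.inl h
          · refine Or.inr fun hh => hh R hR ?_
            rw [Rect.mem_cells] at *
            simp only at *
            omega
        · rcases hs.2.2.2.2 with h | h
          · exact Or.inl h
          · refine Or.inr fun hh => h fun R hR hc2 => hh R hR ?_
            have := h0 R hR hc2
            rw [Rect.mem_cells] at *
            simp only at *
            omega
      obtain ⟨y, h1, h2, R, hR, h3⟩ := hex
      refine ⟨Sum.inl (R, 2), by simp [tok, hR], ?_, ⟨y, h1, h2, h3⟩, fun R' hR' h => h0 R' hR' h⟩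
      have h4 := hf y le_rfl (by omega) h1 h2 R hR
      rw [Rect.mem_cells] at h3 h4
      simp only at h3 h4
      omega
    have hinj : ∀ T T' t, good T → good T' → t ∈ tok → owns T t → owns T' t → T = T' := by
      -- Among the rectangles touching the right edge of `R` only the topmost one can own the token.
      -- If `T` lay below another, the obstacle bounding `T` from above would extend to the left of
      -- `T.x`, by the last condition in `owns`, and would overlap `R`.
      have hup : ∀ T T' R, good T → good T' → R ∈ 𝓜 → owns T (Sum.inl (R, 2)) →
          owns T' (Sum.inl (R, 2)) → T.y + T.h ≤ T'.y → False := by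
        rintro T T' R hT hT' hR ⟨h1, ⟨y, h2, h3, h4⟩, h5⟩ ⟨h1', ⟨y', h2', h3', h4'⟩, h5'⟩ hle
        have hp := hgpos T hT
        have hp' := hgpos T' hT'
        have hs := hseg T hT T.x le_rfl (by omega)
        rcases hs.2.2.2.2 with h | h
        · omega
        simp only [free] at h
        push Not at h
        obtain ⟨R', hR', h⟩ := h
        have h6 := h5 R' hR' h
        have hne : R ≠ R' := by
          rintro rfl
          rw [Rect.mem_cells] at h
          simp only at h
          omega
        have hd := Finset.disjoint_left.1 (hdis R hR R' hR' hne)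
        refine @hd (T.x - 1, T.y + T.h) ?_ ?_
        · rw [Rect.mem_cells] at *
          simp only at *
          omega
        · rw [Rect.mem_cells] at *
          simp only at *
          omega
      intro T T' t hT hT' ht h h'
      have hp := hgpos T hT
      have hp' := hgpos T' hT'
      match t, ht, h, h' with
      | Sum.inl (R, 0), _, h, h' =>
        obtain ⟨h1, h2⟩ := h
        obtain ⟨h3, h4⟩ := h'
        exact huniq T T' hT hT' T.x (T.y + T.h - 1)
          (hcell T hT _ _ le_rfl (by omega) (by omega) (by omega))
          (hcell T' hT' _ _ (by omega) (by omega) (by omega) (by omega))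
      | Sum.inl (R, 1), _, h, h' =>
        obtain ⟨h1, h2⟩ := h
        obtain ⟨h3, h4⟩ := h'
        exact huniq T T' hT hT' T.x T.y
          (hcell T hT _ _ le_rfl (by omega) (by omega) (by omega))
          (hcell T' hT' _ _ (by omega) (by omega) (by omega) (by omega))
      | Sum.inl (R, 2), ht, h, h' =>
        have hR : R ∈ 𝓜 := by simpa [tok] using ht
        have hx : T.x = T'.x := h.1.symm.trans h'.1
        rcases le_or_gt (T.y + T.h) T'.y with hc | hc
        · exact (hup T T' R hT hT' hR h h' hc).elim
        rcases le_or_gt (T'.y + T'.h) T.y with hc' | hc'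
        · exact (hup T' T R hT' hT hR h' h hc').elim
        exact huniq T T' hT hT' T.x (max T.y T'.y)
          (hcell T hT _ _ le_rfl (by omega) (by omega) (by omega))
          (hcell T' hT' _ _ (by omega) (by omega) (by omega) (by omega))
      | Sum.inr _, _, h, h' =>
        obtain ⟨h1, h2⟩ := h
        obtain ⟨h3, h4⟩ := h'
        exact huniq T T' hT hT' T.x T.y
          (hcell T hT _ _ le_rfl (by omega) (by omega) (by omega))
          (hcell T' hT' _ _ (by omega) (by omega) (by omega) (by omega))
    rw [← htok]
    choose! f hf1 hf2 using hown
    exact card_le_card_of_injOn f (fun T hT => hf1 T ((hF T).1 hT)) fun T hT T' hT' he =>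
      hinj T T' (f T) ((hF T).1 hT) ((hF T').1 hT') (hf1 T ((hF T).1 hT)) (hf2 T ((hF T).1 hT))
        (he ▸ hf2 T' ((hF T').1 hT'))
  · have := hgpos T ((hF T).1 hT)
    simp only [Rect.Inside]
    omega
  · rw [Finset.disjoint_left]
    rintro ⟨x, y⟩ h1 h2
    exact hne (huniq T T' ((hF T).1 hT) ((hF T').1 hT') x y h1 h2)
  · rw [Finset.disjoint_left]
    rintro ⟨x, y⟩ h1 h2
    rw [Rect.mem_cells] at h1
    exact (hseg T ((hF T).1 hT) x h1.1.1 h1.1.2).2.2.1 y h1.2.1 h1.2.2 R hR h2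
  · obtain ⟨x, y⟩ := q
    rw [Rect.mem_cells] at hq
    by_cases hfr : free x y
    · obtain ⟨lo, hi, h1, h2, h3⟩ := exists_isMaxInt (free x) hfr (show y < H by simpa using hq.2.2)
      obtain ⟨a, b, h4, h5, h6⟩ := exists_isMaxInt (seg lo hi) h1 (show x < W by simpa using hq.1.2)
      refine Or.inr ⟨⟨a, lo, b - a, hi - lo⟩, (hF _).2 ?_, ?_⟩
      · have := h1.1; have := h4.1
        simp only [good]
        rwa [show lo + (hi - lo) = hi by omega, show a + (b - a) = b by omega]
      · rw [Rect.mem_cells]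
        simp only
        omega
    · simp only [free] at hfr
      push Not at hfr
      exact Or.inl hfr

/-! ### Returning part of the removed columns. -/

lemma exists_smallest {α : Type*} [DecidableEq α] (U : Finset α) (v : α → ℕ) (n : ℕ)
    (hn : n ≤ U.card) :
    ∃ Q ⊆ U, Q.card = n ∧ ∀ x ∈ Q, ∀ y ∈ U \ Q, v x ≤ v y := by
  induction n with
  | zero => exact ⟨∅, by simp, rfl, by simp⟩
  | succ n ih =>
    obtain ⟨Q, hQ, hc, hv⟩ := ih (by omega)
    have hne : (U \ Q).Nonempty := by
      rw [← card_pos, card_sdiff_of_subset hQ]; omega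
    obtain ⟨z, hz, hmin⟩ := exists_min_image _ v hne
    rw [mem_sdiff] at hz
    refine ⟨insert z Q, insert_subset hz.1 hQ, by rw [card_insert_of_notMem hz.2, hc], ?_⟩
    intro x hx y hy
    have hy' : y ∈ U \ Q := by
      simp only [mem_sdiff, mem_insert, not_or] at hy ⊢
      exact ⟨hy.1, hy.2.2⟩
    rcases mem_insert.1 hx with rfl | hx
    · exact hmin y hy'
    · exact hv x hx y hy'

/-- If the slack `σ` is large enough, all but a `1 - φ` fraction of the contents `v x` of the
columns `x ∈ U` find room of a common height `q` above the used height `u` of other columns. -/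
theorem exists_returned {α : Type*} [DecidableEq α] (X U : Finset α) (hU : U ⊆ X) (v u : α → ℕ)
    (H σ B : ℕ) (φ : ℝ) (hH : 0 < H) (hv : ∀ x ∈ U, v x ≤ B)
    (hφ : φ * (H + B) ≤ (1 - φ) * σ)
    (hsum : ∑ x ∈ X, u x + ∑ x ∈ U, (v x + σ) ≤ X.card * H) :
    ∃ q, ∃ Q ⊆ U, (∀ x ∈ Q, v x ≤ q) ∧ (U \ Q).card ≤ ⌊(1 - φ) * X.card⌋₊ ∧
      Q.card ≤ (X.filter fun x => u x + q ≤ H).card := by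
  set m := ⌊(1 - φ) * X.card⌋₊ with hm
  -- If `U` has at most `m` columns, all of them may be left over. Otherwise the `U.card - m`
  -- columns of smallest content are the ones to return, and `q` is their largest content.
  by_cases hd : U.card ≤ m
  · exact ⟨0, ∅, by simp, by simp, by simpa using hd, by simp⟩
  push Not at hd
  obtain ⟨Q, hQ, hQc, hQv⟩ := exists_smallest U v (U.card - m) (by omega)
  have hQne : Q.Nonempty := by rw [← card_pos]; omega
  obtain ⟨z, hz, hmax⟩ := exists_max_image Q v hQne
  refine ⟨v z, Q, hQ, hmax, by rw [card_sdiff_of_subset hQ]; omega, ?_⟩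
  -- Suppose only `N < U.card - m` columns have room of height `q = v z`. The other `X.card - N`
  -- columns have used height at least `H - q`, and at least `m + 1` columns of `U` have content at
  -- least `q`. Together with the slack `U.card * σ` this exceeds the total area `X.card * H`, by
  -- the assumption on `φ`.
  by_contra hN
  push Not at hN
  set N := (X.filter fun x => u x + v z ≤ H).card with hNdef
  have hdX : U.card ≤ X.card := card_le_card hU
  have h1 : (m + 1) * v z ≤ ∑ x ∈ U, v x := by
    have e : insert z (U \ Q) ⊆ U := insert_subset (hQ hz) sdiff_subset
    refine le_trans ?_ (sum_le_sum_of_subset e)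
    have : (insert z (U \ Q)).card = m + 1 := by
      rw [card_insert_of_notMem (by simp [hz]), card_sdiff_of_subset hQ]; omega
    rw [← this, ← smul_eq_mul]
    refine card_nsmul_le_sum _ _ _ fun y hy => ?_
    rcases mem_insert.1 hy with rfl | hy
    · exact le_rfl
    · exact hQv z hz y hy
  have h2 : ((X.card : ℝ) - N) * (H - v z) ≤ ∑ x ∈ X, (u x : ℝ) := by
    have e := card_filter_add_card_filter_not (s := X) (fun x => u x + v z ≤ H)
    have e' : (((X.filter fun x => ¬ u x + v z ≤ H).card : ℕ) : ℝ) = X.card - N := by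
      rw [← e]; push_cast; ring
    rw [← e', ← nsmul_eq_mul]
    refine (card_nsmul_le_sum _ (fun x => (u x : ℝ)) _ fun x hx => ?_).trans
      (sum_le_sum_of_subset_of_nonneg (filter_subset _ _) fun _ _ _ => by positivity)
    have := (mem_filter.1 hx).2
    have : (H : ℝ) < u x + v z := by exact_mod_cast not_le.1 this
    linarith
  have h3 : ∑ x ∈ X, (u x : ℝ) + (∑ x ∈ U, (v x : ℝ) + U.card * σ) ≤ X.card * H := by
    have := hsum
    rw [sum_add_distrib, sum_const, smul_eq_mul] at this
    exact_mod_cast this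
  have h1' : ((m : ℝ) + 1) * v z ≤ ∑ x ∈ U, (v x : ℝ) := by exact_mod_cast h1
  have hvz : (v z : ℝ) ≤ B := by exact_mod_cast hv z (hQ hz)
  have hfl : (1 - φ) * X.card < m + 1 := Nat.lt_floor_add_one _
  have hN' : (N : ℝ) + m + 1 ≤ X.card := by
    have : N + m + 1 ≤ X.card := by omega
    exact_mod_cast this
  have hd' : (m : ℝ) + 1 ≤ U.card := by exact_mod_cast hd
  have hvz0 : (0 : ℝ) ≤ v z := by positivity
  have hN0 : (0 : ℝ) ≤ N := by positivity
  have hH' : (0 : ℝ) < H := by exact_mod_cast hH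
  have hB0 : (0 : ℝ) ≤ B := by positivity
  have hσ0 : (0 : ℝ) ≤ σ := by positivity
  have key : (U.card : ℝ) * σ ≤ N * H + (X.card - m - 1 - N) * v z := by nlinarith
  have key2 : (N : ℝ) * H + (X.card - m - 1 - N) * v z ≤ (X.card - m - 1) * (H + B) := by
    have : ((X.card : ℝ) - m - 1 - N) * v z ≤ (X.card - m - 1) * B :=
      mul_le_mul (by linarith) hvz hvz0 (by linarith)
    have : (N : ℝ) * H ≤ (X.card - m - 1) * H :=
      mul_le_mul_of_nonneg_right (by linarith) hH'.le
    linarith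
  have key3 : ((X.card : ℝ) - m - 1) * (H + B) < φ * X.card * (H + B) :=
    mul_lt_mul_of_pos_right (by linarith) (by linarith)
  have key4 : φ * X.card * (H + B) ≤ (1 - φ) * X.card * σ := by
    have : (0 : ℝ) ≤ X.card := by positivity
    nlinarith
  have key5 : (1 - φ) * X.card * σ ≤ U.card * σ :=
    mul_le_mul_of_nonneg_right (by linarith) hσ0
  linarith

/-- The contents of the columns of `Q` are distributed to the columns of a set `P`. -/
lemma exists_contents {α ι : Type*} [DecidableEq ι] (Q : Finset α) (cont : α → Finset ι)
    (P : Finset ℕ) (h : Q.card ≤ P.card) :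
    ∃ ct : ℕ → Finset ι, (∀ x, ct x = ∅ ∨ ∃ j ∈ Q, ct x = cont j) ∧
      ∀ i, (P.filter fun x => i ∈ ct x).card = (Q.filter fun j => i ∈ cont j).card := by
  classical
  obtain ⟨P', hP', hc⟩ := exists_subset_card_eq h
  let e := Finset.equivOfCardEq hc
  refine ⟨fun x => if hx : x ∈ P' then cont (e ⟨x, hx⟩) else ∅, fun x => ?_, fun i => ?_⟩
  · by_cases hx : x ∈ P'
    · exact Or.inr ⟨e ⟨x, hx⟩, (e ⟨x, hx⟩).2, by simp [hx]⟩
    · exact Or.inl (by simp [hx])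
  have e1 : P.filter (fun x => i ∈ (if hx : x ∈ P' then cont (e ⟨x, hx⟩) else ∅)) =
      (Q.attach.filter fun j : Q => i ∈ cont j).map
        (e.symm.toEmbedding.trans (Function.Embedding.subtype _)) := by
    ext x
    simp only [mem_filter, mem_map, mem_attach, true_and]
    constructor
    · rintro ⟨h1, h2⟩
      by_cases hx : x ∈ P'
      · simp only [hx, dif_pos] at h2
        exact ⟨e ⟨x, hx⟩, h2, by simp⟩
      · simp [hx] at h2
    · rintro ⟨j, h1, rfl⟩
      have : (e.symm j : ℕ) ∈ P' := (e.symm j).2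
      simp [hP' this, h1]
  have e2 : Q.filter (fun j => i ∈ cont j) =
      (Q.attach.filter fun j : Q => i ∈ cont j).map (Function.Embedding.subtype _) := by
    ext x
    simp
    tauto
  rw [e1, e2, card_map, card_map]

/-! ### Columns of vertical items, and the rectangles of runs. -/

/-- A rectangle that is filled by columns of width one; the column at `x` holds parts of the items
of `ct x`, on top of each other. -/
structure VRun (ι : Type) where
  rect : Rect
  ct : ℕ → Finset ι

namespace VRun

variable {ι : Type} [DecidableEq ι]

/-- The columns hold items of `V` and are not too high. -/
def Valid (h : ι → ℕ) (V : Finset ι) (k : VRun ι) : Prop :=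
  ∀ x, k.rect.x ≤ x → x < k.rect.x + k.rect.w → k.ct x ⊆ V ∧ ∑ i ∈ k.ct x, h i ≤ k.rect.h

/-- The number of columns that hold a part of item `i`. -/
def count (k : VRun ι) (i : ι) : ℕ :=
  ((Ico k.rect.x (k.rect.x + k.rect.w)).filter fun x => i ∈ k.ct x).card

lemma count_eq_card {k : VRun ι} {i : ι} {S : Finset ℕ}
    (h : ∀ x, x ∈ S ↔ (k.rect.x ≤ x ∧ x < k.rect.x + k.rect.w) ∧ i ∈ k.ct x) :
    k.count i = S.card := by
  unfold count
  congr 1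
  ext x
  rw [h, mem_filter, mem_Ico]

end VRun

noncomputable instance : DecidableEq Run := Classical.decEq _

/-- The rectangle of a run in a box `[f, c)`, with heights given by half of the key. -/
def Run.rect (f c : ℕ) (R : Run) : Rect :=
  ⟨R.p, if R.side then c - R.key / 2 else f, R.q - R.p, R.key / 2⟩

lemma Run.rect_sep {f c : ℕ} {R R' : Run} (hc : f + R.key / 2 ≤ c) (hc' : f + R'.key / 2 ≤ c)
    (hpq : R.p ≤ R.q) (hpq' : R'.p ≤ R'.q)
    (hs : R.side = R'.side → R.q ≤ R'.p ∨ R'.q ≤ R.p)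
    (ho : R.side ≠ R'.side → R.q ≤ R'.p ∨ R'.q ≤ R.p ∨ R.key / 2 + R'.key / 2 ≤ c - f) :
    (R.rect f c).Sep (R'.rect f c) := by
  unfold Rect.Sep Run.rect
  by_cases h : R.side = R'.side
  · have := hs h
    simp only
    omega
  · have := ho h
    cases h1 : R.side <;> cases h2 : R'.side
    · exact absurd (h1.trans h2.symm) h
    · simp only [if_true, Bool.false_eq_true, if_false]; omega
    · simp only [if_true, Bool.false_eq_true, if_false]; omega
    · exact absurd (h1.trans h2.symm) h

/-! ### One box between two lines. -/

/-- The data of a box between two vertical lines: tall items `T`, standing at the floor or hanging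
from the ceiling, and vertical items `V`. -/
structure BoxData (ι : Type) [DecidableEq ι] where
  T : Finset ι
  V : Finset ι
  top : ι → Bool
  X : ι → ℕ
  Y : ι → ℕ
  w : ι → ℕ
  h : ι → ℕ
  ℓ : ℕ
  r : ℕ
  f : ℕ
  c : ℕ
  g : ℕ
  R : ℕ
  B : ℕ
  σ : ℕ
  hℓr : ℓ < r
  hfc : f < c
  hgf : g ∣ f
  hgc : g ∣ c
  hR : c - f ≤ g * R
  hg : 0 < g
  hpos : ∀ i ∈ T ∪ V, 0 < w i ∧ 0 < h i
  hdvd : ∀ i ∈ T ∪ V, g ∣ Y i ∧ g ∣ h i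
  hbox : ∀ i ∈ T ∪ V, f ≤ Y i ∧ Y i + h i ≤ c
  meets : ∀ i ∈ T ∪ V, ℓ < X i + w i ∧ X i < r
  hTV : Disjoint T V
  hsep : ∀ i ∈ T ∪ V, ∀ j ∈ T ∪ V, i ≠ j →
    Rect.Sep ⟨X i, Y i, w i, h i⟩ ⟨X j, Y j, w j, h j⟩
  hkind : ∀ i ∈ T, ∀ j ∈ T, i ≠ j → top i = top j → X i + w i ≤ X j ∨ X j + w j ≤ X i
  hord : ∀ i ∈ T, ∀ j ∈ T, top i = false → top j = true → Y i ≤ Y j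
  hext : ∀ i ∈ T, top i = false → ∀ j ∈ T ∪ V, j ≠ i → X i < X j + w j → X j < X i + w i →
    Y j + h j ≤ Y i ∨ Y i + h i + σ ≤ Y j
  hB : ∀ x, ∀ i ∈ T, ∀ j ∈ T, top i = false → top j = true → X i ≤ x → x < X i + w i →
    X j ≤ x → x < X j + w j → ∑ k ∈ V.filter (fun k => X k ≤ x ∧ x < X k + w k), h k ≤ B

namespace BoxData

variable {ι : Type} [DecidableEq ι] (𝓑 : BoxData ι)

/-- Item `i` occupies column `x`. -/
def Cov (i : ι) (x : ℕ) : Prop := 𝓑.X i ≤ x ∧ x < 𝓑.X i + 𝓑.w i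

instance (i : ι) (x : ℕ) : Decidable (𝓑.Cov i x) := by unfold Cov; infer_instance

/-- Item `i` crosses a side of the box. -/
def Fix (i : ι) : Prop := 𝓑.X i < 𝓑.ℓ ∨ 𝓑.r < 𝓑.X i + 𝓑.w i

instance : DecidablePred 𝓑.Fix := fun _ => by unfold Fix; infer_instance

/-- The height of a tall item, together with the space between a fixed tall item and its end of
the box. -/
def eh (i : ι) : ℕ :=
  if 𝓑.Fix i then (if 𝓑.top i then 𝓑.c - 𝓑.Y i else 𝓑.Y i + 𝓑.h i - 𝓑.f) else 𝓑.h i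

/-- Column `x` meets two tall items. -/
def Two (x : ℕ) : Prop :=
  ∃ i ∈ 𝓑.T, ∃ j ∈ 𝓑.T, 𝓑.top i = false ∧ 𝓑.top j = true ∧ 𝓑.Cov i x ∧ 𝓑.Cov j x

/-- The vertical item `j` lies between the fixed tall item `i` and its end of the box. -/
def Beyond (i j : ι) : Prop := if 𝓑.top i then 𝓑.Y i ≤ 𝓑.Y j else 𝓑.Y j < 𝓑.Y i

instance (i j : ι) : Decidable (𝓑.Beyond i j) := by unfold Beyond; infer_instance

/-- The vertical items of column `x` that do not lie beyond a fixed tall item. -/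
def mid (x : ℕ) : Finset ι :=
  𝓑.V.filter fun j => 𝓑.Cov j x ∧ ∀ i ∈ 𝓑.T, 𝓑.Fix i → 𝓑.Cov i x → ¬ 𝓑.Beyond i j

/-- Total height of the vertical items in the middle part of a column. -/
def v (x : ℕ) : ℕ := ∑ j ∈ 𝓑.mid x, 𝓑.h j

variable {𝓑}

lemma mem_mid {x : ℕ} {j : ι} : j ∈ 𝓑.mid x ↔ j ∈ 𝓑.V ∧ 𝓑.Cov j x ∧
    ∀ i ∈ 𝓑.T, 𝓑.Fix i → 𝓑.Cov i x → ¬ 𝓑.Beyond i j := by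
  simp [mid]

lemma ysep {i j : ι} (hi : i ∈ 𝓑.T ∪ 𝓑.V) (hj : j ∈ 𝓑.T ∪ 𝓑.V) (hij : i ≠ j) {x : ℕ}
    (hix : 𝓑.Cov i x) (hjx : 𝓑.Cov j x) :
    𝓑.Y i + 𝓑.h i ≤ 𝓑.Y j ∨ 𝓑.Y j + 𝓑.h j ≤ 𝓑.Y i := by
  have := 𝓑.hsep i hi j hj hij
  unfold Cov at *
  unfold Rect.Sep at this
  simp only at this
  omega

lemma eh_bot {i : ι} (hi : i ∈ 𝓑.T) (ht : 𝓑.top i = false) :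
    𝓑.eh i ≤ 𝓑.Y i + 𝓑.h i - 𝓑.f ∧ 𝓑.h i ≤ 𝓑.eh i := by
  have := 𝓑.hbox i (mem_union_left _ hi)
  unfold eh
  simp only [ht, Bool.false_eq_true, if_false]
  split_ifs <;> omega

lemma eh_top {i : ι} (hi : i ∈ 𝓑.T) (ht : 𝓑.top i = true) :
    𝓑.eh i ≤ 𝓑.c - 𝓑.Y i ∧ 𝓑.h i ≤ 𝓑.eh i := by
  have := 𝓑.hbox i (mem_union_left _ hi)
  unfold eh
  simp only [ht, if_true]
  split_ifs <;> omega

lemma eh_le {i : ι} (hi : i ∈ 𝓑.T) : 𝓑.eh i ≤ 𝓑.c - 𝓑.f ∧ 𝓑.h i ≤ 𝓑.eh i ∧ 𝓑.g ∣ 𝓑.eh i := by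
  have h1 := 𝓑.hbox i (mem_union_left _ hi)
  have h2 := 𝓑.hdvd i (mem_union_left _ hi)
  have hf := 𝓑.hgf
  have hc := 𝓑.hgc
  refine ⟨?_, ?_, ?_⟩
  · cases ht : 𝓑.top i
    · have := eh_bot hi ht; omega
    · have := eh_top hi ht; omega
  · cases ht : 𝓑.top i
    · exact (eh_bot hi ht).2
    · exact (eh_top hi ht).2
  · unfold eh
    split_ifs
    · exact Nat.dvd_sub hc h2.1
    · exact Nat.dvd_sub (dvd_add h2.1 h2.2) hf
    · exact h2.2

/-- The tall items and the middle vertical items of a column fit into the height of the box, with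
some slack if there are two tall items. -/
lemma column_le (x : ℕ) :
    ∑ i ∈ 𝓑.T.filter (𝓑.Cov · x), 𝓑.eh i + 𝓑.v x ≤ 𝓑.c - 𝓑.f ∧
    (𝓑.Two x → ∑ i ∈ 𝓑.T.filter (𝓑.Cov · x), 𝓑.eh i + (𝓑.v x + 𝓑.σ) ≤ 𝓑.c - 𝓑.f) := by
  classical
  -- The intervals `[lo i, lo i + len i)` are disjoint inside `[f, c)`. A fixed tall item is
  -- extended to its end of the box, which is harmless because vertical items beyond it are not in
  -- `mid`. In a column with two tall items a bottom one is also lengthened by `σ`, into the space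
  -- that `hext` leaves free above it.
  let Z := 𝓑.T.filter (𝓑.Cov · x) ∪ 𝓑.mid x
  let ex : ι → ℕ := fun i => if 𝓑.top i = false ∧ 𝓑.Two x then 𝓑.σ else 0
  let lo : ι → ℕ := fun i => if i ∈ 𝓑.T ∧ 𝓑.Fix i ∧ 𝓑.top i = false then 𝓑.f else 𝓑.Y i
  let len : ι → ℕ := fun i => if i ∈ 𝓑.T then 𝓑.eh i + ex i else 𝓑.h i
  have hVT : ∀ j ∈ 𝓑.V, j ∉ 𝓑.T := fun j hj hj' => Finset.disjoint_left.1 𝓑.hTV hj' hj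
  have hV : ∀ j ∈ 𝓑.V, lo j = 𝓑.Y j ∧ len j = 𝓑.h j := by
    intro j hj; simp [lo, len, hVT j hj]
  have htop : ∀ i ∈ 𝓑.T, 𝓑.top i = true → lo i = 𝓑.Y i ∧ lo i + len i ≤ 𝓑.c := by
    intro i hi ht
    have := eh_top hi ht
    have := 𝓑.hbox i (mem_union_left _ hi)
    have e1 : lo i = 𝓑.Y i := by simp [lo, ht]
    have e2 : len i = 𝓑.eh i := by simp [len, ex, ht, hi]
    omega
  have hbot : ∀ i ∈ 𝓑.T, 𝓑.top i = false → 𝓑.f ≤ lo i ∧ (¬ 𝓑.Fix i → lo i = 𝓑.Y i) ∧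
      lo i + len i ≤ 𝓑.Y i + 𝓑.h i + ex i := by
    intro i hi ht
    have h1 := eh_bot hi ht
    have h2 := 𝓑.hbox i (mem_union_left _ hi)
    have e2 : len i = 𝓑.eh i + ex i := by simp [len, hi]
    by_cases hF : 𝓑.Fix i
    · have e1 : lo i = 𝓑.f := by simp [lo, ht, hi, hF]
      exact ⟨by omega, fun h => absurd hF h, by omega⟩
    · have : 𝓑.eh i = 𝓑.h i := by simp [eh, hF]
      have e1 : lo i = 𝓑.Y i := by simp [lo, hF]
      exact ⟨by omega, fun _ => e1, by omega⟩
  have hexσ : ∀ i, ex i ≤ 𝓑.σ := by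
    intro i; simp only [ex]; split_ifs <;> omega
  have hov : ∀ i j, 𝓑.Cov i x → 𝓑.Cov j x → 𝓑.X i < 𝓑.X j + 𝓑.w j ∧ 𝓑.X j < 𝓑.X i + 𝓑.w i := by
    intro i j h1 h2
    unfold Cov at *
    omega
  have hbt : ∀ i ∈ 𝓑.T, ∀ j ∈ 𝓑.T, 𝓑.top i = false → 𝓑.top j = true → 𝓑.Cov i x → 𝓑.Cov j x →
      𝓑.Y i + 𝓑.h i + 𝓑.σ ≤ 𝓑.Y j := by
    intro i hi j hj h1 h2 hix hjx
    have h3 := 𝓑.hext i hi h1 j (mem_union_left _ hj) (by rintro rfl; simp [h1] at h2)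
      (hov _ _ hix hjx).1 (hov _ _ hix hjx).2
    have h4 := 𝓑.hord i hi j hj h1 h2
    have h5 := 𝓑.hpos j (mem_union_left _ hj)
    omega
  have hbV : ∀ i ∈ 𝓑.T, ∀ j ∈ 𝓑.mid x, 𝓑.top i = false → 𝓑.Cov i x →
      lo i + len i ≤ lo j ∨ lo j + len j ≤ lo i := by
    intro i hi j hj h1 hix
    obtain ⟨j1, j2, j3⟩ := mem_mid.1 hj
    have h3 := 𝓑.hext i hi h1 j (mem_union_right _ j1) (by rintro rfl; exact hVT _ j1 hi)
      (hov _ _ hix j2).1 (hov _ _ hix j2).2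
    have h4 := hbot i hi h1
    have h5 := hV j j1
    have h6 := hexσ i
    have h7 := 𝓑.hpos j (mem_union_right _ j1)
    by_cases hF : 𝓑.Fix i
    · have := j3 i hi hF hix
      simp only [Beyond, h1, Bool.false_eq_true, if_false] at this
      omega
    · have := h4.2.1 hF
      omega
  have htV : ∀ i ∈ 𝓑.T, ∀ j ∈ 𝓑.mid x, 𝓑.top i = true → 𝓑.Cov i x →
      lo i + len i ≤ lo j ∨ lo j + len j ≤ lo i := by
    intro i hi j hj h1 hix
    obtain ⟨j1, j2, j3⟩ := mem_mid.1 hj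
    have h3 := ysep (mem_union_left _ hi) (mem_union_right _ j1) (by rintro rfl; exact hVT _ j1 hi)
      hix j2
    have h4 := htop i hi h1
    have h5 := hV j j1
    have h7 := 𝓑.hpos i (mem_union_left _ hi)
    by_cases hF : 𝓑.Fix i
    · have := j3 i hi hF hix
      simp only [Beyond, h1, if_true] at this
      omega
    · have : len i = 𝓑.h i := by simp [len, ex, eh, hF, hi, h1]
      omega
  have hZ : ∑ i ∈ Z, len i ≤ 𝓑.c - 𝓑.f := by
    refine sum_width_le Z lo len 𝓑.f 𝓑.c ?_ ?_
    · intro i hi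
      rcases mem_union.1 hi with hi | hi
      · obtain ⟨hi, hix⟩ := mem_filter.1 hi
        have hb := 𝓑.hbox i (mem_union_left _ hi)
        cases h1 : 𝓑.top i
        · have h2 := hbot i hi h1
          refine ⟨h2.1, h2.2.2.trans ?_⟩
          by_cases hT : 𝓑.Two x
          · obtain ⟨i', hi', j, hj, e1, e2, e3, e4⟩ := hT
            have := hbt i hi j hj h1 e2 hix e4
            have := 𝓑.hbox j (mem_union_left _ hj)
            have := hexσ i
            omega
          · have : ex i = 0 := by simp [ex, hT]
            omega
        · have h2 := htop i hi h1
          omega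
      · have hiV := (mem_mid.1 hi).1
        have := hV i hiV
        have := 𝓑.hbox i (mem_union_right _ hiV)
        omega
    · intro i hi j hj hij
      rcases mem_union.1 hi with hi | hi <;> rcases mem_union.1 hj with hj | hj
      · obtain ⟨hi, hix⟩ := mem_filter.1 hi
        obtain ⟨hj, hjx⟩ := mem_filter.1 hj
        have hne : 𝓑.top i ≠ 𝓑.top j := by
          intro he
          have := 𝓑.hkind i hi j hj hij he
          have := hov i j hix hjx
          omega
        cases h1 : 𝓑.top i <;> cases h2 : 𝓑.top j
        · exact absurd (h1.trans h2.symm) hne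
        · have := hbt i hi j hj h1 h2 hix hjx
          have := hbot i hi h1
          have := htop j hj h2
          have := hexσ i
          omega
        · have := hbt j hj i hi h2 h1 hjx hix
          have := hbot j hj h2
          have := htop i hi h1
          have := hexσ j
          omega
        · exact absurd (h1.trans h2.symm) hne
      · obtain ⟨hi, hix⟩ := mem_filter.1 hi
        cases h1 : 𝓑.top i
        · exact hbV i hi j hj h1 hix
        · exact htV i hi j hj h1 hix
      · obtain ⟨hj, hjx⟩ := mem_filter.1 hj
        cases h1 : 𝓑.top j
        · exact (hbV j hj i hi h1 hjx).symm
        · exact (htV j hj i hi h1 hjx).symm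
      · obtain ⟨i1, i2, -⟩ := mem_mid.1 hi
        obtain ⟨j1, j2, -⟩ := mem_mid.1 hj
        have := hV i i1
        have := hV j j1
        have := ysep (mem_union_right _ i1) (mem_union_right _ j1) hij i2 j2
        omega
  have hdisj : Disjoint (𝓑.T.filter (𝓑.Cov · x)) (𝓑.mid x) := by
    rw [Finset.disjoint_left]
    intro i hi hi'
    exact hVT i (mem_mid.1 hi').1 (mem_filter.1 hi).1
  have hsplit : ∑ i ∈ Z, len i = ∑ i ∈ 𝓑.T.filter (𝓑.Cov · x), (𝓑.eh i + ex i) + 𝓑.v x := by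
    rw [sum_union hdisj]
    congr 1
    · refine sum_congr rfl fun i hi => ?_
      simp [len, (mem_filter.1 hi).1]
    · refine sum_congr rfl fun i hi => ?_
      exact (hV i (mem_mid.1 hi).1).2
  rw [hsplit, sum_add_distrib] at hZ
  refine ⟨by omega, fun hT => ?_⟩
  have : 𝓑.σ ≤ ∑ i ∈ 𝓑.T.filter (𝓑.Cov · x), ex i := by
    obtain ⟨i, hi, j, hj, e1, e2, e3, e4⟩ := id hT
    have : ex i = 𝓑.σ := by simp [ex, e1, hT]
    rw [← this]
    exact single_le_sum (f := ex) (fun _ _ => Nat.zero_le _) (mem_filter.2 ⟨hi, e3⟩)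
  omega

end BoxData

namespace BoxData

variable {ι : Type} [DecidableEq ι] (𝓑 : BoxData ι)

open Classical in
/-- The columns with a nonempty middle part next to at most one tall item. -/
noncomputable def cols : Finset ℕ := (Ico 𝓑.ℓ 𝓑.r).filter fun x => ¬ 𝓑.Two x ∧ 0 < 𝓑.v x

open Classical in
/-- Tall items keep their side, a column takes the side that is not used by a tall item. -/
noncomputable def sd : ι ⊕ ℕ → Bool :=
  Sum.elim 𝓑.top fun x => decide (¬ ∃ j ∈ 𝓑.T, 𝓑.top j = true ∧ 𝓑.Cov j x)

def st : ι ⊕ ℕ → ℕ := Sum.elim 𝓑.X id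

def wd : ι ⊕ ℕ → ℕ := Sum.elim 𝓑.w fun _ => 1

/-- Halving gives back the height in both cases. The parity keeps tall items and columns in
different runs even if their heights agree. -/
def ky : ι ⊕ ℕ → ℕ := Sum.elim (fun i => 2 * 𝓑.eh i) fun x => 2 * 𝓑.v x + 1

/-- A column whose contents stay in the box is treated like an item of width one, so that tall items
and columns are sorted by the same argument. -/
noncomputable def movers : Finset (ι ⊕ ℕ) := 𝓑.T.disjSum 𝓑.cols

variable {𝓑}

lemma mem_cols {x : ℕ} : x ∈ 𝓑.cols ↔ (𝓑.ℓ ≤ x ∧ x < 𝓑.r) ∧ ¬ 𝓑.Two x ∧ 0 < 𝓑.v x := by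
  simp [cols]

lemma v_le (x : ℕ) : 𝓑.v x ≤ 𝓑.c - 𝓑.f := by
  have := (column_le (𝓑 := 𝓑) x).1; omega

lemma g_dvd_v (x : ℕ) : 𝓑.g ∣ 𝓑.v x :=
  dvd_sum fun j hj => (𝓑.hdvd j (mem_union_right _ (mem_mid.1 hj).1)).2

lemma ky_half_le {a : ι ⊕ ℕ} (ha : a ∈ 𝓑.movers) : 𝓑.ky a / 2 ≤ 𝓑.c - 𝓑.f := by
  rcases a with i | x
  · have := (eh_le (𝓑 := 𝓑) (inl_mem_disjSum.1 ha)).1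
    simp only [ky, Sum.elim_inl]; omega
  · have := v_le (𝓑 := 𝓑) x
    simp only [ky, Sum.elim_inr]; omega

/-- The total height of the tall items and columns over a point of the box. -/
lemma sum_ky_le {x : ℕ} :
    ∑ a ∈ 𝓑.movers.filter (fun a => 𝓑.st a ≤ x ∧ x < 𝓑.st a + 𝓑.wd a), 𝓑.ky a / 2 ≤
      𝓑.c - 𝓑.f ∧ (𝓑.Two x →
    ∑ a ∈ 𝓑.movers.filter (fun a => 𝓑.st a ≤ x ∧ x < 𝓑.st a + 𝓑.wd a), 𝓑.ky a / 2 +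
      (𝓑.v x + 𝓑.σ) ≤ 𝓑.c - 𝓑.f) := by
  have h := column_le (𝓑 := 𝓑) x
  have e : ∑ a ∈ 𝓑.movers.filter (fun a => 𝓑.st a ≤ x ∧ x < 𝓑.st a + 𝓑.wd a), 𝓑.ky a / 2 =
      ∑ i ∈ 𝓑.T.filter (𝓑.Cov · x), 𝓑.eh i + ∑ y ∈ 𝓑.cols.filter (· = x), 𝓑.v y := by
    rw [movers, sum_filter, sum_disjSum, sum_filter, sum_filter]
    congr 1
    · refine sum_congr rfl fun i _ => ?_
      simp only [st, wd, ky, Sum.elim_inl, Cov]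
      congr 1
      omega
    · refine sum_congr rfl fun y _ => ?_
      have e1 : 𝓑.ky (.inr y) / 2 = 𝓑.v y := by simp only [ky, Sum.elim_inr]; omega
      have e2 : (𝓑.st (.inr y) ≤ x ∧ x < 𝓑.st (.inr y) + 𝓑.wd (.inr y)) ↔ y = x := by
        simp only [st, wd, Sum.elim_inr, id]; omega
      simp only [e1, e2]
  rw [e]
  by_cases hx : x ∈ 𝓑.cols
  · have : 𝓑.cols.filter (· = x) = {x} := by
      ext y; simp only [mem_filter, mem_singleton]
      exact ⟨fun h => h.2, fun h => ⟨h ▸ hx, h⟩⟩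
    rw [this, sum_singleton]
    exact ⟨h.1, fun hT => absurd hT (mem_cols.1 hx).2.1⟩
  · have : 𝓑.cols.filter (· = x) = ∅ := by
      ext y; simp only [mem_filter, notMem_empty, iff_false]
      exact fun h => hx (h.2 ▸ h.1)
    rw [this, sum_empty]
    exact ⟨by omega, fun hT => by have := h.2 hT; omega⟩

/-- `exists_runs` for tall items and columns together. Two of them over a common point have total
height at most that of the box, by the column count in `sum_ky_le`, and a column uses a side free of
tall items. All heights are multiples of `g` up to `g * R`, so with the two parities at most `2 * (R
+ 1)` keys occur. -/
theorem exists_box_runs (𝓑 : BoxData ι) :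
    ∃ ρ : ι ⊕ ℕ → Run,
      (∀ a ∈ 𝓑.movers, (ρ a).side = 𝓑.sd a ∧ (ρ a).key = 𝓑.ky a) ∧
      (∀ i ∈ 𝓑.T, 𝓑.Fix i → (ρ (.inl i)).p = 𝓑.X i ∧ (ρ (.inl i)).q = 𝓑.X i + 𝓑.w i) ∧
      (∀ i ∈ 𝓑.T, ¬ 𝓑.Fix i → 𝓑.ℓ ≤ (ρ (.inl i)).p ∧ (ρ (.inl i)).q ≤ 𝓑.r) ∧
      (∀ x ∈ 𝓑.cols, 𝓑.ℓ ≤ (ρ (.inr x)).p ∧ (ρ (.inr x)).q ≤ 𝓑.r) ∧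
      (∀ a ∈ 𝓑.movers, (ρ a).p + ∑ b ∈ 𝓑.movers.filter (fun b => ρ b = ρ a), 𝓑.wd b = (ρ a).q) ∧
      (∀ a ∈ 𝓑.movers, ∀ b ∈ 𝓑.movers, ρ a ≠ ρ b →
        ((ρ a).rect 𝓑.f 𝓑.c).Sep ((ρ b).rect 𝓑.f 𝓑.c)) ∧
      (𝓑.movers.image ρ).card ≤ 8 * (2 * 𝓑.R + 4) * (2 * 𝓑.R + 3) := by
  classical
  have hHR := 𝓑.hR
  have hover : ∀ a ∈ 𝓑.movers, ∀ b ∈ 𝓑.movers, a ≠ b → 𝓑.st a < 𝓑.st b + 𝓑.wd b →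
      𝓑.st b < 𝓑.st a + 𝓑.wd a → 𝓑.ky a / 2 + 𝓑.ky b / 2 ≤ 𝓑.c - 𝓑.f := by
    intro a ha b hb hab h1 h2
    refine le_trans ?_ (sum_ky_le (𝓑 := 𝓑) (x := max (𝓑.st a) (𝓑.st b))).1
    rw [← sum_pair (f := fun a => 𝓑.ky a / 2) hab]
    have wp : ∀ a ∈ 𝓑.movers, 0 < 𝓑.wd a := by
      rintro (i | x) ha
      · exact (𝓑.hpos i (mem_union_left _ (inl_mem_disjSum.1 ha))).1
      · exact Nat.one_pos
    have := wp a ha; have := wp b hb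
    refine sum_le_sum_of_subset fun z hz => ?_
    rw [mem_filter]
    rcases mem_insert.1 hz with rfl | hz
    · exact ⟨ha, by omega⟩
    · rw [mem_singleton] at hz
      subst hz
      exact ⟨hb, by omega⟩
  have wpos : ∀ a ∈ 𝓑.movers, 0 < 𝓑.wd a := by
    rintro (i | x) ha
    · exact (𝓑.hpos i (mem_union_left _ (inl_mem_disjSum.1 ha))).1
    · exact Nat.one_pos
  obtain ⟨ρ, r1, r2, r3, r4, r5, r6, 𝓡, r7, r8⟩ := exists_runs 𝓑.movers 𝓑.sd 𝓑.st 𝓑.wd 𝓑.ky (· / 2)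
    (fun a b h => Nat.div_le_div_right h) (𝓑.c - 𝓑.f) 𝓑.ℓ 𝓑.r 𝓑.hℓr wpos
    (by
      have hcr : ∀ i ∈ 𝓑.T, ∀ x ∈ 𝓑.cols, 𝓑.sd (.inl i) = 𝓑.sd (.inr x) →
          𝓑.X i + 𝓑.w i ≤ x ∨ x + 1 ≤ 𝓑.X i := by
        intro i hi x hx hs
        by_contra hc
        have hix : 𝓑.Cov i x := by unfold Cov; omega
        simp only [sd, Sum.elim_inl, Sum.elim_inr] at hs
        cases ht : 𝓑.top i
        · rw [ht] at hs
          have hs' := hs.symm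
          simp only [decide_eq_false_iff_not, not_not] at hs'
          obtain ⟨j, hj, h1, h2⟩ := hs'
          exact (mem_cols.1 hx).2.1 ⟨i, hi, j, hj, ht, h1, hix, h2⟩
        · rw [ht] at hs
          have hs' := hs.symm
          simp only [decide_eq_true_eq] at hs'
          exact hs' ⟨i, hi, ht, hix⟩
      rintro (i | x) ha (j | y) hb hab hs
      · exact 𝓑.hkind i (inl_mem_disjSum.1 ha) j (inl_mem_disjSum.1 hb)
          (fun h => hab (by rw [h])) hs
      · exact hcr i (inl_mem_disjSum.1 ha) y (inr_mem_disjSum.1 hb) hs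
      · exact (hcr j (inl_mem_disjSum.1 hb) x (inr_mem_disjSum.1 ha) hs.symm).symm
      · have : x ≠ y := fun h => hab (by rw [h])
        simp only [st, wd, Sum.elim_inr, id]
        omega)
    (by
      intro a ha b hb hs
      by_contra hc
      push Not at hc
      exact absurd (hover a ha b hb (fun h => hs (by rw [h])) hc.2.1 hc.1) (by omega))
    (by
      rintro (i | x) ha
      · exact 𝓑.meets i (mem_union_left _ (inl_mem_disjSum.1 ha))
      · have := (mem_cols.1 (inr_mem_disjSum.1 ha)).1
        simp only [st, wd, Sum.elim_inr, id]
        omega)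
    (2 * (𝓑.R + 1)) ((range (𝓑.R + 1) ×ˢ range 2).image fun t => 2 * (𝓑.g * t.1) + t.2)
    (card_image_le.trans (by rw [card_product, card_range, card_range]; omega))
    (by
      have hm : ∀ y, 𝓑.g ∣ y → y ≤ 𝓑.c - 𝓑.f → ∃ k, k < 𝓑.R + 1 ∧ y = 𝓑.g * k := by
        rintro _ ⟨k, rfl⟩ h
        refine ⟨k, ?_, rfl⟩
        have : 𝓑.g * k ≤ 𝓑.g * 𝓑.R := h.trans hHR
        have := Nat.le_of_mul_le_mul_left this 𝓑.hg
        omega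
      rintro (i | x) ha
      · obtain ⟨h1, -, h2⟩ := eh_le (𝓑 := 𝓑) (inl_mem_disjSum.1 ha)
        obtain ⟨k, hk, e⟩ := hm _ h2 h1
        refine mem_image.2 ⟨(k, 0), by simp [hk], ?_⟩
        simp only [ky, Sum.elim_inl, e, add_zero]
      · obtain ⟨k, hk, e⟩ := hm _ (g_dvd_v x) (v_le x)
        refine mem_image.2 ⟨(k, 1), by simp [hk], ?_⟩
        simp only [ky, Sum.elim_inr, e])
  have hQ : ∀ a ∈ 𝓑.movers,
      (ρ a).p + ∑ b ∈ 𝓑.movers.filter (fun b => ρ b = ρ a), 𝓑.wd b = (ρ a).q :=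
    fun a ha => r4 a ha _ rfl _ fun b => mem_filter
  have hin : ∀ i, i ∈ 𝓑.T → Sum.inl i ∈ 𝓑.movers := fun i hi => inl_mem_disjSum.2 hi
  have hle : ∀ a ∈ 𝓑.movers, (ρ a).p ≤ (ρ a).q ∧ 𝓑.f + (ρ a).key / 2 ≤ 𝓑.c := by
    intro a ha
    have := hQ a ha
    have h1 := ky_half_le ha
    rw [← (r1 a ha).2] at h1
    have := 𝓑.hfc
    omega
  refine ⟨ρ, r1, fun i hi hF => r2 _ (hin i hi) hF, fun i hi hF => ?_, fun x hx => ?_, hQ,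
    fun a ha b hb hne => ?_, ?_⟩
  · simp only [Fix, not_or, not_lt] at hF
    exact r3 _ (hin i hi) hF.1 hF.2
  · have := (mem_cols.1 hx).1
    refine r3 _ (inr_mem_disjSum.2 hx) ?_ ?_ <;> simp only [st, wd, Sum.elim_inr, id] <;> omega
  · refine Run.rect_sep (hle a ha).2 (hle b hb).2 (hle a ha).1 (hle b hb).1 (fun hs => ?_)
      fun hs => ?_
    · exact r5 a ha b hb hne (by rw [← (r1 a ha).1, ← (r1 b hb).1, hs])
    · rw [(r1 a ha).2, (r1 b hb).2]
      exact r6 a ha b hb (by rwa [← (r1 a ha).1, ← (r1 b hb).1])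
  · calc (𝓑.movers.image ρ).card ≤ 𝓡.card := card_le_card fun R hR => by
          obtain ⟨a, ha, rfl⟩ := mem_image.1 hR
          exact r7 a ha
      _ ≤ 8 * (2 * (𝓑.R + 1) + 2) * (2 * (𝓑.R + 1) + 1) := r8
      _ = 8 * (2 * 𝓑.R + 4) * (2 * 𝓑.R + 3) := by ring

end BoxData

/-! ### Rearranging a box. -/

lemma sum_sum_filter_comm {α : Type*} (S : Finset ℕ) (A : Finset α) (C : α → ℕ → Prop)
    [∀ a x, Decidable (C a x)] (F : α → ℕ) :
    ∑ x ∈ S, ∑ a ∈ A.filter (C · x), F a = ∑ a ∈ A, F a * (S.filter (C a)).card := by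
  simp_rw [sum_filter]
  rw [sum_comm]
  refine sum_congr rfl fun a _ => ?_
  rw [← sum_filter, sum_const, smul_eq_mul, mul_comm]

/-- A rearrangement of a box: rectangles `tb` for the tall items inside the box, which are placed at
`P`, runs `vr` for the vertical items, and few columns `rem` whose contents are left over. -/
structure BoxPacking {ι : Type} [DecidableEq ι] (𝓑 : BoxData ι) (φ : ℝ) where
  P : ι → ℕ × ℕ
  τ : Type
  τfin : Fintype τ
  tb : τ → Rect
  κ : Type
  κfin : Fintype κ
  vr : κ → VRun ι
  rem : Finset ℕ
  rct : ℕ → Finset ι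
  hcard : Fintype.card τ + Fintype.card κ ≤ 48 * (2 * 𝓑.R + 4) * (2 * 𝓑.R + 3)
  tb_inside : ∀ b, (tb b).Inside ⟨𝓑.ℓ, 𝓑.f, 𝓑.r - 𝓑.ℓ, 𝓑.c - 𝓑.f⟩
  vr_inside : ∀ k, (vr k).rect.Inside ⟨𝓑.ℓ, 𝓑.f, 𝓑.r - 𝓑.ℓ, 𝓑.c - 𝓑.f⟩
  tb_sep : ∀ b b', b ≠ b' → (tb b).Sep (tb b')
  vr_sep : ∀ k k', k ≠ k' → (vr k).rect.Sep (vr k').rect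
  tb_vr : ∀ b k, (tb b).Sep (vr k).rect
  fix_tb : ∀ i ∈ 𝓑.T, 𝓑.Fix i → ∀ b, Rect.Sep ⟨𝓑.X i, 𝓑.Y i, 𝓑.w i, 𝓑.h i⟩ (tb b)
  fix_vr : ∀ i ∈ 𝓑.T, 𝓑.Fix i → ∀ k, Rect.Sep ⟨𝓑.X i, 𝓑.Y i, 𝓑.w i, 𝓑.h i⟩ (vr k).rect
  tall_inside : ∀ i ∈ 𝓑.T, ¬ 𝓑.Fix i →
    ∃ b, Rect.Inside ⟨(P i).1, (P i).2, 𝓑.w i, 𝓑.h i⟩ (tb b) ∧ (tb b).h = 𝓑.h i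
  tall_sep : ∀ i ∈ 𝓑.T, ∀ j ∈ 𝓑.T, ¬ 𝓑.Fix i → ¬ 𝓑.Fix j → i ≠ j →
    Rect.Sep ⟨(P i).1, (P i).2, 𝓑.w i, 𝓑.h i⟩ ⟨(P j).1, (P j).2, 𝓑.w j, 𝓑.h j⟩
  tb_area : ∑ b, (tb b).w * (tb b).h ≤ ∑ i ∈ 𝓑.T.filter (¬ 𝓑.Fix ·), 𝓑.w i * 𝓑.h i
  valid : ∀ k, (vr k).Valid 𝓑.h 𝓑.V
  rem_mem : ∀ x ∈ rem, (𝓑.ℓ ≤ x ∧ x < 𝓑.r) ∧ 𝓑.Two x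
  rem_card : rem.card ≤ ⌊(1 - φ) * (𝓑.r - 𝓑.ℓ : ℕ)⌋₊
  rct_le : ∀ x ∈ rem, rct x ⊆ 𝓑.V ∧ ∑ i ∈ rct x, 𝓑.h i ≤ 𝓑.B
  count_eq : ∀ i ∈ 𝓑.V, ∑ k, (vr k).count i + (rem.filter fun x => i ∈ rct x).card =
    ((Ico 𝓑.ℓ 𝓑.r).filter (𝓑.Cov i)).card

namespace BoxData

variable {ι : Type} [DecidableEq ι] {𝓑 : BoxData ι}

open Classical in
/-- The part of a column beyond a fixed tall item. -/
noncomputable def beyond (𝓑 : BoxData ι) (i : ι) (x : ℕ) : Finset ι :=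
  𝓑.V.filter fun j => 𝓑.Cov j x ∧ 𝓑.Beyond i j

lemma mem_beyond {i j : ι} {x : ℕ} :
    j ∈ 𝓑.beyond i x ↔ j ∈ 𝓑.V ∧ 𝓑.Cov j x ∧ 𝓑.Beyond i j := by simp [beyond]

/-- The room beyond a fixed tall item. -/
def beyondRun (𝓑 : BoxData ι) (i : ι) : Rect :=
  ⟨max (𝓑.X i) 𝓑.ℓ, if 𝓑.top i then 𝓑.Y i + 𝓑.h i else 𝓑.f,
    min (𝓑.X i + 𝓑.w i) 𝓑.r - max (𝓑.X i) 𝓑.ℓ,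
    if 𝓑.top i then 𝓑.c - (𝓑.Y i + 𝓑.h i) else 𝓑.Y i - 𝓑.f⟩

lemma sum_beyond_le {i : ι} (hi : i ∈ 𝓑.T) {x : ℕ} (hx : 𝓑.Cov i x) :
    ∑ j ∈ 𝓑.beyond i x, 𝓑.h j ≤ (𝓑.beyondRun i).h := by
  have hVT : ∀ j ∈ 𝓑.V, j ≠ i := by
    rintro j hj rfl; exact Finset.disjoint_left.1 𝓑.hTV hi hj
  have key : ∀ lo up, (∀ j ∈ 𝓑.beyond i x, lo ≤ 𝓑.Y j ∧ 𝓑.Y j + 𝓑.h j ≤ up) →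
      ∑ j ∈ 𝓑.beyond i x, 𝓑.h j ≤ up - lo := by
    intro lo up h
    refine sum_width_le _ 𝓑.Y 𝓑.h lo up h fun j hj j' hj' hne => ?_
    have h1 := mem_beyond.1 hj
    have h2 := mem_beyond.1 hj'
    exact ysep (mem_union_right _ h1.1) (mem_union_right _ h2.1) hne h1.2.1 h2.2.1
  have hb := 𝓑.hbox i (mem_union_left _ hi)
  cases ht : 𝓑.top i
  · simp only [beyondRun, ht, Bool.false_eq_true, if_false]
    refine key _ _ fun j hj => ?_
    obtain ⟨h1, h2, h3⟩ := mem_beyond.1 hj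
    have h4 := 𝓑.hbox j (mem_union_right _ h1)
    have h5 := ysep (mem_union_right _ h1) (mem_union_left _ hi) (hVT j h1) h2 hx
    simp only [Beyond, ht, Bool.false_eq_true, if_false] at h3
    omega
  · simp only [beyondRun, ht, if_true]
    refine key _ _ fun j hj => ?_
    obtain ⟨h1, h2, h3⟩ := mem_beyond.1 hj
    have h4 := 𝓑.hbox j (mem_union_right _ h1)
    have h5 := ysep (mem_union_right _ h1) (mem_union_left _ hi) (hVT j h1) h2 hx
    have h6 := 𝓑.hpos j (mem_union_right _ h1)
    simp only [Beyond, ht, if_true] at h3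
    omega

/-- In each column a vertical item lies in the middle part or beyond exactly one fixed item. -/
lemma cov_iff {j : ι} (hj : j ∈ 𝓑.V) (x : ℕ) :
    (if j ∈ 𝓑.mid x then 1 else 0) +
      ∑ i ∈ 𝓑.T.filter 𝓑.Fix, (if 𝓑.Cov i x ∧ j ∈ 𝓑.beyond i x then 1 else 0) =
    if 𝓑.Cov j x then 1 else 0 := by
  by_cases hjx : 𝓑.Cov j x
  swap
  · rw [if_neg hjx, if_neg fun h => hjx (mem_mid.1 h).2.1,
      sum_eq_zero fun i _ => if_neg fun h => hjx (mem_beyond.1 h.2).2.1, add_zero]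
  rw [if_pos hjx]
  by_cases hm : j ∈ 𝓑.mid x
  · rw [if_pos hm, sum_eq_zero fun i hi => if_neg fun h => (mem_mid.1 hm).2.2 i (mem_filter.1 hi).1
      (mem_filter.1 hi).2 h.1 (mem_beyond.1 h.2).2.2, add_zero]
  · rw [if_neg hm, zero_add]
    rw [mem_mid] at hm
    push Not at hm
    obtain ⟨i, hi, hF, hix, hb⟩ := hm hj hjx
    rw [sum_eq_single i]
    · rw [if_pos ⟨hix, mem_beyond.2 ⟨hj, hjx, hb⟩⟩]
    · intro i' hi' hne
      refine if_neg fun h => ?_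
      obtain ⟨h1, h2⟩ := h
      have hb' := (mem_beyond.1 h2).2.2
      have hi'T := (mem_filter.1 hi').1
      have hk := 𝓑.hkind i hi i' hi'T (Ne.symm hne)
      have ho := 𝓑.hord i hi i' hi'T
      have ho' := 𝓑.hord i' hi'T i hi
      unfold Beyond at hb hb'
      unfold Cov at hix h1
      cases t : 𝓑.top i <;> cases t' : 𝓑.top i' <;> simp [t, t'] at hk ho ho' hb hb' <;> omega
    · intro h
      exact absurd (mem_filter.2 ⟨hi, hF⟩) h

end BoxData

namespace BoxData

variable {ι : Type} [DecidableEq ι] {𝓑 : BoxData ι}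

/-- Vertical items find three kinds of room: the runs of columns (`RV`), the space between a fixed
tall item and its end of the box (`Fx`), and cells of height `q` between the floor runs and the
ceiling runs (`good`), which receive the returned columns `Q`. The columns with two tall items that
are not returned, `U \ Q`, are left over. -/
theorem nonempty_boxPacking (𝓑 : BoxData ι) (φ : ℝ) (hφ : φ * ((𝓑.c - 𝓑.f : ℕ) + 𝓑.B) ≤ (1 - φ) * 𝓑.σ) :
    Nonempty (BoxPacking 𝓑 φ) := by
  classical
  obtain ⟨ρ, r1, r2, r3, r4, r5, r6, r7⟩ := exists_box_runs 𝓑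
  have hfc := 𝓑.hfc
  set f := 𝓑.f with hf
  set c := 𝓑.c with hc
  set ℓ := 𝓑.ℓ with hℓ
  set r := 𝓑.r with hr
  have hℓr : ℓ < r := 𝓑.hℓr
  let 𝓡 := 𝓑.movers.image ρ
  have hinl : ∀ i, i ∈ 𝓑.T → Sum.inl i ∈ 𝓑.movers := fun i hi => inl_mem_disjSum.2 hi
  have hinr : ∀ x, x ∈ 𝓑.cols → Sum.inr x ∈ 𝓑.movers := fun x hx => inr_mem_disjSum.2 hx
  have wpos : ∀ a ∈ 𝓑.movers, 0 < 𝓑.wd a := by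
    rintro (i | x) ha
    · exact (𝓑.hpos i (mem_union_left _ (inl_mem_disjSum.1 ha))).1
    · exact Nat.one_pos
  have h𝓡 : ∀ R ∈ 𝓡, R.p < R.q ∧ f + R.key / 2 ≤ c := by
    intro R hR
    obtain ⟨a, ha, rfl⟩ := mem_image.1 hR
    have h0 : 𝓑.wd a ≤ ∑ b ∈ 𝓑.movers.filter (fun b => ρ b = ρ a), 𝓑.wd b :=
      single_le_sum (f := 𝓑.wd) (fun _ _ => Nat.zero_le _) (mem_filter.2 ⟨ha, rfl⟩)
    have h0' := wpos a ha
    have h1 := r5 a ha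
    have h2 := ky_half_le ha
    rw [← (r1 a ha).2] at h2
    omega
  have hsep : ∀ R ∈ 𝓡, ∀ R' ∈ 𝓡, R ≠ R' → (R.rect f c).Sep (R'.rect f c) := by
    intro R hR R' hR' hne
    obtain ⟨a, ha, rfl⟩ := mem_image.1 hR
    obtain ⟨b, hb, rfl⟩ := mem_image.1 hR'
    exact r6 a ha b hb hne
  -- used heights
  let cv : Run → ℕ → Prop := fun R x => R.p ≤ x ∧ x < R.q
  let ca : ι ⊕ ℕ → ℕ → Prop := fun a x => 𝓑.st a ≤ x ∧ x < 𝓑.st a + 𝓑.wd a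
  let u : ℕ → ℕ := fun x => ∑ R ∈ 𝓡.filter (cv · x), R.key / 2
  let bh : ℕ → ℕ := fun x => ∑ R ∈ 𝓡.filter (fun R => cv R x ∧ R.side = false), R.key / 2
  let th : ℕ → ℕ := fun x => ∑ R ∈ 𝓡.filter (fun R => cv R x ∧ R.side = true), R.key / 2
  have hu : ∀ x, u x = bh x + th x := by
    intro x
    simp only [u, bh, th, ← filter_filter]
    rw [← sum_filter_add_sum_filter_not _ (fun R : Run => R.side = false)]
    simp
  -- Sorting does not increase the used area inside the box: a fixed tall item keeps its columns,
  -- and any other run is as wide as its members together.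
  have hsumu : ∑ x ∈ Ico ℓ r, u x ≤
      ∑ x ∈ Ico ℓ r, ∑ a ∈ 𝓑.movers.filter (ca · x), 𝓑.ky a / 2 := by
    simp only [u]
    rw [sum_sum_filter_comm _ 𝓡 cv, sum_sum_filter_comm _ 𝓑.movers ca,
      ← sum_fiberwise_of_maps_to (t := 𝓡) (g := ρ) (fun a ha => mem_image_of_mem ρ ha)]
    refine sum_le_sum fun R hR => ?_
    have e : ∑ a ∈ 𝓑.movers.filter (fun a => ρ a = R), 𝓑.ky a / 2 * ((Ico ℓ r).filter (ca a)).card =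
        R.key / 2 * ∑ a ∈ 𝓑.movers.filter (fun a => ρ a = R), ((Ico ℓ r).filter (ca a)).card := by
      rw [mul_sum]
      refine sum_congr rfl fun a ha => ?_
      obtain ⟨h1, rfl⟩ := mem_filter.1 ha
      rw [(r1 a h1).2]
    rw [e]
    refine Nat.mul_le_mul_left _ ?_
    by_cases hfx : ∃ i ∈ 𝓑.T, 𝓑.Fix i ∧ ρ (.inl i) = R
    · obtain ⟨i, hi, hF, rfl⟩ := hfx
      refine le_trans (le_of_eq ?_) (single_le_sum (f := fun a => ((Ico ℓ r).filter (ca a)).card)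
        (fun _ _ => Nat.zero_le _) (mem_filter.2 ⟨hinl i hi, rfl⟩))
      congr 1
      refine filter_congr fun x _ => ?_
      simp only [cv, ca, st, wd, Sum.elim_inl]
      rw [(r2 i hi hF).1, (r2 i hi hF).2]
    · obtain ⟨a, ha, rfl⟩ := mem_image.1 hR
      have h5 := r5 a ha
      have e2 : ∑ b ∈ 𝓑.movers.filter (fun b => ρ b = ρ a), ((Ico ℓ r).filter (ca b)).card =
          ∑ b ∈ 𝓑.movers.filter (fun b => ρ b = ρ a), 𝓑.wd b := by
        refine sum_congr rfl fun b hb => ?_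
        obtain ⟨hb, hba⟩ := mem_filter.1 hb
        have hin : ℓ ≤ 𝓑.st b ∧ 𝓑.st b + 𝓑.wd b ≤ r := by
          rcases b with i | x
          · have : ¬ 𝓑.Fix i := fun hF => hfx ⟨i, inl_mem_disjSum.1 hb, hF, hba⟩
            simp only [Fix, not_or, not_lt] at this
            exact this
          · have := (mem_cols.1 (inr_mem_disjSum.1 hb)).1
            simp only [st, wd, Sum.elim_inr, id]
            omega
        have : (Ico ℓ r).filter (ca b) = Ico (𝓑.st b) (𝓑.st b + 𝓑.wd b) := by
          ext x
          simp only [mem_filter, mem_Ico, ca]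
          omega
        rw [this, Nat.card_Ico]
        omega
      rw [e2]
      have : ((Ico ℓ r).filter (cv (ρ a))).card ≤ (Ico (ρ a).p (ρ a).q).card := by
        refine card_le_card fun x hx => ?_
        exact mem_Ico.2 (mem_filter.1 hx).2
      rw [Nat.card_Ico] at this
      omega
  -- returned columns
  let U := (Ico ℓ r).filter 𝓑.Two
  obtain ⟨q, Q, hQU, hQq, hQrem, hQP⟩ := exists_returned (Ico ℓ r) U (filter_subset _ _) 𝓑.v u
    (c - f) 𝓑.σ 𝓑.B φ (by omega)
    (by
      intro x hx
      obtain ⟨-, i, hi, j, hj, h1, h2, h3, h4⟩ := mem_filter.1 hx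
      refine le_trans (sum_le_sum_of_subset fun k hk => ?_)
        (𝓑.hB x i hi j hj h1 h2 h3.1 h3.2 h4.1 h4.2)
      exact mem_filter.2 ⟨(mem_mid.1 hk).1, (mem_mid.1 hk).2.1⟩)
    hφ
    (by
      have h1 : ∀ x ∈ Ico ℓ r, ∑ a ∈ 𝓑.movers.filter (ca · x), 𝓑.ky a / 2 +
          (if 𝓑.Two x then 𝓑.v x + 𝓑.σ else 0) ≤ c - f := by
        intro x _
        have := sum_ky_le (𝓑 := 𝓑) (x := x)
        split_ifs with h
        · exact this.2 h
        · exact this.1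
      have h2 := sum_le_sum h1
      rw [sum_const, smul_eq_mul, sum_add_distrib, ← sum_filter] at h2
      refine le_trans (Nat.add_le_add_right hsumu _) ?_
      convert h2 using 1)
  rw [Nat.card_Ico] at hQrem
  let Pq := (Ico ℓ r).filter fun x => u x + q ≤ c - f
  obtain ⟨ctr, ctr1, ctr2⟩ := exists_contents Q 𝓑.mid Pq hQP
  -- cells
  let pts : Finset ℕ := insert ℓ (insert r ((𝓡.image Run.p ∪ 𝓡.image Run.q).filter
    fun x => ℓ ≤ x ∧ x ≤ r))
  have hℓp : ℓ ∈ pts := by simp [pts]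
  have hrp : r ∈ pts := by simp [pts]
  have hpts : ∀ p ∈ pts, ℓ ≤ p ∧ p ≤ r := by
    intro p hp
    simp only [pts, mem_insert, mem_filter] at hp
    omega
  have hpm : ∀ R ∈ 𝓡, (ℓ ≤ R.p → R.p ≤ r → R.p ∈ pts) ∧ (ℓ ≤ R.q → R.q ≤ r → R.q ∈ pts) := by
    intro R hR
    refine ⟨fun h1 h2 => ?_, fun h1 h2 => ?_⟩
    · exact mem_insert_of_mem (mem_insert_of_mem (mem_filter.2
        ⟨mem_union_left _ (mem_image_of_mem _ hR), h1, h2⟩))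
    · exact mem_insert_of_mem (mem_insert_of_mem (mem_filter.2
        ⟨mem_union_right _ (mem_image_of_mem _ hR), h1, h2⟩))
  have hcvlo : ∀ x, ℓ ≤ x → x < r → ∀ R ∈ 𝓡, cv R x ↔ cv R (loPt pts x) := by
    intro x hx hxr R hR
    have h1 := loPt_mem hℓp hx
    have h2 := loPt_le (P := pts) (x := x)
    have h3 := hpts _ h1
    simp only [cv]
    constructor
    · rintro ⟨h4, h5⟩
      refine ⟨?_, by omega⟩
      by_cases h6 : ℓ ≤ R.p
      · exact le_loPt ((hpm R hR).1 h6 (by omega)) h4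
      · omega
    · rintro ⟨h4, h5⟩
      refine ⟨by omega, ?_⟩
      by_contra h6
      have := le_loPt ((hpm R hR).2 (by omega) (by omega)) (not_lt.1 h6)
      omega
  have hulo : ∀ x, ℓ ≤ x → x < r → u x = u (loPt pts x) := by
    intro x hx hxr
    simp only [u]
    rw [filter_congr (hcvlo x hx hxr)]
  let good : Finset ℕ := pts.filter fun p => p < r ∧ u p + q ≤ c - f
  -- Between consecutive points of `pts` no run begins or ends, so the used heights at floor and
  -- ceiling are constant there. A cell rests on the floor run, and if one column of it has room `q`
  -- then all have.
  let cell : ℕ → Rect := fun p => ⟨p, f + bh p, hiPt pts p - p, q⟩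
  have hcell : ∀ p ∈ good, ℓ ≤ p ∧ p < hiPt pts p ∧ hiPt pts p ≤ r ∧ bh p + th p + q ≤ c - f := by
    intro p hp
    obtain ⟨h1, h2, h3⟩ := mem_filter.1 hp
    rw [hu] at h3
    exact ⟨(hpts p h1).1, lt_hiPt hrp h2, hiPt_le hrp h2, h3⟩
  have hcelllo : ∀ p ∈ good, ∀ x, p ≤ x → x < hiPt pts p → loPt pts x = p := by
    intro p hp x h1 h2
    have h3 := hcell p hp
    have h4 := loPt_self (mem_filter.1 hp).1
    rw [(grid_congr (x := p) (y := x) (by omega) h2 hℓp h3.1 hrp (by omega)).1, h4]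
  have cell_sep : ∀ p ∈ good, ∀ R ∈ 𝓡, (cell p).Sep (R.rect f c) := by
    intro p hp R hR
    have h1 := hcell p hp
    have h2 := h𝓡 R hR
    by_cases hov : R.q ≤ p ∨ hiPt pts p ≤ R.p
    · simp only [Rect.Sep, cell, Run.rect]; omega
    have hcvp : cv R p := by
      have h3 : cv R (max p R.p) := by simp only [cv]; omega
      have h4 := (hcvlo (max p R.p) (by omega) (by omega) R hR).1 h3
      rwa [hcelllo p hp (max p R.p) (by omega) (by omega)] at h4
    cases hs : R.side
    · have : R.key / 2 ≤ bh p := single_le_sum (f := fun R : Run => R.key / 2)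
        (fun _ _ => Nat.zero_le _) (mem_filter.2 ⟨hR, hcvp, hs⟩)
      simp only [Rect.Sep, cell, Run.rect, hs, Bool.false_eq_true, if_false]
      omega
    · have : R.key / 2 ≤ th p := single_le_sum (f := fun R : Run => R.key / 2)
        (fun _ _ => Nat.zero_le _) (mem_filter.2 ⟨hR, hcvp, hs⟩)
      simp only [Rect.Sep, cell, Run.rect, hs, if_true]
      omega
  -- hosts
  let RT : Finset Run := (𝓑.T.filter (¬ 𝓑.Fix ·)).image (ρ ∘ Sum.inl)
  let RV : Finset Run := 𝓑.cols.image (ρ ∘ Sum.inr)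
  let Fx : Finset ι := 𝓑.T.filter 𝓑.Fix
  have hRT : ∀ R ∈ RT, R ∈ 𝓡 ∧ ℓ ≤ R.p ∧ R.q ≤ r ∧ R.key % 2 = 0 := by
    intro R hR
    obtain ⟨i, hi, rfl⟩ := mem_image.1 hR
    obtain ⟨hi, hF⟩ := mem_filter.1 hi
    refine ⟨mem_image_of_mem _ (hinl i hi), (r3 i hi hF).1, (r3 i hi hF).2, ?_⟩
    simp only [Function.comp, (r1 _ (hinl i hi)).2, ky, Sum.elim_inl]
    omega
  have hRV : ∀ R ∈ RV, R ∈ 𝓡 ∧ ℓ ≤ R.p ∧ R.q ≤ r ∧ R.key % 2 = 1 := by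
    intro R hR
    obtain ⟨x, hx, rfl⟩ := mem_image.1 hR
    refine ⟨mem_image_of_mem _ (hinr x hx), (r4 x hx).1, (r4 x hx).2, ?_⟩
    simp only [Function.comp, (r1 _ (hinr x hx)).2, ky, Sum.elim_inr]
    omega
  have hFx : ∀ i ∈ Fx, ρ (.inl i) ∈ 𝓡 ∧ ((ρ (.inl i)).p < ℓ ∨ r < (ρ (.inl i)).q) := by
    intro i hi
    obtain ⟨hi, hF⟩ := mem_filter.1 hi
    refine ⟨mem_image_of_mem _ (hinl i hi), ?_⟩
    rw [(r2 i hi hF).1, (r2 i hi hF).2]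
    exact hF
  have hFxinj : ∀ i ∈ Fx, ∀ j ∈ Fx, i ≠ j → ρ (.inl i) ≠ ρ (.inl j) := by
    intro i hi j hj hne he
    obtain ⟨hi, hF⟩ := mem_filter.1 hi
    obtain ⟨hj, hF'⟩ := mem_filter.1 hj
    have h1 := r2 i hi hF
    have h2 := r2 j hj hF'
    rw [he] at h1
    have hs := (r1 _ (hinl i hi)).1
    rw [he, (r1 _ (hinl j hj)).1] at hs
    have h3 := 𝓑.hkind i hi j hj hne hs.symm
    have h4 := 𝓑.hpos i (mem_union_left _ hi)
    omega
  have hRTF : ∀ R ∈ RT, ∀ i ∈ Fx, R ≠ ρ (.inl i) := by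
    rintro R hR i hi rfl
    have := hRT _ hR; have := (hFx i hi).2
    omega
  have hRVF : ∀ R ∈ RV, ∀ i ∈ Fx, R ≠ ρ (.inl i) := by
    rintro R hR i hi rfl
    have := hRV _ hR; have := (hFx i hi).2
    omega
  have hRTV : ∀ R ∈ RT, ∀ R' ∈ RV, R ≠ R' := by
    rintro R hR R' hR' rfl
    have := (hRT R hR).2; have := (hRV R hR').2
    omega
  -- The run of a fixed tall item has height `eh`, so it contains the item and also the room beyond
  -- it. Separation of both from everything else follows from separation of the runs.
  have hFhost : ∀ i ∈ Fx, Rect.Inside ⟨𝓑.X i, 𝓑.Y i, 𝓑.w i, 𝓑.h i⟩ ((ρ (.inl i)).rect f c) ∧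
      Rect.Inside (𝓑.beyondRun i) ((ρ (.inl i)).rect f c) := by
    intro i hi
    obtain ⟨hi, hF⟩ := mem_filter.1 hi
    have h1 := r2 i hi hF
    have h2 := r1 _ (hinl i hi)
    have hb := 𝓑.hbox i (mem_union_left _ hi)
    have hm := 𝓑.meets i (mem_union_left _ hi)
    have e : 𝓑.ky (.inl i) = 2 * 𝓑.eh i := rfl
    have e' : 𝓑.sd (.inl i) = 𝓑.top i := rfl
    simp only [Rect.Inside, Run.rect, beyondRun]
    rw [h1.1, h1.2, h2.1, h2.2, e, e']
    cases ht : 𝓑.top i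
    · have : 𝓑.eh i = 𝓑.Y i + 𝓑.h i - 𝓑.f := by simp [eh, hF, ht]
      simp only [Bool.false_eq_true, if_false]
      omega
    · have : 𝓑.eh i = 𝓑.c - 𝓑.Y i := by simp [eh, hF, ht]
      simp only [if_true]
      omega
  have hself : ∀ i ∈ Fx, Rect.Sep ⟨𝓑.X i, 𝓑.Y i, 𝓑.w i, 𝓑.h i⟩ (𝓑.beyondRun i) := by
    intro i hi
    obtain ⟨hi, hF⟩ := mem_filter.1 hi
    have hb := 𝓑.hbox i (mem_union_left _ hi)
    simp only [Rect.Sep, beyondRun]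
    cases ht : 𝓑.top i
    · simp only [Bool.false_eq_true, if_false]
      omega
    · simp only [if_true]
      omega
  -- the positions of the tall items
  let QT : Run → Finset ι := fun R => 𝓑.T.filter fun i => ρ (.inl i) = R
  choose pos hpos hposd using fun R => exists_line_positions 𝓑.w (QT R)
  have hQT : ∀ R ∈ RT, ∑ i ∈ QT R, 𝓑.w i = R.q - R.p := by
    intro R hR
    obtain ⟨i, hi, rfl⟩ := mem_image.1 hR
    have hi' := (mem_filter.1 hi).1
    have h1 := r5 _ (hinl i hi')
    have h2 : ∑ b ∈ 𝓑.movers.filter (fun b => ρ b = ρ (.inl i)), 𝓑.wd b =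
        ∑ j ∈ QT (ρ (.inl i)), 𝓑.w j := by
      rw [movers, sum_filter, sum_disjSum, sum_eq_zero (s := 𝓑.cols), add_zero]
      · rw [← sum_filter]; rfl
      · intro x hx
        refine if_neg fun he => ?_
        exact hRTV _ hR _ (mem_image_of_mem (ρ ∘ Sum.inr) hx) he.symm
    simp only [Function.comp]
    omega
  have hRTh : ∀ R ∈ RT, ∀ i ∈ QT R, 𝓑.h i = R.key / 2 := by
    intro R hR i hiQ
    obtain ⟨hi, rfl⟩ := mem_filter.1 hiQ
    have h1 : ¬ 𝓑.Fix i := fun hF => hRTF _ hR i (mem_filter.2 ⟨hi, hF⟩) rfl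
    rw [(r1 _ (hinl i hi)).2]
    simp only [ky, Sum.elim_inl, eh, if_neg h1]
    omega
  let P : ι → ℕ × ℕ := fun i =>
    ((ρ (.inl i)).p + pos (ρ (.inl i)) i, ((ρ (.inl i)).rect f c).y)
  have hPin : ∀ i ∈ 𝓑.T, ¬ 𝓑.Fix i → ρ (.inl i) ∈ RT ∧
      Rect.Inside ⟨(P i).1, (P i).2, 𝓑.w i, 𝓑.h i⟩ ((ρ (.inl i)).rect f c) ∧
      ((ρ (.inl i)).rect f c).h = 𝓑.h i := by
    intro i hi hF
    have h0 : ρ (.inl i) ∈ RT :=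
      mem_image_of_mem (ρ ∘ Sum.inl) (mem_filter.2 ⟨hi, hF⟩ : i ∈ 𝓑.T.filter (¬ 𝓑.Fix ·))
    have h1 : i ∈ QT (ρ (.inl i)) := mem_filter.2 ⟨hi, rfl⟩
    have h2 := hQT _ h0
    have h3 := hRTh _ h0 i h1
    have h4 := hpos _ i h1
    have h5 := h𝓡 _ (hRT _ h0).1
    refine ⟨h0, ?_, ?_⟩
    · simp only [Rect.Inside, Run.rect, P]
      omega
    · simp only [Run.rect, h3]
  -- contents of the runs of columns
  let QV : Run → Finset ℕ := fun R => 𝓑.cols.filter fun x => ρ (.inr x) = R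
  have hQV : ∀ R ∈ RV, (QV R).card ≤ (Ico R.p R.q).card := by
    intro R hR
    obtain ⟨x, hx, rfl⟩ := mem_image.1 hR
    have h1 := r5 _ (hinr x hx)
    have h2 : (QV (ρ (.inr x))).card ≤
        ∑ b ∈ 𝓑.movers.filter (fun b => ρ b = ρ (.inr x)), 𝓑.wd b := by
      rw [movers, sum_filter, sum_disjSum, card_eq_sum_ones, ← sum_filter, ← sum_filter]
      exact Nat.le_add_left _ _
    rw [Nat.card_Ico]
    simp only [Function.comp] at *
    omega
  have hctV : ∀ R, ∃ ct : ℕ → Finset ι, R ∈ RV →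
      (∀ x, ct x = ∅ ∨ ∃ j ∈ QV R, ct x = 𝓑.mid j) ∧
      ∀ i, ((Ico R.p R.q).filter fun x => i ∈ ct x).card =
        ((QV R).filter fun j => i ∈ 𝓑.mid j).card := by
    intro R
    by_cases hR : R ∈ RV
    · obtain ⟨ct, h⟩ := exists_contents (QV R) 𝓑.mid (Ico R.p R.q) (hQV R hR)
      exact ⟨ct, fun _ => h⟩
    · exact ⟨fun _ => ∅, fun h => absurd h hR⟩
  choose ctV hctV using hctV
  let vr : {R // R ∈ RV} ⊕ {i // i ∈ Fx} ⊕ {p // p ∈ good} → VRun ι :=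
    Sum.elim (fun R => ⟨R.1.rect f c, ctV R.1⟩)
      (Sum.elim (fun i => ⟨𝓑.beyondRun i.1, 𝓑.beyond i.1⟩) fun p => ⟨cell p.1, ctr⟩)
  have hrunin : ∀ R ∈ 𝓡, ℓ ≤ R.p → R.q ≤ r → (R.rect f c).Inside ⟨ℓ, f, r - ℓ, c - f⟩ := by
    intro R hR h1 h2
    have := h𝓡 R hR
    simp only [Rect.Inside, Run.rect]
    split_ifs <;> omega
  have vr_sep_run : ∀ k, ∀ R ∈ 𝓡, (∀ R' : {R // R ∈ RV}, k = Sum.inl R' → R'.1 ≠ R) →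
      (∀ i : {i // i ∈ Fx}, k = Sum.inr (Sum.inl i) → ρ (.inl i.1) ≠ R) →
      (vr k).rect.Sep (R.rect f c) := by
    rintro (R' | i | p) R hR h1 h2
    · exact hsep _ (hRV _ R'.2).1 _ hR (h1 R' rfl)
    · exact (hsep _ (hFx _ i.2).1 _ hR (h2 i rfl)).mono (hFhost _ i.2).2
        ⟨le_rfl, le_rfl, le_rfl, le_rfl⟩
    · exact cell_sep p.1 p.2 R hR
  have RI : ∀ R : Rect, R.Inside R := fun R => ⟨le_rfl, le_rfl, le_rfl, le_rfl⟩
  refine ⟨⟨P, {R // R ∈ RT}, inferInstance, fun R => R.1.rect f c, _, inferInstance, vr, U \ Q,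
    𝓑.mid, ?_, ?_, ?_, ?_, ?_, ?_, ?_, ?_, ?_, ?_, ?_, ?_, ?_, ?_, ?_, ?_⟩⟩
  · -- number of pieces
    have c1 : RT.card ≤ 𝓡.card := card_le_card fun R hR => (hRT R hR).1
    have c2 : RV.card ≤ 𝓡.card := card_le_card fun R hR => (hRV R hR).1
    have c3 : Fx.card ≤ 𝓡.card := by
      refine card_le_card_of_injOn (fun i => ρ (.inl i)) (fun i hi => (hFx i hi).1) ?_
      intro i hi j hj he
      by_contra hne
      exact hFxinj i hi j hj hne he
    have c4 : good.card ≤ 2 * 𝓡.card + 2 := by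
      refine (card_filter_le _ _).trans ?_
      have e1 : (𝓡.image Run.p ∪ 𝓡.image Run.q).card ≤ 2 * 𝓡.card := by
        refine (card_union_le _ _).trans ?_
        have := card_image_le (s := 𝓡) (f := Run.p)
        have := card_image_le (s := 𝓡) (f := Run.q)
        omega
      have e2 := card_filter_le (𝓡.image Run.p ∪ 𝓡.image Run.q) fun x => ℓ ≤ x ∧ x ≤ r
      have e3 := card_insert_le r ((𝓡.image Run.p ∪ 𝓡.image Run.q).filter fun x => ℓ ≤ x ∧ x ≤ r)
      have e4 := card_insert_le ℓ
        (insert r ((𝓡.image Run.p ∪ 𝓡.image Run.q).filter fun x => ℓ ≤ x ∧ x ≤ r))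
      simp only [pts]
      omega
    simp only [Fintype.card_sum, Fintype.card_coe]
    -- There are at most five times as many pieces as runs, plus two: one each from `RT`, `RV` and
    -- `Fx`, and two per run plus two from the cells. With eight times this product as bound for the
    -- runs, 48 times the product suffices.
    have c5 : 1 ≤ (2 * 𝓑.R + 4) * (2 * 𝓑.R + 3) := Nat.mul_pos (by omega) (by omega)
    have c6 : 8 * (2 * 𝓑.R + 4) * (2 * 𝓑.R + 3) = 8 * ((2 * 𝓑.R + 4) * (2 * 𝓑.R + 3)) := by ring
    have c7 : 48 * (2 * 𝓑.R + 4) * (2 * 𝓑.R + 3) = 48 * ((2 * 𝓑.R + 4) * (2 * 𝓑.R + 3)) := by ring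
    change 𝓡.card ≤ _ at r7
    omega
  · exact fun R => hrunin _ (hRT _ R.2).1 (hRT _ R.2).2.1 (hRT _ R.2).2.2.1
  · rintro (R | i | p)
    · exact hrunin _ (hRV _ R.2).1 (hRV _ R.2).2.1 (hRV _ R.2).2.2.1
    · have hi := (mem_filter.1 i.2).1
      have hb := 𝓑.hbox i.1 (mem_union_left _ hi)
      have hm := 𝓑.meets i.1 (mem_union_left _ hi)
      simp only [vr, Sum.elim_inr, Sum.elim_inl, Rect.Inside, beyondRun]
      split_ifs <;> omega
    · have := hcell p.1 p.2
      simp only [vr, Sum.elim_inr, Rect.Inside, cell]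
      omega
  · exact fun R R' hne => hsep _ (hRT _ R.2).1 _ (hRT _ R'.2).1 fun h => hne (Subtype.ext h)
  · rintro (R | i | p) k hne
    · refine (vr_sep_run k R.1 (hRV _ R.2).1 ?_ ?_).symm
      · rintro R' rfl h; exact hne (by rw [Subtype.ext h])
      · rintro i rfl; exact (hRVF _ R.2 _ i.2).symm
    · refine (vr_sep_run k _ (hFx _ i.2).1 ?_ ?_).symm.mono (hFhost _ i.2).2 (RI _)
      · rintro R' rfl; exact hRVF _ R'.2 _ i.2
      · rintro i' rfl
        exact hFxinj _ i'.2 _ i.2 fun h => hne (by rw [Subtype.ext h])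
    · rcases k with R | i | p'
      · exact cell_sep _ p.2 _ (hRV _ R.2).1
      · exact (cell_sep _ p.2 _ (hFx _ i.2).1).mono (RI _) (hFhost _ i.2).2
      · have hpp : p.1 ≠ p'.1 := fun h => hne (by rw [Subtype.ext h])
        have h1 := hcell _ p.2
        have h2 := hcell _ p'.2
        simp only [vr, Sum.elim_inr, Rect.Sep, cell]
        rcases lt_or_gt_of_ne hpp with h | h
        · have := hiPt_le (mem_filter.1 p'.2).1 h
          omega
        · have := hiPt_le (mem_filter.1 p.2).1 h
          omega
  · intro R k
    refine (vr_sep_run k R.1 (hRT _ R.2).1 ?_ ?_).symm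
    · rintro R' rfl; exact (hRTV _ R.2 _ R'.2).symm
    · rintro i rfl; exact (hRTF _ R.2 _ i.2).symm
  · intro i hi hF R
    have hi' : i ∈ Fx := mem_filter.2 ⟨hi, hF⟩
    exact (hsep _ (hFx i hi').1 _ (hRT _ R.2).1 (hRTF _ R.2 i hi').symm).mono (hFhost i hi').1 (RI _)
  · intro i hi hF k
    have hi' : i ∈ Fx := mem_filter.2 ⟨hi, hF⟩
    by_cases hk : k = Sum.inr (Sum.inl ⟨i, hi'⟩)
    · subst hk
      exact hself i hi'
    · refine (vr_sep_run k _ (hFx i hi').1 ?_ ?_).symm.mono (hFhost i hi').1 (RI _)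
      · rintro R' rfl; exact hRVF _ R'.2 _ hi'
      · rintro i' rfl
        exact hFxinj _ i'.2 _ hi' fun h => hk (by simp only [← h])
  · intro i hi hF
    obtain ⟨h1, h2, h3⟩ := hPin i hi hF
    exact ⟨⟨_, h1⟩, h2, h3⟩
  · intro i hi j hj hF hF' hne
    obtain ⟨h1, h2, h3⟩ := hPin i hi hF
    obtain ⟨h1', h2', h3'⟩ := hPin j hj hF'
    by_cases he : ρ (.inl i) = ρ (.inl j)
    · have := hposd (ρ (.inl i)) i (mem_filter.2 ⟨hi, rfl⟩) j (mem_filter.2 ⟨hj, he.symm⟩) hne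
      simp only [Rect.Sep, P, ← he]
      omega
    · exact (hsep _ (hRT _ h1).1 _ (hRT _ h1').1 he).mono h2 h2'
  · rw [← sum_fiberwise_of_maps_to (s := 𝓑.T.filter (¬ 𝓑.Fix ·)) (t := RT) (g := ρ ∘ Sum.inl)
      (fun i hi => mem_image_of_mem _ hi), ← sum_coe_sort RT]
    refine sum_le_sum fun R _ => ?_
    have e : (𝓑.T.filter (¬ 𝓑.Fix ·)).filter (fun i => (ρ ∘ Sum.inl) i = R.1) = QT R.1 := by
      ext i
      simp only [mem_filter, QT, Function.comp]
      constructor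
      · rintro ⟨⟨h1, h2⟩, h3⟩; exact ⟨h1, h3⟩
      · rintro ⟨h1, h2⟩
        exact ⟨⟨h1, fun hF => hRTF _ R.2 i (mem_filter.2 ⟨h1, hF⟩) h2.symm⟩, h2⟩
    rw [e]
    have : ∑ i ∈ QT R.1, 𝓑.w i * 𝓑.h i = ∑ i ∈ QT R.1, 𝓑.w i * (R.1.key / 2) :=
      sum_congr rfl fun i hi => by rw [hRTh _ R.2 i hi]
    rw [this, ← sum_mul, hQT _ R.2]
    exact le_rfl
  · rintro (R | i | p) x hx1 hx2
    · simp only [vr, Sum.elim_inl]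
      rcases (hctV R.1 R.2).1 x with h | ⟨j, hj, h⟩
      · rw [h]; simp
      · rw [h]
        refine ⟨fun k hk => (mem_mid.1 hk).1, ?_⟩
        obtain ⟨hj1, hj2⟩ := mem_filter.1 hj
        have := (r1 _ (hinr j hj1)).2
        simp only [Run.rect, ← hj2, this, ky, Sum.elim_inr, v]
        omega
    · refine ⟨fun k hk => (mem_beyond.1 hk).1, sum_beyond_le (mem_filter.1 i.2).1 ?_⟩
      have hm := 𝓑.meets i.1 (mem_union_left _ (mem_filter.1 i.2).1)
      have hw := 𝓑.hpos i.1 (mem_union_left _ (mem_filter.1 i.2).1)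
      simp only [vr, Sum.elim_inr, Sum.elim_inl, beyondRun] at hx1 hx2
      unfold Cov
      omega
    · simp only [vr, Sum.elim_inr]
      rcases ctr1 x with h | ⟨j, hj, h⟩
      · rw [h]; simp
      · rw [h]
        exact ⟨fun k hk => (mem_mid.1 hk).1, hQq j hj⟩
  · intro x hx
    have := mem_filter.1 (mem_sdiff.1 hx).1
    exact ⟨mem_Ico.1 this.1, this.2⟩
  · exact hQrem
  · intro x hx
    refine ⟨fun k hk => (mem_mid.1 hk).1, ?_⟩
    obtain ⟨-, i, hi, j, hj, h1, h2, h3, h4⟩ := mem_filter.1 (mem_sdiff.1 hx).1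
    refine le_trans (sum_le_sum_of_subset fun k hk => ?_)
      (𝓑.hB x i hi j hj h1 h2 h3.1 h3.2 h4.1 h4.2)
    exact mem_filter.2 ⟨(mem_mid.1 hk).1, (mem_mid.1 hk).2.1⟩
  · intro j hj
    have hmv : ∀ x, j ∈ 𝓑.mid x → 0 < 𝓑.v x := fun x hx =>
      (𝓑.hpos j (mem_union_right _ hj)).2.trans_le
        (single_le_sum (f := 𝓑.h) (fun _ _ => Nat.zero_le _) hx)
    have A1 : ∑ R : {R // R ∈ RV}, (vr (Sum.inl R)).count j =
        (𝓑.cols.filter fun x => j ∈ 𝓑.mid x).card := by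
      rw [card_eq_sum_card_fiberwise (f := ρ ∘ Sum.inr) (t := RV)
        (fun x hx => mem_image_of_mem _ (mem_filter.1 hx).1), ← sum_coe_sort RV]
      refine sum_congr rfl fun R _ => ?_
      have h1 := (hctV R.1 R.2).2 j
      have h2 := h𝓡 _ (hRV _ R.2).1
      rw [VRun.count_eq_card (S := (Ico R.1.p R.1.q).filter fun x => j ∈ ctV R.1 x) (fun x => ?_), h1]
      · congr 1
        ext x
        simp only [QV, mem_filter, Function.comp]
        tauto
      · simp only [mem_filter, mem_Ico, vr, Sum.elim_inl, Run.rect]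
        rw [Nat.add_sub_cancel' h2.1.le]
    have A2 : ∑ i : {i // i ∈ Fx}, (vr (Sum.inr (Sum.inl i))).count j =
        ∑ i ∈ Fx, ((Ico ℓ r).filter fun x => 𝓑.Cov i x ∧ j ∈ 𝓑.beyond i x).card := by
      rw [← sum_coe_sort Fx]
      refine sum_congr rfl fun i _ => ?_
      have hm := 𝓑.meets i.1 (mem_union_left _ (mem_filter.1 i.2).1)
      have hw := 𝓑.hpos i.1 (mem_union_left _ (mem_filter.1 i.2).1)
      refine VRun.count_eq_card fun x => ?_
      simp only [mem_filter, mem_Ico, vr, Sum.elim_inl, Sum.elim_inr, beyondRun]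
      symm
      constructor
      · rintro ⟨h1, h2⟩
        refine ⟨by omega, ?_, h2⟩
        unfold Cov
        omega
      · rintro ⟨h1, h2, h3⟩
        refine ⟨?_, h3⟩
        unfold Cov at h2
        omega
    have A3 : ∑ p : {p // p ∈ good}, (vr (Sum.inr (Sum.inr p))).count j =
        (Q.filter fun x => j ∈ 𝓑.mid x).card := by
      rw [← ctr2 j, card_eq_sum_card_fiberwise (f := loPt pts) (t := good), ← sum_coe_sort good]
      · refine sum_congr rfl fun p _ => ?_
        have hp := hcell p.1 p.2
        refine VRun.count_eq_card fun x => ?_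
        simp only [mem_filter, mem_Ico, Pq, vr, Sum.elim_inr, cell]
        rw [Nat.add_sub_cancel' hp.2.1.le]
        symm
        constructor
        · rintro ⟨h1, h2⟩
          have h3 := hcelllo p.1 p.2 x h1.1 h1.2
          refine ⟨⟨⟨by omega, ?_⟩, h2⟩, h3⟩
          rw [hulo x (by omega) (by omega), h3]
          exact (mem_filter.1 p.2).2.2
        · rintro ⟨⟨⟨h1, h2⟩, h3⟩, h4⟩
          refine ⟨⟨h4 ▸ loPt_le, ?_⟩, h3⟩
          rw [← h4, (grid_congr (x := x) (y := loPt pts x) le_rfl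
            (loPt_le.trans_lt (lt_hiPt hrp h1.2)) hℓp h1.1 hrp h1.2).2]
          exact lt_hiPt hrp h1.2
      · intro x hx
        obtain ⟨h1, -⟩ := mem_filter.1 hx
        obtain ⟨h2, h3⟩ := mem_filter.1 h1
        rw [mem_Ico] at h2
        refine mem_filter.2 ⟨loPt_mem hℓp h2.1, loPt_le.trans_lt h2.2, ?_⟩
        rwa [← hulo x h2.1 h2.2]
    rw [Fintype.sum_sum_type, Fintype.sum_sum_type, A1, A2, A3]
    change _ = ((Ico ℓ r).filter (𝓑.Cov j)).card
    -- Every column of `j` in the box is counted once: it is in the middle part or beyond one fixed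
    -- item; a middle column meets two tall items or not; with two, it is returned or left over.
    have B1 : ((Ico ℓ r).filter (𝓑.Cov j)).card = ((Ico ℓ r).filter fun x => j ∈ 𝓑.mid x).card +
        ∑ i ∈ Fx, ((Ico ℓ r).filter fun x => 𝓑.Cov i x ∧ j ∈ 𝓑.beyond i x).card := by
      simp only [card_filter]
      rw [sum_comm, ← sum_add_distrib]
      exact sum_congr rfl fun x _ => (cov_iff hj x).symm
    have B2 : ((Ico ℓ r).filter fun x => j ∈ 𝓑.mid x).card =
        (U.filter fun x => j ∈ 𝓑.mid x).card + (𝓑.cols.filter fun x => j ∈ 𝓑.mid x).card := by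
      rw [← card_filter_add_card_filter_not (s := (Ico ℓ r).filter fun x => j ∈ 𝓑.mid x) 𝓑.Two]
      congr 2
      · ext x; simp only [mem_filter, U]; tauto
      · ext x
        simp only [mem_filter, mem_cols, mem_Ico]
        constructor
        · rintro ⟨⟨h1, h2⟩, h3⟩
          exact ⟨⟨h1, h3, hmv x h2⟩, h2⟩
        · rintro ⟨⟨h1, h3, h4⟩, h2⟩
          exact ⟨⟨h1, h2⟩, h3⟩
    have B3 : (U.filter fun x => j ∈ 𝓑.mid x).card =
        (Q.filter fun x => j ∈ 𝓑.mid x).card + ((U \ Q).filter fun x => j ∈ 𝓑.mid x).card := by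
      rw [← card_union_of_disjoint, ← filter_union, union_sdiff_of_subset hQU]
      exact disjoint_filter_filter disjoint_sdiff
    omega

end BoxData

/-! ### All boxes of the strip. -/

/-- Tall and vertical items around disjoint obstacles, and vertical lines through the ends of the
obstacles. -/
structure MainData (ι : Type) [DecidableEq ι] where
  T : Finset ι
  V : Finset ι
  top : ι → Bool
  X : ι → ℕ
  Y : ι → ℕ
  w : ι → ℕ
  h : ι → ℕ
  W : ℕ
  g : ℕ
  R : ℕ
  B : ℕ
  σ : ℕ
  D : ℕ
  obs : Finset Rect
  lines : Finset ℕ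
  hg : 0 < g
  hpos : ∀ i ∈ T ∪ V, 0 < w i ∧ 0 < h i
  hdvd : ∀ i ∈ T ∪ V, g ∣ Y i ∧ g ∣ h i
  hin : ∀ i ∈ T ∪ V, X i + w i ≤ W ∧ Y i + h i ≤ g * R
  hTV : Disjoint T V
  hsep : ∀ i ∈ T ∪ V, ∀ j ∈ T ∪ V, i ≠ j →
    Rect.Sep ⟨X i, Y i, w i, h i⟩ ⟨X j, Y j, w j, h j⟩
  hkind : ∀ i ∈ T, ∀ j ∈ T, i ≠ j → top i = top j → X i + w i ≤ X j ∨ X j + w j ≤ X i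
  hord : ∀ i ∈ T, ∀ j ∈ T, top i = false → top j = true → Y i ≤ Y j
  hext : ∀ i ∈ T, top i = false → ∀ j ∈ T ∪ V, j ≠ i → X i < X j + w j → X j < X i + w i →
    Y j + h j ≤ Y i ∨ Y i + h i + σ ≤ Y j
  hB : ∀ x, ∀ i ∈ T, ∀ j ∈ T, top i = false → top j = true → X i ≤ x → x < X i + w i →
    X j ≤ x → x < X j + w j → ∑ k ∈ V.filter (fun k => X k ≤ x ∧ x < X k + w k), h k ≤ B
  obs_in : ∀ O ∈ obs, O.Inside ⟨0, 0, W, g * R⟩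
  obs_pos : ∀ O ∈ obs, 0 < O.w ∧ 0 < O.h
  obs_dvd : ∀ O ∈ obs, g ∣ O.y ∧ g ∣ O.h
  obs_sep : ∀ i ∈ T ∪ V, ∀ O ∈ obs, Rect.Sep ⟨X i, Y i, w i, h i⟩ O
  line_zero : 0 ∈ lines
  line_W : W ∈ lines
  line_obs : ∀ O ∈ obs, O.x ∈ lines ∧ O.x + O.w ∈ lines
  line_gap : ∀ a ∈ lines, a < W → hiPt lines a ≤ a + D

namespace MainData

variable {ι : Type} [DecidableEq ι] (𝓜 : MainData ι)

/-- No obstacle covers the cell `(a, y)`. -/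
def Free (a y : ℕ) : Prop := ∀ O ∈ 𝓜.obs, (a, y) ∉ O.cells

/-- A box: a slab between consecutive lines, starting at `t.1`, and a maximal free interval. -/
def IsBox (t : ℕ × ℕ × ℕ) : Prop :=
  (t.1 ∈ 𝓜.lines ∧ t.1 < 𝓜.W) ∧ IsMaxInt (𝓜.Free t.1) (𝓜.g * 𝓜.R) t.2.1 t.2.2

/-- Item `i` meets the slab of the box and lies in its interval. -/
def InBox (t : ℕ × ℕ × ℕ) (i : ι) : Prop :=
  (t.1 < 𝓜.X i + 𝓜.w i ∧ 𝓜.X i < hiPt 𝓜.lines t.1) ∧ t.2.1 ≤ 𝓜.Y i ∧ 𝓜.Y i + 𝓜.h i ≤ t.2.2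

noncomputable instance (t : ℕ × ℕ × ℕ) : DecidablePred (𝓜.InBox t) := fun _ => by unfold InBox; infer_instance

/-- Item `i` crosses a line. -/
def Crosses (i : ι) : Prop := ∃ a ∈ 𝓜.lines, 𝓜.X i < a ∧ a < 𝓜.X i + 𝓜.w i

variable {𝓜}

lemma slab {t : ℕ × ℕ × ℕ} (ht : 𝓜.IsBox t) : t.1 < hiPt 𝓜.lines t.1 ∧ hiPt 𝓜.lines t.1 ∈ 𝓜.lines ∧
    hiPt 𝓜.lines t.1 ≤ 𝓜.W ∧ ∀ a ∈ 𝓜.lines, a ≤ t.1 ∨ hiPt 𝓜.lines t.1 ≤ a :=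
  ⟨lt_hiPt 𝓜.line_W ht.1.2, hiPt_mem 𝓜.line_W ht.1.2, hiPt_le 𝓜.line_W ht.1.2, fun a ha => by
    by_cases h : a ≤ t.1
    · exact Or.inl h
    · exact Or.inr (hiPt_le ha (not_le.1 h))⟩

/-- Lines run through both ends of each obstacle, so an obstacle spans a slab completely or misses
it. This is why the free area of a slab consists of full-width boxes. -/
lemma obs_slab {t : ℕ × ℕ × ℕ} (ht : 𝓜.IsBox t) {O : Rect} (hO : O ∈ 𝓜.obs) {x y : ℕ}
    (hx : t.1 ≤ x) (hxr : x < hiPt 𝓜.lines t.1) : (x, y) ∈ O.cells ↔ (t.1, y) ∈ O.cells := by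
  have h1 := (slab ht).2.2.2 _ (𝓜.line_obs O hO).1
  have h2 := (slab ht).2.2.2 _ (𝓜.line_obs O hO).2
  have h3 := slab ht
  rw [Rect.mem_cells, Rect.mem_cells]
  simp only
  omega

/-- The floor and the ceiling of a box are the boundary of the strip or horizontal edges of
obstacles, all of which are multiples of `g`. -/
lemma isBox_dvd {t : ℕ × ℕ × ℕ} (ht : 𝓜.IsBox t) : 𝓜.g ∣ t.2.1 ∧ 𝓜.g ∣ t.2.2 := by
  obtain ⟨h1, h2, h3, h4, h5, h6⟩ := ht
  constructor
  · rcases h5 with h | h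
    · rw [h]; exact dvd_zero _
    · unfold Free at h
      push Not at h
      obtain ⟨O, hO, h⟩ := h
      have h7 := h4 _ le_rfl h2 O hO
      rw [Rect.mem_cells] at h h7
      simp only at h h7
      by_cases h0 : t.2.1 = 0
      · rw [h0]; exact dvd_zero _
      · rw [show t.2.1 = O.y + O.h by omega]
        exact dvd_add (𝓜.obs_dvd O hO).1 (𝓜.obs_dvd O hO).2
  · rcases h6 with h | h
    · rw [h]; exact dvd_mul_right _ _
    · unfold Free at h
      push Not at h
      obtain ⟨O, hO, h⟩ := h
      have h7 := h4 (t.2.2 - 1) (by omega) (by omega) O hO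
      rw [Rect.mem_cells] at h h7
      simp only at h h7
      rw [show t.2.2 = O.y by omega]
      exact (𝓜.obs_dvd O hO).1

/-- The data of a single box. -/
noncomputable def boxData (t : ℕ × ℕ × ℕ) (ht : 𝓜.IsBox t) : BoxData ι where
  T := 𝓜.T.filter (𝓜.InBox t)
  V := 𝓜.V.filter (𝓜.InBox t)
  top := 𝓜.top
  X := 𝓜.X
  Y := 𝓜.Y
  w := 𝓜.w
  h := 𝓜.h
  ℓ := t.1
  r := hiPt 𝓜.lines t.1
  f := t.2.1
  c := t.2.2
  g := 𝓜.g
  R := 𝓜.R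
  B := 𝓜.B
  σ := 𝓜.σ
  hℓr := (slab ht).1
  hfc := ht.2.1
  hgf := (isBox_dvd ht).1
  hgc := (isBox_dvd ht).2
  hR := (Nat.sub_le _ _).trans ht.2.2.1
  hg := 𝓜.hg
  hpos i hi := 𝓜.hpos i (by rw [← filter_union] at hi; exact (mem_filter.1 hi).1)
  hdvd i hi := 𝓜.hdvd i (by rw [← filter_union] at hi; exact (mem_filter.1 hi).1)
  hbox i hi := by rw [← filter_union] at hi; exact (mem_filter.1 hi).2.2
  meets i hi := by rw [← filter_union] at hi; exact (mem_filter.1 hi).2.1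
  hTV := disjoint_filter_filter 𝓜.hTV
  hsep i hi j hj := 𝓜.hsep i (by rw [← filter_union] at hi; exact (mem_filter.1 hi).1) j
    (by rw [← filter_union] at hj; exact (mem_filter.1 hj).1)
  hkind i hi j hj := 𝓜.hkind i (mem_filter.1 hi).1 j (mem_filter.1 hj).1
  hord i hi j hj := 𝓜.hord i (mem_filter.1 hi).1 j (mem_filter.1 hj).1
  hext i hi ht j hj := 𝓜.hext i (mem_filter.1 hi).1 ht j
    (by rw [← filter_union] at hj; exact (mem_filter.1 hj).1)
  hB x i hi j hj h1 h2 h3 h4 h5 h6 := by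
    refine le_trans (sum_le_sum_of_subset fun k hk => ?_)
      (𝓜.hB x i (mem_filter.1 hi).1 j (mem_filter.1 hj).1 h1 h2 h3 h4 h5 h6)
    rw [mem_filter, mem_filter] at hk
    exact mem_filter.2 ⟨hk.1.1, hk.2⟩

/-- The area of a box. -/
noncomputable def boxRect (𝓜 : MainData ι) (t : ℕ × ℕ × ℕ) : Rect :=
  ⟨t.1, t.2.1, hiPt 𝓜.lines t.1 - t.1, t.2.2 - t.2.1⟩

lemma boxRect_sep {t t' : ℕ × ℕ × ℕ} (ht : 𝓜.IsBox t) (ht' : 𝓜.IsBox t') (hne : t ≠ t') :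
    (𝓜.boxRect t).Sep (𝓜.boxRect t') := by
  have h1 := slab ht
  have h2 := slab ht'
  have h3 := h1.2.2.2 _ ht'.1.1
  have h4 := h2.2.2.2 _ ht.1.1
  have h5 := ht.2.1
  have h6 := ht'.2.1
  by_cases he : t.1 = t'.1
  · by_contra hc
    simp only [Rect.Sep, boxRect] at hc
    have h7 := ht'.2
    rw [← he] at h7
    have := ht.2.unique h7 (x := max t.2.1 t'.2.1) (by omega) (by omega)
    exact hne (Prod.ext he (Prod.ext this.1 this.2))
  · simp only [Rect.Sep, boxRect]
    omega

lemma boxRect_obs {t : ℕ × ℕ × ℕ} (ht : 𝓜.IsBox t) {O : Rect} (hO : O ∈ 𝓜.obs) :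
    (𝓜.boxRect t).Sep O := by
  by_contra hc
  have h1 := slab ht
  simp only [Rect.Sep, boxRect] at hc
  have h2 := ht.2.1
  have hp := 𝓜.obs_pos O hO
  have h3 : (max t.1 O.x, max t.2.1 O.y) ∈ O.cells := by
    rw [Rect.mem_cells]; simp only; omega
  rw [obs_slab ht hO (by omega) (by omega)] at h3
  exact ht.2.2.2.1 _ (by omega) (by omega) O hO h3

/-- An item meeting a slab lies in one box of the slab. -/
lemma exists_inBox {i : ι} (hi : i ∈ 𝓜.T ∪ 𝓜.V) {x : ℕ} (hx : 𝓜.X i ≤ x) (hx' : x < 𝓜.X i + 𝓜.w i) :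
    ∃ t, 𝓜.IsBox t ∧ 𝓜.InBox t i ∧ t.1 = loPt 𝓜.lines x := by
  have hin := 𝓜.hin i hi
  have hp := 𝓜.hpos i hi
  have hxW : x < 𝓜.W := by omega
  have g1 := loPt_mem 𝓜.line_zero (Nat.zero_le x)
  have g2 := loPt_le (P := 𝓜.lines) (x := x)
  have g3 := lt_hiPt 𝓜.line_W hxW
  have g4 : hiPt 𝓜.lines (loPt 𝓜.lines x) = hiPt 𝓜.lines x :=
    (grid_congr le_rfl (by omega) 𝓜.line_zero (Nat.zero_le x) 𝓜.line_W hxW).2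
  have hfree : ∀ y, 𝓜.Y i ≤ y → y < 𝓜.Y i + 𝓜.h i → 𝓜.Free (loPt 𝓜.lines x) y := by
    intro y h1 h2 O hO hc
    have h3 := 𝓜.obs_sep i hi O hO
    have h4 := 𝓜.line_obs O hO
    rw [Rect.mem_cells] at hc
    simp only [Rect.Sep] at h3
    simp only at hc
    have h5 : x < O.x + O.w := by
      by_contra h
      have := le_loPt h4.2 (not_lt.1 h)
      omega
    omega
  obtain ⟨f, c, h1, h2, h3⟩ := exists_isMaxInt (N := 𝓜.g * 𝓜.R) _ (hfree _ le_rfl (by omega)) (by omega)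
  refine ⟨(loPt 𝓜.lines x, f, c), ⟨⟨g1, by omega⟩, h1⟩, ⟨by simp only [g4]; omega, h2, ?_⟩, rfl⟩
  by_contra hc
  simp only at hc
  rcases h1.2.2.2.2 with h | h
  · omega
  · exact h (hfree c (by omega) (by omega))

lemma box_unique {i : ι} (hi : i ∈ 𝓜.T ∪ 𝓜.V) {t t' : ℕ × ℕ × ℕ} (ht : 𝓜.IsBox t) (ht' : 𝓜.IsBox t')
    (h1 : 𝓜.InBox t i) (h2 : 𝓜.InBox t' i) (he : t.1 = t'.1) : t = t' := by
  by_contra hne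
  have h3 := boxRect_sep ht ht' hne
  have h4 := slab ht
  have hp := 𝓜.hpos i hi
  simp only [Rect.Sep, boxRect, ← he] at h3
  unfold InBox at h1 h2
  omega

/-- Whether an item is fixed is thus a property of the item alone, so a tall item that meets several
slabs stays in place in each of them. -/
lemma fix_iff {i : ι} {t : ℕ × ℕ × ℕ} (ht : 𝓜.IsBox t) (h : 𝓜.InBox t i) :
    (𝓜.boxData t ht).Fix i ↔ 𝓜.Crosses i := by
  have h1 := slab ht
  unfold InBox at h
  change (𝓜.X i < t.1 ∨ hiPt 𝓜.lines t.1 < 𝓜.X i + 𝓜.w i) ↔ _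
  constructor
  · rintro (h2 | h2)
    · exact ⟨_, ht.1.1, h2, h.1.1⟩
    · exact ⟨_, h1.2.1, h.1.2, h2⟩
  · rintro ⟨a, ha, h2, h3⟩
    have := h1.2.2.2 a ha
    omega

end MainData

attribute [instance] BoxPacking.τfin BoxPacking.κfin

/-- A rearrangement of the tall and vertical items around the obstacles: rectangles `tb` for the
tall items, which are placed at `P`, runs `vr` for the vertical items, and columns `rm` whose
contents are left over. -/
structure MainPacking {ι : Type} [DecidableEq ι] (𝓜 : MainData ι) (φ : ℝ) where
  P : ι → ℕ × ℕ
  τ : Type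
  τfin : Fintype τ
  tb : τ → Rect
  κ : Type
  κfin : Fintype κ
  vr : κ → VRun ι
  rm : Type
  rmfin : Fintype rm
  rct : rm → Finset ι
  hcard : Fintype.card τ + Fintype.card κ ≤
    𝓜.lines.card * ((𝓜.R + 1) * (48 * (2 * 𝓜.R + 4) * (2 * 𝓜.R + 3)) + 2)
  tb_inside : ∀ b, (tb b).Inside ⟨0, 0, 𝓜.W, 𝓜.g * 𝓜.R⟩
  vr_inside : ∀ k, (vr k).rect.Inside ⟨0, 0, 𝓜.W, 𝓜.g * 𝓜.R⟩
  tb_sep : ∀ b b', b ≠ b' → (tb b).Sep (tb b')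
  vr_sep : ∀ k k', k ≠ k' → (vr k).rect.Sep (vr k').rect
  tb_vr : ∀ b k, (tb b).Sep (vr k).rect
  tb_obs : ∀ b, ∀ O ∈ 𝓜.obs, (tb b).Sep O
  vr_obs : ∀ k, ∀ O ∈ 𝓜.obs, (vr k).rect.Sep O
  tb_width : ∀ b, (tb b).w ≤ 𝓜.D ∨ ∃ i ∈ 𝓜.T, tb b = ⟨(P i).1, (P i).2, 𝓜.w i, 𝓜.h i⟩
  vr_width : ∀ k, (vr k).rect.w ≤ 𝓜.D
  tall_inside : ∀ i ∈ 𝓜.T,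
    ∃ b, Rect.Inside ⟨(P i).1, (P i).2, 𝓜.w i, 𝓜.h i⟩ (tb b) ∧ (tb b).h = 𝓜.h i
  tall_sep : ∀ i ∈ 𝓜.T, ∀ j ∈ 𝓜.T, i ≠ j →
    Rect.Sep ⟨(P i).1, (P i).2, 𝓜.w i, 𝓜.h i⟩ ⟨(P j).1, (P j).2, 𝓜.w j, 𝓜.h j⟩
  tb_area : ∑ b, (tb b).w * (tb b).h ≤ ∑ i ∈ 𝓜.T, 𝓜.w i * 𝓜.h i
  valid : ∀ k, (vr k).Valid 𝓜.h 𝓜.V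
  rm_card : (Fintype.card rm : ℝ) ≤ (1 - φ) * 𝓜.W
  rct_le : ∀ z, rct z ⊆ 𝓜.V ∧ ∑ i ∈ rct z, 𝓜.h i ≤ 𝓜.B
  count_eq : ∀ i ∈ 𝓜.V, ∑ k, (vr k).count i + (univ.filter fun z => i ∈ rct z).card = 𝓜.w i

namespace MainData

variable {ι : Type} [DecidableEq ι] {𝓜 : MainData ι}

noncomputable instance : DecidablePred 𝓜.IsBox := Classical.decPred _

noncomputable instance : DecidablePred 𝓜.Crosses := Classical.decPred _

/-- All boxes. -/
noncomputable def boxes (𝓜 : MainData ι) : Finset (ℕ × ℕ × ℕ) :=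
  (𝓜.lines ×ˢ (range (𝓜.g * 𝓜.R + 1) ×ˢ range (𝓜.g * 𝓜.R + 1))).filter 𝓜.IsBox

lemma mem_boxes {t : ℕ × ℕ × ℕ} : t ∈ 𝓜.boxes ↔ 𝓜.IsBox t := by
  rw [boxes, mem_filter, and_iff_right_iff_imp]
  intro h
  have := h.2.1; have := h.2.2.1
  simp only [mem_product, mem_range]
  exact ⟨h.1.1, by omega, by omega⟩

/-- A box is determined by its line and its floor, and the floor is one of the `R + 1` multiples of
`g` up to `g * R`. -/
lemma card_boxes_le (𝓜 : MainData ι) : 𝓜.boxes.card ≤ 𝓜.lines.card * (𝓜.R + 1) := by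
  classical
  have : 𝓜.boxes.card ≤ (𝓜.lines ×ˢ (range (𝓜.R + 1)).image (𝓜.g * ·)).card := by
    refine card_le_card_of_injOn (fun t => (t.1, t.2.1)) (fun t ht => ?_) fun t ht t' ht' he => ?_
    · have ht := mem_boxes.1 ht
      refine mem_coe.2 (mem_product.2 ⟨ht.1.1, ?_⟩)
      obtain ⟨k, hk⟩ := (isBox_dvd ht).1
      refine mem_image.2 ⟨k, ?_, hk.symm⟩
      have h1 : 𝓜.g * k ≤ 𝓜.g * 𝓜.R := by
        rw [← hk]; exact ht.2.1.le.trans ht.2.2.1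
      have := Nat.le_of_mul_le_mul_left h1 𝓜.hg
      rw [mem_range]; omega
    · have ht := mem_boxes.1 ht
      have ht' := mem_boxes.1 ht'
      simp only [Prod.mk.injEq] at he
      have h1 := ht'.2
      rw [← he.1] at h1
      have := ht.2.1; have := ht'.2.1
      have := ht.2.unique h1 (x := t.2.1) (by omega) (by omega)
      exact Prod.ext he.1 (Prod.ext this.1 this.2)
  refine this.trans ?_
  rw [card_product]
  refine Nat.mul_le_mul_left _ (card_image_le.trans ?_)
  rw [card_range]

lemma sum_slab_le (𝓜 : MainData ι) :
    ∑ a ∈ 𝓜.lines.filter (· < 𝓜.W), (hiPt 𝓜.lines a - a) ≤ 𝓜.W := by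
  have h := sum_width_le (𝓜.lines.filter (· < 𝓜.W)) id (fun a => hiPt 𝓜.lines a - a) 0 𝓜.W
    (fun a ha => by
      obtain ⟨h1, h2⟩ := mem_filter.1 ha
      have := hiPt_le 𝓜.line_W h2
      have := lt_hiPt 𝓜.line_W h2
      simp only [id]; omega)
    (fun a ha b hb hne => by
      obtain ⟨h1, h2⟩ := mem_filter.1 ha
      obtain ⟨h3, h4⟩ := mem_filter.1 hb
      have := lt_hiPt 𝓜.line_W h2
      have := lt_hiPt 𝓜.line_W h4
      simp only [id]
      rcases lt_or_gt_of_ne hne with h | h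
      · have := hiPt_le h3 h; omega
      · have := hiPt_le h1 h; omega)
  simpa using h

/-- The boxes are rearranged independently. Tall items that cross a line stay where they are and
become rectangles of their own; every other tall item belongs to exactly one box. -/
theorem nonempty_mainPacking (𝓜 : MainData ι) (φ : ℝ) (hφ0 : 0 ≤ φ) (hφ1 : φ ≤ 1)
    (hφ : φ * ((𝓜.g * 𝓜.R : ℕ) + 𝓜.B) ≤ (1 - φ) * 𝓜.σ) : Nonempty (MainPacking 𝓜 φ) := by
  classical
  have hbox : ∀ t : {t // t ∈ 𝓜.boxes}, 𝓜.IsBox t.1 := fun t => mem_boxes.1 t.2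
  have hne : ∀ t : {t // t ∈ 𝓜.boxes}, Nonempty (BoxPacking (𝓜.boxData t.1 (hbox t)) φ) := by
    intro t
    refine BoxData.nonempty_boxPacking _ φ (le_trans ?_ hφ)
    have h1 : ((t.1.2.2 - t.1.2.1 : ℕ) : ℝ) ≤ (𝓜.g * 𝓜.R : ℕ) := by
      exact_mod_cast (Nat.sub_le _ _).trans (hbox t).2.2.1
    change φ * (((t.1.2.2 - t.1.2.1 : ℕ) : ℝ) + 𝓜.B) ≤ _
    gcongr
  let bp : ∀ t : {t // t ∈ 𝓜.boxes}, BoxPacking (𝓜.boxData t.1 (hbox t)) φ :=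
    fun t => Classical.choice (hne t)
  let it : ι → Rect := fun i => ⟨𝓜.X i, 𝓜.Y i, 𝓜.w i, 𝓜.h i⟩
  let Fx : Finset ι := 𝓜.T.filter 𝓜.Crosses
  have RI : ∀ R : Rect, R.Inside R := fun R => ⟨le_rfl, le_rfl, le_rfl, le_rfl⟩
  have tbr : ∀ t b, ((bp t).tb b).Inside (𝓜.boxRect t.1) := fun t b => (bp t).tb_inside b
  have vrr : ∀ t k, ((bp t).vr k).rect.Inside (𝓜.boxRect t.1) := fun t k => (bp t).vr_inside k
  have brin : ∀ t : {t // t ∈ 𝓜.boxes}, (𝓜.boxRect t.1).Inside ⟨0, 0, 𝓜.W, 𝓜.g * 𝓜.R⟩ := by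
    intro t
    have h1 := slab (hbox t)
    have h2 := (hbox t).2.1
    have h3 := (hbox t).2.2.1
    simp only [Rect.Inside, boxRect]
    omega
  have brsep : ∀ t t' : {t // t ∈ 𝓜.boxes}, t ≠ t' → (𝓜.boxRect t.1).Sep (𝓜.boxRect t'.1) :=
    fun t t' hne => boxRect_sep (hbox t) (hbox t') fun h => hne (Subtype.ext h)
  -- an item that is not in a box is separated from it
  have hout : ∀ i ∈ 𝓜.T ∪ 𝓜.V, ∀ t : {t // t ∈ 𝓜.boxes}, ¬ 𝓜.InBox t.1 i →
      (it i).Sep (𝓜.boxRect t.1) := by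
    intro i hi t hit
    have h1 := slab (hbox t)
    have hp := 𝓜.hpos i hi
    have h2 := (hbox t).2.1
    by_cases hm : t.1.1 < 𝓜.X i + 𝓜.w i ∧ 𝓜.X i < hiPt 𝓜.lines t.1.1
    swap
    · simp only [Rect.Sep, it, boxRect]; omega
    obtain ⟨t', h3, h4, h5⟩ := exists_inBox hi (x := max (𝓜.X i) t.1.1) (by omega) (by omega)
    have h6 : loPt 𝓜.lines (max (𝓜.X i) t.1.1) = t.1.1 := by
      refine loPt_eq (hbox t).1.1 (by omega) fun p hp hpx => ?_
      have := h1.2.2.2 p hp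
      omega
    have hne : t'.1 = t.1.1 := h5.trans h6
    have hne' : t' ≠ t.1 := fun h => hit (h ▸ h4)
    have h7 := boxRect_sep h3 (hbox t) hne'
    have h8 := h4.2
    simp only [Rect.Sep, boxRect, hne] at h7
    simp only [Rect.Sep, boxRect, it]
    omega
  have hfix_sep : ∀ i ∈ Fx, ∀ t b, (it i).Sep ((bp t).tb b) := by
    intro i hi t b
    obtain ⟨hi, hc⟩ := mem_filter.1 hi
    by_cases hit : 𝓜.InBox t.1 i
    · exact (bp t).fix_tb i (mem_filter.2 ⟨hi, hit⟩) ((fix_iff (hbox t) hit).2 hc) b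
    · exact (hout i (mem_union_left _ hi) t hit).mono (RI _) (tbr t b)
  have hfix_sep' : ∀ i ∈ Fx, ∀ t k, (it i).Sep ((bp t).vr k).rect := by
    intro i hi t k
    obtain ⟨hi, hc⟩ := mem_filter.1 hi
    by_cases hit : 𝓜.InBox t.1 i
    · exact (bp t).fix_vr i (mem_filter.2 ⟨hi, hit⟩) ((fix_iff (hbox t) hit).2 hc) k
    · exact (hout i (mem_union_left _ hi) t hit).mono (RI _) (vrr t k)
  -- the box of an item
  have hbx : ∀ i, i ∈ 𝓜.T → ∃ t : {t // t ∈ 𝓜.boxes}, 𝓜.InBox t.1 i := by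
    intro i hi
    have hp := 𝓜.hpos i (mem_union_left _ hi)
    obtain ⟨t, h1, h2, -⟩ := exists_inBox (mem_union_left _ hi) le_rfl (by omega : 𝓜.X i < 𝓜.X i + 𝓜.w i)
    exact ⟨⟨t, mem_boxes.2 h1⟩, h2⟩
  choose bx hbx using fun (i : {i // i ∈ 𝓜.T}) => hbx i.1 i.2
  let P : ι → ℕ × ℕ := fun i => if hi : i ∈ 𝓜.T then
    (if 𝓜.Crosses i then (𝓜.X i, 𝓜.Y i) else (bp (bx ⟨i, hi⟩)).P i) else 0
  have P1 : ∀ i ∈ 𝓜.T, 𝓜.Crosses i → P i = (𝓜.X i, 𝓜.Y i) := by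
    intro i hi hc; simp [P, hi, hc]
  have P2 : ∀ i (hi : i ∈ 𝓜.T), ¬ 𝓜.Crosses i → P i = (bp (bx ⟨i, hi⟩)).P i := by
    intro i hi hc; simp [P, hi, hc]
  let pr : ι → Rect := fun i => ⟨(P i).1, (P i).2, 𝓜.w i, 𝓜.h i⟩
  have pr1 : ∀ i ∈ 𝓜.T, 𝓜.Crosses i → pr i = it i := by
    intro i hi hc; simp only [pr, P1 i hi hc, it]
  have pr2 : ∀ i (hi : i ∈ 𝓜.T), ¬ 𝓜.Crosses i →
      ∃ b, (pr i).Inside ((bp (bx ⟨i, hi⟩)).tb b) ∧ ((bp (bx ⟨i, hi⟩)).tb b).h = 𝓜.h i := by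
    intro i hi hc
    have := (bp (bx ⟨i, hi⟩)).tall_inside i (mem_filter.2 ⟨hi, hbx ⟨i, hi⟩⟩)
      (fun h => hc ((fix_iff _ (hbx ⟨i, hi⟩)).1 h))
    simp only [pr, P2 i hi hc]
    exact this
  -- Bottom tall items start no higher than top ones. If two boxes of one slab both had columns with
  -- two tall items, the bottom item of the upper box would start above the top item of the lower
  -- one. So each slab has left-over columns from at most one box, and their total number is at most
  -- `1 - φ` times the width of the strip.
  have line_unique : ∀ t t' : {t // t ∈ 𝓜.boxes}, (bp t).rem.Nonempty → (bp t').rem.Nonempty →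
      t.1.1 = t'.1.1 → t = t' := by
    rintro t t' ⟨x, hx⟩ ⟨x', hx'⟩ he
    by_contra hne
    obtain ⟨-, i, hi, j, hj, h1, h2, h3, h4⟩ := (bp t).rem_mem x hx
    obtain ⟨-, i', hi', j', hj', h1', h2', h3', h4'⟩ := (bp t').rem_mem x' hx'
    obtain ⟨hiT, hib⟩ := mem_filter.1 hi
    obtain ⟨hjT, hjb⟩ := mem_filter.1 hj
    obtain ⟨hiT', hib'⟩ := mem_filter.1 hi'
    obtain ⟨hjT', hjb'⟩ := mem_filter.1 hj'
    have e1 := brsep t t' hne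
    have e2 := slab (hbox t)
    have o1 := 𝓜.hord i hiT j' hjT' h1 h2'
    have o2 := 𝓜.hord i' hiT' j hjT h1' h2
    have p1 := 𝓜.hpos j (mem_union_left _ hjT)
    have p2 := 𝓜.hpos j' (mem_union_left _ hjT')
    have q1 := hib.2; have q2 := hjb.2; have q3 := hib'.2; have q4 := hjb'.2
    simp only [Rect.Sep, boxRect, ← he] at e1
    omega
  let rm := Σ t : {t // t ∈ 𝓜.boxes}, {x // x ∈ (bp t).rem}
  refine ⟨⟨P, {i // i ∈ Fx} ⊕ Σ t : {t // t ∈ 𝓜.boxes}, (bp t).τ, inferInstance,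
    Sum.elim (fun i => it i.1) (fun z => (bp z.1).tb z.2),
    Σ t : {t // t ∈ 𝓜.boxes}, (bp t).κ, inferInstance, fun z => (bp z.1).vr z.2,
    rm, inferInstance, fun z => (bp z.1).rct z.2.1, ?_, ?_, ?_, ?_, ?_, ?_, ?_, ?_, ?_, ?_, ?_, ?_,
    ?_, ?_, ?_, ?_, ?_⟩⟩
  · -- number of pieces
    -- Tall items of the same kind are disjoint horizontally, so a line is crossed by at most one
    -- item of each kind.
    have c1 : Fx.card ≤ 2 * 𝓜.lines.card := by
      choose! a ha using fun i (hi : 𝓜.Crosses i) => hi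
      have : Fx.card ≤ (𝓜.lines ×ˢ (univ : Finset Bool)).card := by
        refine card_le_card_of_injOn (fun i => (a i, 𝓜.top i)) ?_ ?_
        · intro i hi
          have := (ha i (mem_filter.1 (mem_coe.1 hi)).2).1
          simp [this]
        · intro i hi j hj hij
          obtain ⟨hi, hc⟩ := mem_filter.1 (mem_coe.1 hi)
          obtain ⟨hj, hc'⟩ := mem_filter.1 (mem_coe.1 hj)
          simp only [Prod.mk.injEq] at hij
          by_contra hne
          have h1 := 𝓜.hkind i hi j hj hne hij.2
          have h2 := ha i hc
          have h3 := ha j hc'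
          rw [hij.1] at h2
          omega
      rw [card_product, card_univ, Fintype.card_bool] at this
      omega
    rw [Fintype.card_sum, Fintype.card_sigma, Fintype.card_sigma, Fintype.card_coe, add_assoc,
      ← sum_add_distrib]
    have c2 : ∑ t : {t // t ∈ 𝓜.boxes}, (Fintype.card (bp t).τ + Fintype.card (bp t).κ) ≤
        𝓜.boxes.card * (48 * (2 * 𝓜.R + 4) * (2 * 𝓜.R + 3)) := by
      refine (sum_le_card_nsmul _ _ (48 * (2 * 𝓜.R + 4) * (2 * 𝓜.R + 3))
        fun t _ => (bp t).hcard).trans ?_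
      rw [smul_eq_mul, card_univ, Fintype.card_coe]
    have c3 := Nat.mul_le_mul_right (48 * (2 * 𝓜.R + 4) * (2 * 𝓜.R + 3)) 𝓜.card_boxes_le
    calc _ ≤ 2 * 𝓜.lines.card + 𝓜.lines.card * (𝓜.R + 1) * (48 * (2 * 𝓜.R + 4) * (2 * 𝓜.R + 3)) :=
          add_le_add c1 (c2.trans c3)
      _ = _ := by ring
  · rintro (i | ⟨t, b⟩)
    · have := 𝓜.hin i.1 (mem_union_left _ (mem_filter.1 i.2).1)
      simp only [Sum.elim_inl, it, Rect.Inside]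
      omega
    · exact (tbr t b).trans (brin t)
  · rintro ⟨t, k⟩
    exact (vrr t k).trans (brin t)
  · rintro (i | ⟨t, b⟩) (j | ⟨t', b'⟩) hne
    · exact 𝓜.hsep i.1 (mem_union_left _ (mem_filter.1 i.2).1) j.1
        (mem_union_left _ (mem_filter.1 j.2).1) fun h => hne (by rw [Subtype.ext h])
    · exact hfix_sep i.1 i.2 t' b'
    · exact (hfix_sep j.1 j.2 t b).symm
    · by_cases htt : t = t'
      · subst htt
        exact (bp t).tb_sep b b' fun h => hne (by rw [h])
      · exact (brsep t t' htt).mono (tbr t b) (tbr t' b')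
  · rintro ⟨t, k⟩ ⟨t', k'⟩ hne
    by_cases htt : t = t'
    · subst htt
      exact (bp t).vr_sep k k' fun h => hne (by rw [h])
    · exact (brsep t t' htt).mono (vrr t k) (vrr t' k')
  · rintro (i | ⟨t, b⟩) ⟨t', k⟩
    · exact hfix_sep' i.1 i.2 t' k
    · by_cases htt : t = t'
      · subst htt
        exact (bp t).tb_vr b k
      · exact (brsep t t' htt).mono (tbr t b) (vrr t' k)
  · rintro (i | ⟨t, b⟩) O hO
    · exact 𝓜.obs_sep i.1 (mem_union_left _ (mem_filter.1 i.2).1) O hO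
    · exact (boxRect_obs (hbox t) hO).mono (tbr t b) (RI _)
  · rintro ⟨t, k⟩ O hO
    exact (boxRect_obs (hbox t) hO).mono (vrr t k) (RI _)
  · rintro (i | ⟨t, b⟩)
    · have := mem_filter.1 i.2
      exact Or.inr ⟨i.1, this.1, (pr1 i.1 this.1 this.2).symm⟩
    · have h1 := tbr t b
      have h2 := 𝓜.line_gap t.1.1 (hbox t).1.1 (hbox t).1.2
      simp only [Rect.Inside, boxRect] at h1
      left
      simp only [Sum.elim_inr]
      omega
  · rintro ⟨t, k⟩
    have h1 := vrr t k
    have h2 := 𝓜.line_gap t.1.1 (hbox t).1.1 (hbox t).1.2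
    simp only [Rect.Inside, boxRect] at h1
    simp only
    omega
  · intro i hi
    by_cases hc : 𝓜.Crosses i
    · refine ⟨Sum.inl ⟨i, mem_filter.2 ⟨hi, hc⟩⟩, ?_, rfl⟩
      change (pr i).Inside (it i)
      rw [pr1 i hi hc]
      exact RI _
    · obtain ⟨b, h1, h2⟩ := pr2 i hi hc
      exact ⟨Sum.inr ⟨_, b⟩, h1, h2⟩
  · intro i hi j hj hne
    change (pr i).Sep (pr j)
    by_cases hc : 𝓜.Crosses i <;> by_cases hc' : 𝓜.Crosses j
    · rw [pr1 i hi hc, pr1 j hj hc']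
      exact 𝓜.hsep i (mem_union_left _ hi) j (mem_union_left _ hj) hne
    · obtain ⟨b, h1, h2⟩ := pr2 j hj hc'
      rw [pr1 i hi hc]
      exact (hfix_sep i (mem_filter.2 ⟨hi, hc⟩) _ b).mono (RI _) h1
    · obtain ⟨b, h1, h2⟩ := pr2 i hi hc
      rw [pr1 j hj hc']
      exact ((hfix_sep j (mem_filter.2 ⟨hj, hc'⟩) _ b).mono (RI _) h1).symm
    · obtain ⟨b, h1, h2⟩ := pr2 i hi hc
      obtain ⟨b', h1', h2'⟩ := pr2 j hj hc'
      by_cases htt : bx ⟨i, hi⟩ = bx ⟨j, hj⟩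
      · have := (bp (bx ⟨i, hi⟩)).tall_sep i (mem_filter.2 ⟨hi, hbx ⟨i, hi⟩⟩) j
          (mem_filter.2 ⟨hj, htt ▸ hbx ⟨j, hj⟩⟩) (fun h => hc ((fix_iff _ (hbx ⟨i, hi⟩)).1 h))
          (fun h => hc' ((fix_iff _ (htt ▸ hbx ⟨j, hj⟩)).1 h)) hne
        have e : P j = (bp (bx ⟨i, hi⟩)).P j := by rw [P2 j hj hc', htt]
        simp only [pr, P2 i hi hc, e]
        exact this
      · exact (brsep _ _ htt).mono (h1.trans (tbr _ b)) (h1'.trans (tbr _ b'))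
  · -- area
    rw [Fintype.sum_sum_type, Fintype.sum_sigma]
    have a1 : ∑ i : {i // i ∈ Fx}, ((it i.1).w * (it i.1).h) = ∑ i ∈ Fx, 𝓜.w i * 𝓜.h i :=
      sum_coe_sort Fx fun i => 𝓜.w i * 𝓜.h i
    have a2 : ∑ t : {t // t ∈ 𝓜.boxes}, ∑ b, ((bp t).tb b).w * ((bp t).tb b).h ≤
        ∑ t : {t // t ∈ 𝓜.boxes}, ∑ i ∈ (𝓜.T.filter (𝓜.InBox t.1)).filter
          (¬ 𝓜.Crosses ·), 𝓜.w i * 𝓜.h i := by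
      refine sum_le_sum fun t _ => (bp t).tb_area.trans (le_of_eq ?_)
      refine sum_congr ?_ fun _ _ => rfl
      ext i
      rw [mem_filter, mem_filter]
      refine and_congr_right fun hi => not_congr ?_
      exact fix_iff (hbox t) (mem_filter.1 hi).2
    rw [← sum_biUnion] at a2
    · have a3 : ∑ i ∈ 𝓜.T, 𝓜.w i * 𝓜.h i =
          ∑ i ∈ Fx, 𝓜.w i * 𝓜.h i + ∑ i ∈ 𝓜.T.filter (¬ 𝓜.Crosses ·), 𝓜.w i * 𝓜.h i :=
        (sum_filter_add_sum_filter_not _ _ _).symm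
      have a4 := a2.trans (sum_le_sum_of_subset (f := fun i => 𝓜.w i * 𝓜.h i)
        (t := 𝓜.T.filter (¬ 𝓜.Crosses ·)) fun i hi => by
          obtain ⟨t, -, hi⟩ := mem_biUnion.1 hi
          obtain ⟨h1, h2⟩ := mem_filter.1 hi
          exact mem_filter.2 ⟨(mem_filter.1 h1).1, h2⟩)
      simp only [Sum.elim_inl, Sum.elim_inr]
      omega
    · intro t _ t' _ hne
      rw [Function.onFun, Finset.disjoint_left]
      intro i hi hi'
      obtain ⟨h1, h2⟩ := mem_filter.1 hi
      obtain ⟨h1', -⟩ := mem_filter.1 hi'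
      obtain ⟨hT, hb⟩ := mem_filter.1 h1
      obtain ⟨-, hb'⟩ := mem_filter.1 h1'
      refine hne (Subtype.ext (box_unique (mem_union_left _ hT) (hbox t) (hbox t') hb hb' ?_))
      by_contra hll
      have s1 := slab (hbox t)
      have s2 := slab (hbox t')
      have s3 := s1.2.2.2 _ (hbox t').1.1
      have s4 := s2.2.2.2 _ (hbox t).1.1
      have b1 := hb.1
      have b2 := hb'.1
      rcases lt_or_gt_of_ne hll with h | h
      · exact h2 ⟨_, (hbox t').1.1, by omega, by omega⟩
      · exact h2 ⟨_, (hbox t).1.1, by omega, by omega⟩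
  · rintro ⟨t, k⟩ x h1 h2
    obtain ⟨h3, h4⟩ := (bp t).valid k x h1 h2
    exact ⟨fun i hi => (mem_filter.1 (h3 hi)).1, h4⟩
  · -- left over columns
    have h1 : Fintype.card rm = ∑ t : {t // t ∈ 𝓜.boxes}, (bp t).rem.card := by
      simp only [rm, Fintype.card_sigma, Fintype.card_coe]
    have h2 : ∑ t : {t // t ∈ 𝓜.boxes}, ((bp t).rem.card : ℝ) =
        ∑ t : {t // t ∈ 𝓜.boxes} with (bp t).rem.Nonempty, ((bp t).rem.card : ℝ) := by
      rw [sum_filter]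
      refine sum_congr rfl fun t _ => ?_
      split_ifs with h
      · rfl
      · rw [not_nonempty_iff_eq_empty.1 h]; simp
    rw [h1]
    push_cast
    rw [h2]
    have h3 : ∀ t : {t // t ∈ 𝓜.boxes}, ((bp t).rem.card : ℝ) ≤
        (1 - φ) * (hiPt 𝓜.lines t.1.1 - t.1.1 : ℕ) := fun t =>
      (Nat.cast_le.2 (bp t).rem_card).trans (Nat.floor_le (by
        have : (0 : ℝ) ≤ 1 - φ := by linarith
        positivity))
    refine (sum_le_sum fun t _ => h3 t).trans ?_
    rw [← mul_sum]
    have h4 : ∑ t : {t // t ∈ 𝓜.boxes} with (bp t).rem.Nonempty,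
        (hiPt 𝓜.lines t.1.1 - t.1.1) ≤ 𝓜.W := by
      refine le_trans ?_ 𝓜.sum_slab_le
      have : ∑ t : {t // t ∈ 𝓜.boxes} with (bp t).rem.Nonempty, (hiPt 𝓜.lines t.1.1 - t.1.1) =
          ∑ a ∈ (univ.filter fun t : {t // t ∈ 𝓜.boxes} => (bp t).rem.Nonempty).image
            (fun t => t.1.1), (hiPt 𝓜.lines a - a) := by
        rw [sum_image]
        intro t ht t' ht' he
        exact line_unique t t' (mem_filter.1 (mem_coe.1 ht)).2 (mem_filter.1 (mem_coe.1 ht')).2 he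
      rw [this]
      refine sum_le_sum_of_subset fun a ha => ?_
      obtain ⟨t, -, rfl⟩ := mem_image.1 ha
      exact mem_filter.2 (hbox t).1
    have h5 : (∑ t : {t // t ∈ 𝓜.boxes} with (bp t).rem.Nonempty,
        ((hiPt 𝓜.lines t.1.1 - t.1.1 : ℕ) : ℝ)) ≤ 𝓜.W := by exact_mod_cast h4
    exact mul_le_mul_of_nonneg_left h5 (by linarith)
  · rintro ⟨t, x⟩
    obtain ⟨h1, h2⟩ := (bp t).rct_le x.1 x.2
    exact ⟨fun i hi => (mem_filter.1 (h1 hi)).1, h2⟩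
  · intro i hi
    have hiTV := mem_union_right 𝓜.T hi
    rw [Fintype.sum_sigma]
    have e1 : (univ.filter fun z : rm => i ∈ (bp z.1).rct z.2.1).card =
        ∑ t : {t // t ∈ 𝓜.boxes}, ((bp t).rem.filter fun x => i ∈ (bp t).rct x).card := by
      rw [card_filter, Fintype.sum_sigma]
      refine sum_congr rfl fun t _ => ?_
      rw [card_filter, ← sum_coe_sort (bp t).rem]
    have e2 : ∀ t : {t // t ∈ 𝓜.boxes}, ∑ k, ((bp t).vr k).count i +
        ((bp t).rem.filter fun x => i ∈ (bp t).rct x).card =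
        ((Ico (𝓜.X i) (𝓜.X i + 𝓜.w i)).filter fun x =>
          (t.1.1 ≤ x ∧ x < hiPt 𝓜.lines t.1.1) ∧ 𝓜.InBox t.1 i).card := by
      intro t
      by_cases hb : 𝓜.InBox t.1 i
      · rw [(bp t).count_eq i (mem_filter.2 ⟨hi, hb⟩)]
        congr 1
        ext x
        simp only [mem_filter, mem_Ico, hb, and_true]
        change ((t.1.1 ≤ x ∧ x < hiPt 𝓜.lines t.1.1) ∧ 𝓜.X i ≤ x ∧ x < 𝓜.X i + 𝓜.w i) ↔ _
        tauto
      · have z1 : ∀ k, ((bp t).vr k).count i = 0 := by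
          intro k
          refine card_eq_zero.2 (filter_eq_empty_iff.2 fun x hx hc => ?_)
          rw [mem_Ico] at hx
          exact hb (mem_filter.1 (((bp t).valid k x hx.1 hx.2).1 hc)).2
        have z2 : ((bp t).rem.filter fun x => i ∈ (bp t).rct x).card = 0 :=
          card_eq_zero.2 (filter_eq_empty_iff.2 fun x hx hc =>
            hb (mem_filter.1 (((bp t).rct_le x hx).1 hc)).2)
        simp [z1, z2, hb]
    rw [e1, ← sum_add_distrib, sum_congr rfl fun t _ => e2 t]
    simp_rw [card_filter]
    rw [sum_comm]
    -- Each column of the item lies in exactly one slab, and there in exactly one box that contains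
    -- the item.
    have e3 : ∀ x ∈ Ico (𝓜.X i) (𝓜.X i + 𝓜.w i), ∑ t : {t // t ∈ 𝓜.boxes},
        (if (t.1.1 ≤ x ∧ x < hiPt 𝓜.lines t.1.1) ∧ 𝓜.InBox t.1 i then 1 else 0) = 1 := by
      intro x hx
      rw [mem_Ico] at hx
      obtain ⟨t, h1, h2, h3⟩ := exists_inBox hiTV hx.1 hx.2
      have hxW : x < 𝓜.W := by
        have := 𝓜.hin i hiTV
        omega
      have g4 : hiPt 𝓜.lines t.1 = hiPt 𝓜.lines x := by
        rw [h3]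
        exact (grid_congr le_rfl (loPt_le.trans_lt (lt_hiPt 𝓜.line_W hxW)) 𝓜.line_zero
          (Nat.zero_le x) 𝓜.line_W hxW).2
      have g5 := lt_hiPt 𝓜.line_W hxW
      have g6 := loPt_le (P := 𝓜.lines) (x := x)
      rw [sum_eq_single ⟨t, mem_boxes.2 h1⟩]
      · rw [if_pos]
        simp only
        exact ⟨by omega, h2⟩
      · intro t' _ hne
        refine if_neg fun hc => hne (Subtype.ext (box_unique hiTV (hbox t') h1 hc.2 h2 ?_))
        rw [h3]
        refine (loPt_eq (hbox t').1.1 hc.1.1 fun p hp hpx => ?_).symm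
        have := (slab (hbox t')).2.2.2 p hp
        omega
      · intro h; exact absurd (mem_univ _) h
    rw [sum_congr rfl e3]
    simp

end MainData

/-! ### From columns of width one to boxes of exact heights. -/

section VerticalBoxes

variable {ι : Type}

lemma sum_card_fiber_heights (h : ι → ℕ) (Hs : Finset ℕ) (Q : Finset ι) (hQ : ∀ i ∈ Q, h i ∈ Hs) :
    ∑ θ ∈ Hs, (Q.filter fun i => h i = θ).card = Q.card :=
  (card_eq_sum_card_fiberwise hQ).symm

variable [DecidableEq ι]

/-- A run of columns can be replaced by few boxes of exact heights, with little loss. -/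
lemma exists_vertical_boxes (h : ι → ℕ) (V : Finset ι) (Hs : Finset ℕ) (K L : ℕ)
    (hHs : ∀ i ∈ V, h i ∈ Hs) (hK : Hs.card ≤ K) (k : VRun ι) (hk : k.Valid h V)
    (hL : ∀ x, k.rect.x ≤ x → x < k.rect.x + k.rect.w → (k.ct x).card ≤ L) :
    ∃ (β : Type) (_ : Fintype β) (vb : β → Rect), Fintype.card β ≤ (K + 1) * L ∧
      (∀ b, (vb b).Inside k.rect) ∧ (∀ b b', b ≠ b' → (vb b).Sep (vb b')) ∧
      (∀ b, (vb b).h ∈ Hs) ∧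
      (∀ θ ∈ Hs, ∑ b with (vb b).h = θ, (vb b).w ≤ ∑ i ∈ V.filter (fun i => h i = θ), k.count i) ∧
      ∑ i ∈ V, k.count i ≤ ∑ b, (vb b).w + (K + 1) * L := by
  classical
  set J := Ico k.rect.x (k.rect.x + k.rect.w) with hJ
  have hJm : ∀ x ∈ J, k.ct x ⊆ V ∧ ∑ i ∈ k.ct x, h i ≤ k.rect.h ∧ (k.ct x).card ≤ L := by
    intro x hx
    rw [hJ, mem_Ico] at hx
    exact ⟨(hk x hx.1 hx.2).1, (hk x hx.1 hx.2).2, hL x hx.1 hx.2⟩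
  let cn : ℕ → ℕ → ℕ := fun x θ => ((k.ct x).filter fun i => h i = θ).card
  -- A column is the vector of its numbers of items of each height, with an extra coordinate 1 that
  -- records the width. The run is the sum of its columns, so `Hs.card + 1` different columns with
  -- real widths `y` represent it.
  let v : ℕ → Option {θ // θ ∈ Hs} → ℝ := fun x o => match o with
    | none => 1
    | some θ => cn x θ.1
  obtain ⟨S, y, hSJ, hSc, hy, hsum⟩ := exists_sparse_combination J v (fun _ => 1)
    fun _ _ => zero_le_one
  have hSc' : S.card ≤ K + 1 := by
    rw [Fintype.card_option, Fintype.card_coe] at hSc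
    omega
  have hdem : ∀ θ, ∑ i ∈ V.filter (fun i => h i = θ), k.count i = ∑ x ∈ J, cn x θ := by
    intro θ
    simp only [VRun.count, cn, card_filter]
    rw [sum_comm]
    refine sum_congr rfl fun x hx => ?_
    rw [← sum_filter, ← sum_filter]
    refine sum_congr ?_ fun _ _ => rfl
    ext i
    simp only [mem_filter]
    constructor
    · rintro ⟨⟨h1, h2⟩, h3⟩; exact ⟨h3, h2⟩
    · rintro ⟨h1, h2⟩; exact ⟨⟨(hJm x hx).1 h1, h2⟩, h1⟩
  have hnone : ∑ j ∈ S, y j = k.rect.w := by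
    have := hsum none
    simp only [v, mul_one] at this
    rw [this]
    simp [hJ]
  have hsome : ∀ θ ∈ Hs, ∑ j ∈ S, y j * cn j θ = ∑ j ∈ J, (cn j θ : ℝ) := by
    intro θ hθ
    have := hsum (some ⟨θ, hθ⟩)
    simpa only [v, one_mul] using this
  -- Rounding down keeps the total width and loses less than one unit for each chosen column, hence
  -- at most `L` units of item width for each.
  let z : ℕ → ℕ := fun j => ⌊y j⌋₊
  have hz : ∀ j ∈ S, (z j : ℝ) ≤ y j := fun j hj => Nat.floor_le (hy j hj)
  have hz' : ∀ j, y j ≤ z j + 1 := fun j => (Nat.lt_floor_add_one _).le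
  have hzw : ∑ j ∈ S, z j ≤ k.rect.w := by
    have : (∑ j ∈ S, (z j : ℝ)) ≤ k.rect.w := hnone ▸ sum_le_sum hz
    exact_mod_cast this
  obtain ⟨pos, hp1, hp2⟩ := exists_line_positions z S
  choose ypos hyp1 hyp2 using fun j => exists_line_positions h (k.ct j)
  let β := Σ j : {j // j ∈ S}, {i // i ∈ k.ct j.1}
  let vb : β → Rect := fun b =>
    ⟨k.rect.x + pos b.1.1, k.rect.y + ypos b.1.1 b.2.1, z b.1.1, h b.2.1⟩
  have hcapsum : ∀ F : ℕ → ℕ → ℕ, ∑ b : β, F b.1.1 (h b.2.1) =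
      ∑ j ∈ S, ∑ i ∈ k.ct j, F j (h i) := by
    intro F
    rw [Fintype.sum_sigma, ← sum_coe_sort S]
    refine sum_congr rfl fun j _ => ?_
    rw [← sum_coe_sort (k.ct j.1)]
  have hcap : ∀ θ, ∑ b with (vb b).h = θ, (vb b).w = ∑ j ∈ S, z j * cn j θ := by
    intro θ
    rw [sum_filter]
    have := hcapsum fun j t => if t = θ then z j else 0
    simp only [vb]
    rw [this]
    refine sum_congr rfl fun j _ => ?_
    rw [← sum_filter, sum_const, smul_eq_mul, mul_comm]
  refine ⟨β, inferInstance, vb, ?_, ?_, ?_, ?_, ?_, ?_⟩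
  · rw [Fintype.card_sigma]
    refine (sum_le_card_nsmul _ _ L fun j _ => ?_).trans ?_
    · rw [Fintype.card_coe]; exact (hJm _ (hSJ j.2)).2.2
    · rw [card_univ, Fintype.card_coe, smul_eq_mul]
      exact Nat.mul_le_mul_right _ hSc'
  · rintro ⟨j, i⟩
    have h1 := hp1 j.1 j.2
    have h2 := hyp1 j.1 i.1 i.2
    have h3 := (hJm _ (hSJ j.2)).2.1
    simp only [Rect.Inside, vb]
    omega
  · rintro ⟨j, i⟩ ⟨j', i'⟩ hne
    simp only [Rect.Sep, vb]
    by_cases hj : j = j'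
    · subst hj
      have hi : i.1 ≠ i'.1 := fun h => hne (by rw [Subtype.ext h])
      have := hyp2 j.1 i.1 i.2 i'.1 i'.2 hi
      omega
    · have := hp2 j.1 j.2 j'.1 j'.2 fun h => hj (Subtype.ext h)
      omega
  · rintro ⟨j, i⟩
    exact hHs _ ((hJm _ (hSJ j.2)).1 i.2)
  · intro θ hθ
    rw [hcap, hdem]
    have : (∑ j ∈ S, (z j : ℝ) * cn j θ) ≤ ∑ j ∈ J, (cn j θ : ℝ) := by
      rw [← hsome θ hθ]
      exact sum_le_sum fun j hj => mul_le_mul_of_nonneg_right (hz j hj) (Nat.cast_nonneg _)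
    exact_mod_cast this
  · have e1 : ∑ i ∈ V, k.count i = ∑ θ ∈ Hs, ∑ j ∈ J, cn j θ := by
      rw [← sum_fiberwise_of_maps_to hHs]
      exact sum_congr rfl fun θ _ => hdem θ
    have e2 : ∑ b, (vb b).w = ∑ j ∈ S, z j * (k.ct j).card := by
      have := hcapsum fun j _ => z j
      simp only [vb]
      rw [this]
      exact sum_congr rfl fun j _ => by rw [sum_const, smul_eq_mul, mul_comm]
    rw [e1, e2]
    have e3 : ((∑ θ ∈ Hs, ∑ j ∈ J, cn j θ : ℕ) : ℝ) = ∑ j ∈ S, y j * (k.ct j).card := by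
      push_cast
      rw [sum_congr rfl fun θ hθ => (hsome θ hθ).symm, sum_comm]
      refine sum_congr rfl fun j hj => ?_
      rw [← mul_sum]
      congr 1
      have := sum_card_fiber_heights h Hs (k.ct j) fun i hi => hHs i ((hJm j (hSJ hj)).1 hi)
      exact_mod_cast this
    have e4 : ∑ j ∈ S, y j * (k.ct j).card ≤ ∑ j ∈ S, ((z j : ℝ) * (k.ct j).card + L) := by
      refine sum_le_sum fun j hj => ?_
      have h1 := hz' j
      have h2 : ((k.ct j).card : ℝ) ≤ L := by exact_mod_cast (hJm j (hSJ hj)).2.2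
      have h3 : (0 : ℝ) ≤ (k.ct j).card := Nat.cast_nonneg _
      nlinarith
    rw [sum_add_distrib, sum_const, nsmul_eq_mul] at e4
    have e5 : (S.card : ℝ) * L ≤ (K + 1) * L :=
      mul_le_mul_of_nonneg_right (by exact_mod_cast hSc') (Nat.cast_nonneg _)
    have : ((∑ θ ∈ Hs, ∑ j ∈ J, cn j θ : ℕ) : ℝ) ≤
        ((∑ j ∈ S, z j * (k.ct j).card + (K + 1) * L : ℕ) : ℝ) := by
      rw [e3]; push_cast; linarith
    exact_mod_cast this

/-- Boxes for almost all of the vertical items, inside given runs of columns. -/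
theorem exists_vertical_packing (w h : ι → ℕ) (V : Finset ι) (Hs : Finset ℕ) (K L m : ℕ)
    (hHs : ∀ i ∈ V, h i ∈ Hs) (hK : Hs.card ≤ K) (hm : ∀ i ∈ V, w i ≤ m)
    (κ : Type) [Fintype κ] (vr : κ → VRun ι) (hvr : ∀ k, (vr k).Valid h V)
    (hL : ∀ k x, (vr k).rect.x ≤ x → x < (vr k).rect.x + (vr k).rect.w → ((vr k).ct x).card ≤ L)
    (hsep : ∀ k k', k ≠ k' → (vr k).rect.Sep (vr k').rect)
    (hcount : ∀ i ∈ V, ∑ k, (vr k).count i = w i) :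
    ∃ (β : κ → Type) (_ : ∀ k, Fintype (β k)) (vb : ∀ k, β k → Rect) (rest : Finset ι)
      (P : ι → ℕ × ℕ),
      (∀ k, Fintype.card (β k) ≤ (K + 1) * L) ∧
      (∀ k b, (vb k b).Inside (vr k).rect) ∧
      (∀ k b b', b ≠ b' → (vb k b).Sep (vb k b')) ∧
      (∀ k, ∑ b, (vb k b).w * (vb k b).h ≤ ∑ i ∈ V, (vr k).count i * h i) ∧
      rest ⊆ V ∧
      ∑ i ∈ rest, w i ≤ Fintype.card κ * ((K + 1) * L) * (1 + m) ∧
      (∀ i ∈ V \ rest, ∃ k b, Rect.Inside ⟨(P i).1, (P i).2, w i, h i⟩ (vb k b) ∧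
        (vb k b).h = h i) ∧
      (∀ i ∈ V \ rest, ∀ j ∈ V \ rest, i ≠ j →
        Rect.Sep ⟨(P i).1, (P i).2, w i, h i⟩ ⟨(P j).1, (P j).2, w j, h j⟩) := by
  classical
  choose β βfin vb b1 b2 b3 b4 b5 b6 using fun k =>
    exists_vertical_boxes h V Hs K L hHs hK (vr k) (hvr k) (hL k)
  let B := Σ k, β k
  let bx : B → Rect := fun b => vb b.1 b.2
  have bsep : ∀ b b', b ≠ b' → (bx b).Sep (bx b') := by
    rintro ⟨k, b⟩ ⟨k', b'⟩ hne
    by_cases hk : k = k'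
    · subst hk
      exact b3 k b b' fun h => hne (by rw [h])
    · exact (hsep k k' hk).mono (b2 k b) (b2 k' b')
  let Kθ : ℕ → Finset B := fun θ => univ.filter fun b => (bx b).h = θ
  let sθ : ℕ → Finset ι := fun θ => V.filter fun i => h i = θ
  -- Items of height `θ` are filled as whole items into the boxes of exactly this height, taken from
  -- all runs.
  choose rst fill g1 g2 g3 g4 g5 g6 g7 using fun θ => exists_greedy_fill w m (fun b => (bx b).w) (Kθ θ)
    (sθ θ) fun i hi => hm i (mem_filter.1 hi).1
  let fl : B → Finset ι := fun b => fill (bx b).h b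
  choose pos p1 p2 using fun b => exists_line_positions w (fl b)
  let rest := V.filter fun i => i ∈ rst (h i)
  have hKmem : ∀ b, b ∈ Kθ (bx b).h := fun b => mem_filter.2 ⟨mem_univ _, rfl⟩
  have hb : ∀ i, ∃ b : Option B, i ∈ V \ rest → ∃ b', b = some b' ∧ (bx b').h = h i ∧ i ∈ fl b' := by
    intro i
    by_cases hi : i ∈ V \ rest
    · obtain ⟨hiV, hir⟩ := mem_sdiff.1 hi
      have hir' : i ∉ rst (h i) := fun h => hir (mem_filter.2 ⟨hiV, h⟩)
      rcases g3 (h i) i (mem_filter.2 ⟨hiV, rfl⟩) with h1 | ⟨b, hb, hib⟩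
      · exact absurd h1 hir'
      · have e := (mem_filter.1 hb).2
        exact ⟨some b, fun _ => ⟨b, rfl, e, by simp only [fl, e]; exact hib⟩⟩
    · exact ⟨none, fun h => absurd h hi⟩
  choose bo hbo using hb
  let P : ι → ℕ × ℕ := fun i => match bo i with
    | none => 0
    | some b => ((bx b).x + pos b i, (bx b).y)
  have hP : ∀ i ∈ V \ rest, ∃ b, bo i = some b ∧ (bx b).h = h i ∧ i ∈ fl b ∧
      P i = ((bx b).x + pos b i, (bx b).y) := by
    intro i hi
    obtain ⟨b, e1, e2, e3⟩ := hbo i hi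
    exact ⟨b, e1, e2, e3, by simp only [P, e1]⟩
  have hfl : ∀ b, ∑ i ∈ fl b, w i ≤ (bx b).w := fun b => g6 _ b (hKmem b)
  have hin : ∀ b, ∀ i ∈ fl b, (bx b).h = h i →
      Rect.Inside ⟨(bx b).x + pos b i, (bx b).y, w i, h i⟩ (bx b) := by
    intro b i hi he
    have := p1 b i hi
    have := hfl b
    simp only [Rect.Inside]
    omega
  refine ⟨β, βfin, vb, rest, P, b1, b2, b3, ?_, filter_subset _ _, ?_, ?_, ?_⟩
  · intro k
    have e1 : ∑ b, (vb k b).w * (vb k b).h = ∑ θ ∈ Hs, (∑ b with (vb k b).h = θ, (vb k b).w) * θ := by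
      rw [← sum_fiberwise_of_maps_to (g := fun b => (vb k b).h) (t := Hs) fun b _ => b4 k b]
      refine sum_congr rfl fun θ _ => ?_
      rw [sum_mul]
      exact sum_congr rfl fun b hb => by rw [(mem_filter.1 hb).2]
    have e2 : ∑ i ∈ V, (vr k).count i * h i =
        ∑ θ ∈ Hs, (∑ i ∈ V.filter (fun i => h i = θ), (vr k).count i) * θ := by
      rw [← sum_fiberwise_of_maps_to hHs]
      refine sum_congr rfl fun θ _ => ?_
      rw [sum_mul]
      exact sum_congr rfl fun i hi => by rw [(mem_filter.1 hi).2]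
    rw [e1, e2]
    exact sum_le_sum fun θ hθ => Nat.mul_le_mul_right _ (b5 k θ hθ)
  · -- total width of the rest
    have hcapθ : ∀ θ ∈ Hs, ∑ b ∈ Kθ θ, (bx b).w ≤ ∑ i ∈ sθ θ, w i := by
      intro θ hθ
      have e1 : ∑ b ∈ Kθ θ, (bx b).w = ∑ k, ∑ b with (vb k b).h = θ, (vb k b).w := by
        simp only [Kθ, sum_filter]
        rw [Fintype.sum_sigma]
      have e2 : ∑ i ∈ sθ θ, w i = ∑ k, ∑ i ∈ V.filter (fun i => h i = θ), (vr k).count i := by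
        rw [sum_comm]
        exact sum_congr rfl fun i hi => (hcount i (mem_filter.1 hi).1).symm
      rw [e1, e2]
      exact sum_le_sum fun k _ => b5 k θ hθ
    have hrest : ∑ i ∈ rest, w i = ∑ θ ∈ Hs, ∑ i ∈ rst θ, w i := by
      rw [← sum_fiberwise_of_maps_to (s := rest) (g := h) (t := Hs)
        fun i hi => hHs i (mem_filter.1 hi).1]
      refine sum_congr rfl fun θ _ => sum_congr ?_ fun _ _ => rfl
      ext i
      simp only [rest, mem_filter]
      constructor
      · rintro ⟨⟨h1, h2⟩, h3⟩; rwa [h3] at h2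
      · intro hi
        have := mem_filter.1 (g1 θ hi)
        exact ⟨⟨this.1, by rwa [this.2]⟩, this.2⟩
    have hall : ∑ θ ∈ Hs, ∑ i ∈ rst θ, w i + ∑ θ ∈ Hs, ∑ b ∈ Kθ θ, (bx b).w ≤
        ∑ θ ∈ Hs, ∑ i ∈ sθ θ, w i + (∑ θ ∈ Hs, (Kθ θ).card) * m := by
      rw [sum_mul, ← sum_add_distrib, ← sum_add_distrib]
      refine sum_le_sum fun θ hθ => ?_
      have := g7 θ
      have := hcapθ θ hθ
      omega
    have c1 : ∑ θ ∈ Hs, (Kθ θ).card = Fintype.card B := by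
      rw [← card_univ, card_eq_sum_card_fiberwise (f := fun b => (bx b).h) (t := Hs)
        fun b _ => b4 b.1 b.2]
    have c2 : Fintype.card B ≤ Fintype.card κ * ((K + 1) * L) := by
      rw [Fintype.card_sigma]
      refine (sum_le_card_nsmul _ _ _ fun k _ => b1 k).trans ?_
      rw [card_univ, smul_eq_mul]
    have c3 : ∑ θ ∈ Hs, ∑ b ∈ Kθ θ, (bx b).w = ∑ b, (bx b).w :=
      sum_fiberwise_of_maps_to (fun b _ => b4 b.1 b.2) _
    have c4 : ∑ θ ∈ Hs, ∑ i ∈ sθ θ, w i = ∑ i ∈ V, w i := sum_fiberwise_of_maps_to hHs _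
    have c5 : ∑ i ∈ V, w i ≤ ∑ b, (bx b).w + Fintype.card κ * ((K + 1) * L) := by
      have e1 : ∑ i ∈ V, w i = ∑ k, ∑ i ∈ V, (vr k).count i := by
        rw [sum_comm]
        exact sum_congr rfl fun i hi => (hcount i hi).symm
      rw [e1, Fintype.sum_sigma]
      refine (sum_le_sum fun k _ => b6 k).trans ?_
      rw [sum_add_distrib, sum_const, card_univ, smul_eq_mul]
    have c6 := Nat.mul_le_mul_right m c2
    -- The factor `1 + m`: rounding the widths accounts for the 1, and greedy filling leaves up to
    -- `m` of each box unused.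
    rw [hrest, mul_add, mul_one]
    rw [c1, c3, c4] at hall
    omega
  · intro i hi
    obtain ⟨b, -, e2, e3, e4⟩ := hP i hi
    exact ⟨b.1, b.2, by rw [e4]; exact hin b i e3 e2, e2⟩
  · intro i hi j hj hne
    obtain ⟨b, -, e2, e3, e4⟩ := hP i hi
    obtain ⟨b', -, e2', e3', e4'⟩ := hP j hj
    rw [e4, e4']
    by_cases hbb : b = b'
    · subst hbb
      have := p2 b i e3 j e3' hne
      simp only [Rect.Sep]
      omega
    · exact (bsep b b' hbb).mono (hin b i e3 e2) (hin b' j e3' e2')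

end VerticalBoxes

/-! ### Completing reserved rectangles to a partition, with the small items. -/

section Completion

variable {ι : Type} [DecidableEq ι]

/-- Removing a strip of width `m` and one of height `k` costs at most their areas. With truncated
subtraction this stays true for `a < m` or `b < k`, where the strips cover everything. -/
lemma mul_le_sub_mul_sub_add (a b m k A B : ℕ) (ha : a ≤ A) (hb : b ≤ B) :
    a * b ≤ (a - m) * (b - k) + (m * B + k * A) := by
  have h1 : a * b ≤ (a - m) * b + m * B :=
    calc a * b ≤ (a - m + m) * b := Nat.mul_le_mul_right _ (by omega)
      _ = (a - m) * b + m * b := by ring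
      _ ≤ _ := Nat.add_le_add_left (Nat.mul_le_mul_left _ hb) _
  have h2 : (a - m) * b ≤ (a - m) * (b - k) + k * A :=
    calc (a - m) * b ≤ (a - m) * (b - k + k) := Nat.mul_le_mul_left _ (by omega)
      _ = (a - m) * (b - k) + k * (a - m) := by ring
      _ ≤ _ := Nat.add_le_add_left (Nat.mul_le_mul_left _ (by omega)) _
  omega

/-- Small items fill a family of rectangles up to a small waste. -/
lemma exists_fill_rects (w h : ι → ℕ) (m k A B : ℕ) (𝓕 : Finset Rect) (s : Finset ι)
    (hw0 : ∀ i ∈ s, 0 < w i) (hw : ∀ i ∈ s, w i ≤ m) (hh : ∀ i ∈ s, h i ≤ k)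
    (h𝓕 : ∀ F ∈ 𝓕, F.w ≤ A ∧ F.h ≤ B) :
    ∃ t ⊆ s, ∃ (P : ι → ℕ × ℕ) (asg : ι → Rect),
      (∀ i ∈ t, asg i ∈ 𝓕 ∧ Rect.Inside ⟨(P i).1, (P i).2, w i, h i⟩ (asg i)) ∧
      (∀ i ∈ t, ∀ j ∈ t, i ≠ j → asg i = asg j →
        Rect.Sep ⟨(P i).1, (P i).2, w i, h i⟩ ⟨(P j).1, (P j).2, w j, h j⟩) ∧
      (t = s ∨ ∑ F ∈ 𝓕, F.w * F.h ≤ ∑ i ∈ t, w i * h i + 𝓕.card * (m * B + k * A)) := by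
  classical
  induction 𝓕 using Finset.induction_on with
  | empty => exact ⟨∅, by simp, fun _ => 0, fun _ => ⟨0, 0, 0, 0⟩, by simp, by simp, by simp⟩
  | insert F 𝓕 hF ih =>
    obtain ⟨t, hts, P, asg, h1, h2, h3⟩ := ih fun F hF => h𝓕 F (mem_insert_of_mem hF)
    by_cases htse : t = s
    · exact ⟨t, hts, P, asg, fun i hi => ⟨mem_insert_of_mem (h1 i hi).1, (h1 i hi).2⟩, h2,
        Or.inl htse⟩
    replace h3 := h3.resolve_left htse
    have hFA := h𝓕 F (mem_insert_self _ _)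
    have harea := mul_le_sub_mul_sub_add F.w F.h m k A B hFA.1 hFA.2
    -- A rectangle narrower than `m` stays empty, and its whole area is counted as waste.
    by_cases hmF : m ≤ F.w
    · obtain ⟨u, hu, p, ⟨hp1, hp2⟩, hp3⟩ := exists_shelf_packing w h F.w m (s \ t).card (s \ t) F.h k
        le_rfl (fun i hi => hw i (mem_sdiff.1 hi).1) (fun i hi => (hw i (mem_sdiff.1 hi).1).trans hmF)
        (fun i hi => hw0 i (mem_sdiff.1 hi).1) (fun i hi => hh i (mem_sdiff.1 hi).1)
      have hut : ∀ i ∈ u, i ∉ t := fun i hi => (mem_sdiff.1 (hu hi)).2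
      have htu : Disjoint t u := Finset.disjoint_left.2 fun i hi hiu => hut i hiu hi
      refine ⟨t ∪ u, union_subset hts (hu.trans sdiff_subset),
        fun i => if i ∈ t then P i else (F.x + (p i).1, F.y + (p i).2),
        fun i => if i ∈ t then asg i else F, ?_, ?_, ?_⟩
      · intro i hi
        by_cases hit : i ∈ t
        · simp only [hit, if_true]
          exact ⟨mem_insert_of_mem (h1 i hit).1, (h1 i hit).2⟩
        · have hiu := (mem_union.1 hi).resolve_left hit
          simp only [hit, if_false]
          refine ⟨mem_insert_self _ _, ?_⟩
          have := hp1 i hiu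
          unfold Rect.Inside
          simp only
          omega
      · intro i hi j hj hij he
        by_cases hit : i ∈ t <;> by_cases hjt : j ∈ t <;> simp only [hit, hjt, if_true, if_false] at he ⊢
        · exact h2 i hit j hjt hij he
        · exact absurd (he ▸ (h1 i hit).1) hF
        · exact absurd (he ▸ (h1 j hjt).1) hF
        · have := hp2 i ((mem_union.1 hi).resolve_left hit) j ((mem_union.1 hj).resolve_left hjt) hij
          unfold Rect.Sep at *
          simp only at *
          omega
      · rcases hp3 with hp3 | hp3
        · left
          rw [hp3, union_sdiff_of_subset hts]
        · right
          rw [sum_insert hF, sum_union htu, card_insert_of_notMem hF, add_mul, one_mul]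
          omega
    · refine ⟨t, hts, P, asg, fun i hi => ⟨mem_insert_of_mem (h1 i hi).1, (h1 i hi).2⟩, h2,
        Or.inr ?_⟩
      rw [sum_insert hF, card_insert_of_notMem hF, add_mul, one_mul]
      have : F.w - m = 0 := by omega
      rw [this, zero_mul] at harea
      omega

/-- Reserved rectangles extend to a partition whose other boxes hold given small items. -/
theorem exists_completed_partition (W Ht : ℕ) {ρ : Type} [Fintype ρ] (res : ρ → Rect)
    (hin : ∀ r, (res r).Inside ⟨0, 0, W, Ht⟩)
    (hdis : ∀ r r', r ≠ r' → Disjoint (res r).cells (res r').cells)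
    (w h : ι → ℕ) (m k : ℕ) (s : Finset ι)
    (hw0 : ∀ i ∈ s, 0 < w i) (hw : ∀ i ∈ s, w i ≤ m) (hh : ∀ i ∈ s, h i ≤ k)
    (harea : ∑ i ∈ s, w i * h i + ∑ r, (res r).w * (res r).h +
      (3 * Fintype.card ρ + 1) * (m * Ht + k * W) < W * Ht) :
    ∃ (N : ℕ) (box : Fin N → Rect) (e : ρ → Fin N) (P : ι → ℕ × ℕ) (asg : ι → Fin N),
      N ≤ 4 * Fintype.card ρ + 1 ∧ Function.Injective e ∧ (∀ r, box (e r) = res r) ∧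
      Rect.IsPartition ⟨0, 0, W, Ht⟩ box ∧
      (∀ i ∈ s, Rect.Inside ⟨(P i).1, (P i).2, w i, h i⟩ (box (asg i)) ∧ ∀ r, asg i ≠ e r) ∧
      (∀ i ∈ s, ∀ j ∈ s, i ≠ j →
        Disjoint (⟨(P i).1, (P i).2, w i, h i⟩ : Rect).cells
          (⟨(P j).1, (P j).2, w j, h j⟩ : Rect).cells) := by
  classical
  obtain ⟨𝓕, hc, f1, f2, f3, f4⟩ := exists_free_rects (univ.image res) W Ht (by
    intro R hR R' hR' hne
    obtain ⟨r, -, rfl⟩ := mem_image.1 hR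
    obtain ⟨r', -, rfl⟩ := mem_image.1 hR'
    exact hdis r r' fun h => hne (by rw [h]))
  have hc' : 𝓕.card ≤ 3 * Fintype.card ρ + 1 := by
    have : (univ.image res).card ≤ Fintype.card ρ := card_image_le
    omega
  obtain ⟨t, hts, P, asg, g1, g2, g3⟩ := exists_fill_rects w h m k W Ht 𝓕 s hw0 hw hh (by
    intro F hF
    have := f1 F hF
    unfold Rect.Inside at this
    simp only at this
    omega)
  -- Reserved and free rectangles cover the strip. If some small item did not fit, all free
  -- rectangles would be filled up to the waste, against `harea`.
  have hcov : W * Ht ≤ ∑ r, (res r).w * (res r).h + ∑ F ∈ 𝓕, F.w * F.h := by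
    calc W * Ht = (⟨0, 0, W, Ht⟩ : Rect).cells.card := by rw [Rect.card_cells]
      _ ≤ ((univ.biUnion fun r => (res r).cells) ∪ 𝓕.biUnion fun F => F.cells).card := by
        refine card_le_card fun q hq => ?_
        rw [mem_union, mem_biUnion, mem_biUnion]
        rcases f4 q hq with ⟨R, hR, hq⟩ | h
        · obtain ⟨r, -, rfl⟩ := mem_image.1 hR
          exact Or.inl ⟨r, mem_univ _, hq⟩
        · exact Or.inr h
      _ ≤ _ := by
        refine (card_union_le _ _).trans (add_le_add ?_ ?_)
        · refine card_biUnion_le.trans (le_of_eq ?_)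
          simp only [Rect.card_cells]
        · refine card_biUnion_le.trans (le_of_eq ?_)
          simp only [Rect.card_cells]
  have ht : t = s := by
    refine g3.resolve_right fun hle => ?_
    have h1 : ∑ i ∈ t, w i * h i ≤ ∑ i ∈ s, w i * h i := sum_le_sum_of_subset hts
    have h2 : 𝓕.card * (m * Ht + k * W) ≤ (3 * Fintype.card ρ + 1) * (m * Ht + k * W) :=
      Nat.mul_le_mul_right _ hc'
    omega
  subst ht
  let ψ := Fintype.equivFin (ρ ⊕ {F // F ∈ 𝓕})
  let bx : ρ ⊕ {F // F ∈ 𝓕} → Rect := Sum.elim res fun F => F.1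
  have hN : Fintype.card (ρ ⊕ {F // F ∈ 𝓕}) = Fintype.card ρ + 𝓕.card := by
    rw [Fintype.card_sum, Fintype.card_coe]
  have hbx : ∀ b b', b ≠ b' → Disjoint (bx b).cells (bx b').cells := by
    have f3' : ∀ r (F : {F // F ∈ 𝓕}), Disjoint F.1.cells (res r).cells := fun r F =>
      f3 F.1 F.2 _ (mem_image_of_mem _ (mem_univ r))
    rintro (r | F) (r' | F') hne
    · exact hdis r r' fun h => hne (by rw [h])
    · exact (f3' r F').symm
    · exact f3' r' F
    · exact f2 F.1 F.2 F'.1 F'.2 fun h => hne (by rw [Subtype.ext h])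
  have hex : ∀ i, ∃ b : Fin (Fintype.card (ρ ⊕ {F // F ∈ 𝓕})), i ∈ t →
      ∃ F : {F // F ∈ 𝓕}, F.1 = asg i ∧ b = ψ (Sum.inr F) := by
    intro i
    by_cases hi : i ∈ t
    · exact ⟨ψ (Sum.inr ⟨asg i, (g1 i hi).1⟩), fun _ => ⟨⟨asg i, (g1 i hi).1⟩, rfl, rfl⟩⟩
    · by_cases hne : Nonempty (ρ ⊕ {F // F ∈ 𝓕})
      · exact ⟨ψ hne.some, fun h => absurd h hi⟩
      -- Items outside `t` need some box as a default value. If there were no box at all, the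
      -- covering inequality would make `W * Ht` zero, which `harea` excludes.
      · exfalso
        have hρ : IsEmpty ρ := ⟨fun r => hne ⟨Sum.inl r⟩⟩
        have h𝓕 : 𝓕 = ∅ := by
          by_contra h
          obtain ⟨F, hF⟩ := nonempty_iff_ne_empty.2 h
          exact hne ⟨Sum.inr ⟨F, hF⟩⟩
        subst h𝓕
        rw [univ_eq_empty, sum_empty, sum_empty] at hcov
        omega
  choose a ha using hex
  refine ⟨_, fun b => bx (ψ.symm b), fun r => ψ (Sum.inl r), P, a, by omega, ?_, ?_, ⟨?_, ?_, ?_⟩,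
    ?_, ?_⟩
  · exact ψ.injective.comp Sum.inl_injective
  · intro r
    simp [bx]
  · intro b
    rcases hb : ψ.symm b with r | F
    · simpa only [hb, bx, Sum.elim_inl] using hin r
    · simpa only [hb, bx, Sum.elim_inr] using f1 F.1 F.2
  · intro b b' hne
    exact hbx _ _ fun h => hne (ψ.symm.injective h)
  · intro q hq
    rcases f4 q hq with ⟨R, hR, hq⟩ | ⟨F, hF, hq⟩
    · obtain ⟨r, -, rfl⟩ := mem_image.1 hR
      exact ⟨ψ (Sum.inl r), by simpa [bx] using hq⟩
    · exact ⟨ψ (Sum.inr ⟨F, hF⟩), by simpa [bx] using hq⟩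
  · intro i hi
    obtain ⟨F, hF, hb⟩ := ha i hi
    refine ⟨?_, fun r h => ?_⟩
    · rw [hb]
      simp only [Equiv.symm_apply_apply, bx, Sum.elim_inr, hF]
      exact (g1 i hi).2
    · rw [hb] at h
      exact Sum.inr_ne_inl (ψ.injective h)
  · intro i hi j hj hij
    by_cases he : asg i = asg j
    · exact (g2 i hi j hj hij he).disjoint
    · exact disjoint_of_subset_left (g1 i hi).2.cells_subset
        (disjoint_of_subset_right (g1 j hj).2.cells_subset (f2 _ (g1 i hi).1 _ (g1 j hj).1 he))

end Completion

/-! ### Rows of height `g` and strips for horizontal items. -/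

section HorizontalBoxes

variable {ι : Type} [DecidableEq ι]

/-- The vertical interval `(y, y + h)` contains a grid line. -/
def CrossesRow (g y h : ℕ) : Prop := ∃ r, y < g * r ∧ g * r < y + h

lemma sum_width_le_rows {α : Type*} (F : Finset α) (x w : α → ℕ) (row : α → ℕ) (R W : ℕ)
    (hrow : ∀ i ∈ F, row i < R) (hin : ∀ i ∈ F, x i + w i ≤ W)
    (hsep : ∀ i ∈ F, ∀ j ∈ F, i ≠ j → row i = row j → x i + w i ≤ x j ∨ x j + w j ≤ x i) :
    ∑ i ∈ F, w i ≤ R * W := by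
  classical
  have h1 : ∑ r ∈ range R, ∑ i ∈ F with row i = r, w i = ∑ i ∈ F, w i :=
    sum_fiberwise_of_maps_to (fun i hi => mem_range.2 (hrow i hi)) w
  rw [← h1]
  calc ∑ r ∈ range R, ∑ i ∈ F with row i = r, w i ≤ ∑ r ∈ range R, W := by
        refine sum_le_sum fun r _ => ?_
        refine (sum_width_le (F.filter fun i => row i = r) x w 0 W (fun i hi => ?_)
          fun i hi j hj hij => ?_).trans (by omega)
        · exact ⟨Nat.zero_le _, hin i (mem_filter.1 hi).1⟩
        · exact hsep i (mem_filter.1 hi).1 j (mem_filter.1 hj).1 hij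
            ((mem_filter.1 hi).2.trans (mem_filter.1 hj).2.symm)
    _ = R * W := by simp

/-- Choose for each item a grid line in its interior. Items with the same line are disjoint
horizontally, and fewer than `R + 1` lines are available. -/
lemma sum_width_crossing_le (X Y w h : ι → ℕ) (g R W : ℕ) (F : Finset ι)
    (hc : ∀ i ∈ F, CrossesRow g (Y i) (h i)) (hin : ∀ i ∈ F, X i + w i ≤ W ∧ Y i + h i ≤ g * R)
    (hsep : ∀ i ∈ F, ∀ j ∈ F, i ≠ j →
      Rect.Sep ⟨X i, Y i, w i, h i⟩ ⟨X j, Y j, w j, h j⟩) :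
    ∑ i ∈ F, w i ≤ R * W := by
  choose r hr1 hr2 using hc
  refine sum_width_le_rows F X w (fun i => if hi : i ∈ F then r i hi else 0) R W (fun i hi => ?_)
    (fun i hi => (hin i hi).1) fun i hi j hj hij he => ?_
  · simp only [hi, dif_pos]
    exact lt_of_mul_lt_mul_left' ((hr2 i hi).trans_le (hin i hi).2)
  · simp only [hi, hj, dif_pos] at he
    have h1 := hr1 i hi
    have h2 := hr2 i hi
    have h3 := hr1 j hj
    have h4 := hr2 j hj
    rw [he] at h1 h2
    have := hsep i hi j hj hij
    unfold Rect.Sep at this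
    simp only at this
    omega

/-- Maximal horizontal strips of height `g` that avoid the items of `A` and contain an item of
`Hh`. -/
theorem exists_horizontal_boxes (X Y w h : ι → ℕ) (A Hh S : Finset ι) (g R W : ℕ) (hg : 0 < g)
    (hdvd : ∀ i ∈ A, g ∣ Y i ∧ g ∣ h i)
    (hpos : ∀ i ∈ A ∪ (Hh ∪ S), 0 < w i ∧ 0 < h i)
    (hin : ∀ i ∈ Hh ∪ S, X i + w i ≤ W ∧ Y i + h i ≤ g * R)
    (hsep : ∀ i ∈ A, ∀ j ∈ Hh ∪ S, Rect.Sep ⟨X i, Y i, w i, h i⟩ ⟨X j, Y j, w j, h j⟩) :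
    ∃ 𝓞 : Finset Rect,
      (∀ O ∈ 𝓞, O.Inside ⟨0, 0, W, g * R⟩ ∧ 0 < O.w ∧ g ∣ O.y ∧ O.h = g ∧ ∃ i ∈ Hh, w i ≤ O.w) ∧
      (∀ O ∈ 𝓞, ∀ O' ∈ 𝓞, O ≠ O' → O.Sep O') ∧
      (∀ i ∈ A, ∀ O ∈ 𝓞, Rect.Sep ⟨X i, Y i, w i, h i⟩ O) ∧
      ∑ O ∈ 𝓞, O.w ≤ R * W ∧
      (∀ i ∈ Hh, CrossesRow g (Y i) (h i) ∨
        ∃ O ∈ 𝓞, Rect.Inside ⟨X i, Y i, w i, h i⟩ O) ∧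
      (∀ i ∈ S, CrossesRow g (Y i) (h i) ∨
        (∃ O ∈ 𝓞, Rect.Inside ⟨X i, Y i, w i, h i⟩ O) ∨
        ∀ O ∈ 𝓞, Rect.Sep ⟨X i, Y i, w i, h i⟩ O) := by
  classical
  -- Items of `A` are aligned with the grid, so over a given `x` such an item covers the whole row
  -- or none of it. Testing the lower edge of the row is enough.
  let free : ℕ → ℕ → Prop := fun ρ x => ∀ i ∈ A, ¬ ((X i ≤ x ∧ x < X i + w i) ∧
    Y i ≤ g * ρ ∧ g * ρ < Y i + h i)
  let good : Rect → Prop := fun O => O.h = g ∧ (∃ ρ < R, O.y = g * ρ ∧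
    IsMaxInt (free ρ) W O.x (O.x + O.w)) ∧
    ∃ i ∈ Hh, Rect.Inside ⟨X i, Y i, w i, h i⟩ O
  let 𝓞 : Finset Rect := (((range (W + 1) ×ˢ range (W + 1)) ×ˢ range R).image
    fun t => (⟨t.1.1, g * t.2, t.1.2, g⟩ : Rect)).filter good
  have hmem : ∀ O, O ∈ 𝓞 ↔ good O := by
    intro O
    rw [mem_filter, and_iff_right_iff_imp]
    rintro ⟨h1, ⟨ρ, hρ, h2, h3⟩, -⟩
    have h4 := h3.1
    have h5 := h3.2.1
    refine mem_image.2 ⟨((O.x, O.w), ρ), ?_, ?_⟩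
    · simp only [mem_product, mem_range]
      omega
    · ext
      · rfl
      · exact h2.symm
      · rfl
      · exact h1.symm
  have hrow : ∀ ρ, ∀ i ∈ A, ∀ y k : ℕ, g * ρ ≤ y → y + k ≤ g * (ρ + 1) →
      (Y i ≤ g * ρ ∧ g * ρ < Y i + h i) ∨ y + k ≤ Y i ∨ Y i + h i ≤ y := by
    intro ρ i hi y k h1 h2
    obtain ⟨⟨a, ha⟩, ⟨b, hb⟩⟩ := hdvd i hi
    have e : Y i + h i = g * (a + b) := by rw [ha, hb]; ring
    rw [e, ha]
    by_cases h3 : a ≤ ρ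
    · by_cases h4 : ρ < a + b
      · exact Or.inl ⟨Nat.mul_le_mul_left _ h3, Nat.mul_lt_mul_of_pos_left h4 hg⟩
      · exact Or.inr (Or.inr ((Nat.mul_le_mul_left _ (not_lt.1 h4)).trans h1))
    · exact Or.inr (Or.inl (h2.trans (Nat.mul_le_mul_left _ (not_le.1 h3))))
  have hOsep : ∀ i ∈ A, ∀ O ∈ 𝓞, Rect.Sep ⟨X i, Y i, w i, h i⟩ O := by
    intro i hi O hO
    obtain ⟨h1, ⟨ρ, hρ, h2, h3⟩, -⟩ := (hmem O).1 hO
    have hp := hpos i (mem_union_left _ hi)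
    unfold Rect.Sep
    simp only
    rcases hrow ρ i hi O.y O.h h2.ge (by rw [h2, h1]; ring_nf; rfl) with h4 | h4 | h4
    · by_contra hc
      push Not at hc
      have h5 := h3.1
      refine h3.2.2.1 (max O.x (X i)) (by omega) (by omega) i hi ⟨by omega, h4⟩
    · omega
    · omega
  have hOO : ∀ O ∈ 𝓞, ∀ O' ∈ 𝓞, O ≠ O' → O.y = O'.y → O.x + O.w ≤ O'.x ∨ O'.x + O'.w ≤ O.x := by
    intro O hO O' hO' hne hy
    obtain ⟨h1, ⟨ρ, hρ, h2, h3⟩, -⟩ := (hmem O).1 hO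
    obtain ⟨h1', ⟨ρ', hρ', h2', h3'⟩, -⟩ := (hmem O').1 hO'
    have : ρ = ρ' := Nat.eq_of_mul_eq_mul_left hg (by rw [← h2, ← h2', hy])
    subst this
    by_contra hc
    push Not at hc
    have h4 := h3.1
    have h5 := h3'.1
    have := h3.unique h3' (x := max O.x O'.x) (by omega) (by omega)
    exact hne (Rect.ext this.1 hy (by omega) (h1.trans h1'.symm))
  have hins : ∀ i ∈ Hh ∪ S, ¬ CrossesRow g (Y i) (h i) → ∃ ρ < R, (g * ρ ≤ Y i ∧
      Y i + h i ≤ g * (ρ + 1)) ∧ ∃ a b, IsMaxInt (free ρ) W a b ∧ a ≤ X i ∧ X i + w i ≤ b := by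
    intro i hi hc
    have hp := hpos i (mem_union_right _ hi)
    have hn := hin i hi
    have hd := Nat.div_add_mod (Y i) g
    have hm := Nat.mod_lt (Y i) hg
    have h1 : g * (Y i / g) ≤ Y i := by omega
    have h2 : Y i < g * (Y i / g + 1) := by rw [mul_add, mul_one]; omega
    have h3 : Y i + h i ≤ g * (Y i / g + 1) := by
      by_contra h; exact hc ⟨_, h2, not_le.1 h⟩
    have h4 : Y i / g < R := lt_of_mul_lt_mul_left' (a := g) (by omega)
    -- An aligned item in this row over `x` would cover the full height of the row and therefore
    -- overlap `i`, which does not leave the row.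
    have hf : ∀ x, X i ≤ x → x < X i + w i → free (Y i / g) x := by
      intro x hx hx' j hj ⟨hjx, hjy⟩
      have := hsep j hj i hi
      obtain ⟨⟨a, ha⟩, ⟨b, hb⟩⟩ := hdvd j hj
      have e : Y j + h j = g * (a + b) := by rw [ha, hb]; ring
      rw [e] at hjy
      have h5 : Y i / g + 1 ≤ a + b := lt_of_mul_lt_mul_left' hjy.2
      have h6 : g * (Y i / g + 1) ≤ Y j + h j := by rw [e]; exact Nat.mul_le_mul_left _ h5
      unfold Rect.Sep at this
      simp only at this
      omega
    obtain ⟨a, b, hab, ha, hb⟩ := exists_isMaxInt (free (Y i / g)) (N := W) (x := X i)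
      (hf _ le_rfl (by omega)) (by omega)
    refine ⟨Y i / g, h4, ⟨h1, h3⟩, a, b, hab, ha, ?_⟩
    by_contra hlt
    rcases hab.2.2.2.2 with h5 | h5
    · omega
    · exact h5 (hf b (by omega) (by omega))
  refine ⟨𝓞, fun O hO => ?_, fun O hO O' hO' hne => ?_, hOsep, ?_, fun i hi => ?_, fun i hi => ?_⟩
  · obtain ⟨h1, ⟨ρ, hρ, h2, h3⟩, i, hi, h4⟩ := (hmem O).1 hO
    have h5 := h3.1
    have h6 := h3.2.1
    have h7 : g * (ρ + 1) ≤ g * R := Nat.mul_le_mul_left _ hρ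
    rw [mul_add, mul_one] at h7
    unfold Rect.Inside at h4 ⊢
    simp only at h4 ⊢
    exact ⟨by omega, by omega, ⟨ρ, h2⟩, h1, i, hi, by omega⟩
  · by_cases hy : O.y = O'.y
    · rcases hOO O hO O' hO' hne hy with h | h
      · exact Or.inl h
      · exact Or.inr (Or.inl h)
    · obtain ⟨h1, ⟨ρ, hρ, h2, h3⟩, -⟩ := (hmem O).1 hO
      obtain ⟨h1', ⟨ρ', hρ', h2', h3'⟩, -⟩ := (hmem O').1 hO'
      unfold Rect.Sep
      rw [h1, h1', h2, h2']
      rcases lt_trichotomy ρ ρ' with h | h | h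
      · have : g * (ρ + 1) ≤ g * ρ' := Nat.mul_le_mul_left _ h
        rw [mul_add, mul_one] at this
        omega
      · rw [h2, h2', h] at hy; exact absurd rfl hy
      · have : g * (ρ' + 1) ≤ g * ρ := Nat.mul_le_mul_left _ h
        rw [mul_add, mul_one] at this
        omega
  · refine sum_width_le_rows 𝓞 Rect.x Rect.w (fun O => O.y / g) R W (fun O hO => ?_)
      (fun O hO => ?_) fun O hO O' hO' hne he => ?_
    · obtain ⟨h1, ⟨ρ, hρ, h2, h3⟩, -⟩ := (hmem O).1 hO
      rw [h2, Nat.mul_div_cancel_left _ hg]; exact hρ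
    · obtain ⟨h1, ⟨ρ, hρ, h2, h3⟩, -⟩ := (hmem O).1 hO
      exact h3.2.1
    · obtain ⟨h1, ⟨ρ, hρ, h2, h3⟩, -⟩ := (hmem O).1 hO
      obtain ⟨h1', ⟨ρ', hρ', h2', h3'⟩, -⟩ := (hmem O').1 hO'
      rw [h2, h2', Nat.mul_div_cancel_left _ hg, Nat.mul_div_cancel_left _ hg] at he
      exact hOO O hO O' hO' hne (by rw [h2, h2', he])
  · by_cases hc : CrossesRow g (Y i) (h i)
    · exact Or.inl hc
    · obtain ⟨ρ, hρ, hy, a, b, hab, ha, hb⟩ := hins i (mem_union_left _ hi) hc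
      have hin' : Rect.Inside ⟨X i, Y i, w i, h i⟩ ⟨a, g * ρ, b - a, g⟩ := by
        have := hab.1
        rw [mul_add, mul_one] at hy
        unfold Rect.Inside
        simp only
        omega
      refine Or.inr ⟨_, (hmem _).2 ⟨rfl, ⟨ρ, hρ, rfl, ?_⟩, i, hi, hin'⟩, hin'⟩
      have := hab.1
      simp only
      rwa [Nat.add_sub_cancel' this.le]
  · by_cases hc : CrossesRow g (Y i) (h i)
    · exact Or.inl hc
    right
    obtain ⟨ρ, hρ, hy, a, b, hab, ha, hb⟩ := hins i (mem_union_right _ hi) hc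
    by_contra hcon
    push Not at hcon
    obtain ⟨hno, O, hO, hns⟩ := hcon
    obtain ⟨h1, ⟨ρ', hρ', h2, h3⟩, -⟩ := (hmem O).1 hO
    have hp := hpos i (mem_union_right _ (mem_union_right _ hi))
    unfold Rect.Sep at hns
    simp only at hns
    push Not at hns
    have hρe : ρ' = ρ := by
      rw [mul_add, mul_one] at hy
      rcases lt_trichotomy ρ ρ' with h | h | h
      · have : g * (ρ + 1) ≤ g * ρ' := Nat.mul_le_mul_left _ h
        rw [mul_add, mul_one] at this
        omega
      · exact h.symm
      · have : g * (ρ' + 1) ≤ g * ρ := Nat.mul_le_mul_left _ h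
        rw [mul_add, mul_one] at this
        omega
    subst hρe
    have h5 := h3.1
    have := hab.unique h3 (x := max (X i) O.x) (by omega) (by omega)
    refine hno O hO ?_
    rw [mul_add, mul_one] at hy
    unfold Rect.Inside
    simp only
    omega

end HorizontalBoxes

/-! ### Stretching and aligning to the grid. -/

section Stretch

variable {ι : Type} [DecidableEq ι]

/-- Stretching a packing by the factor `1 + s` aligns the items of `A` to multiples of `g`. -/
lemma exists_stretch (y h : ι → ℕ) (A B : Finset ι) (g R b : ℕ) (hg : 0 < g) (s : ℝ) (hs0 : 0 ≤ s)
    (hs : ∀ i ∈ A, (g : ℝ) ≤ s * h i) (hdvd : ∀ i ∈ A, g ∣ h i)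
    (hin : ∀ i ∈ A ∪ B, y i + h i ≤ b) (hR : (1 + s) * b ≤ g * R) :
    ∃ Y : ι → ℕ, (∀ i ∈ A, g ∣ Y i) ∧ (∀ i ∈ A ∪ B, Y i + h i ≤ g * R) ∧
      (∀ i ∈ A ∪ B, ∀ j ∈ A ∪ B, y i + h i ≤ y j → Y i + h i ≤ Y j) ∧
      (∀ i ∈ A, ∀ j ∈ A, y i ≤ y j → Y i ≤ Y j) ∧
      ∀ i ∈ A, (1 + s) * y i ≤ Y i ∧ (Y i : ℝ) < (1 + s) * y i + g := by
  have hg' : (0 : ℝ) < g := by exact_mod_cast hg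
  -- Items of `A` are rounded up to multiples of `g`, all others down to integers. Below an item
  -- outside `A` rounding up is harmless because the height of an item of `A` is not stretched,
  -- which leaves at least `s * h i ≥ g` above it.
  let Y : ι → ℕ := fun i => if i ∈ A then g * ⌈(1 + s) * y i / g⌉₊ else ⌊(1 + s) * y i⌋₊
  have hYA : ∀ i ∈ A, Y i = g * ⌈(1 + s) * y i / g⌉₊ := fun i hi => if_pos hi
  have hYB : ∀ i, i ∉ A → Y i = ⌊(1 + s) * y i⌋₊ := fun i hi => if_neg hi
  have hy0 : ∀ i, 0 ≤ (1 + s) * y i := fun i => by positivity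
  have hA : ∀ i ∈ A, (1 + s) * y i ≤ Y i ∧ (Y i : ℝ) < (1 + s) * y i + g := by
    intro i hi
    rw [hYA i hi]
    push_cast
    constructor
    · have := Nat.le_ceil ((1 + s) * y i / g)
      rw [div_le_iff₀ hg'] at this
      linarith
    · have := Nat.ceil_lt_add_one (div_nonneg (hy0 i) hg'.le)
      rw [← sub_lt_iff_lt_add, lt_div_iff₀ hg'] at this
      linarith
  have hB : ∀ i, i ∉ A → (Y i : ℝ) ≤ (1 + s) * y i := fun i hi => by
    rw [hYB i hi]
    exact Nat.floor_le (hy0 i)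
  -- Since `h i` is a multiple of `g`, rounding up the bottom and adding the height is the same as
  -- rounding up the sum.
  have key : ∀ i ∈ A, ∀ t : ℝ, (1 + s) * (y i + h i) ≤ t → Y i + h i ≤ g * ⌈t / g⌉₊ := by
    intro i hi t ht
    obtain ⟨c, hc⟩ := hdvd i hi
    have e : (h i : ℝ) = g * c := by exact_mod_cast hc
    have h1 : 0 ≤ s * h i := by positivity
    rw [hYA i hi, hc, ← mul_add, ← Nat.ceil_add_natCast (div_nonneg (hy0 i) hg'.le)]
    refine Nat.mul_le_mul_left _ (Nat.ceil_le_ceil ?_)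
    rw [le_div_iff₀ hg', add_mul, div_mul_cancel₀ _ hg'.ne']
    nlinarith
  refine ⟨Y, fun i hi => ⟨_, hYA i hi⟩, fun i hi => ?_, fun i hi j hj hij => ?_,
    fun i hi j hj hij => ?_, hA⟩
  · have h1 : ((y i : ℝ) + h i) ≤ b := by exact_mod_cast hin i hi
    have h2 : (1 + s) * ((y i : ℝ) + h i) ≤ (1 + s) * b :=
      mul_le_mul_of_nonneg_left h1 (by linarith)
    by_cases hiA : i ∈ A
    · refine (key i hiA (g * R : ℝ) (h2.trans hR)).trans ?_
      rw [mul_div_cancel_left₀ _ hg'.ne', Nat.ceil_natCast]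
    · have h3 := hB i hiA
      have h4 : 0 ≤ s * h i := by positivity
      have h5 : ((Y i + h i : ℕ) : ℝ) ≤ (g * R : ℕ) := by
        push_cast; linarith
      exact_mod_cast h5
  · have h1 : ((y i : ℝ) + h i) ≤ y j := by exact_mod_cast hij
    have h2 : (1 + s) * ((y i : ℝ) + h i) ≤ (1 + s) * y j :=
      mul_le_mul_of_nonneg_left h1 (by linarith)
    have h4 : 0 ≤ s * h i := by positivity
    by_cases hjA : j ∈ A
    · by_cases hiA : i ∈ A
      · rw [hYA j hjA]
        exact key i hiA _ h2
      · have h3 := hB i hiA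
        have h5 := (hA j hjA).1
        have h6 : ((Y i + h i : ℕ) : ℝ) ≤ Y j := by push_cast; linarith
        exact_mod_cast h6
    · rw [hYB j hjA]
      refine Nat.le_floor ?_
      push_cast
      by_cases hiA : i ∈ A
      · have h3 := (hA i hiA).2
        have h5 := hs i hiA
        linarith
      · have h3 := hB i hiA
        linarith
  · rw [hYA i hi, hYA j hj]
    refine Nat.mul_le_mul_left _ (Nat.ceil_le_ceil ?_)
    have : (y i : ℝ) ≤ y j := by exact_mod_cast hij
    gcongr

end Stretch

/-! ### Exact boxes for all tall and almost all vertical items. -/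

section Rounding

/-- Column `x` of a strip whose columns are listed by `ct`, cut into pieces of width `D`. -/
def chunkRun {ι : Type} (ct : ℕ → Finset ι) (c D y B j : ℕ) : VRun ι :=
  ⟨⟨j * D, y, min D (c - j * D), B⟩, ct⟩

lemma sum_count_chunkRun {ι : Type} [DecidableEq ι] (ct : ℕ → Finset ι) (c D y B : ℕ) (hD : 0 < D)
    (i : ι) :
    ∑ j ∈ range (c / D + 1), (chunkRun ct c D y B j).count i =
      ((range c).filter fun x => i ∈ ct x).card := by
  classical
  rw [card_eq_sum_card_fiberwise (f := fun x => x / D) (t := range (c / D + 1))]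
  · refine sum_congr rfl fun j _ => VRun.count_eq_card fun x => ?_
    have h1 := Nat.div_add_mod x D
    have h2 := Nat.mod_lt x hD
    have e := mul_comm D j
    simp only [chunkRun, mem_filter, mem_range]
    constructor
    · rintro ⟨⟨h3, h4⟩, h5⟩
      rw [h5] at h1
      exact ⟨⟨by omega, by omega⟩, h4⟩
    · rintro ⟨⟨h3, h4⟩, h5⟩
      refine ⟨⟨by omega, h5⟩, ?_⟩
      rw [Nat.div_eq_iff hD]
      omega
  · intro x hx
    have := mem_range.1 (mem_filter.1 hx).1
    exact mem_coe.2 (mem_range.2 (Nat.lt_succ_of_le (Nat.div_le_div_right this.le)))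

variable {ι : Type} [DecidableEq ι]

/-- All tall items and almost all vertical items are packed into boxes of exact heights. -/
theorem MainData.exists_rounded_packing (𝓜 : MainData ι) (φ : ℝ) (h0 : 0 ≤ φ) (h1 : φ ≤ 1)
    (hφ : φ * ((𝓜.g * 𝓜.R : ℕ) + 𝓜.B) ≤ (1 - φ) * 𝓜.σ) (hD : 0 < 𝓜.D)
    (Hs : Finset ℕ) (K L m n : ℕ)
    (hHs : ∀ i ∈ 𝓜.V, 𝓜.h i ∈ Hs) (hK : Hs.card ≤ K) (hm : ∀ i ∈ 𝓜.V, 𝓜.w i ≤ m)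
    (hB : 𝓜.B ≤ 𝓜.g * 𝓜.R)
    (hL : ∀ s ⊆ 𝓜.V, ∑ i ∈ s, 𝓜.h i ≤ 𝓜.g * 𝓜.R → s.card ≤ L)
    (hn : 𝓜.lines.card * ((𝓜.R + 1) * (48 * (2 * 𝓜.R + 4) * (2 * 𝓜.R + 3)) + 2) +
      (𝓜.W / 𝓜.D + 1) ≤ n) :
    ∃ (ρ : Type) (_ : Fintype ρ) (res : ρ → Rect) (rest : Finset ι) (P : ι → ℕ × ℕ) (c : ℕ),
      (c : ℝ) ≤ (1 - φ) * 𝓜.W ∧ Fintype.card ρ ≤ n * ((K + 1) * L + 1) ∧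
      (∀ r, (res r).Inside ⟨0, 0, 𝓜.W, 𝓜.g * 𝓜.R⟩ ∨ (res r).Inside ⟨0, 𝓜.g * 𝓜.R, c, 𝓜.B⟩) ∧
      (∀ r r', r ≠ r' → (res r).Sep (res r')) ∧ (∀ r, ∀ O ∈ 𝓜.obs, (res r).Sep O) ∧
      ∑ r, (res r).w * (res r).h ≤ ∑ i ∈ 𝓜.T ∪ 𝓜.V, 𝓜.w i * 𝓜.h i ∧
      rest ⊆ 𝓜.V ∧ ∑ i ∈ rest, 𝓜.w i ≤ n * ((K + 1) * L) * (1 + m) ∧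
      (∀ i ∈ (𝓜.T ∪ 𝓜.V) \ rest, ∃ r, Rect.Inside ⟨(P i).1, (P i).2, 𝓜.w i, 𝓜.h i⟩ (res r) ∧
        (res r).h = 𝓜.h i ∧ ((res r).w ≤ 𝓜.D ∨
          ∃ j ∈ 𝓜.T, res r = ⟨(P j).1, (P j).2, 𝓜.w j, 𝓜.h j⟩)) ∧
      (∀ i ∈ (𝓜.T ∪ 𝓜.V) \ rest, ∀ j ∈ (𝓜.T ∪ 𝓜.V) \ rest, i ≠ j →
        Rect.Sep ⟨(P i).1, (P i).2, 𝓜.w i, 𝓜.h i⟩ ⟨(P j).1, (P j).2, 𝓜.w j, 𝓜.h j⟩) := by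
  classical
  obtain ⟨Q⟩ := 𝓜.nonempty_mainPacking φ h0 h1 hφ
  let := Q.τfin
  let := Q.κfin
  let := Q.rmfin
  set c := Fintype.card Q.rm with hc
  let e : Fin c ≃ Q.rm := (Fintype.equivFin Q.rm).symm
  let ct : ℕ → Finset ι := fun x => if hx : x < c then Q.rct (e ⟨x, hx⟩) else ∅
  have hcW : c ≤ 𝓜.W := by
    have h2 := Q.rm_card
    have h3 : (0 : ℝ) ≤ 𝓜.W := Nat.cast_nonneg _
    have h4 : (c : ℝ) ≤ 𝓜.W := by rw [hc]; nlinarith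
    exact_mod_cast h4
  -- The left-over columns form a layer directly above `g * R`. It is cut into pieces of width `D`,
  -- so that the boxes made from it are narrow enough, and is then treated like the other runs.
  let κ' := Q.κ ⊕ Fin (c / 𝓜.D + 1)
  let vr : κ' → VRun ι := Sum.elim Q.vr fun j => chunkRun ct c 𝓜.D (𝓜.g * 𝓜.R) 𝓜.B j
  have hct : ∀ x, ct x ⊆ 𝓜.V ∧ ∑ i ∈ ct x, 𝓜.h i ≤ 𝓜.B := by
    intro x
    by_cases hx : x < c
    · simp only [ct, hx, dif_pos]
      exact Q.rct_le _
    · simp [ct, hx]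
  have hvalid : ∀ k, (vr k).Valid 𝓜.h 𝓜.V := by
    rintro (k | j)
    · exact Q.valid k
    · intro x _ _
      exact hct x
  have hsep : ∀ k k', k ≠ k' → (vr k).rect.Sep (vr k').rect := by
    rintro (k | j) (k' | j') hne
    · exact Q.vr_sep k k' fun h => hne (by rw [h])
    · have := Q.vr_inside k
      unfold Rect.Inside at this
      simp only at this
      exact Or.inr (Or.inr (Or.inl (by simp only [vr, Sum.elim_inl, Sum.elim_inr, chunkRun]; omega)))
    · have := Q.vr_inside k'
      unfold Rect.Inside at this
      simp only at this
      exact Or.inr (Or.inr (Or.inr (by simp only [vr, Sum.elim_inl, Sum.elim_inr, chunkRun]; omega)))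
    · have hjj : (j : ℕ) ≠ j' := fun h => hne (by rw [Fin.ext h])
      rcases lt_or_gt_of_ne hjj with h | h
      · have := Nat.mul_le_mul_right 𝓜.D (Nat.succ_le_of_lt h)
        rw [Nat.succ_mul] at this
        exact Or.inl (by simp only [vr, Sum.elim_inr, chunkRun]; omega)
      · have := Nat.mul_le_mul_right 𝓜.D (Nat.succ_le_of_lt h)
        rw [Nat.succ_mul] at this
        exact Or.inr (Or.inl (by simp only [vr, Sum.elim_inr, chunkRun]; omega))
  have hchunk : ∀ j : Fin (c / 𝓜.D + 1),
      (chunkRun ct c 𝓜.D (𝓜.g * 𝓜.R) 𝓜.B j).rect.Inside ⟨0, 𝓜.g * 𝓜.R, c, 𝓜.B⟩ := by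
    intro j
    have h2 : (j : ℕ) * 𝓜.D ≤ c :=
      (Nat.mul_le_mul_right _ (Nat.lt_succ_iff.1 j.2)).trans (Nat.div_mul_le_self c 𝓜.D)
    unfold Rect.Inside
    simp only [chunkRun]
    omega
  have hcount : ∀ i ∈ 𝓜.V, ∑ k, (vr k).count i = 𝓜.w i := by
    intro i hi
    rw [Fintype.sum_sum_type, ← Q.count_eq i hi]
    refine congrArg₂ _ rfl ?_
    have h2 := Fin.sum_univ_eq_sum_range
      (fun j => (chunkRun ct c 𝓜.D (𝓜.g * 𝓜.R) 𝓜.B j).count i) (c / 𝓜.D + 1)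
    refine (h2.trans (sum_count_chunkRun ct c 𝓜.D (𝓜.g * 𝓜.R) 𝓜.B hD i)).trans ?_
    refine card_bij' (fun x hx => e ⟨x, mem_range.1 (mem_filter.1 hx).1⟩) (fun z _ => (e.symm z).1)
      (fun x hx => ?_) (fun z hz => ?_) (fun x hx => ?_) fun z hz => ?_
    · have hxc := mem_range.1 (mem_filter.1 hx).1
      have := (mem_filter.1 hx).2
      simp only [ct, hxc, dif_pos] at this
      exact mem_filter.2 ⟨mem_univ _, this⟩
    · refine mem_filter.2 ⟨mem_range.2 (e.symm z).2, ?_⟩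
      simp only [ct, (e.symm z).2, dif_pos, Fin.eta, Equiv.apply_symm_apply]
      exact (mem_filter.1 hz).2
    · simp
    · simp
  have hLv : ∀ k x, (vr k).rect.x ≤ x → x < (vr k).rect.x + (vr k).rect.w →
      ((vr k).ct x).card ≤ L := by
    intro k x hx hx'
    obtain ⟨h2, h3⟩ := hvalid k x hx hx'
    refine hL _ h2 (h3.trans ?_)
    rcases k with k | j
    · have := Q.vr_inside k
      unfold Rect.Inside at this
      simp only at this
      simp only [vr, Sum.elim_inl]
      omega
    · exact hB
  obtain ⟨β, βfin, vb, rest, P, b1, b2, b3, b4, b5, b6, b7, b8⟩ := exists_vertical_packing 𝓜.w 𝓜.h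
    𝓜.V Hs K L m hHs hK hm κ' vr hvalid hLv hsep hcount
  let := βfin
  have hκ' : Fintype.card Q.τ + Fintype.card κ' ≤ n := by
    have h2 := Q.hcard
    have h3 : c / 𝓜.D ≤ 𝓜.W / 𝓜.D := Nat.div_le_div_right hcW
    simp only [κ', Fintype.card_sum, Fintype.card_fin]
    omega
  let res : Q.τ ⊕ (Σ k, β k) → Rect := Sum.elim Q.tb fun b => vb b.1 b.2
  let P' : ι → ℕ × ℕ := fun i => if i ∈ 𝓜.T then Q.P i else P i
  have hTV := Finset.disjoint_left.1 𝓜.hTV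
  have hP1 : ∀ i ∈ 𝓜.T, P' i = Q.P i := fun i hi => if_pos hi
  have hP2 : ∀ i ∈ 𝓜.V, P' i = P i := fun i hi => if_neg fun h => hTV h hi
  have hτκ : ∀ t k, (Q.tb t).Sep (vr k).rect := by
    rintro t (k | j)
    · exact Q.tb_vr t k
    · have := Q.tb_inside t
      unfold Rect.Inside at this
      simp only at this
      exact Or.inr (Or.inr (Or.inl (by simp only [vr, Sum.elim_inr, chunkRun]; omega)))
  have hressep : ∀ r r', r ≠ r' → (res r).Sep (res r') := by
    rintro (t | ⟨k, b⟩) (t' | ⟨k', b'⟩) hne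
    · exact Q.tb_sep t t' fun h => hne (by rw [h])
    · exact (hτκ t k').mono ⟨le_rfl, le_rfl, le_rfl, le_rfl⟩ (b2 k' b')
    · exact ((hτκ t' k).mono ⟨le_rfl, le_rfl, le_rfl, le_rfl⟩ (b2 k b)).symm
    · by_cases hk : k = k'
      · subst hk
        exact b3 k b b' fun h => hne (by rw [h])
      · exact (hsep k k' hk).mono (b2 k b) (b2 k' b')
  have hTb : ∀ i ∈ 𝓜.T, ∃ t, Rect.Inside ⟨(P' i).1, (P' i).2, 𝓜.w i, 𝓜.h i⟩ (Q.tb t) ∧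
      (Q.tb t).h = 𝓜.h i := fun i hi => by
    rw [hP1 i hi]; exact Q.tall_inside i hi
  have hVb : ∀ i ∈ 𝓜.V \ rest, ∃ k b, Rect.Inside ⟨(P' i).1, (P' i).2, 𝓜.w i, 𝓜.h i⟩ (vb k b) ∧
      (vb k b).h = 𝓜.h i := fun i hi => by
    rw [hP2 i (mem_sdiff.1 hi).1]; exact b7 i hi
  refine ⟨Q.τ ⊕ (Σ k, β k), inferInstance, res, rest, P', c, Q.rm_card, ?_, ?_, hressep, ?_, ?_, b5,
    ?_, ?_, ?_⟩
  · rw [Fintype.card_sum, Fintype.card_sigma]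
    have h2 : ∑ k, Fintype.card (β k) ≤ Fintype.card κ' * ((K + 1) * L) :=
      (sum_le_sum fun k _ => b1 k).trans (by simp)
    have h3 : (Fintype.card Q.τ + Fintype.card κ') * ((K + 1) * L + 1) ≤ n * ((K + 1) * L + 1) :=
      Nat.mul_le_mul_right _ hκ'
    refine le_trans ?_ h3
    nlinarith [Nat.zero_le (Fintype.card Q.τ * ((K + 1) * L)), Nat.zero_le (Fintype.card κ')]
  · rintro (t | ⟨k | j, b⟩)
    · exact Or.inl (Q.tb_inside t)
    · exact Or.inl ((b2 (Sum.inl k) b).trans (Q.vr_inside k))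
    · exact Or.inr ((b2 (Sum.inr j) b).trans (hchunk j))
  · rintro (t | ⟨k | j, b⟩) O hO
    · exact Q.tb_obs t O hO
    · exact (Q.vr_obs k O hO).mono (b2 (Sum.inl k) b) ⟨le_rfl, le_rfl, le_rfl, le_rfl⟩
    · have h2 := 𝓜.obs_in O hO
      have h3 := (b2 (Sum.inr j) b).trans (hchunk j)
      unfold Rect.Inside at h2 h3
      simp only at h2 h3
      exact Or.inr (Or.inr (Or.inr (by simp only [res, Sum.elim_inr]; omega)))
  · rw [Fintype.sum_sum_type, Fintype.sum_sigma, sum_union 𝓜.hTV]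
    refine add_le_add Q.tb_area ?_
    calc ∑ k, ∑ b, (vb k b).w * (vb k b).h ≤ ∑ k, ∑ i ∈ 𝓜.V, (vr k).count i * 𝓜.h i :=
          sum_le_sum fun k _ => b4 k
      _ = ∑ i ∈ 𝓜.V, 𝓜.w i * 𝓜.h i := by
          rw [sum_comm]
          refine sum_congr rfl fun i hi => ?_
          rw [← sum_mul, hcount i hi]
  · exact b6.trans (Nat.mul_le_mul_right _ (Nat.mul_le_mul_right _ (by omega)))
  · intro i hi
    obtain ⟨hi, hir⟩ := mem_sdiff.1 hi
    rcases mem_union.1 hi with hiT | hiV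
    · obtain ⟨t, h2, h3⟩ := hTb i hiT
      refine ⟨Sum.inl t, h2, h3, ?_⟩
      rcases Q.tb_width t with h4 | ⟨j, hj, h4⟩
      · exact Or.inl h4
      · exact Or.inr ⟨j, hj, by rw [hP1 j hj]; exact h4⟩
    · obtain ⟨k, b, h2, h3⟩ := hVb i (mem_sdiff.2 ⟨hiV, hir⟩)
      refine ⟨Sum.inr ⟨k, b⟩, h2, h3, Or.inl ?_⟩
      have h4 := b2 k b
      have h5 : (vr k).rect.w ≤ 𝓜.D := by
        rcases k with k | j
        · exact Q.vr_width k
        · exact min_le_left _ _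
      unfold Rect.Inside at h4
      simp only [res, Sum.elim_inr]
      omega
  · intro i hi j hj hij
    obtain ⟨hi, hir⟩ := mem_sdiff.1 hi
    obtain ⟨hj, hjr⟩ := mem_sdiff.1 hj
    have hcross : ∀ i ∈ 𝓜.T, ∀ j ∈ 𝓜.V \ rest,
        Rect.Sep ⟨(P' i).1, (P' i).2, 𝓜.w i, 𝓜.h i⟩ ⟨(P' j).1, (P' j).2, 𝓜.w j, 𝓜.h j⟩ := by
      intro i hi j hj
      obtain ⟨t, h2, -⟩ := hTb i hi
      obtain ⟨k, b, h3, -⟩ := hVb j hj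
      exact (hressep (Sum.inl t) (Sum.inr ⟨k, b⟩) (by simp)).mono h2 h3
    rcases mem_union.1 hi with hiT | hiV <;> rcases mem_union.1 hj with hjT | hjV
    · rw [hP1 i hiT, hP1 j hjT]; exact Q.tall_sep i hiT j hjT hij
    · exact hcross i hiT j (mem_sdiff.2 ⟨hjV, hjr⟩)
    · exact (hcross j hjT i (mem_sdiff.2 ⟨hiV, hir⟩)).symm
    · rw [hP2 i hiV, hP2 j hjV]
      exact b8 i (mem_sdiff.2 ⟨hiV, hir⟩) j (mem_sdiff.2 ⟨hjV, hjr⟩) hij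

end Rounding

/-! ### Instances with parameters, and the stretched packing. -/

lemma sum_area_le {α : Type*} (F : Finset α) (r : α → Rect) (A : Rect)
    (hin : ∀ i ∈ F, (r i).Inside A)
    (hdis : ∀ i ∈ F, ∀ j ∈ F, i ≠ j → Disjoint (r i).cells (r j).cells) :
    ∑ i ∈ F, (r i).w * (r i).h ≤ A.w * A.h := by
  classical
  rw [← Rect.card_cells A]
  calc ∑ i ∈ F, (r i).w * (r i).h = (F.biUnion fun i => (r i).cells).card := by
        rw [card_biUnion fun i hi j hj hij => hdis i hi j hj hij]
        simp only [Rect.card_cells]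
    _ ≤ _ := card_le_card (biUnion_subset.2 fun i hi => (hin i hi).cells_subset)

/-- An instance with a solution, and parameters that fit together. -/
structure Setup (n : ℕ) where
  I : StripInstance n
  ε : ℝ
  δ : ℝ
  μ : ℝ
  OPT : ℕ
  g : ℕ
  p : Fin n → ℕ × ℕ
  ε_pos : 0 < ε
  ε_lt : ε < 1
  δ_pos : 0 < δ
  δ_le : δ ≤ 1
  μ_pos : 0 < μ
  μ_le : μ * 10 ^ 13 ≤ (ε * δ) ^ 10
  g_pos : 0 < g
  g_eq : (g : ℝ) = ε * δ * OPT
  g_dvd : ∀ i ∈ I.large δ OPT ∪ I.tall δ OPT ∪ I.vertical δ μ OPT, g ∣ I.h i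
  sol : I.IsSolution OPT p

namespace Setup

variable {n : ℕ} (E : Setup n)

open Classical in
/-- The large items. -/
noncomputable def L : Finset (Fin n) := univ.filter (· ∈ E.I.large E.δ E.OPT)

open Classical in
/-- The tall items. -/
noncomputable def T : Finset (Fin n) := univ.filter (· ∈ E.I.tall E.δ E.OPT)

open Classical in
/-- The vertical items. -/
noncomputable def V : Finset (Fin n) := univ.filter (· ∈ E.I.vertical E.δ E.μ E.OPT)

open Classical in
/-- The horizontal items. -/
noncomputable def H : Finset (Fin n) := univ.filter (· ∈ E.I.horizontal E.δ E.μ E.OPT)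

open Classical in
/-- The small items. -/
noncomputable def S : Finset (Fin n) := univ.filter (· ∈ E.I.small E.μ E.OPT)

variable {E} {i j : Fin n}

lemma mem_L : i ∈ E.L ↔ E.δ * E.I.W ≤ E.I.w i ∧ E.δ * E.OPT ≤ E.I.h i := by
  simp only [L, mem_filter, mem_univ, true_and]
  rfl

lemma mem_T : i ∈ E.T ↔ (E.I.w i : ℝ) < E.δ * E.I.W ∧ (E.OPT : ℝ) / 3 < E.I.h i := by
  simp only [T, mem_filter, mem_univ, true_and]
  rfl

lemma mem_V : i ∈ E.V ↔ (E.I.w i : ℝ) < E.μ * E.I.W ∧ E.δ * E.OPT ≤ E.I.h i ∧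
    (E.I.h i : ℝ) ≤ (E.OPT : ℝ) / 3 := by
  simp only [V, mem_filter, mem_univ, true_and]
  rfl

lemma mem_H : i ∈ E.H ↔ E.δ * E.I.W ≤ E.I.w i ∧ (E.I.h i : ℝ) < E.μ * E.OPT := by
  simp only [H, mem_filter, mem_univ, true_and]
  rfl

lemma mem_S : i ∈ E.S ↔ (E.I.w i : ℝ) < E.μ * E.I.W ∧ (E.I.h i : ℝ) < E.μ * E.OPT := by
  simp only [S, mem_filter, mem_univ, true_and]
  rfl

variable (E)

lemma OPT_pos : (0 : ℝ) < E.OPT := by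
  have h1 := E.g_eq
  have h2 : (0 : ℝ) < E.g := by exact_mod_cast E.g_pos
  rw [h1] at h2
  exact pos_of_mul_pos_right h2 (mul_pos E.ε_pos E.δ_pos).le

lemma W_pos : (0 : ℝ) < E.I.W := by exact_mod_cast E.I.W_pos

lemma one_le_g : (1 : ℝ) ≤ E.g := by exact_mod_cast E.g_pos

lemma g_le : (E.g : ℝ) ≤ E.ε * E.OPT := by
  rw [E.g_eq]
  have := mul_pos E.ε_pos E.OPT_pos
  nlinarith [E.δ_le]

lemma εδ_pos : 0 < E.ε * E.δ := mul_pos E.ε_pos E.δ_pos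

lemma εδ_le : E.ε * E.δ ≤ 1 := by nlinarith [E.ε_pos, E.ε_lt, E.δ_pos, E.δ_le]

/-- `μ` is small compared with the product of small powers of `ε` and `δ`. -/
lemma μ_le_pow (a b : ℕ) (ha : a ≤ 10) (hb : b ≤ 10) : E.μ * 10 ^ 13 ≤ E.ε ^ a * E.δ ^ b := by
  refine E.μ_le.trans ?_
  rw [mul_pow]
  exact mul_le_mul (pow_le_pow_of_le_one E.ε_pos.le E.ε_lt.le ha)
    (pow_le_pow_of_le_one E.δ_pos.le E.δ_le hb) (pow_pos E.δ_pos _).le (pow_pos E.ε_pos _).le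

lemma μ_lt_δ : E.μ < E.δ := by
  have h := E.μ_le_pow 0 1 (by norm_num) (by norm_num)
  rw [pow_zero, one_mul, pow_one] at h
  linarith [E.μ_pos]

lemma μ_small : E.μ * 10 ^ 13 ≤ 1 := by simpa using E.μ_le_pow 0 0 (by norm_num) (by norm_num)

lemma disj_L_T : Disjoint E.L E.T := Finset.disjoint_left.2 fun i h1 h2 => by
  have := (mem_L.1 h1).1; have := (mem_T.1 h2).1; linarith

lemma δW_gt : E.μ * E.I.W < E.δ * E.I.W := mul_lt_mul_of_pos_right E.μ_lt_δ E.W_pos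

lemma δOPT_gt : E.μ * E.OPT < E.δ * E.OPT := mul_lt_mul_of_pos_right E.μ_lt_δ E.OPT_pos

lemma μOPT_lt : E.μ * E.OPT < E.OPT / 3 := by
  have h1 : E.μ * 3 < 1 := by linarith [E.μ_small, E.μ_pos]
  have h2 := mul_lt_mul_of_pos_right h1 E.OPT_pos
  linarith

lemma disj_L_V : Disjoint E.L E.V := Finset.disjoint_left.2 fun i h1 h2 => by
  have := (mem_L.1 h1).1; have := (mem_V.1 h2).1; have := E.δW_gt; linarith

lemma disj_T_V : Disjoint E.T E.V := Finset.disjoint_left.2 fun i h1 h2 => by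
  have := (mem_T.1 h1).2; have := (mem_V.1 h2).2.2; linarith

lemma disj_LTV_HS : Disjoint (E.L ∪ (E.T ∪ E.V)) (E.H ∪ E.S) :=
  Finset.disjoint_left.2 fun i h1 h2 => by
    have hh : (E.I.h i : ℝ) < E.μ * E.OPT := by
      rcases mem_union.1 h2 with h | h
      · exact (mem_H.1 h).2
      · exact (mem_S.1 h).2
    have := E.δOPT_gt
    have := E.μOPT_lt
    rcases mem_union.1 h1 with h | h
    · have := (mem_L.1 h).2; linarith
    · rcases mem_union.1 h with h | h
      · have := (mem_T.1 h).2; linarith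
      · have := (mem_V.1 h).2.1; linarith

lemma disj_H_S : Disjoint E.H E.S := Finset.disjoint_left.2 fun i h1 h2 => by
  have := (mem_H.1 h1).1; have := (mem_S.1 h2).1; have := E.δW_gt; linarith

lemma dvd_LTV (hi : i ∈ E.L ∪ (E.T ∪ E.V)) : E.g ∣ E.I.h i := by
  refine E.g_dvd i ?_
  simp only [mem_union, L, T, V, mem_filter, mem_univ, true_and] at hi
  simp only [Set.mem_union]
  tauto

lemma sol_inside (i : Fin n) : (E.p i).1 + E.I.w i ≤ E.I.W ∧ (E.p i).2 + E.I.h i ≤ E.OPT := by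
  have := E.sol.1 i (Set.mem_univ _)
  unfold Rect.Inside StripInstance.itemRect at this
  simp only at this
  omega

lemma sol_sep (hij : i ≠ j) :
    Rect.Sep ⟨(E.p i).1, (E.p i).2, E.I.w i, E.I.h i⟩ ⟨(E.p j).1, (E.p j).2, E.I.w j, E.I.h j⟩ :=
  Rect.sep_of_disjoint (E.sol.2 i (Set.mem_univ _) j (Set.mem_univ _) hij) (E.I.w_pos i)
    (E.I.h_pos i) (E.I.w_pos j) (E.I.h_pos j)

lemma sum_area_items_le (F : Finset (Fin n)) : ∑ i ∈ F, E.I.w i * E.I.h i ≤ E.I.W * E.OPT :=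
  sum_area_le F (E.I.itemRect E.p) ⟨0, 0, E.I.W, E.OPT⟩
    (fun i _ => E.sol.1 i (Set.mem_univ _))
    fun i _ j _ hij => E.sol.2 i (Set.mem_univ _) j (Set.mem_univ _) hij

lemma card_L_le : (E.L.card : ℝ) * E.δ ^ 2 ≤ 1 := by
  have h1 : (∑ i ∈ E.L, (E.I.w i : ℝ) * E.I.h i) ≤ E.I.W * E.OPT := by
    exact_mod_cast E.sum_area_items_le E.L
  have h2 : ∑ i ∈ E.L, (E.δ * E.I.W) * (E.δ * E.OPT) ≤ ∑ i ∈ E.L, (E.I.w i : ℝ) * E.I.h i := by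
    refine sum_le_sum fun i hi => ?_
    have := mem_L.1 hi
    exact mul_le_mul this.1 this.2 (mul_pos E.δ_pos E.OPT_pos).le (Nat.cast_nonneg _)
  rw [sum_const, nsmul_eq_mul] at h2
  have h3 : 0 < (E.I.W : ℝ) * E.OPT := mul_pos E.W_pos E.OPT_pos
  have h4 : (E.L.card : ℝ) * E.δ ^ 2 * (E.I.W * E.OPT) ≤ 1 * (E.I.W * E.OPT) := by
    linarith
  exact le_of_mul_le_mul_right h4 h3

/-- The number of rows of the stretched packing. -/
noncomputable def R : ℕ := ⌈(1 + 12 * E.ε) * E.OPT / E.g⌉₊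

lemma le_gR : (1 + 12 * E.ε) * E.OPT ≤ E.g * E.R := by
  have h := Nat.le_ceil ((1 + 12 * E.ε) * E.OPT / E.g)
  have hg : (0 : ℝ) < E.g := by have := E.one_le_g; linarith
  rw [div_le_iff₀ hg] at h
  rw [R]
  linarith

lemma gR_le : (E.g : ℝ) * E.R ≤ (1 + 13 * E.ε) * E.OPT := by
  have hg : (0 : ℝ) < E.g := by have := E.one_le_g; linarith
  have h0 : 0 ≤ (1 + 12 * E.ε) * E.OPT / E.g := by
    have := E.ε_pos; have := E.OPT_pos; positivity
  have h := Nat.ceil_lt_add_one h0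
  rw [← sub_lt_iff_lt_add, lt_div_iff₀ hg] at h
  have := E.g_le
  rw [R]
  linarith

lemma R_le : (E.R : ℝ) * (E.ε * E.δ) ≤ 14 := by
  have h := E.gR_le
  rw [E.g_eq] at h
  have h1 : (E.R * (E.ε * E.δ)) * E.OPT ≤ 14 * E.OPT := by
    have := mul_lt_mul_of_pos_right E.ε_lt E.OPT_pos
    linarith
  exact le_of_mul_le_mul_right h1 E.OPT_pos

end Setup

namespace Setup

variable {n : ℕ} (E : Setup n)

/-- The large, tall and vertical items. -/
noncomputable def A : Finset (Fin n) := E.L ∪ (E.T ∪ E.V)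

/-- The stretched packing, with its horizontal boxes. -/
structure Stretched where
  Y : Fin n → ℕ
  𝓞 : Finset Rect
  Y_dvd : ∀ i ∈ E.A, E.g ∣ Y i
  Y_in : ∀ i ∈ E.A ∪ (E.H ∪ E.S), Y i + E.I.h i ≤ E.g * E.R
  Y_sep : ∀ i ∈ E.A ∪ (E.H ∪ E.S), ∀ j ∈ E.A ∪ (E.H ∪ E.S), i ≠ j →
    Rect.Sep ⟨(E.p i).1, Y i, E.I.w i, E.I.h i⟩ ⟨(E.p j).1, Y j, E.I.w j, E.I.h j⟩
  Y_mono : ∀ i ∈ E.A, ∀ j ∈ E.A, (E.p i).2 ≤ (E.p j).2 → Y i ≤ Y j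
  Y_ord : ∀ i ∈ E.A, ∀ j ∈ E.A, (E.p i).2 + E.I.h i ≤ (E.p j).2 → Y i + E.I.h i ≤ Y j
  Y_near : ∀ i ∈ E.A, (1 + 12 * E.ε) * (E.p i).2 ≤ Y i ∧
    (Y i : ℝ) < (1 + 12 * E.ε) * (E.p i).2 + E.g
  box_in : ∀ O ∈ 𝓞, O.Inside ⟨0, 0, E.I.W, E.g * E.R⟩ ∧ 0 < O.w ∧ E.g ∣ O.y ∧ O.h = E.g ∧
    ∃ i ∈ E.H, E.I.w i ≤ O.w
  box_sep : ∀ O ∈ 𝓞, ∀ O' ∈ 𝓞, O ≠ O' → O.Sep O'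
  item_box : ∀ i ∈ E.A, ∀ O ∈ 𝓞, Rect.Sep ⟨(E.p i).1, Y i, E.I.w i, E.I.h i⟩ O
  box_width : ∑ O ∈ 𝓞, O.w ≤ E.R * E.I.W
  horizontal : ∀ i ∈ E.H, CrossesRow E.g (Y i) (E.I.h i) ∨
    ∃ O ∈ 𝓞, Rect.Inside ⟨(E.p i).1, Y i, E.I.w i, E.I.h i⟩ O
  small : ∀ i ∈ E.S, CrossesRow E.g (Y i) (E.I.h i) ∨
    (∃ O ∈ 𝓞, Rect.Inside ⟨(E.p i).1, Y i, E.I.w i, E.I.h i⟩ O) ∨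
    ∀ O ∈ 𝓞, Rect.Sep ⟨(E.p i).1, Y i, E.I.w i, E.I.h i⟩ O

/-- A large or vertical item has height at least `δ * OPT`, hence `ε * h i ≥ g`; for a tall item `12
* ε * h i` exceeds `4 * ε * OPT ≥ g`. The factor 12, much larger than alignment needs, provides the
slack `4 * ε * OPT` above tall items. -/
theorem nonempty_stretched : Nonempty E.Stretched := by
  have hε := E.ε_pos
  have hstretch : ∀ i ∈ E.A, (E.g : ℝ) ≤ 12 * E.ε * E.I.h i := by
    intro i hi
    have h1 := E.g_le
    have h3 : E.δ * E.OPT ≤ E.I.h i → (E.g : ℝ) ≤ 12 * E.ε * E.I.h i := by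
      intro h
      have := mul_le_mul_of_nonneg_left h hε.le
      have h5 := E.g_eq
      have h6 : 0 ≤ E.ε * E.I.h i := by positivity
      nlinarith
    rcases mem_union.1 hi with h | h
    · exact h3 (mem_L.1 h).2
    · rcases mem_union.1 h with h | h
      · have := mul_lt_mul_of_pos_left (mem_T.1 h).2 hε
        have h6 : 0 ≤ E.ε * E.I.h i := by positivity
        linarith
      · exact h3 (mem_V.1 h).2.1
  obtain ⟨Y, y1, y2, y3, y4, y5⟩ := exists_stretch (fun i => (E.p i).2) E.I.h E.A (E.H ∪ E.S) E.g E.R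
    E.OPT E.g_pos (12 * E.ε) (by positivity) hstretch (fun i hi => E.dvd_LTV hi)
    (fun i _ => (E.sol_inside i).2) E.le_gR
  have hsep : ∀ i ∈ E.A ∪ (E.H ∪ E.S), ∀ j ∈ E.A ∪ (E.H ∪ E.S), i ≠ j →
      Rect.Sep ⟨(E.p i).1, Y i, E.I.w i, E.I.h i⟩ ⟨(E.p j).1, Y j, E.I.w j, E.I.h j⟩ := by
    intro i hi j hj hij
    rcases E.sol_sep hij with h | h | h | h
    · exact Or.inl h
    · exact Or.inr (Or.inl h)
    · exact Or.inr (Or.inr (Or.inl (y3 i hi j hj h)))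
    · exact Or.inr (Or.inr (Or.inr (y3 j hj i hi h)))
  obtain ⟨𝓞, o1, o2, o3, o4, o5, o6⟩ := exists_horizontal_boxes (fun i => (E.p i).1) Y E.I.w E.I.h
    E.A E.H E.S E.g E.R E.I.W E.g_pos (fun i hi => ⟨y1 i hi, E.dvd_LTV hi⟩)
    (fun i _ => ⟨E.I.w_pos i, E.I.h_pos i⟩)
    (fun i hi => ⟨(E.sol_inside i).1, y2 i (mem_union_right _ hi)⟩)
    (fun i hi j hj => hsep i (mem_union_left _ hi) j (mem_union_right _ hj)
      fun h => Finset.disjoint_left.1 E.disj_LTV_HS hi (h ▸ hj))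
  exact ⟨⟨Y, 𝓞, y1, y2, hsep, y4, fun i hi j hj => y3 i (mem_union_left _ hi) j (mem_union_left _ hj),
    y5, o1, o2, o3, o4, o5, o6⟩⟩

/-- The maximal width of the boxes for tall and vertical items. -/
noncomputable def D : ℕ := max 1 ⌊E.ε * E.δ * E.I.W⌋₊

lemma D_pos : 0 < E.D := by unfold D; omega

variable {E} (Z : E.Stretched)

/-- The stretched rectangle of an item. -/
def Stretched.rect (i : Fin n) : Rect := ⟨(E.p i).1, Z.Y i, E.I.w i, E.I.h i⟩

/-- The rectangles that stay in place: large items and horizontal boxes. -/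
noncomputable def Stretched.obs : Finset Rect := by
  classical exact E.L.image Z.rect ∪ Z.𝓞

/-- Vertical lines that cut the strip into slabs. -/
noncomputable def Stretched.lines : Finset ℕ := by
  classical exact {0, E.I.W} ∪ (Z.obs.image Rect.x ∪ Z.obs.image fun O => O.x + O.w) ∪
    (range (E.I.W / E.D + 1)).image (· * E.D)

lemma Stretched.mem_obs {O : Rect} : O ∈ Z.obs ↔ (∃ i ∈ E.L, Z.rect i = O) ∨ O ∈ Z.𝓞 := by
  classical
  rw [obs, mem_union, mem_image]

lemma Stretched.mem_lines {a : ℕ} : a ∈ Z.lines ↔ (a = 0 ∨ a = E.I.W) ∨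
    (∃ O ∈ Z.obs, O.x = a ∨ O.x + O.w = a) ∨ ∃ k ≤ E.I.W / E.D, k * E.D = a := by
  classical
  simp only [lines, mem_union, mem_image, mem_insert, mem_singleton, mem_range, Nat.lt_succ_iff,
    ← exists_or, ← and_or_left, or_assoc]

lemma Stretched.card_obs_le : Z.obs.card ≤ E.L.card + Z.𝓞.card := by
  classical
  rw [obs]
  exact (card_union_le _ _).trans (Nat.add_le_add_right card_image_le _)

lemma Stretched.card_lines_le : Z.lines.card ≤ 2 + 2 * Z.obs.card + (E.I.W / E.D + 1) := by
  classical
  rw [lines]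
  refine (card_union_le _ _).trans (Nat.add_le_add ((card_union_le _ _).trans (Nat.add_le_add
    card_le_two ((card_union_le _ _).trans ?_))) (card_image_le.trans (card_range _).le))
  rw [two_mul]
  exact Nat.add_le_add card_image_le card_image_le

lemma Stretched.obs_inside {O : Rect} (hO : O ∈ Z.obs) :
    O.Inside ⟨0, 0, E.I.W, E.g * E.R⟩ ∧ 0 < O.w ∧ 0 < O.h ∧ E.g ∣ O.y ∧ E.g ∣ O.h := by
  rcases Z.mem_obs.1 hO with ⟨i, hi, rfl⟩ | hO
  · have h1 := (E.sol_inside i).1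
    have h2 := Z.Y_in i (mem_union_left _ (mem_union_left _ hi))
    refine ⟨?_, E.I.w_pos i, E.I.h_pos i, Z.Y_dvd i (mem_union_left _ hi),
      E.dvd_LTV (mem_union_left _ hi)⟩
    unfold Rect.Inside rect
    simp only
    omega
  · obtain ⟨h1, h2, h3, h4, -⟩ := Z.box_in O hO
    exact ⟨h1, h2, h4 ▸ E.g_pos, h3, h4 ▸ dvd_rfl⟩

lemma Stretched.obs_sep {O O' : Rect} (hO : O ∈ Z.obs) (hO' : O' ∈ Z.obs) (hne : O ≠ O') :
    O.Sep O' := by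
  rcases Z.mem_obs.1 hO with ⟨i, hi, rfl⟩ | hO <;> rcases Z.mem_obs.1 hO' with ⟨j, hj, rfl⟩ | hO'
  · exact Z.Y_sep i (mem_union_left _ (mem_union_left _ hi)) j
      (mem_union_left _ (mem_union_left _ hj)) fun h => hne (by rw [h])
  · exact Z.item_box i (mem_union_left _ hi) O' hO'
  · exact (Z.item_box j (mem_union_left _ hj) O hO).symm
  · exact Z.box_sep O hO O' hO' hne

/-- The data for the rearrangement of tall and vertical items. -/
noncomputable def Stretched.mainData : MainData (Fin n) where
  T := E.T
  V := E.V
  top i := decide (¬ 3 * (E.p i).2 < E.OPT)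
  X i := (E.p i).1
  Y := Z.Y
  w := E.I.w
  h := E.I.h
  W := E.I.W
  g := E.g
  R := E.R
  B := E.OPT / 3
  σ := ⌊4 * E.ε * E.OPT⌋₊ - E.g
  D := E.D
  obs := Z.obs
  lines := Z.lines
  hg := E.g_pos
  hpos i _ := ⟨E.I.w_pos i, E.I.h_pos i⟩
  hdvd i hi := ⟨Z.Y_dvd i (mem_union_right _ hi), E.dvd_LTV (mem_union_right _ hi)⟩
  hin i hi := ⟨(E.sol_inside i).1, Z.Y_in i (mem_union_left _ (mem_union_right _ hi))⟩
  hTV := E.disj_T_V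
  hsep i hi j hj := Z.Y_sep i (mem_union_left _ (mem_union_right _ hi)) j
    (mem_union_left _ (mem_union_right _ hj))
  -- A tall item starting below `OPT / 3` covers the level `OPT / 3`; any other tall item covers the
  -- level `2 * OPT / 3`. Two of the same kind therefore cannot lie above each other.
  hkind i hi j hj hij ht := by
    have h1 := E.sol_inside i
    have h2 := E.sol_inside j
    have h3 := (mem_T.1 hi).2
    have h4 := (mem_T.1 hj).2
    rw [div_lt_iff₀ (by norm_num)] at h3 h4
    have h3' : E.OPT < E.I.h i * 3 := by exact_mod_cast h3
    have h4' : E.OPT < E.I.h j * 3 := by exact_mod_cast h4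
    have h5 := E.sol_sep hij
    rw [decide_eq_decide] at ht
    unfold Rect.Sep at h5
    simp only at h5
    omega
  hord i hi j hj h1 h2 := by
    rw [decide_eq_false_iff_not] at h1
    rw [decide_eq_true_iff] at h2
    exact Z.Y_mono i (mem_union_right _ (mem_union_left _ hi)) j
      (mem_union_right _ (mem_union_left _ hj)) (by omega)
  -- An item above `i` is moved up by the factor applied to the height of `i` as well, which exceeds
  -- `OPT / 3`; alignment of `i` takes back at most `g`. This leaves the slack `σ`.
  hext i hi h1 j hj hji hx hx' := by
    have hiA : i ∈ E.A := mem_union_right _ (mem_union_left _ hi)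
    have hjA : j ∈ E.A := mem_union_right _ hj
    rcases E.sol_sep hji with h | h | h | h
    · exact absurd h (not_le.2 hx)
    · exact absurd h (not_le.2 hx')
    · exact Or.inl (Z.Y_ord j hjA i hiA h)
    · right
      simp only at h
      have h2 := (Z.Y_near i hiA).2
      have h3 := (Z.Y_near j hjA).1
      have h4 := (mem_T.1 hi).2
      have h5 : ((E.p i).2 : ℝ) + E.I.h i ≤ (E.p j).2 := by exact_mod_cast h
      have hε := E.ε_pos
      have h6 := mul_le_mul_of_nonneg_left h5 (show 0 ≤ 1 + 12 * E.ε by positivity)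
      have h7 := mul_lt_mul_of_pos_left h4 hε
      have h8 : (⌊4 * E.ε * E.OPT⌋₊ : ℝ) ≤ 4 * E.ε * E.OPT :=
        Nat.floor_le (by have := E.OPT_pos; positivity)
      have h9 : (Z.Y i + E.I.h i + ⌊4 * E.ε * E.OPT⌋₊ : ℝ) < Z.Y j + E.g := by linarith
      have h10 : Z.Y i + E.I.h i + ⌊4 * E.ε * E.OPT⌋₊ < Z.Y j + E.g := by exact_mod_cast h9
      have h11 := Z.Y_ord i hiA j hjA h
      omega
  -- In the original packing the column has height `OPT`, and two tall items use more than two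
  -- thirds of it.
  hB x i hi j hj h1 h2 hx1 hx2 hx3 hx4 := by
    rw [decide_eq_false_iff_not] at h1
    rw [decide_eq_true_iff] at h2
    have hij : i ≠ j := fun h => h1 (h ▸ h2)
    have hTV := Finset.disjoint_left.1 E.disj_T_V
    set Q := E.V.filter fun k => (E.p k).1 ≤ x ∧ x < (E.p k).1 + E.I.w k with hQ
    have hjQ : j ∉ Q := fun h => hTV hj (mem_filter.1 h).1
    have hiQ : i ∉ insert j Q := fun h => by
      rcases mem_insert.1 h with h | h
      · exact hij h
      · exact hTV hi (mem_filter.1 h).1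
    have hcol : ∀ k ∈ insert i (insert j Q), (E.p k).1 ≤ x ∧ x < (E.p k).1 + E.I.w k := by
      intro k hk
      rcases mem_insert.1 hk with rfl | hk
      · exact ⟨hx1, hx2⟩
      · rcases mem_insert.1 hk with rfl | hk
        · exact ⟨hx3, hx4⟩
        · exact (mem_filter.1 hk).2
    have h5 := sum_width_le (insert i (insert j Q)) (fun k => (E.p k).2) E.I.h 0 E.OPT
      (fun k _ => ⟨Nat.zero_le _, (E.sol_inside k).2⟩) fun k hk l hl hkl => by
        have := E.sol_sep hkl
        have := hcol k hk
        have := hcol l hl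
        unfold Rect.Sep at *
        simp only at *
        omega
    rw [sum_insert hiQ, sum_insert hjQ] at h5
    have h3 := (mem_T.1 hi).2
    have h4 := (mem_T.1 hj).2
    rw [div_lt_iff₀ (by norm_num)] at h3 h4
    have h3' : E.OPT < E.I.h i * 3 := by exact_mod_cast h3
    have h4' : E.OPT < E.I.h j * 3 := by exact_mod_cast h4
    omega
  obs_in O hO := (Z.obs_inside hO).1
  obs_pos O hO := ⟨(Z.obs_inside hO).2.1, (Z.obs_inside hO).2.2.1⟩
  obs_dvd O hO := (Z.obs_inside hO).2.2.2
  obs_sep i hi O hO := by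
    rcases Z.mem_obs.1 hO with ⟨j, hj, rfl⟩ | hO
    · refine Z.Y_sep i (mem_union_left _ (mem_union_right _ hi)) j
        (mem_union_left _ (mem_union_left _ hj)) ?_
      rintro rfl
      rcases mem_union.1 hi with h | h
      · exact Finset.disjoint_left.1 E.disj_L_T hj h
      · exact Finset.disjoint_left.1 E.disj_L_V hj h
    · exact Z.item_box i (mem_union_right _ hi) O hO
  line_zero := Z.mem_lines.2 (Or.inl (Or.inl rfl))
  line_W := Z.mem_lines.2 (Or.inl (Or.inr rfl))
  line_obs O hO := ⟨Z.mem_lines.2 (Or.inr (Or.inl ⟨O, hO, Or.inl rfl⟩)),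
    Z.mem_lines.2 (Or.inr (Or.inl ⟨O, hO, Or.inr rfl⟩))⟩
  line_gap a _ haW := by
    have h1 := Nat.div_add_mod a E.D
    have h2 := Nat.mod_lt a E.D_pos
    have h3 : a < (a / E.D + 1) * E.D := by
      rw [add_mul, one_mul, mul_comm]; omega
    have h4 : (a / E.D + 1) * E.D ≤ a + E.D := by
      rw [add_mul, one_mul, mul_comm]; omega
    by_cases h5 : (a / E.D + 1) * E.D ≤ E.I.W
    · refine (hiPt_le (Z.mem_lines.2 (Or.inr (Or.inr ⟨_, ?_, rfl⟩))) h3).trans h4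
      exact (Nat.le_div_iff_mul_le E.D_pos).2 h5
    · exact (hiPt_le (Z.mem_lines.2 (Or.inl (Or.inr rfl))) haW).trans (by omega)

end Setup

/-! ### Numerical bounds, and the core packing. -/

namespace Setup

variable {n : ℕ} {E : Setup n} (Z : E.Stretched)

lemma one_le_inv_ε : 1 ≤ E.ε⁻¹ := (one_le_inv₀ E.ε_pos).2 E.ε_lt.le

lemma one_le_inv_δ : 1 ≤ E.δ⁻¹ := (one_le_inv₀ E.δ_pos).2 E.δ_le

lemma one_le_inv_mul (k l : ℕ) : 1 ≤ E.ε⁻¹ ^ k * E.δ⁻¹ ^ l :=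
  one_le_mul_of_one_le_of_one_le (one_le_pow₀ one_le_inv_ε) (one_le_pow₀ one_le_inv_δ)

lemma inv_mul_le {k l k' l' : ℕ} (hk : k ≤ k') (hl : l ≤ l') :
    E.ε⁻¹ ^ k * E.δ⁻¹ ^ l ≤ E.ε⁻¹ ^ k' * E.δ⁻¹ ^ l' :=
  mul_le_mul (pow_le_pow_right₀ one_le_inv_ε hk) (pow_le_pow_right₀ one_le_inv_δ hl)
    (pow_nonneg (zero_le_one.trans one_le_inv_δ) _) (pow_nonneg (zero_le_one.trans one_le_inv_ε) _)

lemma R_le_inv : (E.R : ℝ) ≤ 14 * (E.ε⁻¹ * E.δ⁻¹) := by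
  rw [← mul_inv, ← div_eq_mul_inv, le_div_iff₀ E.εδ_pos]
  exact E.R_le

lemma card_L_le_inv : (E.L.card : ℝ) ≤ E.δ⁻¹ ^ 2 := by
  rw [inv_pow, ← one_div, le_div_iff₀ (pow_pos E.δ_pos 2)]
  exact E.card_L_le

/-- Every strip contains a horizontal item, so its width is at least `δ * W`, while all strips
together have width at most `R * W`. -/
lemma Stretched.card_boxes_le : (Z.𝓞.card : ℝ) ≤ 14 * (E.ε⁻¹ * E.δ⁻¹ ^ 2) := by
  have h1 : ∑ O ∈ Z.𝓞, E.δ * E.I.W ≤ ∑ O ∈ Z.𝓞, (O.w : ℝ) := by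
    refine sum_le_sum fun O hO => ?_
    obtain ⟨-, -, -, -, i, hi, h⟩ := Z.box_in O hO
    exact (mem_H.1 hi).1.trans (by exact_mod_cast h)
  have h2 : (∑ O ∈ Z.𝓞, (O.w : ℝ)) ≤ E.R * E.I.W := by exact_mod_cast Z.box_width
  rw [sum_const, nsmul_eq_mul] at h1
  have h3 : ((Z.𝓞.card : ℝ) * E.δ) * E.I.W ≤ E.R * E.I.W := by linarith
  have h4 := (le_of_mul_le_mul_right h3 E.W_pos).trans R_le_inv
  rw [← le_div_iff₀ E.δ_pos] at h4
  refine h4.trans (le_of_eq ?_)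
  ring

lemma Stretched.card_obs_le_inv : (Z.obs.card : ℝ) ≤ 15 * (E.ε⁻¹ * E.δ⁻¹ ^ 2) := by
  have h1 : (Z.obs.card : ℝ) ≤ E.L.card + Z.𝓞.card := by exact_mod_cast Z.card_obs_le
  have h2 := card_L_le_inv (E := E)
  have h3 := Z.card_boxes_le
  have h4 := inv_mul_le (E := E) (Nat.zero_le 1) (le_refl 2)
  rw [pow_zero, one_mul, pow_one] at h4
  linarith

lemma le_two_mul_D : E.ε * E.δ * E.I.W ≤ 2 * E.D := by
  have h1 := Nat.lt_floor_add_one (E.ε * E.δ * E.I.W)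
  have h2 : (⌊E.ε * E.δ * E.I.W⌋₊ : ℝ) ≤ E.D := by exact_mod_cast le_max_right _ _
  have h3 : (1 : ℝ) ≤ E.D := by exact_mod_cast E.D_pos
  linarith

lemma div_D_le : ((E.I.W / E.D : ℕ) : ℝ) ≤ 2 * (E.ε⁻¹ * E.δ⁻¹) := by
  rw [← mul_inv, ← div_eq_mul_inv, le_div_iff₀ E.εδ_pos]
  have h1 : ((E.I.W / E.D : ℕ) : ℝ) * E.D ≤ E.I.W := by exact_mod_cast Nat.div_mul_le_self _ _
  have h2 := mul_le_mul_of_nonneg_left (le_two_mul_D (E := E))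
    (Nat.cast_nonneg (α := ℝ) (E.I.W / E.D))
  refine le_of_mul_le_mul_right ?_ E.W_pos
  linarith

lemma Stretched.card_lines_le_inv : (Z.lines.card : ℝ) ≤ 35 * (E.ε⁻¹ * E.δ⁻¹ ^ 2) := by
  have h1 : (Z.lines.card : ℝ) ≤ 2 + 2 * Z.obs.card + ((E.I.W / E.D : ℕ) + 1) := by
    exact_mod_cast Z.card_lines_le
  have h2 := Z.card_obs_le_inv
  have h3 := div_D_le (E := E)
  have h4 := inv_mul_le (E := E) (le_refl 1) one_le_two
  have h5 := one_le_inv_mul (E := E) 1 2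
  simp only [pow_one] at h4 h5
  linarith

/-- A bound on the number of runs. -/
noncomputable def Stretched.runs : ℕ :=
  Z.lines.card * ((E.R + 1) * (48 * (2 * E.R + 4) * (2 * E.R + 3)) + 2) + (E.I.W / E.D + 1)

lemma Stretched.runs_le : (Z.runs : ℝ) ≤ 25 * 10 ^ 6 * (E.ε⁻¹ ^ 4 * E.δ⁻¹ ^ 5) := by
  set a := E.ε⁻¹ * E.δ⁻¹ with ha
  have ha1 : 1 ≤ a := by simpa using one_le_inv_mul (E := E) 1 1
  have hR : (E.R : ℝ) ≤ 14 * a := R_le_inv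
  have h1 := Z.card_lines_le_inv
  have h2 := div_D_le (E := E)
  rw [← ha] at h2
  -- 714242 = 15 · 48 · 32 · 31 + 2, and 35 times it plus 3 stays below 25 · 10⁶.
  have h3 : ((E.R : ℝ) + 1) * (48 * (2 * E.R + 4) * (2 * E.R + 3)) + 2 ≤ 714242 * a ^ 3 := by
    have e1 : (E.R : ℝ) + 1 ≤ 15 * a := by linarith
    have e2 : 2 * (E.R : ℝ) + 4 ≤ 32 * a := by linarith
    have e3 : 2 * (E.R : ℝ) + 3 ≤ 31 * a := by linarith
    have e4 : (1 : ℝ) ≤ a ^ 3 := one_le_pow₀ ha1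
    calc ((E.R : ℝ) + 1) * (48 * (2 * E.R + 4) * (2 * E.R + 3)) + 2
        ≤ (15 * a) * (48 * (32 * a) * (31 * a)) + 2 * a ^ 3 := by gcongr; linarith
      _ = _ := by ring
  have h4 : (Z.runs : ℝ) = Z.lines.card * (((E.R : ℝ) + 1) * (48 * (2 * E.R + 4) *
      (2 * E.R + 3)) + 2) + ((E.I.W / E.D : ℕ) + 1) := by
    rw [runs]; push_cast; ring
  have h5 : (a : ℝ) ≤ E.ε⁻¹ ^ 4 * E.δ⁻¹ ^ 5 := by
    simpa using inv_mul_le (E := E) (show 1 ≤ 4 by norm_num) (show 1 ≤ 5 by norm_num)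
  have h6 : 0 ≤ E.ε⁻¹ * E.δ⁻¹ ^ 2 := by simpa using zero_le_one.trans (one_le_inv_mul (E := E) 1 2)
  calc (Z.runs : ℝ) ≤ (35 * (E.ε⁻¹ * E.δ⁻¹ ^ 2)) * (714242 * a ^ 3) + 3 * a := by
        rw [h4]
        refine add_le_add (mul_le_mul h1 h3 (by positivity) (by linarith)) (by linarith)
    _ = 35 * 714242 * (E.ε⁻¹ ^ 4 * E.δ⁻¹ ^ 5) + 3 * a := by rw [ha]; ring
    _ ≤ _ := by linarith

/-- A bound on the number of heights of vertical items. -/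
noncomputable def K (E : Setup n) : ℕ := ⌊E.ε⁻¹ * E.δ⁻¹⌋₊ + 1

/-- A bound on the number of vertical items in a column. -/
noncomputable def colBound (E : Setup n) : ℕ := ⌊14 * E.δ⁻¹⌋₊

/-- Heights of vertical items are multiples of `g = ε * δ * OPT` and at most `OPT / 3`. -/
lemma card_heights_le : (E.V.image E.I.h).card ≤ E.K := by
  have hsub : E.V.image E.I.h ⊆ (range E.K).image (E.g * ·) := by
    intro y hy
    obtain ⟨i, hi, rfl⟩ := mem_image.1 hy
    obtain ⟨c, hc⟩ := E.dvd_LTV (mem_union_right _ (mem_union_right _ hi))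
    refine mem_image.2 ⟨c, mem_range.2 (Nat.lt_succ_of_le (Nat.le_floor ?_)), hc.symm⟩
    have h1 := (mem_V.1 hi).2.2
    have h2 : (E.I.h i : ℝ) = E.g * c := by exact_mod_cast hc
    rw [h2, E.g_eq] at h1
    rw [← mul_inv, ← one_div, le_div_iff₀ E.εδ_pos]
    refine le_of_mul_le_mul_right ?_ E.OPT_pos
    linarith [E.OPT_pos]
  exact (card_le_card hsub).trans (card_image_le.trans (card_range _).le)

lemma K_add_one_le : (E.K : ℝ) + 1 ≤ 3 * (E.ε⁻¹ * E.δ⁻¹) := by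
  have h1 : 1 ≤ E.ε⁻¹ * E.δ⁻¹ := by simpa using one_le_inv_mul (E := E) 1 1
  have := Nat.floor_le (zero_le_one.trans h1)
  rw [K]
  push_cast
  linarith

lemma colBound_le : (E.colBound : ℝ) ≤ 14 * E.δ⁻¹ :=
  Nat.floor_le (by have := one_le_inv_δ (E := E); linarith)

lemma card_column_le (s : Finset (Fin n)) (hs : s ⊆ E.V) (h : ∑ i ∈ s, E.I.h i ≤ E.g * E.R) :
    s.card ≤ E.colBound := by
  refine Nat.le_floor ?_
  have h1 : ∑ i ∈ s, E.δ * E.OPT ≤ ∑ i ∈ s, (E.I.h i : ℝ) :=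
    sum_le_sum fun i hi => (mem_V.1 (hs hi)).2.1
  have h2 : (∑ i ∈ s, (E.I.h i : ℝ)) ≤ E.g * E.R := by exact_mod_cast h
  rw [sum_const, nsmul_eq_mul] at h1
  have h3 := E.gR_le
  have h4 := mul_lt_mul_of_pos_right E.ε_lt E.OPT_pos
  rw [← div_eq_mul_inv, le_div_iff₀ E.δ_pos]
  refine le_of_mul_le_mul_right ?_ E.OPT_pos
  linarith

/-- A run yields at most `(K + 1) * colBound` boxes. The bound serves twice: for the number of
reserved boxes, and for the total width of the vertical items that do not fit. -/
lemma boxes_le : (Z.runs : ℝ) * (((E.K : ℝ) + 1) * E.colBound + 1) ≤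
    1075 * 10 ^ 6 * (E.ε⁻¹ ^ 5 * E.δ⁻¹ ^ 7) := by
  have h1 := Z.runs_le
  have h2 := K_add_one_le (E := E)
  have h3 := colBound_le (E := E)
  have h4 : ((E.K : ℝ) + 1) * E.colBound ≤ (3 * (E.ε⁻¹ * E.δ⁻¹)) * (14 * E.δ⁻¹) :=
    mul_le_mul h2 h3 (Nat.cast_nonneg _) (by
      have := one_le_inv_mul (E := E) 1 1
      simp only [pow_one] at this
      linarith)
  have h5 : 1 ≤ E.ε⁻¹ * E.δ⁻¹ ^ 2 := by simpa using one_le_inv_mul (E := E) 1 2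
  have h6 : ((E.K : ℝ) + 1) * E.colBound + 1 ≤ 43 * (E.ε⁻¹ * E.δ⁻¹ ^ 2) := by
    have : (3 * (E.ε⁻¹ * E.δ⁻¹)) * (14 * E.δ⁻¹) = 42 * (E.ε⁻¹ * E.δ⁻¹ ^ 2) := by ring
    linarith
  calc _ ≤ (25 * 10 ^ 6 * (E.ε⁻¹ ^ 4 * E.δ⁻¹ ^ 5)) * (43 * (E.ε⁻¹ * E.δ⁻¹ ^ 2)) :=
        mul_le_mul h1 h6 (by positivity) (by have := one_le_inv_mul (E := E) 4 5; linarith)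
    _ = _ := by ring

/-- All tall items and almost all vertical items are packed into vertical boxes. -/
theorem Stretched.exists_core (φ : ℝ) (hφ : φ = 0 ∨ φ = E.ε / 2 ∧ E.ε ≤ 1 / 16) :
    ∃ (ρ : Type) (_ : Fintype ρ) (res : ρ → Rect) (rest : Finset (Fin n)) (P : Fin n → ℕ × ℕ)
      (c : ℕ),
      (c : ℝ) ≤ (1 - φ) * E.I.W ∧
      (Fintype.card ρ : ℝ) ≤ 1075 * 10 ^ 6 * (E.ε⁻¹ ^ 5 * E.δ⁻¹ ^ 7) ∧
      (∀ r, (res r).Inside ⟨0, 0, E.I.W, E.g * E.R⟩ ∨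
        (res r).Inside ⟨0, E.g * E.R, c, E.OPT / 3⟩) ∧
      (∀ r r', r ≠ r' → (res r).Sep (res r')) ∧ (∀ r, ∀ O ∈ Z.obs, (res r).Sep O) ∧
      ∑ r, (res r).w * (res r).h ≤ ∑ i ∈ E.T ∪ E.V, E.I.w i * E.I.h i ∧
      rest ⊆ E.V ∧ ((∑ i ∈ rest, E.I.w i : ℕ) : ℝ) * 1000 ≤ E.ε * E.δ * E.I.W ∧
      (∀ i ∈ (E.T ∪ E.V) \ rest, ∃ r, (E.I.itemRect P i).Inside (res r) ∧
        (res r).h = E.I.h i ∧ (((res r).w : ℝ) ≤ E.ε * E.δ * E.I.W ∨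
          ∃ j ∈ E.T, res r = E.I.itemRect P j)) ∧
      (∀ i ∈ (E.T ∪ E.V) \ rest, ∀ j ∈ (E.T ∪ E.V) \ rest, i ≠ j →
        (E.I.itemRect P i).Sep (E.I.itemRect P j)) := by
  have hε := E.ε_pos
  have hO := E.OPT_pos
  have hεO : 1 ≤ E.ε * E.OPT := E.one_le_g.trans E.g_le
  have hφ0 : 0 ≤ φ := by rcases hφ with rfl | ⟨rfl, -⟩ <;> linarith
  have hφ1 : φ ≤ 1 := by
    rcases hφ with rfl | ⟨rfl, h⟩
    · exact zero_le_one
    · linarith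
  have hB : ((E.OPT / 3 : ℕ) : ℝ) ≤ E.OPT / 3 := Nat.cast_div_le
  have hBg : E.OPT / 3 ≤ E.g * E.R := by
    have h1 := E.le_gR
    have h2 : (0 : ℝ) ≤ E.ε * E.OPT := by positivity
    have h3 : ((E.OPT : ℕ) : ℝ) ≤ (E.g * E.R : ℕ) := by push_cast; linarith
    have h4 : E.OPT ≤ E.g * E.R := by exact_mod_cast h3
    omega
  -- For `φ = ε / 2` and `ε ≤ 1 / 16` the left side is at most `ε / 2 · 3 * OPT`. On the right `σ ≥
  -- 2 * ε * OPT`, because `g` and the rounding cost at most `ε * OPT` each.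
  have hcond : φ * ((Z.mainData.g * Z.mainData.R : ℕ) + Z.mainData.B) ≤
      (1 - φ) * Z.mainData.σ := by
    change φ * ((E.g * E.R : ℕ) + (E.OPT / 3 : ℕ)) ≤ (1 - φ) * ((⌊4 * E.ε * E.OPT⌋₊ - E.g : ℕ) : ℝ)
    rcases hφ with rfl | ⟨rfl, h⟩
    · rw [zero_mul, sub_zero, one_mul]
      exact Nat.cast_nonneg _
    · have h1 := Nat.lt_floor_add_one (4 * E.ε * E.OPT)
      have h2 : (⌊4 * E.ε * E.OPT⌋₊ : ℝ) - E.g ≤ ((⌊4 * E.ε * E.OPT⌋₊ - E.g : ℕ) : ℝ) := by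
        rw [sub_le_iff_le_add]
        exact_mod_cast Nat.sub_le_iff_le_add.1 le_rfl
      have h3 := E.g_le
      have h4 := E.gR_le
      have h5 : 2 * (E.ε * E.OPT) ≤ ((⌊4 * E.ε * E.OPT⌋₊ - E.g : ℕ) : ℝ) := by linarith
      push_cast
      have h6 : E.ε * E.OPT ≤ 1 / 16 * E.OPT := mul_le_mul_of_nonneg_right h hO.le
      calc E.ε / 2 * (E.g * E.R + (E.OPT / 3 : ℕ)) ≤ E.ε / 2 * (3 * E.OPT) :=
            mul_le_mul_of_nonneg_left (by linarith) (by linarith)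
        _ ≤ (1 - 1 / 32) * (2 * (E.ε * E.OPT)) := by
            have : 0 ≤ E.ε * E.OPT := by positivity
            linarith
        _ ≤ _ := mul_le_mul (by linarith) h5 (by positivity) (by linarith)
  obtain ⟨ρ, ρfin, res, rest, P, c, c1, c2, c3, c4, c5, c6, c7, c8, c9, c10⟩ :=
    Z.mainData.exists_rounded_packing φ hφ0 hφ1 hcond E.D_pos (E.V.image E.I.h) E.K E.colBound
      ⌊E.μ * E.I.W⌋₊ Z.runs (fun i hi => mem_image_of_mem _ hi) card_heights_le
      (fun i hi => Nat.le_floor (mem_V.1 hi).1.le) hBg card_column_le le_rfl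
  have hcard : (Fintype.card ρ : ℝ) ≤ 1075 * 10 ^ 6 * (E.ε⁻¹ ^ 5 * E.δ⁻¹ ^ 7) := by
    refine le_trans ?_ (boxes_le Z)
    exact_mod_cast c2
  have hVW : ∀ i ∈ E.V, 1 < E.μ * E.I.W := fun i hi =>
    lt_of_le_of_lt (by exact_mod_cast E.I.w_pos i) (mem_V.1 hi).1
  refine ⟨ρ, ρfin, res, rest, P, c, c1, hcard, c3, c4, c5, c6, c7, ?_, fun i hi => ?_, c10⟩
  · by_cases hne : rest = ∅
    · rw [hne, sum_empty, Nat.cast_zero, zero_mul]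
      exact (mul_pos E.εδ_pos E.W_pos).le
    obtain ⟨i, hi⟩ := nonempty_iff_ne_empty.2 hne
    have h1 := hVW i (c7 hi)
    have h2 := Nat.floor_le (zero_le_one.trans h1.le)
    have h3 : ((∑ i ∈ rest, E.I.w i : ℕ) : ℝ) ≤
        Z.runs * (((E.K : ℝ) + 1) * E.colBound) * (1 + ⌊E.μ * E.I.W⌋₊) := by exact_mod_cast c8
    have h4 := boxes_le Z
    -- These exponents are one more than those in the number of boxes, so that this number times `μ`
    -- is a tiny multiple of `ε * δ`.
    have h5 := E.μ_le_pow 6 8 (by norm_num) (by norm_num)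
    set q := E.ε⁻¹ ^ 5 * E.δ⁻¹ ^ 7 with hq
    have hq1 : 1 ≤ q := one_le_inv_mul 5 7
    have e1 : E.ε ^ 6 * E.δ ^ 8 * q = E.ε * E.δ := by
      have := E.δ_pos.ne'
      have := hε.ne'
      rw [hq]
      field_simp
    have h6 : E.μ * q * 10 ^ 13 ≤ E.ε * E.δ := by
      rw [← e1]
      have := mul_le_mul_of_nonneg_right h5 (zero_le_one.trans hq1)
      linarith
    have h7 : Z.runs * (((E.K : ℝ) + 1) * E.colBound) ≤ 1075 * 10 ^ 6 * q := by
      refine le_trans (mul_le_mul_of_nonneg_left ?_ (Nat.cast_nonneg _)) h4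
      linarith
    have h8 : ((∑ i ∈ rest, E.I.w i : ℕ) : ℝ) ≤ 1075 * 10 ^ 6 * q * (2 * (E.μ * E.I.W)) :=
      h3.trans (mul_le_mul h7 (by linarith) (by positivity) (by positivity))
    have h9 := mul_le_mul_of_nonneg_right h6 E.W_pos.le
    have h10 : 0 ≤ E.μ * q * E.I.W := by
      have := E.μ_pos; have := E.W_pos; positivity
    linarith
  · obtain ⟨r, h1, h2, h3⟩ := c9 i hi
    refine ⟨r, h1, h2, ?_⟩
    rcases h3 with h3 | ⟨j, hj, h3⟩
    -- If `⌊ε * δ * W⌋₊ = 0`, then `D = 1` exceeds the permitted width. In this case `μ * W < 1`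
    -- excludes vertical items, and a box of width one that contains a tall item of its own height
    -- is exactly the area of that item.
    · change (res r).w ≤ E.D at h3
      by_cases h4 : 1 ≤ ⌊E.ε * E.δ * E.I.W⌋₊
      · left
        rw [D, max_eq_right h4] at h3
        exact (Nat.cast_le.2 h3).trans (Nat.floor_le (mul_pos E.εδ_pos E.W_pos).le)
      · right
        rw [D, max_eq_left (by omega)] at h3
        rw [not_le, Nat.lt_one_iff, Nat.floor_eq_zero] at h4
        rcases mem_union.1 (mem_sdiff.1 hi).1 with hiT | hiV
        · refine ⟨i, hiT, ?_⟩
          have h5 := E.I.w_pos i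
          change Rect.Inside ⟨(P i).1, (P i).2, E.I.w i, E.I.h i⟩ _ at h1
          change (res r).h = E.I.h i at h2
          unfold Rect.Inside at h1
          simp only at h1
          unfold StripInstance.itemRect
          ext <;> simp only <;> omega
        · exfalso
          have h5 := hVW i hiV
          have h6 := E.μ_le_pow 1 1 (by norm_num) (by norm_num)
          rw [pow_one, pow_one] at h6
          have h7 := mul_le_mul_of_nonneg_right h6 E.W_pos.le
          linarith
    · exact Or.inr ⟨j, hj, h3⟩

end Setup

/-! ### Area bounds for the small items. -/

namespace Setup

variable {n : ℕ} {E : Setup n} (Z : E.Stretched)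

lemma Stretched.width_crossing_le (F : Finset (Fin n)) (hF : F ⊆ E.A ∪ (E.H ∪ E.S))
    (hc : ∀ i ∈ F, CrossesRow E.g (Z.Y i) (E.I.h i)) : ∑ i ∈ F, E.I.w i ≤ E.R * E.I.W :=
  sum_width_crossing_le (fun i => (E.p i).1) Z.Y E.I.w E.I.h E.g E.R E.I.W F hc
    (fun i hi => ⟨(E.sol_inside i).1, Z.Y_in i (hF hi)⟩)
    fun i hi j hj => Z.Y_sep i (hF hi) j (hF hj)

/-- Horizontal items that cross a row fit into one extra row. -/
lemma Stretched.height_crossing_le (F : Finset (Fin n)) (hF : F ⊆ E.H)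
    (hc : ∀ i ∈ F, CrossesRow E.g (Z.Y i) (E.I.h i)) : ∑ i ∈ F, E.I.h i ≤ E.g := by
  have h1 : ((∑ i ∈ F, E.I.w i : ℕ) : ℝ) ≤ (E.R * E.I.W : ℕ) :=
    Nat.cast_le.2 (Z.width_crossing_le F
      (fun i hi => mem_union_right _ (mem_union_left _ (hF hi))) hc)
  push_cast at h1
  have h2 : ∑ i ∈ F, E.δ * E.I.W ≤ ∑ i ∈ F, (E.I.w i : ℝ) :=
    sum_le_sum fun i hi => (mem_H.1 (hF hi)).1
  have h3 : ∑ i ∈ F, (E.I.h i : ℝ) ≤ ∑ i ∈ F, E.μ * E.OPT :=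
    sum_le_sum fun i hi => (mem_H.1 (hF hi)).2.le
  rw [sum_const, nsmul_eq_mul] at h2 h3
  have h4 : ((F.card : ℝ) * E.δ) * E.I.W ≤ E.R * E.I.W := by linarith
  have h5 := mul_le_mul_of_nonneg_right (le_of_mul_le_mul_right h4 E.W_pos) E.εδ_pos.le
  have h6 := E.R_le
  have h7 := E.μ_le_pow 2 3 (by norm_num) (by norm_num)
  have h8 : ((∑ i ∈ F, E.I.h i : ℕ) : ℝ) ≤ E.g := by
    push_cast
    rw [E.g_eq]
    refine h3.trans ?_
    rw [← mul_assoc]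
    refine mul_le_mul_of_nonneg_right ?_ E.OPT_pos.le
    have h9 := mul_le_mul_of_nonneg_left h7 (Nat.cast_nonneg (α := ℝ) F.card)
    have h10 := mul_le_mul_of_nonneg_right (h5.trans h6) E.εδ_pos.le
    have h11 : 0 ≤ (F.card : ℝ) * E.μ := mul_nonneg (Nat.cast_nonneg _) E.μ_pos.le
    have h12 := E.εδ_pos
    have e : (F.card : ℝ) * (E.ε ^ 2 * E.δ ^ 3) = F.card * E.δ * (E.ε * E.δ) * (E.ε * E.δ) := by
      ring
    linarith
  exact_mod_cast h8

/-- The area of the reserved rectangles and of the small items outside of them. -/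
lemma Stretched.area_le (S' : Finset (Fin n)) (hS : S' ⊆ E.S)
    (hbox : ∀ i ∈ S', ¬ ∃ O ∈ Z.𝓞, (Z.rect i).Inside O) :
    ∑ i ∈ S', E.I.w i * E.I.h i + ∑ O ∈ Z.obs, O.w * O.h + ∑ i ∈ E.T ∪ E.V, E.I.w i * E.I.h i ≤
      E.I.W * (E.g * E.R) + ⌊E.μ * E.OPT⌋₊ * (E.R * E.I.W) := by
  classical
  have hSA : ∀ i ∈ S', i ∈ E.A ∪ (E.H ∪ E.S) := fun i hi =>
    mem_union_right _ (mem_union_right _ (hS hi))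
  have hTA : ∀ i ∈ E.T ∪ E.V, i ∈ E.A := fun i hi => mem_union_right _ hi
  -- Small items across a row line may overlap the strips, so their area is estimated separately:
  -- width at most `R * W` in total, height at most `μ * OPT`. The others lie outside the strips and
  -- are part of a packing together with obstacles, tall and vertical items.
  set Sc := S'.filter fun i => CrossesRow E.g (Z.Y i) (E.I.h i) with hSc
  set Sn := S'.filter fun i => ¬ CrossesRow E.g (Z.Y i) (E.I.h i) with hSn
  have h1 : ∑ i ∈ Sc, E.I.w i * E.I.h i + ∑ i ∈ Sn, E.I.w i * E.I.h i =
      ∑ i ∈ S', E.I.w i * E.I.h i := sum_filter_add_sum_filter_not _ _ _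
  have h2 : ∑ i ∈ Sc, E.I.w i * E.I.h i ≤ ⌊E.μ * E.OPT⌋₊ * (E.R * E.I.W) := by
    calc ∑ i ∈ Sc, E.I.w i * E.I.h i ≤ ∑ i ∈ Sc, E.I.w i * ⌊E.μ * E.OPT⌋₊ := by
          refine sum_le_sum fun i hi => Nat.mul_le_mul_left _ (Nat.le_floor ?_)
          exact (mem_S.1 (hS (mem_filter.1 hi).1)).2.le
      _ = ⌊E.μ * E.OPT⌋₊ * ∑ i ∈ Sc, E.I.w i := by rw [← sum_mul, mul_comm]
      _ ≤ _ := Nat.mul_le_mul_left _ (Z.width_crossing_le Sc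
          (fun i hi => hSA i (mem_filter.1 hi).1) fun i hi => (mem_filter.1 hi).2)
  have hSnTV : Disjoint Sn (E.T ∪ E.V) := Finset.disjoint_left.2 fun i h3 h4 =>
    Finset.disjoint_left.1 E.disj_LTV_HS (hTA i h4) (mem_union_right _ (hS (mem_filter.1 h3).1))
  have hmem : ∀ i ∈ Sn ∪ (E.T ∪ E.V), i ∈ E.A ∪ (E.H ∪ E.S) := fun i hi => by
    rcases mem_union.1 hi with h | h
    · exact hSA i (mem_filter.1 h).1
    · exact mem_union_left _ (hTA i h)
  have hobs : ∀ O ∈ Z.obs, ∀ i ∈ Sn ∪ (E.T ∪ E.V), O.Sep (Z.rect i) := by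
    intro O hO i hi
    refine Rect.Sep.symm ?_
    rcases Z.mem_obs.1 hO with ⟨j, hj, rfl⟩ | hO
    · refine Z.Y_sep i (hmem i hi) j (mem_union_left _ (mem_union_left _ hj)) ?_
      rintro rfl
      rcases mem_union.1 hi with h | h
      · exact Finset.disjoint_left.1 E.disj_LTV_HS (mem_union_left _ hj)
          (mem_union_right _ (hS (mem_filter.1 h).1))
      · rcases mem_union.1 h with h | h
        · exact Finset.disjoint_left.1 E.disj_L_T hj h
        · exact Finset.disjoint_left.1 E.disj_L_V hj h
    · rcases mem_union.1 hi with h | h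
      · obtain ⟨hi, hc⟩ := mem_filter.1 h
        exact ((Z.small i (hS hi)).resolve_left hc).resolve_left (hbox i hi) O hO
      · exact Z.item_box i (hTA i h) O hO
  have h3 := sum_area_le (Z.obs.disjSum (Sn ∪ (E.T ∪ E.V))) (Sum.elim id Z.rect)
    ⟨0, 0, E.I.W, E.g * E.R⟩ (by
      rintro (O | i) hi
      · exact (Z.obs_inside (inl_mem_disjSum.1 hi)).1
      · have h4 := Z.Y_in i (hmem i (inr_mem_disjSum.1 hi))
        have h5 := (E.sol_inside i).1
        unfold Rect.Inside
        simp only [Sum.elim_inr, rect]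
        omega) (by
      rintro (O | i) hi (O' | j) hj hij
      · exact (Z.obs_sep (inl_mem_disjSum.1 hi) (inl_mem_disjSum.1 hj)
          fun h => hij (by rw [h])).disjoint
      · exact (hobs O (inl_mem_disjSum.1 hi) j (inr_mem_disjSum.1 hj)).disjoint
      · exact (hobs O' (inl_mem_disjSum.1 hj) i (inr_mem_disjSum.1 hi)).symm.disjoint
      · exact (Z.Y_sep i (hmem i (inr_mem_disjSum.1 hi)) j (hmem j (inr_mem_disjSum.1 hj))
          fun h => hij (by rw [h])).disjoint)
  rw [sum_disjSum, sum_union hSnTV] at h3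
  simp only [Sum.elim_inl, Sum.elim_inr, id, rect] at h3
  omega

lemma inv_pow_mul_cancel : E.ε ^ 6 * E.δ ^ 7 * (E.ε⁻¹ ^ 5 * E.δ⁻¹ ^ 7) = E.ε := by
  have := E.δ_pos.ne'
  have := E.ε_pos.ne'
  field_simp

lemma floor_εOPT : E.ε * E.OPT ≤ 2 * ⌊E.ε * E.OPT⌋₊ := by
  have h1 := E.one_le_g.trans E.g_le
  have h2 := Nat.lt_floor_add_one (E.ε * E.OPT)
  have h3 : (1 : ℝ) ≤ ⌊E.ε * E.OPT⌋₊ := by exact_mod_cast Nat.le_floor (by exact_mod_cast h1)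
  linarith

/-- The summand 3 stands for the two medium boxes and the row of displaced horizontal items, `E.K`
for the boxes of remaining vertical items, one for each height. -/
lemma card_reserved_le (cρ : ℕ) (hρ : (cρ : ℝ) ≤ 1075 * 10 ^ 6 * (E.ε⁻¹ ^ 5 * E.δ⁻¹ ^ 7)) :
    ((cρ + (Z.obs.card + E.K) + 3 : ℕ) : ℝ) ≤ 11 * 10 ^ 8 * (E.ε⁻¹ ^ 5 * E.δ⁻¹ ^ 7) := by
  have h1 := Z.card_obs_le_inv
  have h2 := K_add_one_le (E := E)
  have h3 := inv_mul_le (E := E) (show 1 ≤ 5 by norm_num) (show 2 ≤ 7 by norm_num)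
  have h4 := inv_mul_le (E := E) (show 1 ≤ 5 by norm_num) (show 1 ≤ 7 by norm_num)
  have h5 := one_le_inv_mul (E := E) 5 7
  rw [pow_one] at h3 h4
  rw [pow_one] at h4
  push_cast
  linarith

/-- The waste of the small items is less than the area of the extra shelf. -/
lemma waste_lt (N Ht : ℕ) (hN : (N : ℝ) ≤ 11 * 10 ^ 8 * (E.ε⁻¹ ^ 5 * E.δ⁻¹ ^ 7))
    (hHt : (Ht : ℝ) ≤ 24 * E.OPT) :
    ⌊E.μ * E.OPT⌋₊ * (E.R * E.I.W) +
      (3 * N + 1) * (⌊E.μ * E.I.W⌋₊ * Ht + ⌊E.μ * E.OPT⌋₊ * E.I.W) <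
      E.I.W * ⌊E.ε * E.OPT⌋₊ := by
  set q := E.ε⁻¹ ^ 5 * E.δ⁻¹ ^ 7 with hq
  have hq1 : 1 ≤ q := one_le_inv_mul 5 7
  have hW := E.W_pos
  have hO := E.OPT_pos
  have hμ := E.μ_pos
  have h1 : (⌊E.μ * E.OPT⌋₊ : ℝ) ≤ E.μ * E.OPT := Nat.floor_le (by positivity)
  have h2 : (⌊E.μ * E.I.W⌋₊ : ℝ) ≤ E.μ * E.I.W := Nat.floor_le (by positivity)
  have hR : (E.R : ℝ) ≤ 14 * q := by
    have h3 := inv_mul_le (E := E) (show 1 ≤ 5 by norm_num) (show 1 ≤ 7 by norm_num)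
    rw [pow_one, pow_one] at h3
    have := R_le_inv (E := E)
    linarith
  have h3 : E.μ * q * 10 ^ 13 ≤ E.ε := by
    have h4 := mul_le_mul_of_nonneg_right (E.μ_le_pow 6 7 (by norm_num) (by norm_num))
      (zero_le_one.trans hq1)
    rw [hq, inv_pow_mul_cancel, ← hq] at h4
    linarith
  have h4 : (⌊E.μ * E.OPT⌋₊ : ℝ) * (E.R * E.I.W) ≤ (E.μ * E.OPT) * (14 * q * E.I.W) := by
    gcongr
  have h5 : (⌊E.μ * E.I.W⌋₊ : ℝ) * Ht + ⌊E.μ * E.OPT⌋₊ * E.I.W ≤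
      E.μ * E.I.W * (24 * E.OPT) + E.μ * E.OPT * E.I.W := by
    gcongr
  have h6 : (3 * (N : ℝ) + 1) ≤ 34 * 10 ^ 8 * q := by linarith
  have h7 : (3 * (N : ℝ) + 1) * (⌊E.μ * E.I.W⌋₊ * Ht + ⌊E.μ * E.OPT⌋₊ * E.I.W) ≤
      34 * 10 ^ 8 * q * (E.μ * E.I.W * (24 * E.OPT) + E.μ * E.OPT * E.I.W) :=
    mul_le_mul h6 h5 (by positivity) (by positivity)
  have h8 := mul_le_mul_of_nonneg_right h3 (mul_pos hW hO).le
  have h9 := mul_le_mul_of_nonneg_left (floor_εOPT (E := E)) hW.le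
  have h10 : 0 < E.μ * q * (E.I.W * E.OPT) := by positivity
  have h11 : ((⌊E.μ * E.OPT⌋₊ * (E.R * E.I.W) +
      (3 * N + 1) * (⌊E.μ * E.I.W⌋₊ * Ht + ⌊E.μ * E.OPT⌋₊ * E.I.W) : ℕ) : ℝ) <
      (E.I.W * ⌊E.ε * E.OPT⌋₊ : ℕ) := by
    push_cast
    linarith
  exact_mod_cast h11

end Setup

/-! ### Assembling the packing. -/

namespace Setup

variable {n : ℕ} (E : Setup n)

/-- Where the box for medium items and the remaining vertical items is placed. -/
lemma exists_layout : ∃ (φ : ℝ) (x₀ y₀ top : ℕ), (φ = 0 ∨ φ = E.ε / 2 ∧ E.ε ≤ 1 / 16) ∧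
    (∀ c : ℕ, (c : ℝ) ≤ (1 - φ) * E.I.W → c ≤ x₀ ∨ E.g * E.R + E.OPT / 3 ≤ y₀) ∧
    E.g * E.R ≤ y₀ ∧ y₀ + E.OPT / 3 = top ∧ E.g * E.R + E.OPT / 3 ≤ top ∧
    (∀ r : ℕ, (r : ℝ) * 1000 ≤ E.ε * E.δ * E.I.W → x₀ + ⌊E.ε * E.I.W / 3⌋₊ + r ≤ E.I.W) ∧
    (top : ℝ) ≤ (4 / 3 + 19 * E.ε) * E.OPT := by
  have hε := E.ε_pos
  have hW := E.W_pos
  have hO := E.OPT_pos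
  have hgR := E.gR_le
  have hB : ((E.OPT / 3 : ℕ) : ℝ) ≤ E.OPT / 3 := Nat.cast_div_le
  have hεW : 0 < E.ε * E.I.W := mul_pos hε hW
  have hεO : 0 < E.ε * E.OPT := mul_pos hε hO
  have h1 : (⌊E.ε * E.I.W / 3⌋₊ : ℝ) ≤ E.ε * E.I.W / 3 := Nat.floor_le (by positivity)
  have h2 : E.ε * E.δ * E.I.W ≤ E.ε * E.I.W := by
    have := mul_le_mul_of_nonneg_left E.δ_le hεW.le
    linarith
  -- For small `ε` the layer of left-over columns has `ε * W / 2` of free width, enough for the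
  -- medium box of width `ε * W / 3` and the remaining vertical items. Otherwise a further layer of
  -- height `OPT / 3 < 16 / 3 * ε * OPT` is affordable.
  by_cases h : E.ε ≤ 1 / 16
  · refine ⟨E.ε / 2, ⌊(1 - E.ε / 2) * E.I.W⌋₊, E.g * E.R, E.g * E.R + E.OPT / 3, Or.inr ⟨rfl, h⟩,
      fun c hc => Or.inl (Nat.le_floor hc), le_rfl, rfl, le_rfl, fun r hr => ?_, ?_⟩
    · have h3 : (⌊(1 - E.ε / 2) * E.I.W⌋₊ : ℝ) ≤ (1 - E.ε / 2) * E.I.W :=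
        Nat.floor_le (mul_nonneg (by linarith) hW.le)
      have h4 : ((⌊(1 - E.ε / 2) * E.I.W⌋₊ + ⌊E.ε * E.I.W / 3⌋₊ + r : ℕ) : ℝ) ≤ E.I.W := by
        push_cast
        linarith
      exact_mod_cast h4
    · push_cast
      linarith
  · refine ⟨0, 0, E.g * E.R + E.OPT / 3, E.g * E.R + E.OPT / 3 + E.OPT / 3, Or.inl rfl,
      fun c hc => Or.inr le_rfl, Nat.le_add_right _ _, rfl, Nat.le_add_right _ _, fun r hr => ?_, ?_⟩
    · have h3 := mul_lt_mul_of_pos_right E.ε_lt hW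
      have h4 : ((0 + ⌊E.ε * E.I.W / 3⌋₊ + r : ℕ) : ℝ) ≤ E.I.W := by
        push_cast
        linarith
      exact_mod_cast h4
    · have h3 := mul_lt_mul_of_pos_right (not_le.1 h) hO
      push_cast
      linarith

lemma mem_medium {i : Fin n} :
    i ∈ E.I.medium E.δ E.μ E.OPT ↔ i ∉ E.A ∪ (E.H ∪ E.S) := by
  simp only [A, L, T, V, H, S, mem_union, mem_filter, mem_univ, true_and, StripInstance.medium,
    Set.mem_compl_iff, Set.mem_union, or_assoc]

/-- The structured packing. -/
theorem exists_structured_packing (hM : E.I.MediumPackable E.ε E.δ E.μ E.OPT) :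
    ∃ (Ht : ℕ) (p : Fin n → ℕ × ℕ) (N : ℕ) (box : Fin N → Rect) (a : Fin n → Fin N)
      (m₁ m₂ : Fin N),
      (Ht : ℝ) ≤ (4 / 3 + 22 * E.ε) * E.OPT ∧
      E.I.IsSolution Ht p ∧
      Rect.IsPartition ⟨0, 0, E.I.W, Ht⟩ box ∧
      (N : ℝ) ≤ 45 * 10 ^ 8 * (E.ε⁻¹ ^ 5 * E.δ⁻¹ ^ 7) ∧
      (∀ i, (E.I.itemRect p i).Inside (box (a i))) ∧
      (∀ i ∈ E.I.large E.δ E.OPT, ∀ j, a j = a i → j = i) ∧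
      m₁ ≠ m₂ ∧
      (box m₁).w = E.I.W ∧ (box m₁).h = ⌊E.ε * E.OPT⌋₊ ∧
      (box m₂).w = ⌊E.ε * E.I.W / 3⌋₊ ∧ (box m₂).h = E.OPT / 3 ∧
      (∀ i, (a i = m₁ ∨ a i = m₂) ↔ i ∈ E.I.medium E.δ E.μ E.OPT) ∧
      (∀ i ∈ E.I.tall E.δ E.OPT ∪ E.I.vertical E.δ E.μ E.OPT,
        E.I.IsVerticalBox E.ε E.δ E.OPT p (box (a i)) ∧ (box (a i)).h = E.I.h i) ∧
      (∀ i ∈ E.I.horizontal E.δ E.μ E.OPT,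
        StripInstance.IsHorizontalBox E.ε E.δ E.OPT (box (a i))) := by
  classical
  obtain ⟨Z⟩ := E.nonempty_stretched
  obtain ⟨φ, x₀, y₀, top, hφ, hx₀, hy₀, htop, htop', hfit, htopR⟩ := E.exists_layout
  obtain ⟨ρ, ρfin, res, rest, P, c, c1, c2, c3, c4, c5, c6, c7, c8, c9, c10⟩ := Z.exists_core φ hφ
  obtain ⟨s, t, hst, ⟨ps, ps1, ps2⟩, pt, pt1, pt2⟩ := hM
  have hcx := hx₀ c c1
  have hfit' := hfit _ c8
  set m := ⌊E.ε * E.I.W / 3⌋₊ with hm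
  set B := E.OPT / 3 with hB
  set e := ⌊E.ε * E.OPT⌋₊ with he
  set Hs := E.V.image E.I.h with hHs
  -- remaining vertical items
  let wθ : ℕ → ℕ := fun θ => ∑ i ∈ rest with E.I.h i = θ, E.I.w i
  obtain ⟨pos, pos1, pos2⟩ := exists_line_positions wθ Hs
  choose pin pin1 pin2 using fun θ => exists_line_positions E.I.w (rest.filter (E.I.h · = θ))
  have hwθ : ∑ θ ∈ Hs, wθ θ = ∑ i ∈ rest, E.I.w i :=
    sum_fiberwise_of_maps_to (fun i hi => mem_image_of_mem _ (c7 hi)) E.I.w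
  have hHsB : ∀ θ ∈ Hs, θ ≤ B := by
    intro θ hθ
    obtain ⟨i, hi, rfl⟩ := mem_image.1 hθ
    have h1 := (mem_V.1 hi).2.2
    rw [le_div_iff₀ (by norm_num)] at h1
    have h2 : E.I.h i * 3 ≤ E.OPT := by exact_mod_cast h1
    omega
  -- displaced horizontal items
  let Hc := E.H.filter fun i => CrossesRow E.g (Z.Y i) (E.I.h i)
  have hHc : ∑ i ∈ Hc, E.I.h i ≤ E.g :=
    Z.height_crossing_le Hc (filter_subset _ _) fun i hi => (mem_filter.1 hi).2
  obtain ⟨ph, ph1, ph2⟩ := exists_line_positions E.I.h Hc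
  -- small items that are packed into free rectangles
  let S' := E.S.filter fun i => ¬ ∃ O ∈ Z.𝓞, (Z.rect i).Inside O
  have hS' : ∀ i, i ∈ S' ↔ i ∈ E.S ∧ ¬ ∃ O ∈ Z.𝓞, (Z.rect i).Inside O := fun i => mem_filter
  -- reserved boxes
  let ρ' := Option (Option (Option (ρ ⊕ {O // O ∈ Z.obs} ⊕ {θ // θ ∈ Hs})))
  let bx : ρ' → Rect := fun r => match r with
    | none => ⟨0, top, E.I.W, e⟩
    | some none => ⟨x₀, y₀, m, B⟩
    | some (some none) => ⟨0, top + e, E.I.W, E.g⟩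
    | some (some (some (Sum.inl r))) => res r
    | some (some (some (Sum.inr (Sum.inl O)))) => O.1
    | some (some (some (Sum.inr (Sum.inr θ)))) => ⟨x₀ + m + pos θ.1, y₀, wθ θ.1, θ.1⟩
  have hres : ∀ r, (res r).x + (res r).w ≤ E.I.W ∧ ((res r).y + (res r).h ≤ E.g * E.R ∨
      (E.g * E.R ≤ (res r).y ∧ (res r).x + (res r).w ≤ c ∧
        (res r).y + (res r).h ≤ E.g * E.R + B)) := by
    intro r
    have hcW : c ≤ E.I.W := by
      have h1 : (c : ℝ) ≤ E.I.W := by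
        have h2 : 0 ≤ φ := by
          have := E.ε_pos
          rcases hφ with rfl | ⟨rfl, -⟩ <;> linarith
        have := mul_nonneg h2 E.W_pos.le
        linarith
      exact_mod_cast h1
    rcases c3 r with h | h <;> unfold Rect.Inside at h <;> simp only at h <;> omega
  have hobs : ∀ O ∈ Z.obs, O.x + O.w ≤ E.I.W ∧ O.y + O.h ≤ E.g * E.R := by
    intro O hO
    have h := (Z.obs_inside hO).1
    unfold Rect.Inside at h
    simp only at h
    omega
  have hleft : ∀ θ ∈ Hs, pos θ + wθ θ ≤ E.I.W - (x₀ + m) ∧ θ ≤ B := by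
    intro θ hθ
    have := pos1 θ hθ
    exact ⟨by omega, hHsB θ hθ⟩
  -- Above `top` follow the wide medium box, the row for displaced horizontal items and an empty
  -- shelf of height `e` for the small items. Each adds at most `ε * OPT`.
  let Ht := top + e + E.g + e
  have hinner : ∀ x : ρ ⊕ {O // O ∈ Z.obs} ⊕ {θ // θ ∈ Hs},
      (bx (some (some (some x)))).x + (bx (some (some (some x)))).w ≤ E.I.W ∧
      (bx (some (some (some x)))).y + (bx (some (some (some x)))).h ≤ top ∧
      (⟨x₀, y₀, m, B⟩ : Rect).Sep (bx (some (some (some x)))) := by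
    rintro (r | O | θ)
    · have h1 := hres r
      unfold Rect.Sep
      simp only [bx]
      omega
    · have h1 := hobs O.1 O.2
      unfold Rect.Sep
      simp only [bx]
      omega
    · have h1 := hleft θ.1 θ.2
      unfold Rect.Sep
      simp only [bx]
      omega
  have hinner2 : ∀ x x' : ρ ⊕ {O // O ∈ Z.obs} ⊕ {θ // θ ∈ Hs}, x ≠ x' →
      (bx (some (some (some x)))).Sep (bx (some (some (some x')))) := by
    have hθ1 : ∀ (r : ρ) (θ : {θ // θ ∈ Hs}),
        (res r).Sep ⟨x₀ + m + pos θ.1, y₀, wθ θ.1, θ.1⟩ := fun r θ => by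
      have h1 := hres r
      unfold Rect.Sep
      simp only
      omega
    have hθ2 : ∀ (O : {O // O ∈ Z.obs}) (θ : {θ // θ ∈ Hs}),
        O.1.Sep ⟨x₀ + m + pos θ.1, y₀, wθ θ.1, θ.1⟩ := fun O θ => by
      have h1 := hobs O.1 O.2
      unfold Rect.Sep
      simp only
      omega
    rintro (r | O | θ) (r' | O' | θ') hne
    · exact c4 r r' fun h => hne (by rw [h])
    · exact c5 r O'.1 O'.2
    · exact hθ1 r θ'
    · exact (c5 r' O.1 O.2).symm
    · exact Z.obs_sep O.2 O'.2 fun h => hne (by rw [Subtype.ext h])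
    · exact hθ2 O θ'
    · exact (hθ1 r' θ).symm
    · exact (hθ2 O' θ).symm
    · have := pos2 θ.1 θ.2 θ'.1 θ'.2 fun h => hne (by rw [Subtype.ext h])
      unfold Rect.Sep
      simp only [bx]
      omega
  have hbxin : ∀ r, (bx r).Inside ⟨0, 0, E.I.W, Ht⟩ := by
    rintro (_ | _ | _ | x)
    · unfold Rect.Inside
      simp only [bx, Ht]
      omega
    · unfold Rect.Inside
      simp only [bx, Ht]
      omega
    · unfold Rect.Inside
      simp only [bx, Ht]
      omega
    · have := hinner x
      unfold Rect.Inside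
      simp only [Ht]
      omega
  have hbxsep : ∀ r r', r ≠ r' → (bx r).Sep (bx r') := by
    have h0 : ∀ r, r ≠ none → (bx none).Sep (bx r) := by
      rintro (_ | _ | _ | x) hne
      · exact absurd rfl hne
      · exact Or.inr (Or.inr (Or.inr htop.le))
      · exact Or.inr (Or.inr (Or.inl le_rfl))
      · exact Or.inr (Or.inr (Or.inr (hinner x).2.1))
    have h1 : ∀ r, r ≠ none → (bx (some none)).Sep (bx (some r)) := by
      rintro (_ | _ | x) hne
      · exact absurd rfl hne
      · exact Or.inr (Or.inr (Or.inl (by simp only [bx]; omega)))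
      · exact (hinner x).2.2
    have h2 : ∀ x, (bx (some (some none))).Sep (bx (some (some (some x)))) := fun x => by
      have := (hinner x).2.1
      exact Or.inr (Or.inr (Or.inr (this.trans (Nat.le_add_right _ _))))
    rintro (_ | _ | _ | x) (_ | _ | _ | x') hne
    · exact absurd rfl hne
    · exact h0 _ hne.symm
    · exact h0 _ hne.symm
    · exact h0 _ hne.symm
    · exact (h0 _ hne).symm
    · exact absurd rfl hne
    · exact h1 (some none) (by simp)
    · exact h1 _ (by simp)
    · exact (h0 _ hne).symm
    · exact (h1 (some none) (by simp)).symm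
    · exact absurd rfl hne
    · exact h2 x'
    · exact (h0 _ hne).symm
    · exact (h1 _ (by simp)).symm
    · exact (h2 x).symm
    · exact hinner2 x x' fun h => hne (by rw [h])
  have hHtR : (Ht : ℝ) ≤ (4 / 3 + 22 * E.ε) * E.OPT := by
    have h1 : (e : ℝ) ≤ E.ε * E.OPT :=
      Nat.floor_le (mul_pos E.ε_pos E.OPT_pos).le
    have h2 := E.g_le
    simp only [Ht]
    push_cast
    linarith
  have hcard : Fintype.card ρ' ≤ Fintype.card ρ + (Z.obs.card + E.K) + 3 := by
    have h1 := card_heights_le (E := E)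
    rw [← hHs] at h1
    simp only [ρ', Fintype.card_option, Fintype.card_sum, Fintype.card_coe]
    omega
  have hcardR : (Fintype.card ρ' : ℝ) ≤ 11 * 10 ^ 8 * (E.ε⁻¹ ^ 5 * E.δ⁻¹ ^ 7) :=
    (Nat.cast_le.2 hcard).trans (card_reserved_le Z _ c2)
  -- The strip up to `g * R` pays for obstacles, tall, vertical and most small items; a layer of
  -- height `B` pays for the second medium box and the remaining vertical items. The empty shelf
  -- exceeds the area of crossing small items and the shelf waste, by `waste_lt`.
  have harea : ∑ i ∈ S', E.I.w i * E.I.h i + ∑ r, (bx r).w * (bx r).h +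
      (3 * Fintype.card ρ' + 1) * (⌊E.μ * E.I.W⌋₊ * Ht + ⌊E.μ * E.OPT⌋₊ * E.I.W) <
      E.I.W * Ht := by
    have h1 := waste_lt (E := E) (Fintype.card ρ') Ht hcardR (by
      have := mul_lt_mul_of_pos_right E.ε_lt E.OPT_pos
      have := E.OPT_pos
      linarith)
    rw [← he] at h1
    have h2 := Z.area_le S' (filter_subset _ _) fun i hi => ((hS' i).1 hi).2
    have h3 : ∑ θ : {θ // θ ∈ Hs}, wθ θ.1 * θ.1 + m * B ≤ E.I.W * B := by
      have h4 : ∑ θ : {θ // θ ∈ Hs}, wθ θ.1 * θ.1 ≤ (∑ θ ∈ Hs, wθ θ) * B := by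
        rw [← sum_coe_sort Hs wθ, sum_mul]
        exact sum_le_sum fun θ _ => Nat.mul_le_mul_left _ (hHsB θ.1 θ.2)
      rw [hwθ] at h4
      have h5 : (∑ i ∈ rest, E.I.w i + m) * B ≤ E.I.W * B := Nat.mul_le_mul_right _ (by omega)
      rw [add_mul] at h5
      omega
    have h6 : ∑ O : {O // O ∈ Z.obs}, O.1.w * O.1.h = ∑ O ∈ Z.obs, O.w * O.h :=
      sum_coe_sort Z.obs fun O => O.w * O.h
    have h7 : ∑ r, (bx r).w * (bx r).h = E.I.W * e + (m * B + (E.I.W * E.g +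
        (∑ r, (res r).w * (res r).h + (∑ O : {O // O ∈ Z.obs}, O.1.w * O.1.h +
          ∑ θ : {θ // θ ∈ Hs}, wθ θ.1 * θ.1)))) := by
      rw [Fintype.sum_option, Fintype.sum_option, Fintype.sum_option, Fintype.sum_sum_type,
        Fintype.sum_sum_type]
    have h8 : E.I.W * (E.g * E.R) + E.I.W * B ≤ E.I.W * top := by
      rw [← mul_add]; exact Nat.mul_le_mul_left _ htop'
    have h9 : E.I.W * Ht = E.I.W * top + E.I.W * e + E.I.W * E.g + E.I.W * e := by
      simp only [Ht, mul_add]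
    omega
  obtain ⟨N, box, emb, P', asg, n1, n2, n3, n4, n5, n6⟩ := exists_completed_partition E.I.W Ht bx
    hbxin (fun r r' h => (hbxsep r r' h).disjoint) E.I.w E.I.h ⌊E.μ * E.I.W⌋₊ ⌊E.μ * E.OPT⌋₊ S'
    (fun i _ => E.I.w_pos i) (fun i hi => Nat.le_floor (mem_S.1 ((hS' i).1 hi).1).1.le)
    (fun i hi => Nat.le_floor (mem_S.1 ((hS' i).1 hi).1).2.le) harea
  have hmed : ∀ i, i ∈ s ∪ t ↔ i ∉ E.A ∪ (E.H ∪ E.S) := fun i => by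
    rw [← hst]; exact E.mem_medium
  -- The ways in which an item outside `S'` may be placed at `q` in the reserved box `r`, together
  -- with all facts needed later. Only obstacles keep their items in stretched position; small items
  -- inside a strip stay there too.
  let Pl : Fin n → ρ' → ℕ × ℕ → Prop := fun i r q => match r with
    | none => i ∈ s ∧ q = ((ps i).1, top + (ps i).2)
    | some none => i ∈ t ∧ q = (x₀ + (pt i).1, y₀ + (pt i).2)
    | some (some none) => i ∈ Hc ∧ q = (0, top + e + ph i)
    | some (some (some (Sum.inl r))) => i ∈ (E.T ∪ E.V) \ rest ∧ q = P i ∧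
        (E.I.itemRect P i).Inside (res r) ∧ (res r).h = E.I.h i ∧
        (((res r).w : ℝ) ≤ E.ε * E.δ * E.I.W ∨ ∃ j ∈ E.T, res r = E.I.itemRect P j)
    | some (some (some (Sum.inr (Sum.inl O)))) => i ∈ E.L ∪ (E.H ∪ E.S) ∧
        (i ∈ E.L → O.1 = Z.rect i) ∧ (i ∈ E.H → O.1.h = E.g) ∧ q = ((E.p i).1, Z.Y i) ∧
        (Z.rect i).Inside O.1
    | some (some (some (Sum.inr (Sum.inr θ)))) => i ∈ rest ∧ E.I.h i = θ.1 ∧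
        q = (x₀ + m + pos θ.1 + pin θ.1 i, y₀)
  have hLHS : ∀ i, i ∈ E.L ∪ (E.H ∪ E.S) → i ∈ E.A ∪ (E.H ∪ E.S) := fun i hi => by
    rcases mem_union.1 hi with h | h
    · exact mem_union_left _ (mem_union_left _ h)
    · exact mem_union_right _ h
  have hTVA : ∀ i, i ∈ E.T ∪ E.V → i ∈ E.A := fun i hi => mem_union_right _ hi
  have hTVL : ∀ i, i ∈ E.T ∪ E.V → i ∉ E.L := fun i hi hL => by
    rcases mem_union.1 hi with h | h
    · exact Finset.disjoint_left.1 E.disj_L_T hL h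
    · exact Finset.disjoint_left.1 E.disj_L_V hL h
  have hAHS : ∀ i, i ∈ E.A → i ∉ E.H ∪ E.S := fun i hi => Finset.disjoint_left.1 E.disj_LTV_HS hi
  have hPlex : ∀ i, i ∉ S' → ∃ r q, Pl i r q := by
    intro i hiS
    by_cases hA : i ∈ E.A ∪ (E.H ∪ E.S)
    · rcases mem_union.1 hA with hA | hHS
      · rcases mem_union.1 hA with hL | hTV
        · refine ⟨some (some (some (Sum.inr (Sum.inl ⟨Z.rect i, Z.mem_obs.2 (Or.inl ⟨i, hL, rfl⟩)⟩)))),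
            _, mem_union_left _ hL, fun _ => rfl, fun hH => ?_, rfl, le_rfl, le_rfl, le_rfl, le_rfl⟩
          exact absurd (mem_union_left _ hH) (hAHS i hA)
        · by_cases hr : i ∈ rest
          · exact ⟨some (some (some (Sum.inr (Sum.inr ⟨E.I.h i, mem_image_of_mem _ (c7 hr)⟩)))), _,
              hr, rfl, rfl⟩
          · obtain ⟨r, h1, h2, h3⟩ := c9 i (mem_sdiff.2 ⟨hTV, hr⟩)
            exact ⟨some (some (some (Sum.inl r))), _, mem_sdiff.2 ⟨hTV, hr⟩, rfl, h1, h2, h3⟩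
      · have hnL : i ∉ E.L := fun hL => hAHS i (mem_union_left _ hL) hHS
        have hbox : (∃ O ∈ Z.𝓞, (Z.rect i).Inside O) → ∃ r q, Pl i r q := by
          rintro ⟨O, hO, h1⟩
          exact ⟨some (some (some (Sum.inr (Sum.inl ⟨O, Z.mem_obs.2 (Or.inr hO)⟩)))), _,
            mem_union_right _ hHS, fun h => absurd h hnL, fun _ => (Z.box_in O hO).2.2.2.1, rfl, h1⟩
        rcases mem_union.1 hHS with hH | hS
        · rcases Z.horizontal i hH with h | h
          · exact ⟨some (some none), _, mem_filter.2 ⟨hH, h⟩, rfl⟩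
          · exact hbox h
        · exact hbox (not_not.1 fun h => hiS ((hS' i).2 ⟨hS, h⟩))
    · rcases (hmed i).2 hA with h | h
      · exact ⟨none, _, h, rfl⟩
      · exact ⟨some none, _, h, rfl⟩
  have hPlin : ∀ i r q, Pl i r q → Rect.Inside ⟨q.1, q.2, E.I.w i, E.I.h i⟩ (bx r) := by
    rintro i (_ | _ | _ | r | O | θ) q hq
    · obtain ⟨h1, rfl⟩ := hq
      have := ps1 i h1
      unfold Rect.Inside StripInstance.itemRect at *
      simp only [bx] at *
      omega
    · obtain ⟨h1, rfl⟩ := hq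
      have := pt1 i h1
      unfold Rect.Inside StripInstance.itemRect at *
      simp only [bx] at *
      omega
    · obtain ⟨h1, rfl⟩ := hq
      have h2 := ph1 i h1
      have h3 := (E.sol_inside i).1
      unfold Rect.Inside
      simp only [bx]
      omega
    · obtain ⟨h1, rfl, h2, -⟩ := hq
      exact h2
    · obtain ⟨h1, -, -, rfl, h2⟩ := hq
      exact h2
    · obtain ⟨h1, h2, rfl⟩ := hq
      have h3 := pin1 θ.1 i (mem_filter.2 ⟨h1, h2⟩)
      change _ ≤ wθ θ.1 at h3
      unfold Rect.Inside
      simp only [bx]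
      omega
  have hPlsep : ∀ i j r q q', i ≠ j → Pl i r q → Pl j r q' →
      Disjoint (⟨q.1, q.2, E.I.w i, E.I.h i⟩ : Rect).cells
        (⟨q'.1, q'.2, E.I.w j, E.I.h j⟩ : Rect).cells := by
    rintro i j (_ | _ | _ | r | O | θ) q q' hij hq hq'
    · obtain ⟨h1, rfl⟩ := hq
      obtain ⟨h1', rfl⟩ := hq'
      have h2 := Rect.sep_of_disjoint (ps2 i h1 j h1' hij) (E.I.w_pos i) (E.I.h_pos i) (E.I.w_pos j)
        (E.I.h_pos j)
      refine Rect.Sep.disjoint ?_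
      unfold Rect.Sep StripInstance.itemRect at *
      simp only at *
      omega
    · obtain ⟨h1, rfl⟩ := hq
      obtain ⟨h1', rfl⟩ := hq'
      have h2 := Rect.sep_of_disjoint (pt2 i h1 j h1' hij) (E.I.w_pos i) (E.I.h_pos i) (E.I.w_pos j)
        (E.I.h_pos j)
      refine Rect.Sep.disjoint ?_
      unfold Rect.Sep StripInstance.itemRect at *
      simp only at *
      omega
    · obtain ⟨h1, rfl⟩ := hq
      obtain ⟨h1', rfl⟩ := hq'
      have h2 := ph2 i h1 j h1' hij
      refine Rect.Sep.disjoint ?_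
      unfold Rect.Sep
      simp only
      omega
    · obtain ⟨h1, rfl, -⟩ := hq
      obtain ⟨h1', rfl, -⟩ := hq'
      exact (c10 i h1 j h1' hij).disjoint
    · obtain ⟨h1, -, -, rfl, -⟩ := hq
      obtain ⟨h1', -, -, rfl, -⟩ := hq'
      exact (Z.Y_sep i (hLHS i h1) j (hLHS j h1') hij).disjoint
    · obtain ⟨h1, h2, rfl⟩ := hq
      obtain ⟨h1', h2', rfl⟩ := hq'
      have h3 := pin2 θ.1 i (mem_filter.2 ⟨h1, h2⟩) j (mem_filter.2 ⟨h1', h2'⟩) hij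
      refine Rect.Sep.disjoint ?_
      unfold Rect.Sep
      simp only
      omega
  have hPlM : ∀ i r q, Pl i r q → ((r = none ∨ r = some none) ↔ i ∈ s ∪ t) := by
    rintro i (_ | _ | _ | r | O | θ) q hq
    · exact iff_of_true (Or.inl rfl) (Or.inl hq.1)
    · exact iff_of_true (Or.inr rfl) (Or.inr hq.1)
    all_goals refine iff_of_false (by rintro (h | h) <;> cases h) fun h => (hmed i).1 h ?_
    · exact mem_union_right _ (mem_union_left _ (mem_filter.1 hq.1).1)
    · exact mem_union_left _ (hTVA i (mem_sdiff.1 hq.1).1)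
    · exact hLHS i hq.1
    · exact mem_union_left _ (hTVA i (mem_union_right _ (c7 hq.1)))
  have hPlT : ∀ i r q, Pl i r q → i ∈ E.T → q = P i := by
    rintro i (_ | _ | _ | r | O | θ) q hq hT
    · exact absurd (mem_union_left _ (hTVA i (mem_union_left _ hT))) ((hmed i).1 (Or.inl hq.1))
    · exact absurd (mem_union_left _ (hTVA i (mem_union_left _ hT))) ((hmed i).1 (Or.inr hq.1))
    · exact absurd (mem_union_left _ (mem_filter.1 hq.1).1) (hAHS i (hTVA i (mem_union_left _ hT)))
    · exact hq.2.1
    · rcases mem_union.1 hq.1 with h | h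
      · exact absurd h (hTVL i (mem_union_left _ hT))
      · exact absurd h (hAHS i (hTVA i (mem_union_left _ hT)))
    · exact absurd (c7 hq.1) (Finset.disjoint_left.1 E.disj_T_V hT)
  have hPlTV : ∀ i r q, Pl i r q → i ∈ E.T ∪ E.V → (bx r).h = E.I.h i ∧
      (((bx r).w : ℝ) ≤ E.ε * E.δ * E.I.W ∨ ∃ j ∈ E.T, bx r = E.I.itemRect P j) := by
    rintro i (_ | _ | _ | r | O | θ) q hq hTV
    · exact absurd (mem_union_left _ (hTVA i hTV)) ((hmed i).1 (Or.inl hq.1))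
    · exact absurd (mem_union_left _ (hTVA i hTV)) ((hmed i).1 (Or.inr hq.1))
    · exact absurd (mem_union_left _ (mem_filter.1 hq.1).1) (hAHS i (hTVA i hTV))
    · exact hq.2.2.2
    · rcases mem_union.1 hq.1 with h | h
      · exact absurd h (hTVL i hTV)
      · exact absurd h (hAHS i (hTVA i hTV))
    · refine ⟨hq.2.1.symm, Or.inl ?_⟩
      have h1 : wθ θ.1 ≤ ∑ i ∈ rest, E.I.w i := by
        rw [← hwθ]
        exact single_le_sum (fun _ _ => Nat.zero_le _) θ.2
      have h2 : ((wθ θ.1 : ℕ) : ℝ) ≤ ((∑ i ∈ rest, E.I.w i : ℕ) : ℝ) := Nat.cast_le.2 h1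
      have h3 : (0 : ℝ) ≤ ((∑ i ∈ rest, E.I.w i : ℕ) : ℝ) := Nat.cast_nonneg _
      change ((wθ θ.1 : ℕ) : ℝ) ≤ _
      linarith
  have hPlH : ∀ i r q, Pl i r q → i ∈ E.H → (bx r).h = E.g := by
    rintro i (_ | _ | _ | r | O | θ) q hq hH
    · exact absurd (mem_union_right _ (mem_union_left _ hH)) ((hmed i).1 (Or.inl hq.1))
    · exact absurd (mem_union_right _ (mem_union_left _ hH)) ((hmed i).1 (Or.inr hq.1))
    · rfl
    · exact absurd (mem_union_left _ hH) (hAHS i (hTVA i (mem_sdiff.1 hq.1).1))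
    · exact hq.2.2.1 hH
    · exact absurd (mem_union_left _ hH) (hAHS i (hTVA i (mem_union_right _ (c7 hq.1))))
  have hPlL : ∀ i r q, Pl i r q → i ∈ E.L → bx r = ⟨q.1, q.2, E.I.w i, E.I.h i⟩ := by
    rintro i (_ | _ | _ | r | O | θ) q hq hL
    · exact absurd (mem_union_left _ (mem_union_left _ hL)) ((hmed i).1 (Or.inl hq.1))
    · exact absurd (mem_union_left _ (mem_union_left _ hL)) ((hmed i).1 (Or.inr hq.1))
    · exact absurd (mem_union_left _ (mem_filter.1 hq.1).1) (hAHS i (mem_union_left _ hL))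
    · exact absurd hL (hTVL i (mem_sdiff.1 hq.1).1)
    · obtain ⟨-, h1, -, rfl, -⟩ := hq
      exact h1 hL
    · exact absurd hL (hTVL i (mem_union_right _ (c7 hq.1)))
  have hnonS : ∀ i, i ∈ S' → i ∈ E.S := fun i hi => ((hS' i).1 hi).1
  have hAS : ∀ i, i ∈ E.A → i ∉ S' := fun i hi h => hAHS i hi (mem_union_right _ (hnonS i h))
  have hHS : ∀ i, i ∈ E.H → i ∉ S' := fun i hi h =>
    Finset.disjoint_left.1 E.disj_H_S hi (hnonS i h)
  have hex : ∀ i, ∃ rq : ρ' × (ℕ × ℕ), i ∉ S' → Pl i rq.1 rq.2 := by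
    intro i
    by_cases hi : i ∈ S'
    · exact ⟨(none, 0), fun h => absurd hi h⟩
    · obtain ⟨r, q, h⟩ := hPlex i hi
      exact ⟨(r, q), fun _ => h⟩
  choose rq hrq using hex
  let p : Fin n → ℕ × ℕ := fun i => if i ∈ S' then P' i else (rq i).2
  let a : Fin n → Fin N := fun i => if i ∈ S' then asg i else emb (rq i).1
  have hp1 : ∀ i, i ∈ S' → p i = P' i := fun i hi => if_pos hi
  have hp2 : ∀ i, i ∉ S' → p i = (rq i).2 := fun i hi => if_neg hi
  have ha1 : ∀ i, i ∈ S' → a i = asg i := fun i hi => if_pos hi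
  have ha2 : ∀ i, i ∉ S' → a i = emb (rq i).1 := fun i hi => if_neg hi
  have hr1 : ∀ i, i ∈ S' → E.I.itemRect p i = ⟨(P' i).1, (P' i).2, E.I.w i, E.I.h i⟩ := fun i hi => by
    rw [StripInstance.itemRect, hp1 i hi]
  have hr2 : ∀ i, i ∉ S' → E.I.itemRect p i = ⟨(rq i).2.1, (rq i).2.2, E.I.w i, E.I.h i⟩ :=
    fun i hi => by rw [StripInstance.itemRect, hp2 i hi]
  have hin : ∀ i, (E.I.itemRect p i).Inside (box (a i)) := by
    intro i
    by_cases hi : i ∈ S'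
    · rw [hr1 i hi, ha1 i hi]
      exact (n5 i hi).1
    · rw [hr2 i hi, ha2 i hi, n3]
      exact hPlin i _ _ (hrq i hi)
  have hane : ∀ i j, i ∈ S' → j ∉ S' → a i ≠ a j := by
    intro i j hi hj
    rw [ha1 i hi, ha2 j hj]
    exact (n5 i hi).2 _
  have hdis : ∀ i j, i ≠ j → Disjoint (E.I.itemRect p i).cells (E.I.itemRect p j).cells := by
    intro i j hij
    by_cases he : a i = a j
    · by_cases hi : i ∈ S' <;> by_cases hj : j ∈ S'
      · rw [hr1 i hi, hr1 j hj]
        exact n6 i hi j hj hij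
      · exact absurd he (hane i j hi hj)
      · exact absurd he.symm (hane j i hj hi)
      · rw [ha2 i hi, ha2 j hj] at he
        have h1 := hrq j hj
        rw [← n2 he] at h1
        rw [hr2 i hi, hr2 j hj]
        exact hPlsep i j _ _ _ hij (hrq i hi) h1
    · exact disjoint_of_subset_left (hin i).cells_subset
        (disjoint_of_subset_right (hin j).cells_subset (n4.2.1 _ _ he))
  refine ⟨Ht, p, N, box, a, emb none, emb (some none), hHtR, ⟨fun i _ => (hin i).trans (n4.1 _),
    fun i _ j _ hij => hdis i j hij⟩, n4, ?_, hin, ?_, fun h => ?_, ?_, ?_, ?_, ?_, fun i => ?_,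
    fun i hi => ?_, fun i hi => ?_⟩
  · have h1 : (N : ℝ) ≤ 4 * Fintype.card ρ' + 1 := by exact_mod_cast n1
    have h2 := one_le_inv_mul (E := E) 5 7
    linarith
  · intro i hi j hji
    have hiL : i ∈ E.L := mem_L.2 hi
    have hiS := hAS i (mem_union_left _ hiL)
    -- The box of a large item is exactly its rectangle, so another item in it would be both
    -- contained in that rectangle and disjoint from it.
    by_contra hne
    have h1 := hdis j i hne
    have h2 := hin j
    rw [hji, ha2 i hiS, n3, hPlL i _ _ (hrq i hiS) hiL, ← hr2 i hiS] at h2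
    have h3 := h1.eq_bot_of_le h2.cells_subset
    have h4 := congrArg Finset.card h3
    rw [Rect.card_cells] at h4
    have h5 := Nat.mul_pos (E.I.w_pos j) (E.I.h_pos j)
    simp only [StripInstance.itemRect, bot_eq_empty, card_empty] at h4
    omega
  · cases n2 h
  · rw [n3]
  · rw [n3]
  · rw [n3]
  · rw [n3]
  · rw [hst]
    by_cases hi : i ∈ S'
    · refine iff_of_false ?_ fun h => (hmed i).1 h (mem_union_right _ (mem_union_right _ (hnonS i hi)))
      rw [ha1 i hi]
      exact fun h => h.elim ((n5 i hi).2 _) ((n5 i hi).2 _)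
    · rw [ha2 i hi, ← hPlM i _ _ (hrq i hi), n2.eq_iff, n2.eq_iff]
  · have hiTV : i ∈ E.T ∪ E.V := mem_union.2 (hi.imp mem_T.2 mem_V.2)
    have hiS := hAS i (hTVA i hiTV)
    obtain ⟨h1, h2⟩ := hPlTV i _ _ (hrq i hiS) hiTV
    rw [ha2 i hiS, n3]
    refine ⟨?_, h1⟩
    rcases h2 with h2 | ⟨j, hj, h2⟩
    · exact Or.inl h2
    · refine Or.inr ⟨j, mem_T.1 hj, ?_⟩
      have hjS := hAS j (hTVA j (mem_union_left _ hj))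
      rw [h2, StripInstance.itemRect, StripInstance.itemRect, hp2 j hjS,
        hPlT j _ _ (hrq j hjS) hj]
  · have hiH : i ∈ E.H := mem_H.2 hi
    have hiS := hHS i hiH
    rw [ha2 i hiS, n3, StripInstance.IsHorizontalBox, hPlH i _ _ (hrq i hiS) hiH]
    exact E.g_eq

end Setup

/-! ### Existence of admissible parameters. -/

section Admissible

/-- The sequence of candidates for the parameters. -/
noncomputable def thresholds (ε : ℝ) (k : ℕ) : ℕ → ℝ
  | 0 => ε / 100
  | j + 1 => (ε * thresholds ε k j) ^ k

variable {ε : ℝ} {k : ℕ}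

lemma thresholds_pos (hε : 0 < ε) (j : ℕ) : 0 < thresholds ε k j := by
  induction j with
  | zero => exact div_pos hε (by norm_num)
  | succ j ih => exact pow_pos (mul_pos hε ih) k

lemma thresholds_succ_lt (hε : 0 < ε) (hε1 : ε < 1) (hk : k ≠ 0) (j : ℕ) :
    thresholds ε k j ≤ ε / 100 ∧ thresholds ε k (j + 1) < thresholds ε k j := by
  have key : ∀ j, thresholds ε k j ≤ ε / 100 → thresholds ε k (j + 1) < thresholds ε k j := by
    intro j hj
    have h0 := thresholds_pos (k := k) hε j
    have h1 : ε * thresholds ε k j < thresholds ε k j := by nlinarith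
    exact (pow_le_of_le_one (mul_pos hε h0).le (by linarith) hk).trans_lt h1
  induction j with
  | zero => exact ⟨le_rfl, key 0 le_rfl⟩
  | succ j ih =>
    have h := ih.2.le.trans ih.1
    exact ⟨h, key _ h⟩

lemma thresholds_antitone (hε : 0 < ε) (hε1 : ε < 1) (hk : k ≠ 0) : Antitone (thresholds ε k) :=
  antitone_nat_of_succ_le fun j => (thresholds_succ_lt hε hε1 hk j).2.le

/-- The intervals `[d (j + 1), d j)` of an antitone sequence are disjoint, so each index contributes
for at most one `j`. -/
lemma sum_intervals_le {ι : Type*} [Fintype ι] (d : ℕ → ℝ) (hd : Antitone d) (x : ι → ℝ)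
    (a : ι → ℕ) (N : ℕ) :
    ∑ j ∈ range N, ∑ i with d (j + 1) ≤ x i ∧ x i < d j, a i ≤ ∑ i, a i := by
  classical
  rw [← sum_biUnion]
  · exact sum_le_sum_of_subset (subset_univ _)
  · have key : ∀ j j' : ℕ, j < j' → Disjoint (univ.filter fun i => d (j + 1) ≤ x i ∧ x i < d j)
        (univ.filter fun i => d (j' + 1) ≤ x i ∧ x i < d j') := by
      intro j j' h
      rw [Finset.disjoint_left]
      intro i hi hi'
      have h1 := (mem_filter.1 hi).2.1
      have h2 := (mem_filter.1 hi').2.2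
      have h3 := hd (Nat.succ_le_of_lt h)
      rw [Nat.succ_eq_add_one] at h3
      linarith
    intro j _ j' _ hne
    rcases lt_or_gt_of_ne hne with h | h
    · exact key j j' h
    · exact (key j' j h).symm

variable {n : ℕ} (I : StripInstance n)

/-- If neither size lies between `μ` and `δ`, each of them is below `μ` or at least `δ`, and in all
four combinations the item belongs to one of the other classes. -/
lemma StripInstance.medium_cases {δ μ : ℝ} {OPT : ℕ} {i : Fin n} (hi : i ∈ I.medium δ μ OPT) :
    (μ * I.W ≤ I.w i ∧ (I.w i : ℝ) < δ * I.W) ∨ (μ * OPT ≤ I.h i ∧ (I.h i : ℝ) < δ * OPT) := by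
  simp only [medium, large, tall, vertical, horizontal, small, Set.mem_compl_iff, Set.mem_union,
    Set.mem_ofPred_eq, not_or, not_and_or, not_lt, not_le] at hi
  obtain ⟨⟨⟨⟨h1, h2⟩, h3⟩, h4⟩, h5⟩ := hi
  by_contra hc
  rw [not_or, not_and_or, not_and_or, not_le, not_lt, not_le, not_lt] at hc
  obtain ⟨h6 | h6, h7 | h7⟩ := hc
  · rcases h5 with h | h <;> linarith
  · by_cases h8 : (OPT : ℝ) / 3 < I.h i
    · rcases h3 with h | h | h
      · linarith
      · linarith
      · rcases h2 with h2 | h2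
        · rcases h1 with h1 | h1
          · linarith
          · linarith
        · linarith
    · rcases h3 with h | h | h <;> linarith
  · rcases h4 with h | h <;> linarith
  · rcases h1 with h | h <;> linarith

lemma StripInstance.isPacking_of_packIn {s : Finset (Fin n)} {a b : ℕ} {p : Fin n → ℕ × ℕ}
    (h : PackIn I.w I.h s a b p) : I.IsPacking (s : Set (Fin n)) a b p := by
  refine ⟨fun i hi => ?_, fun i hi j hj hij => (h.2 i hi j hj hij).disjoint⟩
  have := h.1 i hi
  unfold Rect.Inside itemRect
  simp only
  omega

lemma StripInstance.isPacking_of_packIn_swap {s : Finset (Fin n)} {a b : ℕ} {p : Fin n → ℕ × ℕ}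
    (h : PackIn I.h I.w s b a p) : I.IsPacking (s : Set (Fin n)) a b fun i => (p i).swap := by
  refine I.isPacking_of_packIn ⟨fun i hi => ?_, fun i hi j hj hij => ?_⟩
  · have := h.1 i hi
    simp only [Prod.fst_swap, Prod.snd_swap]
    omega
  · have := h.2 i hi j hj hij
    unfold Rect.Sep at *
    simp only [Prod.fst_swap, Prod.snd_swap] at *
    omega

/-- Few medium items can be packed into the two boxes. -/
lemma StripInstance.mediumPackable_of_area {δ μ : ℝ} {OPT N : ℕ} (hε : 0 < ε) (hδ : 0 < δ)
    (hδε : δ ≤ ε / 100) (hO : 0 < OPT) (hN : 200 ≤ N * ε) (M : Finset (Fin n))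
    (hM : ∀ i, i ∈ M ↔ i ∈ I.medium δ μ OPT) (hw : ∀ i, I.w i ≤ I.W)
    (harea : N * ∑ i ∈ M, I.w i * I.h i ≤ 2 * (I.W * OPT)) : I.MediumPackable ε δ μ OPT := by
  classical
  have hW : (0 : ℝ) < I.W := by exact_mod_cast I.W_pos
  have hO' : (0 : ℝ) < OPT := by exact_mod_cast hO
  have hWO := mul_pos hW hO'
  have hareaR : ((∑ i ∈ M, I.w i * I.h i : ℕ) : ℝ) * 100 ≤ ε * (I.W * OPT) := by
    have h1 : (N : ℝ) * ((∑ i ∈ M, I.w i * I.h i : ℕ) : ℝ) ≤ 2 * (I.W * OPT) := by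
      exact_mod_cast harea
    have h2 := mul_le_mul_of_nonneg_right hN
      (Nat.cast_nonneg (α := ℝ) (∑ i ∈ M, I.w i * I.h i))
    have h3 := mul_le_mul_of_nonneg_left h1 hε.le
    linarith
  -- Items lower than `δ * OPT` go into the wide box. Every other medium item is narrower than `δ *
  -- W` and, not being tall, has height at most `OPT / 3`; these are packed into the second box with
  -- width and height exchanged.
  set s := M.filter fun i => (I.h i : ℝ) < δ * OPT with hs
  set t := M.filter fun i => ¬ (I.h i : ℝ) < δ * OPT with ht
  have hsub : ∀ u ⊆ M, ((∑ i ∈ u, I.w i * I.h i : ℕ) : ℝ) ≤ (∑ i ∈ M, I.w i * I.h i : ℕ) :=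
    fun u hu => Nat.cast_le.2 (sum_le_sum_of_subset hu)
  refine ⟨s, t, ?_, ?_, ?_⟩
  · ext i
    rw [← hM, ← coe_union, mem_coe, hs, ht, filter_union_filter_not_eq]
  · rcases s.eq_empty_or_nonempty with he | ⟨i, hi⟩
    · exact ⟨fun _ => 0, by simp [IsPacking, he]⟩
    have h1 : 1 < δ * OPT := lt_of_le_of_lt (by exact_mod_cast I.h_pos i) (mem_filter.1 hi).2
    have h2 : 100 < ε * OPT := by
      have := mul_le_mul_of_nonneg_right hδε hO'.le
      linarith
    obtain ⟨p, hp⟩ := exists_half_packing I.w I.h s I.W ⌊ε * OPT⌋₊ ⌊δ * OPT⌋₊ (fun i _ => hw i)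
      (fun i _ => I.w_pos i) (fun i hi => Nat.le_floor (mem_filter.1 hi).2.le) (by
        have h3 := hsub s (filter_subset _ _)
        have h4 := Nat.lt_floor_add_one (ε * OPT)
        have h5 : (⌊δ * OPT⌋₊ : ℝ) ≤ δ * OPT := Nat.floor_le (by positivity)
        have h6 := mul_le_mul_of_nonneg_right hδε hWO.le
        have h7 := mul_le_mul_of_nonneg_left h5 hW.le
        have h8 := mul_lt_mul_of_pos_left h4 hW
        have h9 := mul_lt_mul_of_pos_left h2 hW
        have h10 : ((2 * ∑ i ∈ s, I.w i * I.h i + 2 * I.W * ⌊δ * OPT⌋₊ : ℕ) : ℝ) <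
            (I.W * ⌊ε * OPT⌋₊ : ℕ) := by
          rw [Nat.cast_add, Nat.cast_mul, Nat.cast_mul, Nat.cast_mul, Nat.cast_mul]
          push_cast at h3 hareaR ⊢
          linarith
        exact_mod_cast h10)
    exact ⟨p, I.isPacking_of_packIn hp⟩
  · rcases t.eq_empty_or_nonempty with he | ⟨i₀, hi₀⟩
    · exact ⟨fun _ => 0, by simp [IsPacking, he]⟩
    have hti : ∀ i ∈ t, (I.w i : ℝ) < δ * I.W ∧ I.h i ≤ OPT / 3 := by
      intro i hi
      obtain ⟨hiM, hih⟩ := mem_filter.1 hi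
      have hmed := (hM i).1 hiM
      have h1 : (I.w i : ℝ) < δ * I.W := by
        rcases I.medium_cases hmed with h | h
        · exact h.2
        · exact absurd h.2 hih
      refine ⟨h1, ?_⟩
      by_contra h2
      have h3 : (OPT : ℝ) / 3 < I.h i := by
        rw [div_lt_iff₀ (by norm_num)]
        have : OPT < I.h i * 3 := by omega
        exact_mod_cast this
      exact hmed (Or.inl (Or.inl (Or.inl (Or.inr ⟨h1, h3⟩))))
    have h1 : 1 < δ * I.W := lt_of_le_of_lt (by exact_mod_cast I.w_pos i₀) (hti i₀ hi₀).1
    have h2 : 100 < ε * I.W := by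
      have := mul_le_mul_of_nonneg_right hδε hW.le
      linarith
    -- `t` has an item of positive height at most `OPT / 3`, so the rounded third is at least 1 and
    -- rounding costs at most the factor 5/3.
    have h3 : (OPT : ℝ) ≤ 5 * (OPT / 3 : ℕ) := by
      have h4 := (hti i₀ hi₀).2
      have h5 := I.h_pos i₀
      have : OPT ≤ 5 * (OPT / 3) := by omega
      exact_mod_cast this
    have h3' : ((OPT / 3 : ℕ) : ℝ) ≤ OPT / 3 := Nat.cast_div_le
    obtain ⟨p, hp⟩ := exists_half_packing I.h I.w t (OPT / 3) ⌊ε * I.W / 3⌋₊ ⌊δ * I.W⌋₊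
      (fun i hi => (hti i hi).2) (fun i _ => I.h_pos i)
      (fun i hi => Nat.le_floor (hti i hi).1.le) (by
        have h4 := hsub t (filter_subset _ _)
        have h5 := Nat.lt_floor_add_one (ε * I.W / 3)
        have h6 : (⌊δ * I.W⌋₊ : ℝ) ≤ δ * I.W := Nat.floor_le (by positivity)
        have e : ∑ i ∈ t, I.h i * I.w i = ∑ i ∈ t, I.w i * I.h i :=
          sum_congr rfl fun _ _ => mul_comm _ _
        rw [e]
        set b : ℝ := ((OPT / 3 : ℕ) : ℝ) with hb
        have hb0 : 0 < b := by linarith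
        have h7 := mul_le_mul_of_nonneg_right hδε hW.le
        have h8 : (⌊δ * I.W⌋₊ : ℝ) ≤ ε * I.W / 100 := by linarith
        have h9 : ε * I.W / 4 < (⌊ε * I.W / 3⌋₊ : ℝ) := by linarith
        have h10 := mul_le_mul_of_nonneg_left h8 hb0.le
        have h11 := mul_lt_mul_of_pos_left h9 hb0
        have h12 := mul_le_mul_of_nonneg_left h3 (mul_pos hε hW).le
        have h13 : ((2 * ∑ i ∈ t, I.w i * I.h i + 2 * (OPT / 3) * ⌊δ * I.W⌋₊ : ℕ) : ℝ) <
            (OPT / 3 * ⌊ε * I.W / 3⌋₊ : ℕ) := by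
          rw [Nat.cast_add, Nat.cast_mul, Nat.cast_mul, Nat.cast_mul, Nat.cast_mul, ← hb]
          push_cast at h4 hareaR ⊢
          have h14 : 0 < b * (ε * I.W) := by positivity
          linarith
        exact_mod_cast h13)
    exact ⟨_, I.isPacking_of_packIn_swap hp⟩

/-- Admissible parameters exist, bounded below in terms of `ε` and `k`. -/
theorem StripInstance.exists_admissible (hε : 0 < ε) (hε1 : ε < 1) (hk : k ≠ 0) :
    ∃ c : ℝ, 0 < c ∧ ∀ (n : ℕ) (I : StripInstance n) (OPT : ℕ), 0 < OPT →
      (∃ p, I.IsSolution OPT p) → ∃ δ μ : ℝ, c ≤ μ ∧ I.Admissible ε k δ μ OPT := by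
  classical
  obtain ⟨N, hN⟩ := exists_nat_ge (200 / ε)
  rw [div_le_iff₀ hε] at hN
  set d := thresholds ε k with hd
  refine ⟨d N, thresholds_pos hε N, fun n I OPT hO ⟨p, hp⟩ => ?_⟩
  have hanti : Antitone d := thresholds_antitone hε hε1 hk
  let M : ℕ → Finset (Fin n) := fun j => univ.filter (· ∈ I.medium (d j) (d (j + 1)) OPT)
  have hW : (0 : ℝ) < I.W := by exact_mod_cast I.W_pos
  have hO' : (0 : ℝ) < OPT := by exact_mod_cast hO
  have htot : ∑ i, I.w i * I.h i ≤ I.W * OPT :=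
    sum_area_le univ (I.itemRect p) ⟨0, 0, I.W, OPT⟩ (fun i _ => hp.1 i (Set.mem_univ _))
      fun i _ j _ hij => hp.2 i (Set.mem_univ _) j (Set.mem_univ _) hij
  -- An item is medium for at most one index because of its width and for at most one because of its
  -- height. Some index therefore has area at most `2 * W * OPT / N`, and `N ≥ 200 / ε`.
  have hsum : ∑ j ∈ range N, ∑ i ∈ M j, I.w i * I.h i ≤ 2 * (I.W * OPT) := by
    have h1 := sum_intervals_le (fun j => d j * I.W)
      (fun a b hab => mul_le_mul_of_nonneg_right (hanti hab) hW.le) (fun i => (I.w i : ℝ))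
      (fun i => I.w i * I.h i) N
    have h2 := sum_intervals_le (fun j => d j * OPT)
      (fun a b hab => mul_le_mul_of_nonneg_right (hanti hab) hO'.le) (fun i => (I.h i : ℝ))
      (fun i => I.w i * I.h i) N
    have h3 : ∑ j ∈ range N, ∑ i ∈ M j, I.w i * I.h i ≤
        ∑ j ∈ range N, (∑ i with d (j + 1) * I.W ≤ I.w i ∧ (I.w i : ℝ) < d j * I.W, I.w i * I.h i +
          ∑ i with d (j + 1) * OPT ≤ I.h i ∧ (I.h i : ℝ) < d j * OPT, I.w i * I.h i) := by
      refine sum_le_sum fun j _ => ?_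
      rw [← sum_union_inter]
      refine (sum_le_sum_of_subset fun i hi => ?_).trans (Nat.le_add_right _ _)
      rw [mem_union, mem_filter, mem_filter]
      exact (I.medium_cases (mem_filter.1 hi).2).imp (fun h => ⟨mem_univ _, h⟩)
        fun h => ⟨mem_univ _, h⟩
    rw [sum_add_distrib] at h3
    omega
  have hN0 : (range N).Nonempty := by
    rw [nonempty_range_iff]
    rintro rfl
    rw [Nat.cast_zero, zero_mul] at hN
    linarith
  obtain ⟨j, hj, hjmin⟩ := exists_min_image (range N) (fun j => ∑ i ∈ M j, I.w i * I.h i) hN0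
  have hjarea : N * ∑ i ∈ M j, I.w i * I.h i ≤ 2 * (I.W * OPT) := by
    refine le_trans ?_ hsum
    have := card_nsmul_le_sum (range N) (fun j => ∑ i ∈ M j, I.w i * I.h i) _ hjmin
    rwa [card_range, smul_eq_mul] at this
  have hdj := thresholds_succ_lt (k := k) hε hε1 hk j
  refine ⟨d j, d (j + 1), hanti (mem_range.1 hj), thresholds_pos hε _, hdj.2,
    hdj.1.trans (by linarith), le_rfl, ?_⟩
  refine I.mediumPackable_of_area hε (thresholds_pos hε j) hdj.1 hO hN (M j)
    (fun i => by simp only [M, mem_filter, mem_univ, true_and]) (fun i => ?_) hjarea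
  have := hp.1 i (Set.mem_univ _)
  unfold Rect.Inside itemRect at this
  simp only at this
  omega

end Admissible

end StructuredPacking

/-! ### The theorem. -/

theorem theorem2 :
    ∃ C : ℝ, 0 < C ∧ ∀ ε : ℝ, 0 < ε → ε < 1 → ∃ k : ℕ,
      -- admissible parameters, bounded below in terms of `ε` only, always exist
      (∃ c : ℝ, 0 < c ∧ ∀ (n : ℕ) (I : StripInstance n) (OPT : ℕ), 0 < OPT →
        (∃ p, I.IsSolution OPT p) →
        ∃ δ μ : ℝ, c ≤ μ ∧ I.Admissible ε k δ μ OPT) ∧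
      -- the box partition, for all admissible parameters and rounded heights
      (∀ (n : ℕ) (I : StripInstance n) (OPT : ℕ) (δ μ : ℝ),
        I.Admissible ε k δ μ OPT →
        (∃ p, I.IsSolution OPT p) →
        (∃ g : ℕ, 0 < g ∧ (g : ℝ) = ε * δ * OPT ∧
          ∀ i ∈ I.large δ OPT ∪ I.tall δ OPT ∪ I.vertical δ μ OPT, g ∣ I.h i) →
        ∃ (Ht : ℕ) (p : Fin n → ℕ × ℕ) (N : ℕ) (box : Fin N → Rect) (a : Fin n → Fin N)
            (m₁ m₂ : Fin N),
          (Ht : ℝ) ≤ (4 / 3 + C * ε) * OPT ∧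
          I.IsSolution Ht p ∧
          Rect.IsPartition ⟨0, 0, I.W, Ht⟩ box ∧
          (N : ℝ) ≤ C / (ε ^ 6 * δ ^ 7) ∧
          -- every item `i` lies in the box `a i`
          (∀ i, (I.itemRect p i).Inside (box (a i))) ∧
          (∀ i ∈ I.large δ OPT, ∀ j, a j = a i → j = i) ∧
          m₁ ≠ m₂ ∧
          (box m₁).w = I.W ∧ (box m₁).h = ⌊ε * OPT⌋₊ ∧
          (box m₂).w = ⌊ε * I.W / 3⌋₊ ∧ (box m₂).h = OPT / 3 ∧
          (∀ i, (a i = m₁ ∨ a i = m₂) ↔ i ∈ I.medium δ μ OPT) ∧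
          (∀ i ∈ I.tall δ OPT ∪ I.vertical δ μ OPT,
            I.IsVerticalBox ε δ OPT p (box (a i)) ∧ (box (a i)).h = I.h i) ∧
          (∀ i ∈ I.horizontal δ μ OPT,
            StripInstance.IsHorizontalBox ε δ OPT (box (a i)))) := by
  refine ⟨10 ^ 10, by norm_num, fun ε hε hε1 => ?_⟩
  -- The additional exponent `j` absorbs the constant: `μ ≤ (ε * δ) ^ (10 + j)` gives `μ * 10 ^ 13 ≤
  -- (ε * δ) ^ 10`, the smallness that all estimates use.
  obtain ⟨j, hj⟩ := exists_pow_lt_of_lt_one (show (0 : ℝ) < (10 ^ 13)⁻¹ by norm_num) hε1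
  refine ⟨10 + j, StripInstance.exists_admissible hε hε1 (by omega),
    fun n I OPT δ μ ⟨hμ, hμδ, hδ1, hμk, hM⟩ ⟨p, hp⟩ ⟨g, hg, hgε, hdvd⟩ => ?_⟩
  have hδ : 0 < δ := hμ.trans hμδ
  have hμ' : μ * 10 ^ 13 ≤ (ε * δ) ^ 10 := by
    have h0 : 0 < ε * δ := mul_pos hε hδ
    have h1 : (ε * δ) ^ j ≤ (10 ^ 13)⁻¹ :=
      (pow_le_pow_left₀ h0.le (mul_le_of_le_one_right hε.le hδ1) j).trans hj.le
    have h2 := hμk.trans (le_of_eq (pow_add (ε * δ) 10 j))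
    have h3 := mul_le_mul_of_nonneg_left h1 (pow_pos h0 10).le
    linarith
  obtain ⟨Ht, p', N, box, a, m₁, m₂, h1, h2, h3, h4, h5⟩ := Setup.exists_structured_packing
    ⟨I, ε, δ, μ, OPT, g, p, hε, hε1, hδ, hδ1, hμ, hμ', hg, hgε, hdvd, hp⟩ hM
  refine ⟨Ht, p', N, box, a, m₁, m₂, h1.trans ?_, h2, h3, h4.trans ?_, h5⟩
  · refine mul_le_mul_of_nonneg_right ?_ (Nat.cast_nonneg _)
    linarith
  -- The construction needs only `ε ^ 5` in the denominator; the spare factor `ε` is at most 1.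
  · rw [le_div_iff₀ (mul_pos (pow_pos hε 6) (pow_pos hδ 7))]
    have e : 45 * 10 ^ 8 * (ε⁻¹ ^ 5 * δ⁻¹ ^ 7) * (ε ^ 6 * δ ^ 7) = 45 * 10 ^ 8 * ε := by
      have := hε.ne'
      have := hδ.ne'
      field_simp
    change 45 * 10 ^ 8 * (ε⁻¹ ^ 5 * δ⁻¹ ^ 7) * (ε ^ 6 * δ ^ 7) ≤ _
    rw [e]
    linarith
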